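/- **Setting.** Let $\lambda=\Delta x/\Delta t>0$ and let $v_j=\lambda\xi_j$ ($0\le j\le 16$) be the D2Q17 velocities: $\xi_j$ runs over $(0,0)$, $(\pm1,0),(0,\pm1)$, $(\pm1,\pm1)$, $(\pm2,0),(0,\pm2)$, $(\pm2,\pm2)$. With $N=X^2+Y^2$, the moments $m=Mf$, $M_{kj}=p_k(v_j)$, are given by the polynomials - $\rho$: $1$; $\ \mathbf j=(j_x,j_y)$: $(X,Y)$; $\ E$: $-60\lambda^2+17N$; $\ XX$: $X^2-Y^2$; $\ XY$: $XY$; - $\mathbf q$: $(X,Y)\,(-17\lambda^2+3N)$; $\ \mathbf r$: $(X,Y)\,\big(\tfrac{47}{6}\lambda^4-\tfrac{17}{4}\lambda^2N+\tfrac5{12}N^2\big)$; - $\tau$: $(X,Y)\,\big(-\tfrac{7429}{42}\lambda^6+\tfrac{1565}{8}\lambda^4N-\tfrac{2635}{48}\lambda^2N^2+\tfrac{465}{112}N^3\big)$; - $XX_e$: $(X^2-Y^2)\big(-\tfrac{65}{12}\lambda^2+\tfrac{17}{12}N\big)$; $\ XY_e$: $XY\big(-\tfrac{65}{12}\lambda^2+\tfrac{17}{24}N\big)$;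 - $E_2$: $620\lambda^4-\tfrac{969}2\lambda^2N+\tfrac{109}2N^2$; - $E_3$: $-16740\lambda^6+\tfrac{330361}{12}\lambda^4N-\tfrac{74485}8\lambda^2N^2+\tfrac{18445}{24}N^3$; - $E_4$: $84\lambda^8-\tfrac{24055}{56}\lambda^6N+\tfrac{35425}{96}\lambda^4N^2-\tfrac{6035}{64}\lambda^2N^3+\tfrac{9193}{1344}N^4$. The moments $\rho,j_x,j_y,E$ are conserved. The others relax by $m_k^*=m_k+s_k(m_k^{eq}-m_k)$ with rates in $(0,2)$: $s_5$ for $XX,XY$; $s_7$ for $\mathbf q$; $s_9$ for $\mathbf r$; $s_{13}$ for $XX_e,XY_e$; $s_{15}$ for $\tau$; and one further rate for each of $E_2,E_3,E_4$. Put $\sigma_i=1/s_i-1/2$. The scheme is $f_j(x,t+\Delta t)=f_j^*(x-v_j\Delta t,t)$, $f^*=M^{-1}m^*$. The equilibria (around a state at rest) are linear in the conserved moments: $XX^{eq}=XY^{eq}=0$, $$E_2^{eq}=\alpha_2\lambda^4\rho+\beta_2\lambda^2E,\quad E_3^{eq}=\alpha_3\lambda^6\rho+\beta_3\lambda^4E,\quad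 E_4^{eq}=\alpha_4\lambda^8\rho+\beta_4\lambda^6E,$$ and $\mathbf q^{eq},\mathbf r^{eq},\tau^{eq},XX_e^{eq},XY_e^{eq}$ are specified below. **Isotropy.** On plane waves $e^{ik\cdot x}$ the scheme acts by the amplification matrix $G=\mathrm{diag}(e^{-i\Delta t\,k\cdot v_j})\,M^{-1}CM$, with $C$ the collision matrix in moment space. For a sound velocity $c_0>0$, the scheme is *fourth-order isotropic* if its four physical modes decay like $e^{-\mu t}$, with $\mu$ equal, up to $O(\Delta t^4)$ ($\lambda$, $k$ fixed), to $$\Delta t\,p_1+\Delta t^2\tilde p_1+\Delta t^3\bar p_1,\quad \Delta t\,p_2+\Delta t^2\tilde p_2+\Delta t^3\bar p_2,\quad \pm c_0\sqrt\Delta+\Delta t\,p_3\pm\Delta t^2\tilde p_3+\Delta t^3\bar p_3,\qquad \sqrt\Delta=i|k|,$$ where all $p_j,\tilde p_j,\bar p_j$ are functions of $|k|$ only. Precisely: for each $k$ there are four power series $\phi$ in $\Delta t$ with values in $\mathbb C^{17}$, linearly independent at $\Delta t=0$, such that $G\phi=e^{-\Delta t\,\mu}\phi+O(\Delta t^5)$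 for these four $\mu$. **Statement.** Assume $\sigma_5\sigma_7=\tfrac1{12}$. In both parts $c_0>0$ is such that the shear and thermal modes split at second order: $$\tfrac{c_0^2}{2}\sigma_5\ne\tfrac{\lambda^4}{218\,c_0^2}(60\beta_2+620-\alpha_2)\,\sigma_7 .\tag{$*$}$$ Consider the equilibria $$\mathbf q^{eq}=c_1\mathbf j,\quad \mathbf r^{eq}=c_2\mathbf j,\quad \tau^{eq}=c_3\mathbf j,\quad XX_e^{eq}=XY_e^{eq}=0,\tag{V}$$ $$c_1=6c_0^2-17\lambda^2,\quad c_2=\tfrac{\lambda^2}6(31\lambda^2-21c_0^2),\quad c_3=\tfrac{\lambda^4}{24}(555c_0^2-596\lambda^2),$$ and the relations $$\sigma_9=\sigma_7,\qquad \sigma_{13}=\sigma_5,\qquad \sigma_{15}=\sigma_7,\tag{S}$$ $$\alpha_3=-\tfrac5{436}(2696442+7519\alpha_2),\qquad \beta_3=-\tfrac1{2616}(2949247+225570\beta_2),$$ $$\alpha_4=\tfrac1{177888}(69687842+139145\alpha_2),\qquad \beta_4=\tfrac5{355776}(940101+55658\beta_2).\tag{A}$$ 1. ($c_0$ left free.)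 With the equilibria (V), the scheme is fourth-order isotropic for every $c_0>0$ satisfying $(*)$ if and only if (S) and (A) hold. 2. Assume (S) and (A), and let $c_0>0$ satisfy $(*)$. Let the remaining equilibria have the general form $$q_x^{eq}=q_x^\rho\rho+q^{xx}j_x+q^{xy}j_y+q_x^EE,\qquad q_y^{eq}=q_y^\rho\rho+q^{xy}j_x+q^{yy}j_y+q_y^EE,$$ $$r_x^{eq}=\lambda^3(c_x^\rho\lambda^2\rho+c_x^x\lambda j_x+c_x^y\lambda j_y+c_x^\varepsilon E),\qquad r_y^{eq}=\lambda^3(c_y^\rho\lambda^2\rho+c_y^x\lambda j_x+c_y^y\lambda j_y+c_y^\varepsilon E),$$ $$\tau_x^{eq}=-\tfrac{31}2\lambda^5\Big[c_x^\rho\lambda^2\rho+\tfrac{\lambda}{124}\big(124c_x^x+249\tfrac{c_0^2}{\lambda^2}-442\big)j_x+c_x^y\lambda j_y+c_x^\varepsilon E\Big],$$ $$\tau_y^{eq}=-\tfrac{31}2\lambda^5\Big[c_y^\rho\lambda^2\rho+c_y^x\lambda j_x+\tfrac{\lambda}{124}\big(124c_y^y+249\tfrac{c_0^2}{\lambda^2}-442\big)j_y+c_y^\varepsilon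 E\Big],$$ $$XX_e^{eq}=\xi_x\big(\lambda^4\rho+\tfrac{\lambda^2}{60}E\big),\qquad XY_e^{eq}=\xi_y\big(\lambda^4\rho+\tfrac{\lambda^2}{60}E\big)$$ with real coefficients. Then the scheme is fourth-order isotropic with sound velocity $c_0$ for all values in $(0,2)$ of the rates of $E_2,E_3,E_4$ if and only if the equilibria are those of (V). -/

import Mathlib

open scoped Matrix

noncomputable section

namespace D2Q17

/-- The seventeen (dimensionless) discrete velocities of the D2Q17 stencil. -/
def xi : Fin 17 → Fin 2 → ℝ :=
  ![![0, 0], ![1, 0], ![0, 1], ![-1, 0], ![0, -1],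
    ![1, 1], ![-1, 1], ![-1, -1], ![1, -1],
    ![2, 0], ![0, 2], ![-2, 0], ![0, -2],
    ![2, 2], ![-2, 2], ![-2, -2], ![2, -2]]

/-- The discrete velocities `v_j = lam * xi_j`, where `lam = Δx / Δt` is the lattice velocity. -/
def velocity (lam : ℝ) (j : Fin 17) (a : Fin 2) : ℝ := lam * xi j a

/-- The seventeen polynomials that define the moments, in the order
`ρ, j_x, j_y, E, XX, XY, q_x, q_y, r_x, r_y, τ_x, τ_y, XX_e, XY_e, E₂, E₃, E₄`. -/
def momentPoly (lam X Y : ℝ) : Fin 17 → ℝ :=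
  let N := X ^ 2 + Y ^ 2
  let pr := 47 / 6 * lam ^ 4 - 17 / 4 * lam ^ 2 * N + 5 / 12 * N ^ 2
  let pt := -(7429 / 42) * lam ^ 6 + 1565 / 8 * lam ^ 4 * N - 2635 / 48 * lam ^ 2 * N ^ 2
    + 465 / 112 * N ^ 3
  ![1,
    X,
    Y,
    -60 * lam ^ 2 + 17 * N,
    X ^ 2 - Y ^ 2,
    X * Y,
    X * (-17 * lam ^ 2 + 3 * N),
    Y * (-17 * lam ^ 2 + 3 * N),
    X * pr,
    Y * pr,
    X * pt,
    Y * pt,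
    (X ^ 2 - Y ^ 2) * (-(65 / 12) * lam ^ 2 + 17 / 12 * N),
    X * Y * (-(65 / 12) * lam ^ 2 + 17 / 24 * N),
    620 * lam ^ 4 - 969 / 2 * lam ^ 2 * N + 109 / 2 * N ^ 2,
    -16740 * lam ^ 6 + 330361 / 12 * lam ^ 4 * N - 74485 / 8 * lam ^ 2 * N ^ 2
      + 18445 / 24 * N ^ 3,
    84 * lam ^ 8 - 24055 / 56 * lam ^ 6 * N + 35425 / 96 * lam ^ 4 * N ^ 2
      - 6035 / 64 * lam ^ 2 * N ^ 3 + 9193 / 1344 * N ^ 4]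

/-- The matrix `M_{kj} = p_k(v_j)`: the moments of the particle densities `f` are `m = M f`. -/
def momentMatrix (lam : ℝ) : Matrix (Fin 17) (Fin 17) ℝ :=
  Matrix.of fun k j => momentPoly lam (velocity lam j 0) (velocity lam j 1) k

/-- The relaxation rates of the scheme. The two components of each vector, and the two moments
`XX, XY` and `XX_e, XY_e` of each tensor, share the same rate. -/
structure Rates where
  /-- rate of `XX` and `XY` -/
  s5 : ℝ
  /-- rate of `q_x` and `q_y` -/
  s7 : ℝ
  /-- rate of `r_x` and `r_y` -/
  s9 : ℝ
  /-- rate of `XX_e` and `XY_e` -/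
  s13 : ℝ
  /-- rate of `τ_x` and `τ_y` -/
  s15 : ℝ
  /-- rate of `E₂` -/
  sE2 : ℝ
  /-- rate of `E₃` -/
  sE3 : ℝ
  /-- rate of `E₄` -/
  sE4 : ℝ

/-- All relaxation rates lie in the open interval `(0, 2)`, i.e. all `σ`'s are positive. -/
def Rates.Admissible (R : Rates) : Prop :=
  R.s5 ∈ Set.Ioo 0 2 ∧ R.s7 ∈ Set.Ioo 0 2 ∧ R.s9 ∈ Set.Ioo 0 2 ∧ R.s13 ∈ Set.Ioo 0 2 ∧
  R.s15 ∈ Set.Ioo 0 2 ∧ R.sE2 ∈ Set.Ioo 0 2 ∧ R.sE3 ∈ Set.Ioo 0 2 ∧ R.sE4 ∈ Set.Ioo 0 2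

/-- `σ = 1/s - 1/2`. -/
def sigma (s : ℝ) : ℝ := 1 / s - 1 / 2

/-- The rates listed in the order of the moments. The conserved moments `ρ, j_x, j_y, E` do not
relax. -/
def Rates.toFun (R : Rates) : Fin 17 → ℝ :=
  ![0, 0, 0, 0, R.s5, R.s5, R.s7, R.s7, R.s9, R.s9, R.s15, R.s15, R.s13, R.s13,
    R.sE2, R.sE3, R.sE4]

/-- The projection of a moment vector on the conserved moments `(ρ, j_x, j_y, E)`. -/
def conserved : Matrix (Fin 4) (Fin 17) ℝ :=
  Matrix.of fun a k => if (k : ℕ) = (a : ℕ) then 1 else 0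

/-- The collision step `m_k* = m_k + s_k (m_k^eq - m_k)` in moment space. A linear equilibrium is
given by its matrix `Eq`: `m_k^eq = Eq k 0 * ρ + Eq k 1 * j_x + Eq k 2 * j_y + Eq k 3 * E`. -/
def collision (R : Rates) (Eq : Matrix (Fin 17) (Fin 4) ℝ) : Matrix (Fin 17) (Fin 17) ℝ :=
  1 + Matrix.diagonal R.toFun * (Eq * conserved - 1)

/-- The number `exp (-i Δt k·v_j)` as a power series in `X = Δt`. -/
def phase (lam : ℝ) (k : EuclideanSpace ℝ (Fin 2)) (j : Fin 17) : PowerSeries ℂ :=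
  PowerSeries.mk fun n =>
    (-(Complex.I * ((k 0 * velocity lam j 0 + k 1 * velocity lam j 1 : ℝ) : ℂ))) ^ n
      / (n.factorial : ℂ)

/-- The amplification matrix of the scheme `f_j(x, t + Δt) = f_j*(x - v_j Δt, t)`,
`f* = M⁻¹ m*`, on the plane waves `f(x, t) = exp(i k·x) φ(t)`, as a power series in `X = Δt`
(with `lam = Δx / Δt` and `k` fixed). -/
def amplification (lam : ℝ) (R : Rates) (Eq : Matrix (Fin 17) (Fin 4) ℝ)
    (k : EuclideanSpace ℝ (Fin 2)) : Matrix (Fin 17) (Fin 17) (PowerSeries ℂ) :=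
  Matrix.diagonal (phase lam k) *
    ((momentMatrix lam)⁻¹ * collision R Eq * momentMatrix lam).map
      fun x : ℝ => PowerSeries.C (x : ℂ)

/-- `exp (-Δt μ)` as a power series in `X = Δt`, up to terms of order `X ^ 5`. -/
def decay (mu : PowerSeries ℂ) : PowerSeries ℂ :=
  ∑ n ∈ Finset.range 5, PowerSeries.C (1 / (n.factorial : ℂ)) * (-(PowerSeries.X * mu)) ^ n

/-- The four physical modes of the matrix `G` (a power series in `Δt`, of which
`1` is an eigenvalue of multiplicity four at `Δt = 0`) decay like `exp (-μ_j t)`, where the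
`μ_j` are given up to an error `O(Δt⁴)`: there are four eigenvectors `φ_j`, power series in `Δt`
that are linearly independent at `Δt = 0`, with
`G φ_j = exp (-Δt μ_j) φ_j + O(Δt⁵)`. In other words the eigenvalues of the equivalent
system of partial differential equations of the scheme are `∂_t + μ_j + O(Δt⁴)`. -/
def HasModes (G : Matrix (Fin 17) (Fin 17) (PowerSeries ℂ)) (mu : Fin 4 → PowerSeries ℂ) : Prop :=
  ∃ phi : Fin 4 → Fin 17 → PowerSeries ℂ,
    LinearIndependent ℂ (fun j i => PowerSeries.constantCoeff (phi j i)) ∧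
    ∀ j i, ∀ m ≤ 4,
      PowerSeries.coeff m ((G *ᵥ phi j) i) = PowerSeries.coeff m (decay (mu j) * phi j i)

/-- The fourth order expansions of the eigenvalues around a state at rest:
`Δt p₁ + Δt² p̃₁ + Δt³ p̄₁` (shear), `Δt p₂ + Δt² p̃₂ + Δt³ p̄₂` (thermal) and
`± c₀ √Δ + Δt p₃ ± Δt² p̃₃ + Δt³ p̄₃` (acoustics), where `√Δ = i κ` for a wave number `κ = |k|`.
The arguments `p, pt, pb` stand for `p, p̃, p̄`. -/
def expansion (c0 kappa : ℝ) (p pt pb : Fin 3 → ℂ) : Fin 4 → PowerSeries ℂ :=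
  let e (a b c d : ℂ) : PowerSeries ℂ :=
    PowerSeries.C a + PowerSeries.C b * PowerSeries.X + PowerSeries.C c * PowerSeries.X ^ 2
      + PowerSeries.C d * PowerSeries.X ^ 3
  ![e 0 (p 0) (pt 0) (pb 0),
    e 0 (p 1) (pt 1) (pb 1),
    e (c0 * (Complex.I * kappa)) (p 2) (pt 2) (pb 2),
    e (-(c0 * (Complex.I * kappa))) (p 2) (-(pt 2)) (pb 2)]

/-- Fourth order isotropy with sound velocity `c₀`: the coefficients `p_j, p̃_j, p̄_j` of the
expansions of the eigenvalues are functions of the Laplace operator only, i.e. functions of the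
length of the wave vector `k`. -/
def FourthOrderIsotropic (lam c0 : ℝ) (R : Rates) (Eq : Matrix (Fin 17) (Fin 4) ℝ) : Prop :=
  ∃ p pt pb : ℝ → Fin 3 → ℂ, ∀ k : EuclideanSpace ℝ (Fin 2),
    HasModes (amplification lam R Eq k) (expansion c0 ‖k‖ (p ‖k‖) (pt ‖k‖) (pb ‖k‖))

/-- The coefficients of the equilibria `E_n^eq = α_n lam^(2n) ρ + β_n lam^(2n-2) E` of the scalar
moments `E₂, E₃, E₄`. -/
structure ScalarCoeffs where
  alpha2 : ℝ
  beta2 : ℝ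
  alpha3 : ℝ
  beta3 : ℝ
  alpha4 : ℝ
  beta4 : ℝ

/-- The coefficients of the equilibria of the moments `q, r, τ, XX_e, XY_e`. -/
structure TensorCoeffs where
  /-- `q_x^eq = qx0 ρ + qxx j_x + qxy j_y + qxE E` -/
  qx0 : ℝ
  qxx : ℝ
  qxy : ℝ
  qxE : ℝ
  /-- `q_y^eq = qy0 ρ + qxy j_x + qyy j_y + qyE E` -/
  qy0 : ℝ
  qyy : ℝ
  qyE : ℝ
  /-- `r_x^eq = lam³ (cx0 lam² ρ + cxx lam j_x + cxy lam j_y + cxE E)` -/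
  cx0 : ℝ
  cxx : ℝ
  cxy : ℝ
  cxE : ℝ
  /-- `r_y^eq = lam³ (cy0 lam² ρ + cyx lam j_x + cyy lam j_y + cyE E)` -/
  cy0 : ℝ
  cyx : ℝ
  cyy : ℝ
  cyE : ℝ
  /-- `XX_e^eq = xix (lam⁴ ρ + lam² E / 60)` -/
  xix : ℝ
  /-- `XY_e^eq = xiy (lam⁴ ρ + lam² E / 60)` -/
  xiy : ℝ

/-- The equilibria of the scheme around a state at rest, before fourth order isotropy is
enforced. The rows are the coefficients of `(ρ, j_x, j_y, E)`, in the order of the moments. -/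
def generalEquilibrium (lam c0 : ℝ) (a : ScalarCoeffs) (v : TensorCoeffs) :
    Matrix (Fin 17) (Fin 4) ℝ :=
  let g : ℝ := 249 * (c0 ^ 2 / lam ^ 2) - 442
  Matrix.of ![
    ![1, 0, 0, 0],
    ![0, 1, 0, 0],
    ![0, 0, 1, 0],
    ![0, 0, 0, 1],
    ![0, 0, 0, 0],
    ![0, 0, 0, 0],
    ![v.qx0, v.qxx, v.qxy, v.qxE],
    ![v.qy0, v.qxy, v.qyy, v.qyE],
    lam ^ 3 • ![v.cx0 * lam ^ 2, v.cxx * lam, v.cxy * lam, v.cxE],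
    lam ^ 3 • ![v.cy0 * lam ^ 2, v.cyx * lam, v.cyy * lam, v.cyE],
    (-(31 / 2) * lam ^ 5) •
      ![v.cx0 * lam ^ 2, lam / 124 * (124 * v.cxx + g), v.cxy * lam, v.cxE],
    (-(31 / 2) * lam ^ 5) •
      ![v.cy0 * lam ^ 2, v.cyx * lam, lam / 124 * (124 * v.cyy + g), v.cyE],
    v.xix • ![lam ^ 4, 0, 0, lam ^ 2 / 60],
    v.xiy • ![lam ^ 4, 0, 0, lam ^ 2 / 60],
    ![a.alpha2 * lam ^ 4, 0, 0, a.beta2 * lam ^ 2],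
    ![a.alpha3 * lam ^ 6, 0, 0, a.beta3 * lam ^ 4],
    ![a.alpha4 * lam ^ 8, 0, 0, a.beta4 * lam ^ 6]]

/-- `q^eq = c₁ j`. -/
def c1 (lam c0 : ℝ) : ℝ := 6 * c0 ^ 2 - 17 * lam ^ 2

/-- `r^eq = c₂ j`. -/
def c2 (lam c0 : ℝ) : ℝ := lam ^ 2 / 6 * (31 * lam ^ 2 - 21 * c0 ^ 2)

/-- `τ^eq = c₃ j`. -/
def c3 (lam c0 : ℝ) : ℝ := lam ^ 4 / 24 * (555 * c0 ^ 2 - 596 * lam ^ 2)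

/-- The equilibria `q^eq = c₁ j`, `r^eq = c₂ j`, `τ^eq = c₃ j`, `XX_e^eq = XY_e^eq = 0`. -/
def isotropicEquilibrium (lam c0 : ℝ) (a : ScalarCoeffs) : Matrix (Fin 17) (Fin 4) ℝ :=
  Matrix.of ![
    ![1, 0, 0, 0],
    ![0, 1, 0, 0],
    ![0, 0, 1, 0],
    ![0, 0, 0, 1],
    ![0, 0, 0, 0],
    ![0, 0, 0, 0],
    ![0, c1 lam c0, 0, 0],
    ![0, 0, c1 lam c0, 0],
    ![0, c2 lam c0, 0, 0],
    ![0, 0, c2 lam c0, 0],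
    ![0, c3 lam c0, 0, 0],
    ![0, 0, c3 lam c0, 0],
    ![0, 0, 0, 0],
    ![0, 0, 0, 0],
    ![a.alpha2 * lam ^ 4, 0, 0, a.beta2 * lam ^ 2],
    ![a.alpha3 * lam ^ 6, 0, 0, a.beta3 * lam ^ 4],
    ![a.alpha4 * lam ^ 8, 0, 0, a.beta4 * lam ^ 6]]

/-- The relations between the dissipation coefficients. -/
def SigmaRelations (R : Rates) : Prop :=
  sigma R.s9 = sigma R.s7 ∧ sigma R.s13 = sigma R.s5 ∧ sigma R.s15 = sigma R.s7

/-- The relations between the coefficients of the scalar equilibria. -/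
def AlphaRelations (a : ScalarCoeffs) : Prop :=
  a.alpha3 = -(5 / 436) * (2696442 + 7519 * a.alpha2) ∧
  a.beta3 = -(1 / 2616) * (2949247 + 225570 * a.beta2) ∧
  a.alpha4 = 1 / 177888 * (69687842 + 139145 * a.alpha2) ∧
  a.beta4 = 5 / 355776 * (940101 + 55658 * a.beta2)

/-- The second order coefficients `p₁ = -(c₀² / 2) σ₅ Δ` and
`p₂ = -(lam⁴ / (218 c₀²)) (60 β₂ + 620 - α₂) σ₇ Δ` of the shear and thermal modes differ, so that
the double eigenvalue splits and its fourth order expansion makes sense. -/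
def Splits (lam c0 : ℝ) (R : Rates) (a : ScalarCoeffs) : Prop :=
  c0 ^ 2 / 2 * sigma R.s5 ≠
    lam ^ 4 / (218 * c0 ^ 2) * (60 * a.beta2 + 620 - a.alpha2) * sigma R.s7

end D2Q17

end

/-! A mode of the scheme is expanded as a formal series in the time step. If `φ*` denotes the
densities after collision, transport says, velocity by velocity and modulo `Δt⁵`, that `φ* = exp(-z)
φ` with `z = Δt (μ - i k·v)`. In terms of the half-sum and the difference this reads `φ - φ* = 2
tanh(z/2) · (φ + φ*)/2`, and `2 tanh(z/2) = z - z³/12` to the required order. The same half-sum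
symmetrizes collision: with `ψ` the moments of `(φ + φ*)/2` and `θ` those of `φ - φ*`, collision
becomes `θ = 0` on conserved moments and `ψ = ψ^eq + σ θ` on the others. So only the `σ` enter, and
the number `1/12` is that of the hyperbolic tangent.

On moments, in units where `λ = 1`, multiplication by a component of the velocity is the sparse
operator `advect`. Therefore `HasModes` is equivalent to the existence of four solutions of the
recursion `IsExpansion` whose conserved moments are independent at order zero (`hasModes_iff`,
`fourthOrderIsotropic_iff`).

When (S) holds, the non-conserved moments can be eliminated order by order. What remains at each
order is four conservation laws, for mass, divergence and curl of momentum, and a pressure `p = (E +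
60 ρ)/34` (`Rows`). The hypothesis `σ₅ σ₇ = 1/12` cancels transport of relaxation terms against the
cubic term of the hyperbolic tangent. After that cancellation the direction of `k` enters the laws,
up to order three, only through terms multiplied by the deviations `D`, `F` of `E₃`, `E₄` from (A)
and `X`, `Y` of `r` (to which `τ` is tied) from (V).

Sufficiency: if these deviations vanish, the laws involve the wave vector only through `q = x² +
y²`, and they are solved by triangular elimination for the shear, thermal and acoustic modes
(`exists_shear`, `exists_thermal`, `exists_acoustic`). This gives
`fourthOrderIsotropic_isotropicEquilibrium`.

Necessity: condition (*) says that shear and thermal decay rates differ at leading order. Hence an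
isotropic scheme has, for each `|k|`, a shear, a thermal and an acoustic mode, each with a rate
common to all directions and with a free normalization (`exists_modes`). Comparing two wave vectors
of equal length isolates an anisotropic coefficient, which must vanish.

For the first part, the shear rate at order three along an axis and along a diagonal gives a
quadratic polynomial in `g = c₀²/λ²`; two of its coefficients give `σ₉ = σ₁₅ = σ₇`
(`sigma_eq_of_isotropic`). The acoustic mode at order two gives `σ₁₃ = σ₅`
(`tensor_rate_of_isotropic`), and the thermal and acoustic modes at order three give (A)
(`alphaRelations_of_isotropic`).

For the second part, each order removes some of the unknown equilibria: order zero fixes `q`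
(`vector_equilibrium_of_isotropic`), order one removes `XX_e` and `XY_e`
(`tensor_equilibrium_of_isotropic`), order two reduces the deviation of `r` to `X = e j_x + d j_y`,
`Y = e j_y - d j_x` (`IsotropicModes.order_two`), and order three gives `e = d = 0`
(`IsotropicModes.order_three`). Freedom in the rate of `E₂` serves to avoid the value at which the
coefficient used at order two vanishes. -/

noncomputable section

namespace D2Q17

/-! ### The moments of the stencil, and multiplication by the velocity in moment space. -/

/-- The moment matrix for `lam = 1` has integer entries. -/
def momentTable : Matrix (Fin 17) (Fin 17) ℤ :=
  Matrix.of ![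
    ![1, 1, 1, 1, 1, 1, 1, 1, 1, 1, 1, 1, 1, 1, 1, 1, 1],
    ![0, 1, 0, -1, 0, 1, -1, -1, 1, 2, 0, -2, 0, 2, -2, -2, 2],
    ![0, 0, 1, 0, -1, 1, 1, -1, -1, 0, 2, 0, -2, 2, 2, -2, -2],
    ![-60, -43, -43, -43, -43, -26, -26, -26, -26, 8, 8, 8, 8, 76, 76, 76, 76],
    ![0, 1, -1, 1, -1, 0, 0, 0, 0, 4, -4, 4, -4, 0, 0, 0, 0],
    ![0, 0, 0, 0, 0, 1, -1, 1, -1, 0, 0, 0, 0, 4, -4, 4, -4],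
    ![0, -14, 0, 14, 0, -11, 11, 11, -11, -10, 0, 10, 0, 14, -14, -14, 14],
    ![0, 0, -14, 0, 14, -11, -11, 11, 11, 0, -10, 0, 10, 14, 14, -14, -14],
    ![0, 4, 0, -4, 0, 1, -1, -1, 1, -5, 0, 5, 0, 1, -1, -1, 1],
    ![0, 0, 4, 0, -4, 1, 1, -1, -1, 0, -5, 0, 5, 1, 1, -1, -1],
    ![0, -32, 0, 32, 0, 28, -28, -28, 28, -14, 0, 14, 0, 1, -1, -1, 1],
    ![0, 0, -32, 0, 32, 28, 28, -28, -28, 0, -14, 0, 14, 1, 1, -1, -1],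
    ![0, -4, 4, -4, 4, 0, 0, 0, 0, 1, -1, 1, -1, 0, 0, 0, 0],
    ![0, 0, 0, 0, 0, -4, 4, -4, 4, 0, 0, 0, 0, 1, -1, 1, -1],
    ![620, 190, 190, 190, 190, -131, -131, -131, -131, -446, -446, -446, -446, 232, 232, 232, 232],
    ![-16740, 2248, 2248, 2248, 2248, 7226, 7226, 7226, 7226, -6403, -6403, -6403, -6403, 1114,
        1114, 1114, 1114],
    ![84, -64, -64, -64, -64, 56, 56, 56, 56, -14, -14, -14, -14, 1, 1, 1, 1]]

/-- Multiplication of a function of the velocity by `x v₀ + y v₁` (`lam = 1`), expressed on its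
moments. -/
def advect {F : Type*} [Field F] (x y : F) (w : Fin 17 → F) : Fin 17 → F :=
  ![x * w 1 + y * w 2,
    30 / 17 * x * w 0 + 1 / 34 * x * w 3 + 1 / 2 * x * w 4 + y * w 5,
    30 / 17 * y * w 0 + 1 / 34 * y * w 3 - 1 / 2 * y * w 4 + x * w 5,
    109 / 3 * x * w 1 + 109 / 3 * y * w 2 + 17 / 3 * x * w 6 + 17 / 3 * y * w 7,
    17 / 15 * x * w 1 - 17 / 15 * y * w 2 - 47 / 465 * x * w 6 + 47 / 465 * y * w 7
        - 4 / 5 * x * w 8 + 4 / 5 * y * w 9 - 8 / 155 * x * w 10 + 8 / 155 * y * w 11,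
    34 / 15 * y * w 1 + 34 / 15 * x * w 2 + 101 / 465 * y * w 6 + 101 / 465 * x * w 7
        + 2 / 5 * y * w 8 + 2 / 5 * x * w 9 + 4 / 155 * y * w 10 + 4 / 155 * x * w 11,
    31 / 109 * x * w 3 - 47 / 17 * x * w 4 + 101 / 17 * y * w 5 + 18 / 17 * x * w 12
        + 72 / 17 * y * w 13 + 3 / 109 * x * w 14,
    31 / 109 * y * w 3 + 47 / 17 * y * w 4 + 101 / 17 * x * w 5 - 18 / 17 * y * w 12
        + 72 / 17 * x * w 13 + 3 / 109 * y * w 14,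
    -(18 / 17 * x * w 4) + 9 / 17 * y * w 5 - 13 / 17 * x * w 12 - 2 / 17 * y * w 13
        + 27 / 3689 * x * w 14 + 1 / 3689 * x * w 15,
    18 / 17 * y * w 4 + 9 / 17 * x * w 5 + 13 / 17 * y * w 12 - 2 / 17 * x * w 13
        + 27 / 3689 * y * w 14 + 1 / 3689 * y * w 15,
    -(72 / 17 * x * w 4) + 36 / 17 * y * w 5 + 50 / 17 * x * w 12 - 110 / 17 * y * w 13
        + 14 / 9193 * x * w 15 + 2790 / 9193 * x * w 16,
    72 / 17 * y * w 4 + 36 / 17 * x * w 5 - 50 / 17 * y * w 12 - 110 / 17 * x * w 13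
        + 14 / 9193 * y * w 15 + 2790 / 9193 * y * w 16,
    6 / 155 * x * w 6 - 6 / 155 * y * w 7 - 26 / 45 * x * w 8 + 26 / 45 * y * w 9
        + 10 / 279 * x * w 10 - 10 / 279 * y * w 11,
    24 / 155 * y * w 6 + 24 / 155 * x * w 7 - 4 / 45 * y * w 8 - 4 / 45 * x * w 9
        - 22 / 279 * y * w 10 - 22 / 279 * x * w 11,
    119 / 5 * x * w 6 + 119 / 5 * y * w 7 + 654 / 5 * x * w 8 + 654 / 5 * y * w 9,
    18386 / 9 * x * w 8 + 18386 / 9 * y * w 9 + 1666 / 9 * x * w 10 + 1666 / 9 * y * w 11,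
    2 * x * w 10 + 2 * y * w 11]

lemma advect_0 {F : Type*} [Field F] (x y : F) (w : Fin 17 → F) :
    advect x y w 0 = x * w 1 + y * w 2 := rfl
lemma advect_1 {F : Type*} [Field F] (x y : F) (w : Fin 17 → F) :
    advect x y w 1 = 30 / 17 * x * w 0 + 1 / 34 * x * w 3 + 1 / 2 * x * w 4 + y * w 5 := rfl
lemma advect_2 {F : Type*} [Field F] (x y : F) (w : Fin 17 → F) :
    advect x y w 2 = 30 / 17 * y * w 0 + 1 / 34 * y * w 3 - 1 / 2 * y * w 4 + x * w 5 := rfl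
lemma advect_3 {F : Type*} [Field F] (x y : F) (w : Fin 17 → F) :
    advect x y w 3 = 109 / 3 * x * w 1 + 109 / 3 * y * w 2 + 17 / 3 * x * w 6
        + 17 / 3 * y * w 7 := rfl
lemma advect_4 {F : Type*} [Field F] (x y : F) (w : Fin 17 → F) :
    advect x y w 4 = 17 / 15 * x * w 1 - 17 / 15 * y * w 2 - 47 / 465 * x * w 6
        + 47 / 465 * y * w 7 - 4 / 5 * x * w 8 + 4 / 5 * y * w 9 - 8 / 155 * x * w 10
        + 8 / 155 * y * w 11 := rfl
lemma advect_5 {F : Type*} [Field F] (x y : F) (w : Fin 17 → F) :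
    advect x y w 5 = 34 / 15 * y * w 1 + 34 / 15 * x * w 2 + 101 / 465 * y * w 6
        + 101 / 465 * x * w 7 + 2 / 5 * y * w 8 + 2 / 5 * x * w 9 + 4 / 155 * y * w 10
        + 4 / 155 * x * w 11 := rfl
lemma advect_6 {F : Type*} [Field F] (x y : F) (w : Fin 17 → F) :
    advect x y w 6 = 31 / 109 * x * w 3 - 47 / 17 * x * w 4 + 101 / 17 * y * w 5
        + 18 / 17 * x * w 12 + 72 / 17 * y * w 13 + 3 / 109 * x * w 14 := rfl
lemma advect_7 {F : Type*} [Field F] (x y : F) (w : Fin 17 → F) :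
    advect x y w 7 = 31 / 109 * y * w 3 + 47 / 17 * y * w 4 + 101 / 17 * x * w 5
        - 18 / 17 * y * w 12 + 72 / 17 * x * w 13 + 3 / 109 * y * w 14 := rfl
lemma advect_8 {F : Type*} [Field F] (x y : F) (w : Fin 17 → F) :
    advect x y w 8 = -(18 / 17 * x * w 4) + 9 / 17 * y * w 5 - 13 / 17 * x * w 12
        - 2 / 17 * y * w 13 + 27 / 3689 * x * w 14 + 1 / 3689 * x * w 15 := rfl
lemma advect_9 {F : Type*} [Field F] (x y : F) (w : Fin 17 → F) :
    advect x y w 9 = 18 / 17 * y * w 4 + 9 / 17 * x * w 5 + 13 / 17 * y * w 12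
        - 2 / 17 * x * w 13 + 27 / 3689 * y * w 14 + 1 / 3689 * y * w 15 := rfl
lemma advect_10 {F : Type*} [Field F] (x y : F) (w : Fin 17 → F) :
    advect x y w 10 = -(72 / 17 * x * w 4) + 36 / 17 * y * w 5 + 50 / 17 * x * w 12
        - 110 / 17 * y * w 13 + 14 / 9193 * x * w 15 + 2790 / 9193 * x * w 16 := rfl
lemma advect_11 {F : Type*} [Field F] (x y : F) (w : Fin 17 → F) :
    advect x y w 11 = 72 / 17 * y * w 4 + 36 / 17 * x * w 5 - 50 / 17 * y * w 12
        - 110 / 17 * x * w 13 + 14 / 9193 * y * w 15 + 2790 / 9193 * y * w 16 := rfl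
lemma advect_12 {F : Type*} [Field F] (x y : F) (w : Fin 17 → F) :
    advect x y w 12 = 6 / 155 * x * w 6 - 6 / 155 * y * w 7 - 26 / 45 * x * w 8
        + 26 / 45 * y * w 9 + 10 / 279 * x * w 10 - 10 / 279 * y * w 11 := rfl
lemma advect_13 {F : Type*} [Field F] (x y : F) (w : Fin 17 → F) :
    advect x y w 13 = 24 / 155 * y * w 6 + 24 / 155 * x * w 7 - 4 / 45 * y * w 8
        - 4 / 45 * x * w 9 - 22 / 279 * y * w 10 - 22 / 279 * x * w 11 := rfl
lemma advect_14 {F : Type*} [Field F] (x y : F) (w : Fin 17 → F) :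
    advect x y w 14 = 119 / 5 * x * w 6 + 119 / 5 * y * w 7 + 654 / 5 * x * w 8
        + 654 / 5 * y * w 9 := rfl
lemma advect_15 {F : Type*} [Field F] (x y : F) (w : Fin 17 → F) :
    advect x y w 15 = 18386 / 9 * x * w 8 + 18386 / 9 * y * w 9 + 1666 / 9 * x * w 10
        + 1666 / 9 * y * w 11 := rfl
lemma advect_16 {F : Type*} [Field F] (x y : F) (w : Fin 17 → F) :
    advect x y w 16 = 2 * x * w 10 + 2 * y * w 11 := rfl

lemma forall_fin17 {P : Fin 17 → Prop} (h0 : P 0) (h1 : P 1) (h2 : P 2) (h3 : P 3) (h4 : P 4)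
    (h5 : P 5) (h6 : P 6) (h7 : P 7) (h8 : P 8) (h9 : P 9) (h10 : P 10) (h11 : P 11) (h12 : P 12)
    (h13 : P 13) (h14 : P 14) (h15 : P 15) (h16 : P 16) (k : Fin 17) : P k := by
  fin_cases k <;> assumption

/-- The moments are mutually orthogonal for the counting measure on the stencil. Invertibility of
the moment matrix follows without expanding its determinant. -/
lemma momentTable_mul_transpose : momentTable * momentTableᵀ =
    Matrix.diagonal ![17, 30, 30, 37060, 68, 68, 1860, 1860, 90, 90, 5580, 5580, 68, 68, 1608404,
        678259540, 36772] := by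
  decide +kernel

/-- The homogeneity degrees of the moments in the velocity. -/
def momentDegree : Fin 17 → ℕ := ![0, 1, 1, 2, 2, 2, 3, 3, 5, 5, 7, 7, 4, 4, 4, 6, 8]

/-- Every moment polynomial is homogeneous jointly in `λ` and the velocity, so all computations can
be made at `λ = 1`. -/
lemma momentPoly_homogeneous (lam X Y : ℝ) (k : Fin 17) :
    momentPoly lam (lam * X) (lam * Y) k = lam ^ momentDegree k * momentPoly 1 X Y k := by
  fin_cases k <;> simp [momentPoly, momentDegree] <;> ring

/-- A rational form of the polynomials, so that the table of moments becomes a decidable statement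
over `ℚ`. -/
lemma momentPoly_one_int (X Y : ℤ) (k : Fin 17) :
    momentPoly 1 X Y k = ((![1, X, Y, -60 + 17 * (X ^ 2 + Y ^ 2), X ^ 2 - Y ^ 2, X * Y,
      X * (-17 + 3 * (X ^ 2 + Y ^ 2)), Y * (-17 + 3 * (X ^ 2 + Y ^ 2)),
      X * (47 / 6 - 17 / 4 * (X ^ 2 + Y ^ 2) + 5 / 12 * (X ^ 2 + Y ^ 2) ^ 2),
      Y * (47 / 6 - 17 / 4 * (X ^ 2 + Y ^ 2) + 5 / 12 * (X ^ 2 + Y ^ 2) ^ 2),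
      X * (-(7429 / 42) + 1565 / 8 * (X ^ 2 + Y ^ 2) - 2635 / 48 * (X ^ 2 + Y ^ 2) ^ 2
        + 465 / 112 * (X ^ 2 + Y ^ 2) ^ 3),
      Y * (-(7429 / 42) + 1565 / 8 * (X ^ 2 + Y ^ 2) - 2635 / 48 * (X ^ 2 + Y ^ 2) ^ 2
        + 465 / 112 * (X ^ 2 + Y ^ 2) ^ 3),
      (X ^ 2 - Y ^ 2) * (-(65 / 12) + 17 / 12 * (X ^ 2 + Y ^ 2)),
      X * Y * (-(65 / 12) + 17 / 24 * (X ^ 2 + Y ^ 2)),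
      620 - 969 / 2 * (X ^ 2 + Y ^ 2) + 109 / 2 * (X ^ 2 + Y ^ 2) ^ 2,
      -16740 + 330361 / 12 * (X ^ 2 + Y ^ 2) - 74485 / 8 * (X ^ 2 + Y ^ 2) ^ 2
        + 18445 / 24 * (X ^ 2 + Y ^ 2) ^ 3,
      84 - 24055 / 56 * (X ^ 2 + Y ^ 2) + 35425 / 96 * (X ^ 2 + Y ^ 2) ^ 2
        - 6035 / 64 * (X ^ 2 + Y ^ 2) ^ 3 + 9193 / 1344 * (X ^ 2 + Y ^ 2) ^ 4] :
      Fin 17 → ℚ) k : ℚ) := by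
  fin_cases k <;> simp [momentPoly]

/-- The velocities have integer coordinates. -/
def xiInt : Fin 17 → Fin 2 → ℤ :=
  ![![0, 0], ![1, 0], ![0, 1], ![-1, 0], ![0, -1],
    ![1, 1], ![-1, 1], ![-1, -1], ![1, -1],
    ![2, 0], ![0, 2], ![-2, 0], ![0, -2],
    ![2, 2], ![-2, 2], ![-2, -2], ![2, -2]]

lemma xi_eq_xiInt (j : Fin 17) (a : Fin 2) : xi j a = xiInt j a := by
  fin_cases j <;> fin_cases a <;> simp [xi, xiInt]

lemma momentPoly_one_xi (k j : Fin 17) :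
    momentPoly 1 (xi j 0) (xi j 1) k = momentTable k j := by
  rw [xi_eq_xiInt, xi_eq_xiInt, momentPoly_one_int, ← Rat.cast_intCast]
  congr 1
  revert k j
  decide +kernel

lemma advect_map (w : Fin 17 → ℚ) (x y : ℚ) (k : Fin 17) :
    advect (x : ℂ) y (fun l => (w l : ℂ)) k = (advect x y w k : ℚ) := by
  revert k
  apply forall_fin17 <;> simp only [advect_0, advect_1, advect_2, advect_3, advect_4, advect_5,
      advect_6,
    advect_7, advect_8, advect_9, advect_10, advect_11, advect_12, advect_13, advect_14, advect_15,
    advect_16] <;>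
    push_cast <;> rfl

lemma advect_split (x y : ℂ) (w : Fin 17 → ℂ) :
    advect x y w = x • advect 1 0 w + y • advect 0 1 w := by
  funext k
  revert k
  apply forall_fin17 <;> simp only [Pi.add_apply, Pi.smul_apply, smul_eq_mul, advect_0, advect_1,
      advect_2, advect_3, advect_4, advect_5, advect_6,
    advect_7, advect_8, advect_9, advect_10, advect_11, advect_12, advect_13, advect_14, advect_15,
    advect_16] <;>
    ring

lemma advect_add (x y : ℂ) (v w : Fin 17 → ℂ) :
    advect x y (v + w) = advect x y v + advect x y w := by
  funext k
  revert k
  apply forall_fin17 <;> simp only [Pi.add_apply, Pi.smul_apply, smul_eq_mul, advect_0, advect_1,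
      advect_2, advect_3, advect_4, advect_5, advect_6,
    advect_7, advect_8, advect_9, advect_10, advect_11, advect_12, advect_13, advect_14, advect_15,
    advect_16] <;>
    ring

lemma advect_smul (x y c : ℂ) (w : Fin 17 → ℂ) :
    advect x y (c • w) = c • advect x y w := by
  funext k
  revert k
  apply forall_fin17 <;> simp only [Pi.add_apply, Pi.smul_apply, smul_eq_mul, advect_0, advect_1,
      advect_2, advect_3, advect_4, advect_5, advect_6,
    advect_7, advect_8, advect_9, advect_10, advect_11, advect_12, advect_13, advect_14, advect_15,
    advect_16] <;>
    ring

/-- The linear map `advect x y`. -/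
def advectLin (x y : ℂ) : (Fin 17 → ℂ) →ₗ[ℂ] (Fin 17 → ℂ) where
  toFun := advect x y
  map_add' := advect_add x y
  map_smul' := advect_smul x y

/-- Columns of the moment table are eigenvectors of `advect`, with the coordinates of the velocity
as eigenvalues. As the columns form a basis, this finite check identifies `advect` completely. -/
lemma advect_table (j k : Fin 17) :
    advect (1 : ℚ) 0 (fun l => (momentTable l j : ℚ)) k = xiInt j 0 * momentTable k j ∧
    advect (0 : ℚ) 1 (fun l => (momentTable l j : ℚ)) k = xiInt j 1 * momentTable k j := by
  revert j k
  decide +kernel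

/-- The moment matrix for `lam = 1`, with complex entries. -/
def momentC : Matrix (Fin 17) (Fin 17) ℂ := momentTable.map (fun n : ℤ => (n : ℂ))

lemma momentC_col (j : Fin 17) :
    momentC.col j = fun l => (((momentTable l j : ℤ) : ℚ) : ℂ) := by
  funext l
  simp [momentC]

lemma advect_momentC_col (x y : ℂ) (j : Fin 17) :
    advect x y (momentC.col j) = (x * (xi j 0 : ℂ) + y * (xi j 1 : ℂ)) • momentC.col j := by
  have h0 : advect (1 : ℂ) 0 (momentC.col j) = (xi j 0 : ℂ) • momentC.col j := by
    funext k
    have := advect_map (fun l => (momentTable l j : ℚ)) 1 0 k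
    rw [(advect_table j k).1, ← momentC_col] at this
    rw [xi_eq_xiInt]
    push_cast at this
    simpa [momentC] using this
  have h1 : advect (0 : ℂ) 1 (momentC.col j) = (xi j 1 : ℂ) • momentC.col j := by
    funext k
    have := advect_map (fun l => (momentTable l j : ℚ)) 0 1 k
    rw [(advect_table j k).2, ← momentC_col] at this
    rw [xi_eq_xiInt]
    push_cast at this
    simpa [momentC] using this
  rw [advect_split, h0, h1, smul_smul, smul_smul, ← add_smul]

/-- By linearity from the eigenvector property of the columns: `advect` is multiplication by the
velocity, transported by the moment matrix. -/
lemma advect_momentC (x y : ℂ) (f : Fin 17 → ℂ) :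
    advect x y (momentC *ᵥ f) =
      momentC *ᵥ (fun j => (x * (xi j 0 : ℂ) + y * (xi j 1 : ℂ)) * f j) := by
  have h : ∀ f : Fin 17 → ℂ, momentC *ᵥ f = ∑ j, f j • momentC.col j := by
    intro f
    funext k
    simp [Matrix.mulVec, dotProduct, Matrix.col, mul_comm]
  rw [h f, h]
  change advectLin x y _ = _
  rw [map_sum]
  refine Finset.sum_congr rfl fun j _ => ?_
  rw [map_smul]
  change f j • advect x y (momentC.col j) = _
  rw [advect_momentC_col, smul_smul, mul_comm]

/-- By orthogonality the square of the determinant is a product of nonzero squared norms. -/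
lemma isUnit_det_momentC : IsUnit momentC.det := by
  have h : momentTable.det ≠ 0 := by
    intro h0
    have := congrArg Matrix.det momentTable_mul_transpose
    rw [Matrix.det_mul, h0, zero_mul, Matrix.det_diagonal] at this
    revert this
    decide +kernel
  have h2 : momentC.det = (momentTable.det : ℂ) := by
    rw [momentC]
    exact (RingHom.map_det (Int.castRingHom ℂ) momentTable).symm
  rw [h2, isUnit_iff_ne_zero]
  exact_mod_cast h

lemma momentMatrix_eq (lam : ℝ) :
    momentMatrix lam = Matrix.diagonal (fun k => lam ^ momentDegree k) *
      momentTable.map (fun n : ℤ => (n : ℝ)) := by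
  ext k j
  rw [Matrix.diagonal_mul]
  simp only [momentMatrix, Matrix.of_apply, velocity, Matrix.map_apply]
  rw [momentPoly_homogeneous, momentPoly_one_xi]

/-! ### Transport modulo the fifth power of the time step, in time-centred form. -/

open PowerSeries in
/-- The truncation of `exp (-z)` at order `5`. -/
def truncExp (z : PowerSeries ℂ) : PowerSeries ℂ :=
  C (1 / 24) * (24 - 24 * z + 12 * z ^ 2 - 4 * z ^ 3 + z ^ 4)

open PowerSeries in
lemma twentyfour_mul_C : (24 : PowerSeries ℂ) * C (1 / 24) = 1 := by
  rw [← map_ofNat (C (R := ℂ)) 24, ← map_mul]; norm_num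

open PowerSeries in
lemma decay_eq_truncExp (mu : PowerSeries ℂ) : decay mu = truncExp (X * mu) := by
  have h2 : (C (1 / 2) : PowerSeries ℂ) = 12 * C (1 / 24) := by
    rw [← map_ofNat (C (R := ℂ)) 12, ← map_mul]; norm_num
  have h6 : (C (1 / 6) : PowerSeries ℂ) = 4 * C (1 / 24) := by
    rw [← map_ofNat (C (R := ℂ)) 4, ← map_mul]; norm_num
  have h := twentyfour_mul_C
  simp only [decay, truncExp, Finset.sum_range_succ, Finset.sum_range_zero]
  norm_num [Nat.factorial]
  rw [h2, h6]
  linear_combination (-1 + X * mu) * h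

open PowerSeries in
lemma coeff_eq_le_four_iff (a b : PowerSeries ℂ) :
    (∀ m ≤ 4, coeff m a = coeff m b) ↔ X ^ 5 ∣ a - b := by
  rw [X_pow_dvd_iff]
  simp only [map_sub, sub_eq_zero, Nat.lt_succ_iff]

open PowerSeries in
-- The functional equation of the exponential, truncated; the witness is the explicit polynomial
-- quotient by `X ^ 5`.
lemma truncExp_mul_truncExp (a b : PowerSeries ℂ) :
    X ^ 5 ∣ truncExp (X * a) * truncExp (X * b) - truncExp (X * (a + b)) := by
  refine ⟨C (1 / 24) ^ 2 * (-24 * a * b ^ 4 - 48 * a ^ 2 * b ^ 3 - 48 * a ^ 3 * b ^ 2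
    - 24 * a ^ 4 * b + X * (12 * a ^ 2 * b ^ 4 + 16 * a ^ 3 * b ^ 3 + 12 * a ^ 4 * b ^ 2)
    - X ^ 2 * (4 * a ^ 3 * b ^ 4 + 4 * a ^ 4 * b ^ 3) + X ^ 3 * (a ^ 4 * b ^ 4)), ?_⟩
  rw [← one_mul (truncExp (X * (a + b))), ← twentyfour_mul_C]
  simp only [truncExp]
  ring

open PowerSeries in
-- With `z = X b`, this is `(1 - exp(-z)) / (1 + exp(-z)) = tanh(z/2) = z/2 - z³/24 + O(z⁵)`,
-- cleared of denominators.
lemma truncExp_tanh (b : PowerSeries ℂ) :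
    X ^ 5 ∣ 24 * (truncExp (X * b) - 1)
      + (12 * (X * b) - X ^ 3 * b ^ 3) * (1 + truncExp (X * b)) := by
  have h : (24 : PowerSeries ℂ) * C (1 / 24) = 1 := twentyfour_mul_C
  refine ⟨C (1 / 24) * (4 * X * b ^ 6 - X ^ 2 * b ^ 7), ?_⟩
  simp only [truncExp]
  linear_combination (24 - 12 * X * b + X ^ 3 * b ^ 3 : PowerSeries ℂ) * h

open PowerSeries in
lemma phase_congr (lam : ℝ) (k : EuclideanSpace ℝ (Fin 2)) (j : Fin 17) :
    X ^ 5 ∣ phase lam k j - truncExp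
      (X * C (Complex.I * ((k 0 * velocity lam j 0 + k 1 * velocity lam j 1 : ℝ) : ℂ))) := by
  rw [← decay_eq_truncExp, X_pow_dvd_iff]
  intro m hm
  have h : ∀ (c d : ℂ) (n : ℕ), (C c * (-(X * C d)) ^ n : PowerSeries ℂ)
      = C (c * (-d) ^ n) * X ^ n := by
    intro c d n
    rw [map_mul, map_pow, map_neg]
    ring
  rw [map_sub, sub_eq_zero, decay, map_sum]
  simp only [h, coeff_C_mul_X_pow, phase, coeff_mk]
  rw [Finset.sum_ite_eq, if_pos (Finset.mem_range.mpr hm)]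
  ring

open PowerSeries in
/-- The mode equation of one velocity, in a form that is odd in the increment of time. -/
lemma mode_component_iff (ph mu phi phis : PowerSeries ℂ) (d : ℂ)
    (hph : X ^ 5 ∣ ph - truncExp (X * C d)) :
    (∀ m ≤ 4, coeff m (ph * phis) = coeff m (decay mu * phi)) ↔
      X ^ 5 ∣ 24 * (phis - phi)
        + (12 * (X * (mu - C d)) - X ^ 3 * (mu - C d) ^ 3) * (phi + phis) := by
  rw [coeff_eq_le_four_iff, decay_eq_truncExp]
  have h0 : truncExp (X * (C d + -C d)) = 1 := by
    rw [truncExp, add_neg_cancel]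
    linear_combination twentyfour_mul_C
  have h1 := truncExp_mul_truncExp (C d) (-C d)
  have h2 := truncExp_mul_truncExp (-C d) mu
  have h3 := truncExp_mul_truncExp (C d) (mu - C d)
  have h4 := truncExp_tanh (mu - C d)
  rw [h0] at h1
  rw [show -C d + mu = mu - C d by ring] at h2
  rw [show C d + (mu - C d) = mu by ring] at h3
  generalize truncExp (X * (mu - C d)) = tb at *
  -- The phase is invertible modulo `X ^ 5`, with inverse the truncated exponential of the opposite
  -- argument, so it can be moved to the other side.
  have e1 : X ^ 5 ∣ ph * phis - truncExp (X * mu) * phi ↔ X ^ 5 ∣ phis - tb * phi := by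
    constructor
    · intro h
      have := dvd_add (dvd_add (dvd_add (hph.mul_left (-(truncExp (X * -C d) * phis)))
        (h1.mul_left (-phis))) (h.mul_left (truncExp (X * -C d)))) (h2.mul_left phi)
      convert this using 1
      ring
    · intro h
      have := dvd_add (dvd_add (h.mul_left ph) (hph.mul_left (tb * phi))) (h3.mul_left phi)
      convert this using 1
      ring
  rw [e1]
  generalize mu - C d = b at *
  -- This series is the coefficient of `phis` in the odd form. Its constant term is 24, so dividing
  -- by it preserves divisibility by `X ^ 5`.
  have hu : IsUnit (24 + 12 * (X * b) - X ^ 3 * b ^ 3 : PowerSeries ℂ) := by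
    rw [isUnit_iff_constantCoeff]
    simp [map_ofNat]
  constructor
  · intro h
    have := dvd_add (h4.mul_left phi) (h.mul_left (24 + 12 * (X * b) - X ^ 3 * b ^ 3))
    convert this using 1
    ring
  · intro h
    rw [← hu.dvd_mul_left]
    have := dvd_sub h (h4.mul_left phi)
    convert this using 1
    ring

open PowerSeries in
/-- A polynomial of degree three in the increment of time, with given coefficients. -/
def cubic (m : Fin 4 → ℂ) : PowerSeries ℂ :=
  C (m 0) + C (m 1) * X + C (m 2) * X ^ 2 + C (m 3) * X ^ 3

open PowerSeries in
lemma coeff_cubic_sub (m : Fin 4 → ℂ) (d : ℂ) :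
    coeff 0 (cubic m - C d) = m 0 - d ∧ coeff 1 (cubic m - C d) = m 1 ∧
    coeff 2 (cubic m - C d) = m 2 ∧ coeff 3 (cubic m - C d) = m 3 := by
  refine ⟨?_, ?_, ?_, ?_⟩ <;> simp [cubic, coeff_X_pow, coeff_C]

open PowerSeries in
lemma coeff_mul_low (a f : PowerSeries ℂ) :
    coeff 0 (a * f) = coeff 0 a * coeff 0 f ∧
    coeff 1 (a * f) = coeff 0 a * coeff 1 f + coeff 1 a * coeff 0 f ∧
    coeff 2 (a * f) = coeff 0 a * coeff 2 f + coeff 1 a * coeff 1 f + coeff 2 a * coeff 0 f ∧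
    coeff 3 (a * f) = coeff 0 a * coeff 3 f + coeff 1 a * coeff 2 f + coeff 2 a * coeff 1 f
      + coeff 3 a * coeff 0 f := by
  refine ⟨?_, ?_, ?_, ?_⟩ <;> rw [coeff_mul] <;>
    simp [Finset.Nat.antidiagonal_succ] <;> ring

open PowerSeries in
lemma X_pow_five_dvd_iff (a : PowerSeries ℂ) :
    X ^ 5 ∣ a ↔ coeff 0 a = 0 ∧ coeff 1 a = 0 ∧ coeff 2 a = 0 ∧ coeff 3 a = 0 ∧
      coeff 4 a = 0 := by
  rw [X_pow_dvd_iff]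
  constructor
  · intro h
    exact ⟨h 0 (by norm_num), h 1 (by norm_num), h 2 (by norm_num), h 3 (by norm_num),
      h 4 (by norm_num)⟩
  · rintro ⟨h0, h1, h2, h3, h4⟩ m hm
    interval_cases m <;> assumption

/-- The expansion of `b f - X² b³ f / 12` where `b = b₀ + m₁ X + m₂ X² + m₃ X³`. -/
def oddStep (b0 : ℂ) (m f : Fin 4 → ℂ) : Fin 4 → ℂ :=
  let e0 := b0 * f 0
  let e1 := b0 * f 1 + m 1 * f 0
  ![e0, e1,
    b0 * f 2 + m 1 * f 1 + m 2 * f 0 - 1 / 12 * (b0 * (b0 * e0)),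
    b0 * f 3 + m 1 * f 2 + m 2 * f 1 + m 3 * f 0
      - 1 / 12 * (b0 * (b0 * e1) + 2 * m 1 * (b0 * e0))]

lemma oddStep_0 (b0 : ℂ) (m f : Fin 4 → ℂ) : oddStep b0 m f 0 = b0 * f 0 := rfl

lemma oddStep_1 (b0 : ℂ) (m f : Fin 4 → ℂ) :
    oddStep b0 m f 1 = b0 * f 1 + m 1 * f 0 := rfl

lemma oddStep_2 (b0 : ℂ) (m f : Fin 4 → ℂ) :
    oddStep b0 m f 2 = b0 * f 2 + m 1 * f 1 + m 2 * f 0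
      - 1 / 12 * (b0 * (b0 * oddStep b0 m f 0)) := rfl

lemma oddStep_3 (b0 : ℂ) (m f : Fin 4 → ℂ) :
    oddStep b0 m f 3 = b0 * f 3 + m 1 * f 2 + m 2 * f 1 + m 3 * f 0
      - 1 / 12 * (b0 * (b0 * oddStep b0 m f 1) + 2 * m 1 * (b0 * oddStep b0 m f 0)) := rfl

open PowerSeries in
-- The odd form is read coefficient by coefficient, with `f` the half-sum. Since `z = X b` has a
-- factor `X`, the increment at order `n + 1` involves the half-sums only up to order `n`, and four
-- orders of `f` suffice.
lemma mode_component_iff_oddStep (ph phi phis : PowerSeries ℂ) (m f : Fin 4 → ℂ) (d : ℂ)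
    (hph : X ^ 5 ∣ ph - truncExp (X * C d))
    (hf : ∀ n : Fin 4, 2 * f n = coeff n phi + coeff n phis) :
    (∀ i ≤ 4, coeff i (ph * phis) = coeff i (decay (cubic m) * phi)) ↔
      coeff 0 phis = coeff 0 phi ∧
      ∀ n : Fin 4, coeff (n + 1) phis - coeff (n + 1) phi = - oddStep (m 0 - d) m f n := by
  rw [mode_component_iff ph (cubic m) phi phis d hph, X_pow_five_dvd_iff]
  obtain ⟨b0, b1, b2, b3⟩ := coeff_cubic_sub m d
  generalize cubic m - C d = b at *
  have hf0 : 2 * f 0 = coeff 0 phi + coeff 0 phis := hf 0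
  have hf1 : 2 * f 1 = coeff 1 phi + coeff 1 phis := hf 1
  have hf2 : 2 * f 2 = coeff 2 phi + coeff 2 phis := hf 2
  have hf3 : 2 * f 3 = coeff 3 phi + coeff 3 phis := hf 3
  obtain ⟨g0, g1, g2, g3⟩ := coeff_mul_low b (phi + phis)
  obtain ⟨k0, k1, -, -⟩ := coeff_mul_low b (b * (phi + phis))
  obtain ⟨l0, l1, -, -⟩ := coeff_mul_low b (b * (b * (phi + phis)))
  have e : (12 * (X * b) - X ^ 3 * b ^ 3) * (phi + phis)
      = X * (12 * (b * (phi + phis)) - X ^ 2 * (b * (b * (b * (phi + phis))))) := by ring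
  have c12 : ∀ n (a : PowerSeries ℂ), coeff n (12 * a) = 12 * coeff n a := by
    intro n a
    rw [← map_ofNat (C (R := ℂ)) 12, coeff_C_mul]
  have c24 : ∀ n (a : PowerSeries ℂ), coeff n (24 * a) = 24 * coeff n a := by
    intro n a
    rw [← map_ofNat (C (R := ℂ)) 24, coeff_C_mul]
  have s1 : ∀ (a : PowerSeries ℂ), coeff 0 (X * a) = 0 ∧ coeff 1 (X * a) = coeff 0 a ∧
      coeff 2 (X * a) = coeff 1 a ∧ coeff 3 (X * a) = coeff 2 a ∧ coeff 4 (X * a) = coeff 3 a :=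
    fun a => ⟨coeff_zero_X_mul a, coeff_succ_X_mul 0 a, coeff_succ_X_mul 1 a,
      coeff_succ_X_mul 2 a, coeff_succ_X_mul 3 a⟩
  have s2 : ∀ (a : PowerSeries ℂ), coeff 0 (X ^ 2 * a) = 0 ∧ coeff 1 (X ^ 2 * a) = 0 ∧
      coeff 2 (X ^ 2 * a) = coeff 0 a ∧ coeff 3 (X ^ 2 * a) = coeff 1 a := by
    intro a
    refine ⟨?_, ?_, ?_, ?_⟩ <;> rw [coeff_X_pow_mul'] <;> norm_num
  obtain ⟨t0, t1, t2, t3⟩ := s2 (b * (b * (b * (phi + phis))))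
  obtain ⟨u0, u1, u2, u3, u4⟩ :=
    s1 (12 * (b * (phi + phis)) - X ^ 2 * (b * (b * (b * (phi + phis)))))
  rw [e]
  simp only [map_add, map_sub, c24, c12] at u0 u1 u2 u3 u4 g0 g1 g2 g3 ⊢
  simp only [u0, u1, u2, u3, u4, t0, t1, t2, t3, l0, l1, k0, k1, g0, g1, g2, g3, b0, b1, b2, b3]
  rw [← hf0, ← hf1, ← hf2, ← hf3]
  constructor
  · rintro ⟨h0, h1, h2, h3, h4⟩
    refine ⟨by linear_combination h0 / 24, fun n => ?_⟩
    fin_cases n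
    · change coeff 1 phis - coeff 1 phi = - oddStep (m 0 - d) m f 0
      rw [oddStep_0]
      linear_combination h1 / 24
    · change coeff 2 phis - coeff 2 phi = - oddStep (m 0 - d) m f 1
      rw [oddStep_1]
      linear_combination h2 / 24
    · change coeff 3 phis - coeff 3 phi = - oddStep (m 0 - d) m f 2
      rw [oddStep_2, oddStep_0]
      linear_combination h3 / 24
    · change coeff 4 phis - coeff 4 phi = - oddStep (m 0 - d) m f 3
      rw [oddStep_3, oddStep_0, oddStep_1]
      linear_combination h4 / 24
  · rintro ⟨h0, h⟩
    have h1 : coeff 1 phis - coeff 1 phi = - oddStep (m 0 - d) m f 0 := h 0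
    have h2 : coeff 2 phis - coeff 2 phi = - oddStep (m 0 - d) m f 1 := h 1
    have h3 : coeff 3 phis - coeff 3 phi = - oddStep (m 0 - d) m f 2 := h 2
    have h4 : coeff 4 phis - coeff 4 phi = - oddStep (m 0 - d) m f 3 := h 3
    rw [oddStep_0] at h1
    rw [oddStep_1] at h2
    rw [oddStep_2, oddStep_0] at h3
    rw [oddStep_3, oddStep_0, oddStep_1] at h4
    refine ⟨?_, ?_, ?_, ?_, ?_⟩
    · linear_combination 24 * h0
    · linear_combination 24 * h1
    · linear_combination 24 * h2
    · linear_combination 24 * h3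
    · linear_combination 24 * h4

/-! ### The scheme as a recursion on moments. -/

/-- The embedding of the indices of the conserved moments. -/
def consIdx (a : Fin 4) : Fin 17 := Fin.castLE (by norm_num) a

/-- The value of the moments at equilibrium, where the linear equilibrium is given by the rows
of `Q`. -/
def equilibrium (Q : Matrix (Fin 17) (Fin 4) ℂ) (w : Fin 17 → ℂ) (k : Fin 17) : ℂ :=
  Q k 0 * w 0 + Q k 1 * w 1 + Q k 2 * w 2 + Q k 3 * w 3

/-- The coefficients `ψ n` of the moments, and their increments `θ n`, in the expansion of a mode
`exp (-t (m₀ + m₁ Δt + m₂ Δt² + m₃ Δt³))` of the scheme at the wave vector `(i x, i y)`. -/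
structure IsExpansion (x y : ℂ) (sig : Fin 17 → ℂ) (Q : Matrix (Fin 17) (Fin 4) ℂ)
    (m : Fin 4 → ℂ) (psi theta : Fin 4 → Fin 17 → ℂ) : Prop where
  theta0 : theta 0 = advect x y (psi 0) + m 0 • psi 0
  theta1 : theta 1 = advect x y (psi 1) + m 0 • psi 1 + m 1 • psi 0
  theta2 : theta 2 = advect x y (psi 2) + m 0 • psi 2 + m 1 • psi 1 + m 2 • psi 0
    - (1 / 12 : ℂ) • (advect x y (advect x y (theta 0) + m 0 • theta 0)
      + m 0 • (advect x y (theta 0) + m 0 • theta 0))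
  theta3 : theta 3 = advect x y (psi 3) + m 0 • psi 3 + m 1 • psi 2 + m 2 • psi 1 + m 3 • psi 0
    - (1 / 12 : ℂ) • (advect x y (advect x y (theta 1) + m 0 • theta 1)
      + m 0 • (advect x y (theta 1) + m 0 • theta 1)
      + (2 * m 1) • (advect x y (theta 0) + m 0 • theta 0))
  conserved : ∀ n a, theta n (consIdx a) = 0
  relax0 : ∀ k : Fin 17, 4 ≤ (k : ℕ) → psi 0 k = equilibrium Q (psi 0) k
  relax : ∀ n : Fin 3, ∀ k : Fin 17, 4 ≤ (k : ℕ) →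
    psi n.succ k = equilibrium Q (psi n.succ) k + sig k * theta n.castSucc k

/-- The increments of the moments of the densities with the expansion `f`. -/
lemma momentC_mulVec_oddStep (x y : ℂ) (m : Fin 4 → ℂ) (f : Fin 4 → Fin 17 → ℂ) :
    let d : Fin 17 → ℂ := fun j => -(x * (xi j 0 : ℂ) + y * (xi j 1 : ℂ))
    let psi : Fin 4 → Fin 17 → ℂ := fun n => momentC *ᵥ f n
    let theta : Fin 4 → Fin 17 → ℂ :=
      fun n => momentC *ᵥ fun j => oddStep (m 0 - d j) m (fun i => f i j) n
    theta 0 = advect x y (psi 0) + m 0 • psi 0 ∧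
    theta 1 = advect x y (psi 1) + m 0 • psi 1 + m 1 • psi 0 ∧
    theta 2 = advect x y (psi 2) + m 0 • psi 2 + m 1 • psi 1 + m 2 • psi 0
      - (1 / 12 : ℂ) • (advect x y (advect x y (theta 0) + m 0 • theta 0)
        + m 0 • (advect x y (theta 0) + m 0 • theta 0)) ∧
    theta 3 = advect x y (psi 3) + m 0 • psi 3 + m 1 • psi 2 + m 2 • psi 1 + m 3 • psi 0
      - (1 / 12 : ℂ) • (advect x y (advect x y (theta 1) + m 0 • theta 1)
        + m 0 • (advect x y (theta 1) + m 0 • theta 1)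
        + (2 * m 1) • (advect x y (theta 0) + m 0 • theta 0)) := by
  intro d psi theta
  refine ⟨?_, ?_, ?_, ?_⟩ <;>
  -- All terms are images under `momentC`, so each identity reduces to a scalar one at a single
  -- velocity, where `advect` is multiplication.
  · simp only [psi, theta, advect_momentC, ← Matrix.mulVec_smul, ← Matrix.mulVec_add,
      ← Matrix.mulVec_sub]
    congr 1
    funext j
    simp only [Pi.add_apply, Pi.sub_apply, Pi.smul_apply, smul_eq_mul, oddStep_0, oddStep_1,
      oddStep_2, oddStep_3, d]
    ring

/-- The equilibrium in the units where `lam = 1`. -/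
def scaledEquilibrium (lam : ℝ) (Eq : Matrix (Fin 17) (Fin 4) ℝ) : Matrix (Fin 17) (Fin 4) ℂ :=
  Matrix.of fun k a =>
    ((Eq k a * lam ^ momentDegree (consIdx a) / lam ^ momentDegree k : ℝ) : ℂ)

/-- The amplification matrix at `Δt = 0`. -/
def collisionC (lam : ℝ) (R : Rates) (Eq : Matrix (Fin 17) (Fin 4) ℝ) :
    Matrix (Fin 17) (Fin 17) ℂ :=
  ((momentMatrix lam)⁻¹ * collision R Eq * momentMatrix lam).map fun x : ℝ => (x : ℂ)

lemma isUnit_det_momentMatrix {lam : ℝ} (hlam : 0 < lam) : IsUnit (momentMatrix lam).det := by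
  have h := isUnit_det_momentC
  have h2 : momentC.det = (((momentTable.map (fun n : ℤ => (n : ℝ))).det : ℝ) : ℂ) := by
    rw [show ((momentTable.map (fun n : ℤ => (n : ℝ))).det : ℂ) = Complex.ofRealHom _ from rfl,
      RingHom.map_det]
    congr 1
  rw [isUnit_iff_ne_zero] at h ⊢
  rw [momentMatrix_eq, Matrix.det_mul, Matrix.det_diagonal]
  refine mul_ne_zero (Finset.prod_ne_zero_iff.mpr fun k _ => (pow_pos hlam _).ne') ?_
  intro h0
  rw [h2, h0] at h
  simp at h

lemma collision_mulVec (R : Rates) (Eq : Matrix (Fin 17) (Fin 4) ℝ) (w : Fin 17 → ℂ)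
    (k : Fin 17) :
    ((collision R Eq).map (fun x : ℝ => (x : ℂ)) *ᵥ w) k =
      w k + R.toFun k * (∑ a, (Eq k a : ℂ) * w (consIdx a) - w k) := by
  have hc : ∀ l, (Eq * conserved) k l = ∑ a, Eq k a * (if (l : ℕ) = (a : ℕ) then 1 else 0) := by
    intro l
    simp [Matrix.mul_apply, conserved]
  have h1 : ∀ l, collision R Eq k l = (if k = l then 1 else 0) + R.toFun k *
      (∑ a, Eq k a * (if (l : ℕ) = (a : ℕ) then 1 else 0) - if k = l then 1 else 0) := by
    intro l
    rw [collision, Matrix.add_apply, Matrix.diagonal_mul, Matrix.sub_apply, hc, Matrix.one_apply]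
  have h2 : ∀ a : Fin 4, (∑ l : Fin 17, (if (l : ℕ) = (a : ℕ) then (1 : ℂ) else 0) * w l)
      = w (consIdx a) := by
    intro a
    rw [Finset.sum_eq_single (consIdx a)]
    · simp [consIdx]
    · intro l _ hl
      have : (l : ℕ) ≠ a := fun h => hl (Fin.ext h)
      simp [this]
    · simp
  have h3 : ∀ l, ((collision R Eq k l : ℝ) : ℂ) * w l = (if k = l then w l else 0) + R.toFun k *
      (∑ a, (Eq k a : ℂ) * ((if (l : ℕ) = (a : ℕ) then (1 : ℂ) else 0) * w l)
        - if k = l then w l else 0) := by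
    intro l
    rw [h1]
    simp only [← mul_assoc, ← Finset.sum_mul]
    simp only [Complex.ofReal_add, Complex.ofReal_sub, Complex.ofReal_mul, Complex.ofReal_sum,
      apply_ite Complex.ofReal, Complex.ofReal_one, Complex.ofReal_zero]
    split_ifs <;> ring
  simp only [Matrix.mulVec, dotProduct, Matrix.map_apply, h3, Finset.sum_add_distrib,
    ← Finset.mul_sum, Finset.sum_sub_distrib]
  rw [Finset.sum_comm]
  simp only [← Finset.mul_sum, h2]
  simp

/-- The collision step on the moments in the units where `lam = 1`. -/
lemma momentC_mulVec_collisionC {lam : ℝ} (hlam : 0 < lam) (R : Rates)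
    (Eq : Matrix (Fin 17) (Fin 4) ℝ) (v : Fin 17 → ℂ) (k : Fin 17) :
    (momentC *ᵥ (collisionC lam R Eq *ᵥ v)) k = (momentC *ᵥ v) k + R.toFun k *
      (equilibrium (scaledEquilibrium lam Eq) (momentC *ᵥ v) k - (momentC *ᵥ v) k) := by
  have hM : (momentMatrix lam).map (fun x : ℝ => (x : ℂ)) =
      Matrix.diagonal (fun k => (lam : ℂ) ^ momentDegree k) * momentC := by
    ext i j
    rw [momentMatrix_eq, Matrix.map_apply, Matrix.diagonal_mul, Matrix.diagonal_mul]
    simp [momentC]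
  have hmul : (momentMatrix lam).map (fun x : ℝ => (x : ℂ)) * collisionC lam R Eq =
      (collision R Eq).map (fun x : ℝ => (x : ℂ)) *
        (momentMatrix lam).map (fun x : ℝ => (x : ℂ)) := by
    have : momentMatrix lam * ((momentMatrix lam)⁻¹ * collision R Eq * momentMatrix lam) =
        collision R Eq * momentMatrix lam := by
      rw [mul_assoc, ← mul_assoc, Matrix.mul_nonsing_inv _ (isUnit_det_momentMatrix hlam), one_mul]
    have h := congrArg (fun A => A.map Complex.ofRealHom) this
    simp only [Matrix.map_mul] at h
    rw [collisionC]
    change (momentMatrix lam).map Complex.ofRealHom *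
      ((momentMatrix lam)⁻¹ * collision R Eq * momentMatrix lam).map Complex.ofRealHom = _
    simp only [Matrix.map_mul]
    exact h
  have hv := congrArg (fun A => (A *ᵥ v) k) hmul
  simp only [← Matrix.mulVec_mulVec, hM] at hv
  rw [collision_mulVec] at hv
  simp only [Matrix.mulVec_diagonal] at hv
  have hk : (lam : ℂ) ^ momentDegree k ≠ 0 := by
    exact_mod_cast (pow_pos hlam _).ne'
  have he : (∑ a, (Eq k a : ℂ) * ((lam : ℂ) ^ momentDegree (consIdx a)
      * (momentC *ᵥ v) (consIdx a)))
      = (lam : ℂ) ^ momentDegree k *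
        equilibrium (scaledEquilibrium lam Eq) (momentC *ᵥ v) k := by
    rw [Fin.sum_univ_four]
    simp only [equilibrium, scaledEquilibrium, Matrix.of_apply]
    push_cast
    field_simp
    rfl
  rw [he] at hv
  apply mul_left_cancel₀ hk
  rw [hv]
  ring

lemma equilibrium_congr (Q : Matrix (Fin 17) (Fin 4) ℂ) {u v : Fin 17 → ℂ}
    (h : ∀ a, u (consIdx a) = v (consIdx a)) (k : Fin 17) :
    equilibrium Q u k = equilibrium Q v k := by
  have h0 : u 0 = v 0 := h 0
  have h1 : u 1 = v 1 := h 1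
  have h2 : u 2 = v 2 := h 2
  have h3 : u 3 = v 3 := h 3
  rw [equilibrium, equilibrium, h0, h1, h2, h3]

lemma toFun_consIdx (R : Rates) (a : Fin 4) : R.toFun (consIdx a) = 0 := by
  fin_cases a <;> rfl

lemma toFun_ne_zero {R : Rates} (hR : R.Admissible) : ∀ k : Fin 17,
    4 ≤ (k : ℕ) → R.toFun k ≠ 0 := by
  obtain ⟨h5, h7, h9, h13, h15, hE2, hE3, hE4⟩ := hR
  apply forall_fin17 <;> intro hk
  · simp at hk
  · simp at hk
  · simp at hk
  · simp at hk
  · exact h5.1.ne'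
  · exact h5.1.ne'
  · exact h7.1.ne'
  · exact h7.1.ne'
  · exact h9.1.ne'
  · exact h9.1.ne'
  · exact h15.1.ne'
  · exact h15.1.ne'
  · exact h13.1.ne'
  · exact h13.1.ne'
  · exact hE2.1.ne'
  · exact hE3.1.ne'
  · exact hE4.1.ne'

lemma consIdx_or (k : Fin 17) : (∃ a, k = consIdx a) ∨ 4 ≤ (k : ℕ) := by
  by_cases hk : (k : ℕ) < 4
  · exact Or.inl ⟨⟨k, hk⟩, rfl⟩
  · exact Or.inr (by omega)

/-- The coefficients `σ = 1 / s - 1 / 2` of the moments. -/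
def sigmaC (R : Rates) (k : Fin 17) : ℂ := (sigma (R.toFun k) : ℝ)

/-- The relaxation step, centred in time. -/
lemma relaxation_iff {R : Rates} (hR : R.Admissible) (Q : Matrix (Fin 17) (Fin 4) ℂ)
    (u t psi : Fin 17 → ℂ) (hpsi : ∀ k, 2 * psi k = 2 * u k - t k) :
    (∀ k, R.toFun k * (equilibrium Q u k - u k) = - t k) ↔
      (∀ a, t (consIdx a) = 0) ∧
        ∀ k : Fin 17, 4 ≤ (k : ℕ) → psi k = equilibrium Q psi k + sigmaC R k * t k := by
  have key : (∀ a, t (consIdx a) = 0) → ∀ k : Fin 17, 4 ≤ (k : ℕ) →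
      (R.toFun k * (equilibrium Q u k - u k) = - t k ↔
        psi k = equilibrium Q psi k + sigmaC R k * t k) := by
    intro ht k hk
    -- The equilibrium sees only conserved moments, on which `t = 0` and thus `u = psi`. The shift
    -- by half an increment then turns `1 / s` into `σ = 1 / s - 1 / 2`.
    have he : equilibrium Q u k = equilibrium Q psi k := by
      apply equilibrium_congr
      intro a
      have := hpsi (consIdx a)
      rw [ht] at this
      linear_combination - this / 2
    have hs : (R.toFun k : ℂ) ≠ 0 := by exact_mod_cast toFun_ne_zero hR k hk
    have hu : u k = psi k + t k / 2 := by linear_combination - hpsi k / 2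
    rw [he, hu, sigmaC, sigma]
    push_cast
    constructor
    · intro h
      field_simp
      linear_combination -2 * h
    · intro h
      field_simp at h
      linear_combination - h / 2
  constructor
  · intro h
    have ht : ∀ a, t (consIdx a) = 0 := by
      intro a
      have := h (consIdx a)
      rw [toFun_consIdx] at this
      simpa using this
    exact ⟨ht, fun k hk => (key ht k hk).1 (h k)⟩
  · rintro ⟨ht, h⟩ k
    rcases consIdx_or k with ⟨a, rfl⟩ | hk
    · rw [toFun_consIdx, ht]
      simp
    · exact (key ht k hk).2 (h k hk)

open PowerSeries in
-- `phis` is the state after collision. Collision does not involve the time step, so it acts on each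
-- coefficient separately; only the phase mixes orders.
lemma coeff_amplification_mulVec (lam : ℝ) (R : Rates) (Eq : Matrix (Fin 17) (Fin 4) ℝ)
    (k : EuclideanSpace ℝ (Fin 2)) (phi : Fin 17 → PowerSeries ℂ) :
    ∃ phis : Fin 17 → PowerSeries ℂ,
      (∀ i, (amplification lam R Eq k *ᵥ phi) i = phase lam k i * phis i) ∧
      ∀ n i, coeff n (phis i) = (collisionC lam R Eq *ᵥ fun j => coeff n (phi j)) i := by
  refine ⟨((momentMatrix lam)⁻¹ * collision R Eq * momentMatrix lam).map
    (fun x : ℝ => PowerSeries.C (x : ℂ)) *ᵥ phi, fun i => ?_, fun n i => ?_⟩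
  · rw [amplification, ← Matrix.mulVec_mulVec, Matrix.mulVec_diagonal]
  · simp only [Matrix.mulVec, dotProduct, Matrix.map_apply, map_sum, coeff_C_mul, collisionC]

lemma momentC_mulVec_injective : Function.Injective (momentC *ᵥ ·) :=
  Matrix.mulVec_injective_of_isUnit ((Matrix.isUnit_iff_isUnit_det _).2 isUnit_det_momentC)

open PowerSeries in
/-- The expansion of a mode of the amplification matrix. -/
lemma isExpansion_of_mode {lam : ℝ} (hlam : 0 < lam) {R : Rates} (hR : R.Admissible)
    (Eq : Matrix (Fin 17) (Fin 4) ℝ) (k : EuclideanSpace ℝ (Fin 2)) (m : Fin 4 → ℂ)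
    (phi : Fin 17 → PowerSeries ℂ)
    (h : ∀ i, ∀ n ≤ 4, coeff n ((amplification lam R Eq k *ᵥ phi) i)
      = coeff n (decay (cubic m) * phi i)) :
    ∃ psi theta : Fin 4 → Fin 17 → ℂ,
      IsExpansion (-(Complex.I * lam * k 0)) (-(Complex.I * lam * k 1)) (sigmaC R)
        (scaledEquilibrium lam Eq) m psi theta ∧
      psi 0 = momentC *ᵥ fun i => constantCoeff (phi i) := by
  obtain ⟨phis, h1, h2⟩ := coeff_amplification_mulVec lam R Eq k phi
  set x : ℂ := -(Complex.I * lam * k 0) with hx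
  set y : ℂ := -(Complex.I * lam * k 1) with hy
  have hd : ∀ j, (Complex.I * ((k 0 * velocity lam j 0 + k 1 * velocity lam j 1 : ℝ) : ℂ))
      = -(x * (xi j 0 : ℂ) + y * (xi j 1 : ℂ)) := by
    intro j
    rw [hx, hy]
    simp only [velocity]
    push_cast
    ring
  set f : Fin 4 → Fin 17 → ℂ := fun n j => (coeff n (phi j) + coeff n (phis j)) / 2 with hf
  have hstep := fun j => (mode_component_iff_oddStep (phase lam k j) (phi j) (phis j) m
    (fun n => f n j) _ (phase_congr lam k j) (fun n => by simp only [hf]; ring)).1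
      (by intro i hi; rw [← h1]; exact h j i hi)
  simp only [hd] at hstep
  obtain ⟨t0, t1, t2, t3⟩ := momentC_mulVec_oddStep x y m f
  set d : Fin 17 → ℂ := fun j => -(x * (xi j 0 : ℂ) + y * (xi j 1 : ℂ)) with hdd
  set psi : Fin 4 → Fin 17 → ℂ := fun n => momentC *ᵥ f n with hpsi
  set theta : Fin 4 → Fin 17 → ℂ :=
      fun n => momentC *ᵥ fun j => oddStep (m 0 - d j) m (fun i => f i j) n with htheta
  have hc : ∀ (n : ℕ) (i : Fin 17),
      R.toFun i * (equilibrium (scaledEquilibrium lam Eq) (momentC *ᵥ fun j => coeff n (phi j)) i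
        - (momentC *ᵥ fun j => coeff n (phi j)) i)
      = (momentC *ᵥ fun j => coeff n (phis j) - coeff n (phi j)) i := by
    intro n i
    have e1 := momentC_mulVec_collisionC hlam R Eq (fun j => coeff n (phi j)) i
    have e2 : (fun j => coeff n (phis j) - coeff n (phi j)) =
        collisionC lam R Eq *ᵥ (fun j => coeff n (phi j)) - fun j => coeff n (phi j) := by
      funext j
      simp [h2]
    rw [e2, Matrix.mulVec_sub, Pi.sub_apply, e1]
    ring
  -- At order zero nothing is transported, so the mode is fixed by collision and its half-sum is the
  -- mode itself.
  have hpsi0 : psi 0 = momentC *ᵥ fun j => coeff 0 (phi j) := by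
    simp only [hpsi]
    congr 1
    funext j
    have := (hstep j).1
    simp only [hf]
    change (coeff 0 (phi j) + coeff 0 (phis j)) / 2 = _
    rw [this]
    ring
  have hth : ∀ (n : Fin 4) i, (momentC *ᵥ fun j => coeff (n + 1) (phis j) - coeff (n + 1) (phi j)) i
      = - theta n i := by
    intro n i
    rw [htheta, ← Pi.neg_apply, ← Matrix.mulVec_neg]
    congr 2
    funext j
    exact (hstep j).2 n
  have hrel : ∀ n : Fin 4, (∀ a, theta n (consIdx a) = 0) ∧
      ∀ k : Fin 17, 4 ≤ (k : ℕ) →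
        (momentC *ᵥ fun j => (coeff (n + 1) (phi j) + coeff (n + 1) (phis j)) / 2) k
        = equilibrium (scaledEquilibrium lam Eq)
          (momentC *ᵥ fun j => (coeff (n + 1) (phi j) + coeff (n + 1) (phis j)) / 2) k
          + sigmaC R k * theta n k := by
    intro n
    refine (relaxation_iff hR _ (momentC *ᵥ fun j => coeff (n + 1) (phi j)) (theta n) _ ?_).1 ?_
    · intro i
      have := hth n i
      rw [show (fun j => coeff (n + 1) (phis j) - coeff (n + 1) (phi j)) =
        (2 : ℂ) • (fun j => (coeff (n + 1) (phi j) + coeff (n + 1) (phis j)) / 2)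
          - (2 : ℂ) • (fun j => coeff (n + 1) (phi j)) by
        funext j
        simp only [Pi.sub_apply, Pi.smul_apply, smul_eq_mul]
        ring, Matrix.mulVec_sub, Matrix.mulVec_smul, Matrix.mulVec_smul] at this
      simp only [Pi.sub_apply, Pi.smul_apply, smul_eq_mul] at this
      linear_combination this
    · intro i
      rw [hc, hth]
  refine ⟨psi, theta, ⟨t0, t1, t2, t3, fun n => (hrel n).1, ?_, ?_⟩, by simpa using hpsi0⟩
  -- Relaxation with zero increment: the leading order is exactly at equilibrium.
  · have := (relaxation_iff hR (scaledEquilibrium lam Eq) (psi 0) 0 (psi 0) (by simp)).1 ?_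
    · intro i hi
      simpa using this.2 i hi
    · intro i
      rw [hpsi0, hc]
      simp only [Pi.zero_apply, neg_zero]
      rw [show (fun j => coeff 0 (phis j) - coeff 0 (phi j)) = 0 by
        funext j
        simp only [(hstep j).1, sub_self, Pi.zero_apply]]
      simp
  · intro n i hi
    exact (hrel n.castSucc).2 i hi

/-- The four recursions determine `theta` from `psi` without any choice, so `theta` must be the
image of the componentwise odd step. This returns from moments to densities. -/
lemma IsExpansion.theta_eq {x y : ℂ} {sig : Fin 17 → ℂ} {Q : Matrix (Fin 17) (Fin 4) ℂ}
    {m : Fin 4 → ℂ} {psi theta : Fin 4 → Fin 17 → ℂ} (h : IsExpansion x y sig Q m psi theta)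
    (f : Fin 4 → Fin 17 → ℂ) (hf : ∀ n, psi n = momentC *ᵥ f n) (n : Fin 4) :
    theta n = momentC *ᵥ fun j =>
      oddStep (m 0 - -(x * (xi j 0 : ℂ) + y * (xi j 1 : ℂ))) m (fun i => f i j) n := by
  obtain ⟨t0, t1, t2, t3⟩ := momentC_mulVec_oddStep x y m f
  simp only [← hf] at t0 t1 t2 t3
  have e0 := h.theta0.trans t0.symm
  have e1 := h.theta1.trans t1.symm
  have e2 := h.theta2
  have e3 := h.theta3
  rw [e0] at e2 e3
  rw [e1] at e3
  fin_cases n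
  · exact e0
  · exact e1
  · exact e2.trans t2.symm
  · exact e3.trans t3.symm

open PowerSeries in
lemma exists_mode_of_isExpansion {lam : ℝ} (hlam : 0 < lam) {R : Rates} (hR : R.Admissible)
    (Eq : Matrix (Fin 17) (Fin 4) ℝ) (k : EuclideanSpace ℝ (Fin 2)) (m : Fin 4 → ℂ)
    (psi theta : Fin 4 → Fin 17 → ℂ)
    (h : IsExpansion (-(Complex.I * lam * k 0)) (-(Complex.I * lam * k 1)) (sigmaC R)
        (scaledEquilibrium lam Eq) m psi theta) :
    ∃ phi : Fin 17 → PowerSeries ℂ,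
      (∀ i, ∀ n ≤ 4, coeff n ((amplification lam R Eq k *ᵥ phi) i)
        = coeff n (decay (cubic m) * phi i)) ∧
      psi 0 = momentC *ᵥ fun i => constantCoeff (phi i) := by
  set x : ℂ := -(Complex.I * lam * k 0) with hx
  set y : ℂ := -(Complex.I * lam * k 1) with hy
  have hd : ∀ j, (Complex.I * ((k 0 * velocity lam j 0 + k 1 * velocity lam j 1 : ℝ) : ℂ))
      = -(x * (xi j 0 : ℂ) + y * (xi j 1 : ℂ)) := by
    intro j
    rw [hx, hy]
    simp only [velocity]
    push_cast
    ring
  have hinv : ∀ v : Fin 17 → ℂ, momentC *ᵥ (momentC⁻¹ *ᵥ v) = v := by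
    intro v
    rw [Matrix.mulVec_mulVec, Matrix.mul_nonsing_inv _ isUnit_det_momentC, Matrix.one_mulVec]
  -- Half-sums at all orders. At order four only the increment `theta 3` matters modulo `X ^ 5`; the
  -- half-sum is chosen with zero conserved moments, hence zero equilibrium, which leaves `σ θ`.
  let p : ℕ → Fin 17 → ℂ := fun n => match n with
    | 0 => psi 0
    | 1 => psi 1
    | 2 => psi 2
    | 3 => psi 3
    | 4 => fun k => sigmaC R k * theta 3 k
    | _ + 5 => 0
  -- Increments are shifted by one order relative to `theta`, the one at order zero being zero.
  let t : ℕ → Fin 17 → ℂ := fun n => match n with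
    | 0 => 0
    | 1 => theta 0
    | 2 => theta 1
    | 3 => theta 2
    | 4 => theta 3
    | _ + 5 => 0
  have hp : ∀ n : Fin 4, p n = psi n := by intro n; fin_cases n <;> rfl
  have ht : ∀ n : Fin 4, t (n + 1) = theta n := by intro n; fin_cases n <;> rfl
  have hrel : ∀ n, (∀ a, t n (consIdx a) = 0) ∧ ∀ k : Fin 17, 4 ≤ (k : ℕ) →
      p n k = equilibrium (scaledEquilibrium lam Eq) (p n) k + sigmaC R k * t n k := by
    intro n
    rcases n with _ | _ | _ | _ | _ | n
    · exact ⟨fun a => rfl, fun k hk => by simpa [p, t] using h.relax0 k hk⟩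
    · exact ⟨h.conserved 0, h.relax 0⟩
    · exact ⟨h.conserved 1, h.relax 1⟩
    · exact ⟨h.conserved 2, h.relax 2⟩
    · refine ⟨h.conserved 3, fun k hk => ?_⟩
      have : equilibrium (scaledEquilibrium lam Eq) (p 4) k
          = equilibrium (scaledEquilibrium lam Eq) 0 k := by
        apply equilibrium_congr
        intro a
        simp [p, h.conserved 3 a]
      change _ = equilibrium (scaledEquilibrium lam Eq) (p 4) k + _
      rw [this]
      simp [p, t, equilibrium]
    · exact ⟨fun a => rfl, fun k hk => by simp [p, t, equilibrium]⟩
  -- The state before collision is the half-sum plus half of the increment.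
  let phin : ℕ → Fin 17 → ℂ := fun n => momentC⁻¹ *ᵥ (p n + (1 / 2 : ℂ) • t n)
  let phi : Fin 17 → PowerSeries ℂ := fun i => PowerSeries.mk fun n => phin n i
  have hphi : ∀ n, (fun i => coeff n (phi i)) = phin n := by
    intro n
    funext i
    simp [phi]
  obtain ⟨phis, h1, h2⟩ := coeff_amplification_mulVec lam R Eq k phi
  have hdiff : ∀ n, momentC *ᵥ (fun j => coeff n (phis j) - coeff n (phi j)) = - t n := by
    intro n
    have e2 : (fun j => coeff n (phis j) - coeff n (phi j)) =
        collisionC lam R Eq *ᵥ (phin n) - phin n := by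
      funext j
      rw [h2, Pi.sub_apply, hphi, ← hphi]
    have h3 := (relaxation_iff hR (scaledEquilibrium lam Eq) (momentC *ᵥ phin n) (t n) (p n) (by
      intro i
      simp only [phin, hinv, Pi.add_apply, Pi.smul_apply, smul_eq_mul]
      ring)).2 (hrel n)
    funext i
    rw [e2, Matrix.mulVec_sub, Pi.sub_apply, momentC_mulVec_collisionC hlam, Pi.neg_apply, ← h3]
    ring
  have hstar : ∀ n j, coeff n (phis j) - coeff n (phi j) = - (momentC⁻¹ *ᵥ t n) j := by
    intro n j
    have : (fun j => coeff n (phis j) - coeff n (phi j)) = - (momentC⁻¹ *ᵥ t n) := by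
      apply momentC_mulVec_injective
      simp only [hdiff, Matrix.mulVec_neg, hinv]
    exact congrFun this j
  let f : Fin 4 → Fin 17 → ℂ := fun n => momentC⁻¹ *ᵥ psi n
  have hth := h.theta_eq f (fun n => (hinv _).symm)
  refine ⟨phi, fun i n hn => ?_, ?_⟩
  · rw [h1]
    revert n
    rw [mode_component_iff_oddStep (phase lam k i) (phi i) (phis i) m (fun n => f n i) _
      (phase_congr lam k i)]
    · refine ⟨?_, fun n => ?_⟩
      · have := hstar 0 i
        simp only [t, Matrix.mulVec_zero, Pi.zero_apply, neg_zero] at this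
        linear_combination this
      · rw [hstar, ht, hd, hth, Matrix.mulVec_mulVec,
          Matrix.nonsing_inv_mul _ isUnit_det_momentC, Matrix.one_mulVec]
    · intro n
      have e := hstar n i
      have e2 : coeff n (phi i) = phin n i := congrFun (hphi n) i
      simp only [phin, hp, Matrix.mulVec_add, Matrix.mulVec_smul, Pi.add_apply, Pi.smul_apply,
        smul_eq_mul] at e2
      simp only [f]
      linear_combination - e - 2 * e2
  · have e : (fun i => constantCoeff (phi i)) = phin 0 := by
      simpa only [coeff_zero_eq_constantCoeff_apply] using hphi 0
    rw [e]
    simp [phin, p, t, hinv]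

/-! ### Physical modes as independent solutions of the recursion. -/

/-- The restriction of a vector of moments to the conserved moments. -/
def consLin : (Fin 17 → ℂ) →ₗ[ℂ] (Fin 4 → ℂ) where
  toFun w a := w (consIdx a)
  map_add' _ _ := rfl
  map_smul' _ _ := rfl

/-- The moments at equilibrium with given conserved moments. -/
def equilibriumLin (Q : Matrix (Fin 17) (Fin 4) ℂ) : (Fin 4 → ℂ) →ₗ[ℂ] (Fin 17 → ℂ) where
  toFun w k := if h : (k : ℕ) < 4 then w ⟨k, h⟩ else ∑ a, Q k a * w a
  map_add' v w := by
    funext k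
    by_cases h : (k : ℕ) < 4 <;> simp [h, mul_add, Finset.sum_add_distrib]
  map_smul' c w := by
    funext k
    by_cases h : (k : ℕ) < 4 <;> simp [h, Finset.mul_sum, mul_left_comm]

/-- Since the leading order is at equilibrium, its four conserved moments determine it linearly. -/
lemma IsExpansion.psi_zero_eq {x y : ℂ} {sig : Fin 17 → ℂ} {Q : Matrix (Fin 17) (Fin 4) ℂ}
    {m : Fin 4 → ℂ} {psi theta : Fin 4 → Fin 17 → ℂ} (h : IsExpansion x y sig Q m psi theta) :
    psi 0 = equilibriumLin Q (consLin (psi 0)) := by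
  funext k
  by_cases hk : (k : ℕ) < 4
  · simp [equilibriumLin, hk, consLin, consIdx]
  · rw [h.relax0 k (by omega)]
    simp only [equilibriumLin, LinearMap.coe_mk, AddHom.coe_mk, hk, dite_false,
      Fin.sum_univ_four, equilibrium]
    rfl

/-- Modes and expansions correspond one by one. Independence of the densities passes to the moments
because `momentC` is injective, and from there to the conserved moments because the leading order is
a linear function of them. -/
lemma hasModes_iff {lam : ℝ} (hlam : 0 < lam) {R : Rates} (hR : R.Admissible)
    (Eq : Matrix (Fin 17) (Fin 4) ℝ) (k : EuclideanSpace ℝ (Fin 2)) (m : Fin 4 → Fin 4 → ℂ) :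
    HasModes (amplification lam R Eq k) (fun j => cubic (m j)) ↔
      ∃ psi theta : Fin 4 → Fin 4 → Fin 17 → ℂ,
        LinearIndependent ℂ (fun j => consLin (psi j 0)) ∧
        ∀ j, IsExpansion (-(Complex.I * lam * k 0)) (-(Complex.I * lam * k 1)) (sigmaC R)
          (scaledEquilibrium lam Eq) (m j) (psi j) (theta j) := by
  have hker : LinearMap.ker momentC.mulVecLin = ⊥ :=
    LinearMap.ker_eq_bot.2 momentC_mulVec_injective
  constructor
  · rintro ⟨phi, hli, hphi⟩
    have h := fun j => isExpansion_of_mode hlam hR Eq k (m j) (phi j) (hphi j)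
    choose psi theta hexp h0 using h
    refine ⟨psi, theta, ?_, hexp⟩
    have hli2 : LinearIndependent ℂ (fun j => psi j 0) := by
      have := hli.map' momentC.mulVecLin hker
      rwa [show (momentC.mulVecLin ∘ fun j i => PowerSeries.constantCoeff (phi j i))
        = fun j => psi j 0 from funext fun j => (h0 j).symm] at this
    apply LinearIndependent.of_comp (equilibriumLin (scaledEquilibrium lam Eq))
    convert hli2 using 1
    funext j
    exact (hexp j).psi_zero_eq.symm
  · rintro ⟨psi, theta, hli, hexp⟩
    have h := fun j => exists_mode_of_isExpansion hlam hR Eq k (m j) (psi j) (theta j) (hexp j)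
    choose phi hphi h0 using h
    refine ⟨phi, ?_, hphi⟩
    apply LinearIndependent.of_comp momentC.mulVecLin
    have : (momentC.mulVecLin ∘ fun j i => PowerSeries.constantCoeff (phi j i))
        = fun j => psi j 0 := by
      funext j
      exact (h0 j).symm
    rw [this]
    exact LinearIndependent.of_comp consLin hli

/-- The coefficients of the expansions of the decay rates of the four physical modes. -/
def modeCoeff (c0 kappa : ℝ) (p pt pb : Fin 3 → ℂ) : Fin 4 → Fin 4 → ℂ :=
  ![![0, p 0, pt 0, pb 0], ![0, p 1, pt 1, pb 1],
    ![c0 * (Complex.I * kappa), p 2, pt 2, pb 2],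
    ![-(c0 * (Complex.I * kappa)), p 2, -(pt 2), pb 2]]

lemma expansion_eq_cubic (c0 kappa : ℝ) (p pt pb : Fin 3 → ℂ) :
    expansion c0 kappa p pt pb = fun j => cubic (modeCoeff c0 kappa p pt pb j) := by
  funext j
  fin_cases j <;> rfl

lemma fourthOrderIsotropic_iff {lam : ℝ} (hlam : 0 < lam) {R : Rates} (hR : R.Admissible)
    (Eq : Matrix (Fin 17) (Fin 4) ℝ) (c0 : ℝ) :
    FourthOrderIsotropic lam c0 R Eq ↔
      ∃ p pt pb : ℝ → Fin 3 → ℂ, ∀ k : EuclideanSpace ℝ (Fin 2),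
        ∃ psi theta : Fin 4 → Fin 4 → Fin 17 → ℂ,
          LinearIndependent ℂ (fun j => consLin (psi j 0)) ∧
          ∀ j, IsExpansion (-(Complex.I * lam * k 0)) (-(Complex.I * lam * k 1)) (sigmaC R)
            (scaledEquilibrium lam Eq) (modeCoeff c0 ‖k‖ (p ‖k‖) (pt ‖k‖) (pb ‖k‖) j)
            (psi j) (theta j) := by
  simp only [FourthOrderIsotropic, expansion_eq_cubic, hasModes_iff hlam hR]

/-- Multiplication of a mode by a power series in the increment of time: a linear functional of
the mode can be made constant. -/
lemma IsExpansion.normalize {x y : ℂ} {sig : Fin 17 → ℂ} {Q : Matrix (Fin 17) (Fin 4) ℂ}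
    {m : Fin 4 → ℂ} {psi theta : Fin 4 → Fin 17 → ℂ} (h : IsExpansion x y sig Q m psi theta)
    (l : (Fin 17 → ℂ) →ₗ[ℂ] ℂ) (hl : l (psi 0) ≠ 0) (c : ℂ) :
    ∃ psi' theta' : Fin 4 → Fin 17 → ℂ, IsExpansion x y sig Q m psi' theta' ∧
      psi' 0 = (c / l (psi 0)) • psi 0 ∧ l (psi' 0) = c ∧ l (psi' 1) = 0 ∧ l (psi' 2) = 0 ∧
      l (psi' 3) = 0 := by
  -- `a0, …, a3` are the first coefficients of the series `c / l(psi)`, by which the mode is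
  -- multiplied.
  set a0 := c / l (psi 0) with ha0
  set a1 := -(a0 * l (psi 1)) / l (psi 0) with ha1
  set a2 := -(a0 * l (psi 2) + a1 * l (psi 1)) / l (psi 0) with ha2
  set a3 := -(a0 * l (psi 3) + a1 * l (psi 2) + a2 * l (psi 1)) / l (psi 0) with ha3
  let mul : (Fin 4 → Fin 17 → ℂ) → Fin 4 → Fin 17 → ℂ := fun v =>
    ![a0 • v 0, a0 • v 1 + a1 • v 0, a0 • v 2 + a1 • v 1 + a2 • v 0,
      a0 • v 3 + a1 • v 2 + a2 • v 1 + a3 • v 0]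
  have mul0 : ∀ v, mul v 0 = a0 • v 0 := fun v => rfl
  have mul1 : ∀ v, mul v 1 = a0 • v 1 + a1 • v 0 := fun v => rfl
  have mul2 : ∀ v, mul v 2 = a0 • v 2 + a1 • v 1 + a2 • v 0 := fun v => rfl
  have mul3 : ∀ v, mul v 3 = a0 • v 3 + a1 • v 2 + a2 • v 1 + a3 • v 0 := fun v => rfl
  have t0 := h.theta0
  have t1 := h.theta1
  have t2 := h.theta2
  have t3 := h.theta3
  simp only [advect_add, advect_smul] at t2 t3
  refine ⟨mul psi, mul theta, ⟨?_, ?_, ?_, ?_, ?_, ?_, ?_⟩, rfl, ?_, ?_, ?_, ?_⟩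
  · simp only [mul0, advect_smul]
    linear_combination (norm := module) a0 • t0
  · simp only [mul0, mul1, advect_smul, advect_add]
    linear_combination (norm := module) a0 • t1 + a1 • t0
  · simp only [mul0, mul1, mul2, advect_smul, advect_add]
    linear_combination (norm := module) a0 • t2 + a1 • t1 + a2 • t0
  · simp only [mul0, mul1, mul2, mul3, advect_smul, advect_add]
    linear_combination (norm := module) a0 • t3 + a1 • t2 + a2 • t1 + a3 • t0
  · intro n a
    fin_cases n
    · change mul theta 0 (consIdx a) = 0
      simp [mul0, h.conserved]
    · change mul theta 1 (consIdx a) = 0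
      simp [mul1, h.conserved]
    · change mul theta 2 (consIdx a) = 0
      simp [mul2, h.conserved]
    · change mul theta 3 (consIdx a) = 0
      simp [mul3, h.conserved]
  · intro k hk
    have e := h.relax0 k hk
    simp only [mul0, equilibrium, Pi.smul_apply, smul_eq_mul] at e ⊢
    linear_combination a0 * e
  · intro n k hk
    have e := h.relax0 k hk
    have e0 := h.relax 0 k hk
    have e1 := h.relax 1 k hk
    have e2 := h.relax 2 k hk
    fin_cases n
    · change mul psi 1 k = equilibrium Q (mul psi 1) k + sig k * mul theta 0 k
      change psi 1 k = equilibrium Q (psi 1) k + sig k * theta 0 k at e0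
      simp only [mul0, mul1, equilibrium, Pi.smul_apply, Pi.add_apply, smul_eq_mul] at e e0 ⊢
      linear_combination a0 * e0 + a1 * e
    · change mul psi 2 k = equilibrium Q (mul psi 2) k + sig k * mul theta 1 k
      change psi 1 k = equilibrium Q (psi 1) k + sig k * theta 0 k at e0
      change psi 2 k = equilibrium Q (psi 2) k + sig k * theta 1 k at e1
      simp only [mul1, mul2, equilibrium, Pi.smul_apply, Pi.add_apply, smul_eq_mul] at e e0 e1 ⊢
      linear_combination a0 * e1 + a1 * e0 + a2 * e
    · change mul psi 3 k = equilibrium Q (mul psi 3) k + sig k * mul theta 2 k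
      change psi 1 k = equilibrium Q (psi 1) k + sig k * theta 0 k at e0
      change psi 2 k = equilibrium Q (psi 2) k + sig k * theta 1 k at e1
      change psi 3 k = equilibrium Q (psi 3) k + sig k * theta 2 k at e2
      simp only [mul2, mul3, equilibrium, Pi.smul_apply, Pi.add_apply, smul_eq_mul]
        at e e0 e1 e2 ⊢
      linear_combination a0 * e2 + a1 * e1 + a2 * e0 + a3 * e
  · simp only [mul0, map_smul, smul_eq_mul, ha0]
    field_simp
  · simp only [mul1, map_smul, map_add, smul_eq_mul, ha1]
    field_simp
    ring
  · simp only [mul2, map_smul, map_add, smul_eq_mul, ha2]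
    field_simp
    ring
  · simp only [mul3, map_smul, map_add, smul_eq_mul, ha3]
    field_simp
    ring

set_option linter.unusedSimpArgs false

/-! ### Macroscopic fields and closed formulas for the increments. -/

/-- The conserved moments `r = ρ`, `j` and `p = (E + 60 ρ) / 34`, the value `l` of
`(31 E + 3 E₂) / 654` at equilibrium, and the deviations `D`, `F`, `(X, Y)` of the equilibria of
`E₃`, `E₄`, `r` from those of an isotropic scheme. -/
structure Macro where
  r : ℂ
  jx : ℂ
  jy : ℂ
  p : ℂ
  l : ℂ
  D : ℂ
  F : ℂ
  X : ℂ
  Y : ℂ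

/-- The divergence of the momentum. -/
def Macro.div (w : Macro) (x y : ℂ) : ℂ := x * w.jx + y * w.jy

/-- The curl of the momentum. -/
def Macro.curl (w : Macro) (x y : ℂ) : ℂ := x * w.jy - y * w.jx

/-- The moments at equilibrium, where `g = c₀² / λ²`. -/
def moments (g : ℂ) (w : Macro) : Fin 17 → ℂ :=
  ![w.r,
    w.jx,
    w.jy,
    34 * w.p - 60 * w.r,
    0,
    0,
    6 * g * w.jx - 17 * w.jx,
    6 * g * w.jy - 17 * w.jy,
    -(7 / 2 * g * w.jx) + w.X + 31 / 6 * w.jx,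
    -(7 / 2 * g * w.jy) + w.Y + 31 / 6 * w.jy,
    185 / 8 * g * w.jx - 31 / 2 * w.X - 149 / 6 * w.jx,
    185 / 8 * g * w.jy - 31 / 2 * w.Y - 149 / 6 * w.jy,
    0,
    0,
    218 * w.l - 1054 / 3 * w.p + 620 * w.r,
    33912977 * w.D - 37595 / 2 * w.l - 32147 / 4 * w.p - 16740 * w.r,
    9193 * w.F + 8185 / 48 * w.l + 50225 / 288 * w.p + 84 * w.r]

/-- The dissipation coefficients `σ` under the relations between them. -/
def relaxSigma (S T s2 s3 s4 : ℂ) : Fin 17 → ℂ :=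
  ![0, 0, 0, 0, S, S, T, T, T, T, T, T, S, S, s2, s3, s4]

/-- The increments of the moments at order zero. -/
def theta0 (g x y m0 : ℂ) (w0 : Macro) : Fin 17 → ℂ :=
  ![0,
    0,
    0,
    0,
    -2 * g * w0.jy * y - g * m0 * w0.r,
    1 / 2 * g * w0.jx * y + 1 / 2 * g * w0.jy * x,
    -6 * g * w0.p * x + 6 * w0.l * x + 17 * w0.p * x,
    -6 * g * w0.p * y + 6 * w0.l * y + 17 * w0.p * y,
    7 / 2 * g * w0.p * x + 9193 * w0.D * x + w0.X * m0 - 7 / 2 * w0.l * x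
      - 119 / 12 * w0.p * x,
    7 / 2 * g * w0.p * y + 9193 * w0.D * y + w0.Y * m0 - 7 / 2 * w0.l * y
      - 119 / 12 * w0.p * y,
    -(185 / 8 * g * w0.p * x) + 51646 * w0.D * x + 2790 * w0.F * x - 31 / 2 * w0.X * m0
      + 185 / 8 * w0.l * x + 3145 / 48 * w0.p * x,
    -(185 / 8 * g * w0.p * y) + 51646 * w0.D * y + 2790 * w0.F * y - 31 / 2 * w0.Y * m0
      + 185 / 8 * w0.l * y + 3145 / 48 * w0.p * y,
    -(37 / 6 * g * w0.jy * y) - 37 / 12 * g * m0 * w0.r - 17 / 15 * w0.X * x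
      + 17 / 15 * w0.Y * y + 136 / 15 * w0.jy * y + 68 / 15 * m0 * w0.r,
    -(7 / 12 * g * w0.jx * y) - 7 / 12 * g * w0.jy * x + 17 / 15 * w0.X * y
      + 17 / 15 * w0.Y * x - 17 / 15 * w0.jx * y - 17 / 15 * w0.jy * x,
    -(109 / 3 * g * m0 * w0.r) + 654 / 5 * w0.X * x + 654 / 5 * w0.Y * y + 218 * w0.l * m0
      + 1744 / 5 * m0 * w0.r,
    -(15502 / 3 * g * m0 * w0.r) + 33912977 * w0.D * m0 - 2479 / 3 * w0.X * x
      - 2479 / 3 * w0.Y * y - 37595 / 2 * w0.l * m0 - 22698 * m0 * w0.r,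
    36905 / 288 * g * m0 * w0.r + 9193 * w0.F * m0 - 31 * w0.X * x - 31 * w0.Y * y
      + 8185 / 48 * w0.l * m0 + 401 / 3 * m0 * w0.r]

/-- The increments of the moments at order one. -/
def theta1 (g S T s2 s3 s4 x y m0 m1 : ℂ) (w0 w1 : Macro) : Fin 17 → ℂ :=
  ![0,
    0,
    0,
    0,
    -S * g * w0.p * x ^ 2 + S * g * w0.p * y ^ 2 - T * g * w0.p * x ^ 2 + T * g * w0.p * y ^ 2
      - 10020 * w0.D * T * x ^ 2 + 10020 * w0.D * T * y ^ 2 - 144 * w0.F * T * x ^ 2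
      + 144 * w0.F * T * y ^ 2 + T * w0.l * x ^ 2 - T * w0.l * y ^ 2 + 17 / 6 * T * w0.p * x ^ 2
      - 17 / 6 * T * w0.p * y ^ 2 + g * w1.jx * x - g * w1.jy * y,
    -S * g * w0.p * x * y - T * g * w0.p * x * y + 10020 * w0.D * T * x * y
      + 144 * w0.F * T * x * y + T * w0.l * x * y + 17 / 6 * T * w0.p * x * y
      + 1 / 2 * g * w1.jx * y + 1 / 2 * g * w1.jy * x,
    -6 * T * g ^ 2 * m0 * w0.r * x + 1 / 2 * S * g * w0.jx * y ^ 2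
      - 1 / 2 * S * g * w0.jy * x * y - 1 / 2 * S * g * m0 * w0.r * x
      + 17 * T * g * m0 * w0.r * x - g * m0 * w0.r * s2 * x - 6 / 5 * S * w0.X * x ^ 2
      + 24 / 5 * S * w0.X * y ^ 2 + 6 * S * w0.Y * x * y - 24 / 5 * S * w0.jx * y ^ 2
      + 24 / 5 * S * w0.jy * x * y + 24 / 5 * S * m0 * w0.r * x + 6 * T * w0.l * m0 * x
      + 18 / 5 * w0.X * s2 * x ^ 2 + 18 / 5 * w0.Y * s2 * x * y + 6 * w0.l * m0 * s2 * x
      + 48 / 5 * m0 * w0.r * s2 * x + 6 * g * w0.jx * m1 + 6 * g * w1.jx * m0 - 17 * w0.jx * m1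
      - 17 * w1.jx * m0 + 6 * w1.l * x,
    -6 * T * g ^ 2 * m0 * w0.r * y + 1 / 2 * S * g * w0.jy * x ^ 2
      + 1 / 2 * S * g * w0.jy * y ^ 2 + 17 * T * g * m0 * w0.r * y - g * m0 * w0.r * s2 * y
      + 6 * S * w0.X * x * y + 24 / 5 * S * w0.Y * x ^ 2 - 6 / 5 * S * w0.Y * y ^ 2
      - 24 / 5 * S * w0.jy * x ^ 2 - 24 / 5 * S * w0.jy * y ^ 2 + 6 * T * w0.l * m0 * y
      + 18 / 5 * w0.X * s2 * x * y + 18 / 5 * w0.Y * s2 * y ^ 2 + 6 * w0.l * m0 * s2 * y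
      + 48 / 5 * m0 * w0.r * s2 * y + 6 * g * w0.jy * m1 + 6 * g * w1.jy * m0 - 17 * w0.jy * m1
      - 17 * w1.jy * m0 + 6 * w1.l * y,
    7 / 2 * T * g ^ 2 * m0 * w0.r * x + 1 / 3 * S * g * w0.jx * y ^ 2
      + 43 / 6 * S * g * w0.jy * x * y + 41 / 12 * S * g * m0 * w0.r * x
      - 119 / 12 * T * g * m0 * w0.r * x - 981 / 3689 * g * m0 * w0.r * s2 * x
      - 15502 / 11067 * g * m0 * w0.r * s3 * x + 9193 * w0.D * T * m0 * x
      + 9193 * w0.D * m0 * s3 * x + 13 / 15 * S * w0.X * x ^ 2 - 2 / 15 * S * w0.X * y ^ 2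
      - S * w0.Y * x * y + 2 / 15 * S * w0.jx * y ^ 2 - 34 / 5 * S * w0.jy * x * y
      - 52 / 15 * S * m0 * w0.r * x + T * w0.X * m0 ^ 2 - 7 / 2 * T * w0.l * m0 * x
      + 17658 / 18445 * w0.X * s2 * x ^ 2 - 2479 / 11067 * w0.X * s3 * x ^ 2
      + 17658 / 18445 * w0.Y * s2 * x * y - 2479 / 11067 * w0.Y * s3 * x * y
      + 5886 / 3689 * w0.l * m0 * s2 * x - 37595 / 7378 * w0.l * m0 * s3 * x
      + 47088 / 18445 * m0 * w0.r * s2 * x - 22698 / 3689 * m0 * w0.r * s3 * x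
      - 7 / 2 * g * w0.jx * m1 - 7 / 2 * g * w1.jx * m0 + 9193 * w1.D * x + w0.X * m1
      + w1.X * m0 + 31 / 6 * w0.jx * m1 + 31 / 6 * w1.jx * m0 - 7 / 2 * w1.l * x
      - 19 / 4 * w1.p * x,
    7 / 2 * T * g ^ 2 * m0 * w0.r * y + 1 / 3 * S * g * w0.jy * x ^ 2
      - 43 / 6 * S * g * w0.jy * y ^ 2 - 15 / 4 * S * g * m0 * w0.r * y
      - 119 / 12 * T * g * m0 * w0.r * y - 981 / 3689 * g * m0 * w0.r * s2 * y
      - 15502 / 11067 * g * m0 * w0.r * s3 * y + 9193 * w0.D * T * m0 * y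
      + 9193 * w0.D * m0 * s3 * y - S * w0.X * x * y - 2 / 15 * S * w0.Y * x ^ 2
      + 13 / 15 * S * w0.Y * y ^ 2 + 2 / 15 * S * w0.jy * x ^ 2 + 34 / 5 * S * w0.jy * y ^ 2
      + 10 / 3 * S * m0 * w0.r * y + T * w0.Y * m0 ^ 2 - 7 / 2 * T * w0.l * m0 * y
      + 17658 / 18445 * w0.X * s2 * x * y - 2479 / 11067 * w0.X * s3 * x * y
      + 17658 / 18445 * w0.Y * s2 * y ^ 2 - 2479 / 11067 * w0.Y * s3 * y ^ 2
      + 5886 / 3689 * w0.l * m0 * s2 * y - 37595 / 7378 * w0.l * m0 * s3 * y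
      + 47088 / 18445 * m0 * w0.r * s2 * y - 22698 / 3689 * m0 * w0.r * s3 * y
      - 7 / 2 * g * w0.jy * m1 - 7 / 2 * g * w1.jy * m0 + 9193 * w1.D * y + w0.Y * m1
      + w1.Y * m0 + 31 / 6 * w0.jy * m1 + 31 / 6 * w1.jy * m0 - 7 / 2 * w1.l * y
      - 19 / 4 * w1.p * y,
    -(185 / 8 * T * g ^ 2 * m0 * w0.r * x) + 29 / 6 * S * g * w0.jx * y ^ 2
      - 29 / 6 * S * g * w0.jy * x * y - 29 / 6 * S * g * m0 * w0.r * x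
      + 3145 / 48 * T * g * m0 * w0.r * x - 217028 / 27579 * g * m0 * w0.r * s3 * x
      + 5720275 / 147088 * g * m0 * w0.r * s4 * x + 51646 * w0.D * T * m0 * x
      + 51646 * w0.D * m0 * s3 * x + 2790 * w0.F * T * m0 * x + 2790 * w0.F * m0 * s4 * x
      - 10 / 3 * S * w0.X * x ^ 2 - 22 / 3 * S * w0.X * y ^ 2 - 4 * S * w0.Y * x * y
      + 22 / 3 * S * w0.jx * y ^ 2 + 34 * S * w0.jy * x * y + 40 / 3 * S * m0 * w0.r * x
      - 31 / 2 * T * w0.X * m0 ^ 2 + 185 / 8 * T * w0.l * m0 * x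
      - 34706 / 27579 * w0.X * s3 * x ^ 2 - 86490 / 9193 * w0.X * s4 * x ^ 2
      - 34706 / 27579 * w0.Y * s3 * x * y - 86490 / 9193 * w0.Y * s4 * x * y
      - 263165 / 9193 * w0.l * m0 * s3 * x + 3806025 / 73544 * w0.l * m0 * s4 * x
      - 317772 / 9193 * m0 * w0.r * s3 * x + 372930 / 9193 * m0 * w0.r * s4 * x
      + 185 / 8 * g * w0.jx * m1 + 185 / 8 * g * w1.jx * m0 + 51646 * w1.D * x + 2790 * w1.F * x
      - 31 / 2 * w0.X * m1 - 31 / 2 * w1.X * m0 - 149 / 6 * w0.jx * m1 - 149 / 6 * w1.jx * m0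
      + 185 / 8 * w1.l * x + 651 / 16 * w1.p * x,
    -(185 / 8 * T * g ^ 2 * m0 * w0.r * y) + 29 / 6 * S * g * w0.jy * x ^ 2
      + 29 / 6 * S * g * w0.jy * y ^ 2 + 3145 / 48 * T * g * m0 * w0.r * y
      - 217028 / 27579 * g * m0 * w0.r * s3 * y + 5720275 / 147088 * g * m0 * w0.r * s4 * y
      + 51646 * w0.D * T * m0 * y + 51646 * w0.D * m0 * s3 * y + 2790 * w0.F * T * m0 * y
      + 2790 * w0.F * m0 * s4 * y - 4 * S * w0.X * x * y - 22 / 3 * S * w0.Y * x ^ 2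
      - 10 / 3 * S * w0.Y * y ^ 2 + 22 / 3 * S * w0.jy * x ^ 2 - 34 * S * w0.jy * y ^ 2
      - 62 / 3 * S * m0 * w0.r * y - 31 / 2 * T * w0.Y * m0 ^ 2 + 185 / 8 * T * w0.l * m0 * y
      - 34706 / 27579 * w0.X * s3 * x * y - 86490 / 9193 * w0.X * s4 * x * y
      - 34706 / 27579 * w0.Y * s3 * y ^ 2 - 86490 / 9193 * w0.Y * s4 * y ^ 2
      - 263165 / 9193 * w0.l * m0 * s3 * y + 3806025 / 73544 * w0.l * m0 * s4 * y
      - 317772 / 9193 * m0 * w0.r * s3 * y + 372930 / 9193 * m0 * w0.r * s4 * y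
      + 185 / 8 * g * w0.jy * m1 + 185 / 8 * g * w1.jy * m0 + 51646 * w1.D * y + 2790 * w1.F * y
      - 31 / 2 * w0.Y * m1 - 31 / 2 * w1.Y * m0 - 149 / 6 * w0.jy * m1 - 149 / 6 * w1.jy * m0
      + 185 / 8 * w1.l * y + 651 / 16 * w1.p * y,
    -(37 / 12 * S * g * w0.p * x ^ 2) + 37 / 12 * S * g * w0.p * y ^ 2
      - 37 / 12 * T * g * w0.p * x ^ 2 + 37 / 12 * T * g * w0.p * y ^ 2
      - 17302 / 5 * w0.D * T * x ^ 2 + 17302 / 5 * w0.D * T * y ^ 2 + 100 * w0.F * T * x ^ 2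
      - 100 * w0.F * T * y ^ 2 - 17 / 15 * S * w0.X * m0 * x + 17 / 15 * S * w0.Y * m0 * y
      + 68 / 15 * S * w0.p * x ^ 2 - 68 / 15 * S * w0.p * y ^ 2 - 17 / 15 * T * w0.X * m0 * x
      + 17 / 15 * T * w0.Y * m0 * y + 37 / 12 * T * w0.l * x ^ 2 - 37 / 12 * T * w0.l * y ^ 2
      + 629 / 72 * T * w0.p * x ^ 2 - 629 / 72 * T * w0.p * y ^ 2 + 37 / 12 * g * w1.jx * x
      - 37 / 12 * g * w1.jy * y - 17 / 15 * w1.X * x + 17 / 15 * w1.Y * y - 68 / 15 * w1.jx * x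
      + 68 / 15 * w1.jy * y,
    7 / 6 * S * g * w0.p * x * y + 7 / 6 * T * g * w0.p * x * y - 48896 / 5 * w0.D * T * x * y
      - 440 * w0.F * T * x * y + 17 / 15 * S * w0.X * m0 * y + 17 / 15 * S * w0.Y * m0 * x
      + 34 / 15 * S * w0.p * x * y + 17 / 15 * T * w0.X * m0 * y + 17 / 15 * T * w0.Y * m0 * x
      - 7 / 6 * T * w0.l * x * y - 119 / 36 * T * w0.p * x * y - 7 / 12 * g * w1.jx * y
      - 7 / 12 * g * w1.jy * x + 17 / 15 * w1.X * y + 17 / 15 * w1.Y * x - 17 / 15 * w1.jx * y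
      - 17 / 15 * w1.jy * x,
    315 * T * g * w0.p * x ^ 2 + 315 * T * g * w0.p * y ^ 2 - 109 / 3 * g * w0.p * s2 * x ^ 2
      - 109 / 3 * g * w0.p * s2 * y ^ 2 + 6012222 / 5 * w0.D * T * x ^ 2
      + 6012222 / 5 * w0.D * T * y ^ 2 + 654 / 5 * T * w0.X * m0 * x
      + 654 / 5 * T * w0.Y * m0 * y - 315 * T * w0.l * x ^ 2 - 315 * T * w0.l * y ^ 2
      - 1785 / 2 * T * w0.p * x ^ 2 - 1785 / 2 * T * w0.p * y ^ 2 + 654 / 5 * w0.X * m0 * s2 * x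
      + 654 / 5 * w0.Y * m0 * s2 * y + 218 * w0.l * m0 ^ 2 * s2 + 1744 / 5 * w0.p * s2 * x ^ 2
      + 1744 / 5 * w0.p * s2 * y ^ 2 - 315 * g * w1.jx * x - 315 * g * w1.jy * y
      + 654 / 5 * w1.X * x + 654 / 5 * w1.Y * y + 1356 / 5 * w1.jx * x + 1356 / 5 * w1.jy * y
      + 218 * w0.l * m1 + 218 * w1.l * m0 - 1054 / 3 * m0 * w1.p + 620 * m0 * w1.r
      - 1054 / 3 * m1 * w0.p + 620 * m1 * w0.r,
    34433 / 12 * T * g * w0.p * x ^ 2 + 34433 / 12 * T * g * w0.p * y ^ 2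
      - 15502 / 3 * g * w0.p * s3 * x ^ 2 - 15502 / 3 * g * w0.p * s3 * y ^ 2
      + 28340526 * w0.D * T * x ^ 2 + 28340526 * w0.D * T * y ^ 2
      + 33912977 * w0.D * m0 ^ 2 * s3 + 516460 * w0.F * T * x ^ 2 + 516460 * w0.F * T * y ^ 2
      - 2479 / 3 * T * w0.X * m0 * x - 2479 / 3 * T * w0.Y * m0 * y
      - 34433 / 12 * T * w0.l * x ^ 2 - 34433 / 12 * T * w0.l * y ^ 2
      - 585361 / 72 * T * w0.p * x ^ 2 - 585361 / 72 * T * w0.p * y ^ 2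
      - 2479 / 3 * w0.X * m0 * s3 * x - 2479 / 3 * w0.Y * m0 * s3 * y
      - 37595 / 2 * w0.l * m0 ^ 2 * s3 - 22698 * w0.p * s3 * x ^ 2 - 22698 * w0.p * s3 * y ^ 2
      - 34433 / 12 * g * w1.jx * x - 34433 / 12 * g * w1.jy * y + 33912977 * w0.D * m1
      + 33912977 * w1.D * m0 - 2479 / 3 * w1.X * x - 2479 / 3 * w1.Y * y + 5958 * w1.jx * x
      + 5958 * w1.jy * y - 37595 / 2 * w0.l * m1 - 37595 / 2 * w1.l * m0 - 32147 / 4 * m0 * w1.p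
      - 16740 * m0 * w1.r - 32147 / 4 * m1 * w0.p - 16740 * m1 * w0.r,
    -(185 / 4 * T * g * w0.p * x ^ 2) - 185 / 4 * T * g * w0.p * y ^ 2
      + 36905 / 288 * g * w0.p * s4 * x ^ 2 + 36905 / 288 * g * w0.p * s4 * y ^ 2
      + 103292 * w0.D * T * x ^ 2 + 103292 * w0.D * T * y ^ 2 + 5580 * w0.F * T * x ^ 2
      + 5580 * w0.F * T * y ^ 2 + 9193 * w0.F * m0 ^ 2 * s4 - 31 * T * w0.X * m0 * x
      - 31 * T * w0.Y * m0 * y + 185 / 4 * T * w0.l * x ^ 2 + 185 / 4 * T * w0.l * y ^ 2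
      + 3145 / 24 * T * w0.p * x ^ 2 + 3145 / 24 * T * w0.p * y ^ 2 - 31 * w0.X * m0 * s4 * x
      - 31 * w0.Y * m0 * s4 * y + 8185 / 48 * w0.l * m0 ^ 2 * s4 + 401 / 3 * w0.p * s4 * x ^ 2
      + 401 / 3 * w0.p * s4 * y ^ 2 + 185 / 4 * g * w1.jx * x + 185 / 4 * g * w1.jy * y
      + 9193 * w0.F * m1 + 9193 * w1.F * m0 - 31 * w1.X * x - 31 * w1.Y * y
      - 149 / 3 * w1.jx * x - 149 / 3 * w1.jy * y + 8185 / 48 * w0.l * m1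
      + 8185 / 48 * w1.l * m0 + 50225 / 288 * m0 * w1.p + 84 * m0 * w1.r
      + 50225 / 288 * m1 * w0.p + 84 * m1 * w0.r]

set_option maxHeartbeats 1000000 in
/-- The increment of `XX` at order two. -/
def theta2_XX (g S T s2 s3 s4 x y m0 : ℂ) (w0 w1 w2 : Macro) : ℂ :=
  S ^ 2 * g ^ 2 * w0.jy * x ^ 2 * y + S ^ 2 * g ^ 2 * w0.jy * y ^ 3
    - 1 / 2 * S ^ 2 * g ^ 2 * m0 * w0.r * x ^ 2 + 3 / 2 * S ^ 2 * g ^ 2 * m0 * w0.r * y ^ 2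
    - T ^ 2 * g ^ 2 * m0 * w0.r * x ^ 2 + T ^ 2 * g ^ 2 * m0 * w0.r * y ^ 2
    + 3473 / 11067 * T * g * m0 * w0.r * s2 * x ^ 2
    - 3473 / 11067 * T * g * m0 * w0.r * s2 * y ^ 2
    + 51776680 / 33912977 * T * g * m0 * w0.r * s3 * x ^ 2
    - 51776680 / 33912977 * T * g * m0 * w0.r * s3 * y ^ 2
    - 36905 / 18386 * T * g * m0 * w0.r * s4 * x ^ 2
    + 36905 / 18386 * T * g * m0 * w0.r * s4 * y ^ 2 + 17 / 6 * T ^ 2 * g * m0 * w0.r * x ^ 2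
    - 17 / 6 * T ^ 2 * g * m0 * w0.r * y ^ 2 - 10020 * w0.D * T * m0 * s3 * x ^ 2
    + 10020 * w0.D * T * m0 * s3 * y ^ 2 - 10020 * w0.D * T ^ 2 * m0 * x ^ 2
    + 10020 * w0.D * T ^ 2 * m0 * y ^ 2 - 144 * w0.F * T * m0 * s4 * x ^ 2
    + 144 * w0.F * T * m0 * s4 * y ^ 2 - 144 * w0.F * T ^ 2 * m0 * x ^ 2
    + 144 * w0.F * T ^ 2 * m0 * y ^ 2 + 20838 / 18445 * T * w0.X * s2 * x * y ^ 2
    - 20838 / 18445 * T * w0.X * s2 * x ^ 3 - 8279860 / 33912977 * T * w0.X * s3 * x * y ^ 2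
    + 8279860 / 33912977 * T * w0.X * s3 * x ^ 3 - 4464 / 9193 * T * w0.X * s4 * x * y ^ 2
    + 4464 / 9193 * T * w0.X * s4 * x ^ 3 - 20838 / 18445 * T * w0.Y * s2 * x ^ 2 * y
    + 20838 / 18445 * T * w0.Y * s2 * y ^ 3 + 8279860 / 33912977 * T * w0.Y * s3 * x ^ 2 * y
    - 8279860 / 33912977 * T * w0.Y * s3 * y ^ 3 + 4464 / 9193 * T * w0.Y * s4 * x ^ 2 * y
    - 4464 / 9193 * T * w0.Y * s4 * y ^ 3 - 6946 / 3689 * T * w0.l * m0 * s2 * x ^ 2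
    + 6946 / 3689 * T * w0.l * m0 * s2 * y ^ 2
    + 188350950 / 33912977 * T * w0.l * m0 * s3 * x ^ 2
    - 188350950 / 33912977 * T * w0.l * m0 * s3 * y ^ 2
    - 24555 / 9193 * T * w0.l * m0 * s4 * x ^ 2 + 24555 / 9193 * T * w0.l * m0 * s4 * y ^ 2
    - 55568 / 18445 * T * m0 * w0.r * s2 * x ^ 2 + 55568 / 18445 * T * m0 * w0.r * s2 * y ^ 2
    + 227433960 / 33912977 * T * m0 * w0.r * s3 * x ^ 2
    - 227433960 / 33912977 * T * m0 * w0.r * s3 * y ^ 2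
    - 19248 / 9193 * T * m0 * w0.r * s4 * x ^ 2 + 19248 / 9193 * T * m0 * w0.r * s4 * y ^ 2
    + T ^ 2 * w0.l * m0 * x ^ 2 - T ^ 2 * w0.l * m0 * y ^ 2 + 1 / 12 * g ^ 2 * w0.jy * x ^ 2 * y
    + 1 / 12 * g ^ 2 * w0.jy * y ^ 3 + 5 / 24 * g ^ 2 * m0 * w0.r * x ^ 2
    - 1 / 8 * g ^ 2 * m0 * w0.r * y ^ 2 - S * g * w1.p * x ^ 2 + S * g * w1.p * y ^ 2
    - T * g * w1.p * x ^ 2 + T * g * w1.p * y ^ 2 - 2 / 9 * g * m0 * w0.r * x ^ 2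
    + 2 / 9 * g * m0 * w0.r * y ^ 2 + 1670 * w0.D * m0 * x ^ 2 - 1670 * w0.D * m0 * y ^ 2
    - 10020 * w1.D * T * x ^ 2 + 10020 * w1.D * T * y ^ 2 + 24 * w0.F * m0 * x ^ 2
    - 24 * w0.F * m0 * y ^ 2 - 144 * w1.F * T * x ^ 2 + 144 * w1.F * T * y ^ 2
    + T * w1.l * x ^ 2 - T * w1.l * y ^ 2 + 17 / 6 * T * w1.p * x ^ 2
    - 17 / 6 * T * w1.p * y ^ 2 - 1 / 30 * w0.X * x * y ^ 2 + 1 / 30 * w0.X * x ^ 3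
    + 1 / 30 * w0.Y * x ^ 2 * y - 1 / 30 * w0.Y * y ^ 3 - 1 / 6 * w0.l * m0 * x ^ 2
    + 1 / 6 * w0.l * m0 * y ^ 2 - 2 / 15 * m0 * w0.r * x ^ 2 + 2 / 15 * m0 * w0.r * y ^ 2
    + g * w2.jx * x - g * w2.jy * y

set_option maxHeartbeats 1000000 in
/-- The increment of `XY` at order two. -/
def theta2_XY (g S T s2 s3 s4 x y m0 : ℂ) (w0 w1 w2 : Macro) : ℂ :=
  -(1 / 4 * S ^ 2 * g ^ 2 * w0.jx * y ^ 3) - 1 / 4 * S ^ 2 * g ^ 2 * w0.jy * x ^ 3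
    - 3 / 4 * S ^ 2 * g ^ 2 * m0 * w0.r * x * y - T ^ 2 * g ^ 2 * m0 * w0.r * x * y
    - 7162 / 11067 * T * g * m0 * w0.r * s2 * x * y
    - 51776680 / 33912977 * T * g * m0 * w0.r * s3 * x * y
    + 36905 / 18386 * T * g * m0 * w0.r * s4 * x * y + 17 / 6 * T ^ 2 * g * m0 * w0.r * x * y
    + 10020 * w0.D * T * m0 * s3 * x * y + 10020 * w0.D * T ^ 2 * m0 * x * y
    + 144 * w0.F * T * m0 * s4 * x * y + 144 * w0.F * T ^ 2 * m0 * x * y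
    + 42972 / 18445 * T * w0.X * s2 * x ^ 2 * y - 8279860 / 33912977 * T * w0.X * s3 * x ^ 2 * y
    - 4464 / 9193 * T * w0.X * s4 * x ^ 2 * y + 42972 / 18445 * T * w0.Y * s2 * x * y ^ 2
    - 8279860 / 33912977 * T * w0.Y * s3 * x * y ^ 2 - 4464 / 9193 * T * w0.Y * s4 * x * y ^ 2
    + 14324 / 3689 * T * w0.l * m0 * s2 * x * y
    - 188350950 / 33912977 * T * w0.l * m0 * s3 * x * y
    + 24555 / 9193 * T * w0.l * m0 * s4 * x * y + 114592 / 18445 * T * m0 * w0.r * s2 * x * y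
    - 227433960 / 33912977 * T * m0 * w0.r * s3 * x * y
    + 19248 / 9193 * T * m0 * w0.r * s4 * x * y + T ^ 2 * w0.l * m0 * x * y
    - 1 / 48 * g ^ 2 * w0.jx * y ^ 3 - 1 / 48 * g ^ 2 * w0.jy * x ^ 3
    + 3 / 16 * g ^ 2 * m0 * w0.r * x * y - S * g * w1.p * x * y - T * g * w1.p * x * y
    - 2 / 9 * g * m0 * w0.r * x * y - 1670 * w0.D * m0 * x * y + 10020 * w1.D * T * x * y
    - 24 * w0.F * m0 * x * y + 144 * w1.F * T * x * y + T * w1.l * x * y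
    + 17 / 6 * T * w1.p * x * y - 2 / 15 * w0.X * x ^ 2 * y - 2 / 15 * w0.Y * x * y ^ 2
    - 1 / 6 * w0.l * m0 * x * y - 2 / 15 * m0 * w0.r * x * y + 1 / 2 * g * w2.jx * y
    + 1 / 2 * g * w2.jy * x

set_option maxHeartbeats 1000000 in
/-- The increment of `qx` at order two. -/
def theta2_qx (g S T s2 x y m0 m1 m2 : ℂ) (w0 w1 w2 : Macro) : ℂ :=
  -12 * T ^ 2 * g ^ 2 * w0.p * x * y ^ 2 - 12 * T ^ 2 * g ^ 2 * w0.p * x ^ 3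
    - 1 / 2 * S ^ 2 * g * w0.p * x * y ^ 2 - 1 / 2 * S ^ 2 * g * w0.p * x ^ 3
    - 2 * T * g * w0.p * s2 * x * y ^ 2 - 2 * T * g * w0.p * s2 * x ^ 3
    + 6 * T ^ 2 * g * w0.l * x * y ^ 2 + 6 * T ^ 2 * g * w0.l * x ^ 3
    + 51 * T ^ 2 * g * w0.p * x * y ^ 2 + 51 * T ^ 2 * g * w0.p * x ^ 3
    - g * w0.p * s2 ^ 2 * x * y ^ 2 - g * w0.p * s2 ^ 2 * x ^ 3
    + 165474 / 5 * w0.D * T * s2 * x * y ^ 2 + 165474 / 5 * w0.D * T * s2 * x ^ 3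
    - 6 / 5 * S ^ 2 * w0.X * m0 * x ^ 2 + 24 / 5 * S ^ 2 * w0.X * m0 * y ^ 2
    + 6 * S ^ 2 * w0.Y * m0 * x * y + 24 / 5 * S ^ 2 * w0.p * x * y ^ 2
    + 24 / 5 * S ^ 2 * w0.p * x ^ 3 + 36 / 5 * T * w0.X * m0 * s2 * x ^ 2
    + 36 / 5 * T * w0.Y * m0 * s2 * x * y - 6 * T * g ^ 2 * m0 * w1.r * x
    - 6 * T * g ^ 2 * m1 * w0.r * x + 6 * T * w0.l * m0 ^ 2 * s2 * x + T * w0.l * s2 * x * y ^ 2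
    + T * w0.l * s2 * x ^ 3 + 373 / 30 * T * w0.p * s2 * x * y ^ 2
    + 373 / 30 * T * w0.p * s2 * x ^ 3 + 6 * T ^ 2 * w0.l * m0 ^ 2 * x
    - 17 * T ^ 2 * w0.l * x * y ^ 2 - 17 * T ^ 2 * w0.l * x ^ 3
    - 289 / 6 * T ^ 2 * w0.p * x * y ^ 2 - 289 / 6 * T ^ 2 * w0.p * x ^ 3
    + 18 / 5 * w0.X * m0 * s2 ^ 2 * x ^ 2 + 18 / 5 * w0.Y * m0 * s2 ^ 2 * x * y
    + 3 / 4 * g ^ 2 * w0.p * x * y ^ 2 + 3 / 4 * g ^ 2 * w0.p * x ^ 3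
    + 6 * w0.l * m0 ^ 2 * s2 ^ 2 * x + 48 / 5 * w0.p * s2 ^ 2 * x * y ^ 2
    + 48 / 5 * w0.p * s2 ^ 2 * x ^ 3 + 1 / 2 * S * g * w1.jx * y ^ 2
    - 1 / 2 * S * g * w1.jy * x * y - 1 / 2 * S * g * m0 * w1.r * x
    - 1 / 2 * S * g * m1 * w0.r * x + 17 * T * g * m0 * w1.r * x + 17 * T * g * m1 * w0.r * x
    - g * m0 * w1.r * s2 * x - g * m1 * w0.r * s2 * x - 11 / 6 * g * w0.p * x * y ^ 2
    - 11 / 6 * g * w0.p * x ^ 3 - 27579 / 10 * w0.D * x * y ^ 2 - 27579 / 10 * w0.D * x ^ 3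
    - 6 / 5 * S * w1.X * x ^ 2 + 24 / 5 * S * w1.X * y ^ 2 + 6 * S * w1.Y * x * y
    - 24 / 5 * S * w1.jx * y ^ 2 + 24 / 5 * S * w1.jy * x * y + 24 / 5 * S * m0 * w1.r * x
    + 24 / 5 * S * m1 * w0.r * x + 6 * T * w0.l * m1 * x + 6 * T * w1.l * m0 * x
    - 4 / 5 * w0.X * m0 * x ^ 2 - 2 / 5 * w0.X * m0 * y ^ 2 + 18 / 5 * w1.X * s2 * x ^ 2
    - 7 / 5 * w0.Y * m0 * x * y + 18 / 5 * w1.Y * s2 * x * y - 3 / 2 * w0.l * m0 ^ 2 * x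
    + 6 * w0.l * m1 * s2 * x - 1 / 12 * w0.l * x * y ^ 2 - 1 / 12 * w0.l * x ^ 3
    + 6 * w1.l * m0 * s2 * x + 48 / 5 * m0 * w1.r * s2 * x + 48 / 5 * m1 * w0.r * s2 * x
    - 161 / 72 * w0.p * x * y ^ 2 - 161 / 72 * w0.p * x ^ 3 + 6 * g * w0.jx * m2
    + 6 * g * w1.jx * m1 + 6 * g * w2.jx * m0 - 17 * w0.jx * m2 - 17 * w1.jx * m1
    - 17 * w2.jx * m0 + 6 * w2.l * x

set_option maxHeartbeats 1000000 in
/-- The increment of `qy` at order two. -/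
def theta2_qy (g S T s2 x y m0 m1 m2 : ℂ) (w0 w1 w2 : Macro) : ℂ :=
  -12 * T ^ 2 * g ^ 2 * w0.p * x ^ 2 * y - 12 * T ^ 2 * g ^ 2 * w0.p * y ^ 3
    - 1 / 2 * S ^ 2 * g * w0.p * x ^ 2 * y - 1 / 2 * S ^ 2 * g * w0.p * y ^ 3
    - 2 * T * g * w0.p * s2 * x ^ 2 * y - 2 * T * g * w0.p * s2 * y ^ 3
    + 6 * T ^ 2 * g * w0.l * x ^ 2 * y + 6 * T ^ 2 * g * w0.l * y ^ 3
    + 51 * T ^ 2 * g * w0.p * x ^ 2 * y + 51 * T ^ 2 * g * w0.p * y ^ 3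
    - g * w0.p * s2 ^ 2 * x ^ 2 * y - g * w0.p * s2 ^ 2 * y ^ 3
    + 165474 / 5 * w0.D * T * s2 * x ^ 2 * y + 165474 / 5 * w0.D * T * s2 * y ^ 3
    + 6 * S ^ 2 * w0.X * m0 * x * y + 24 / 5 * S ^ 2 * w0.Y * m0 * x ^ 2
    - 6 / 5 * S ^ 2 * w0.Y * m0 * y ^ 2 + 24 / 5 * S ^ 2 * w0.p * x ^ 2 * y
    + 24 / 5 * S ^ 2 * w0.p * y ^ 3 + 36 / 5 * T * w0.X * m0 * s2 * x * y
    + 36 / 5 * T * w0.Y * m0 * s2 * y ^ 2 - 6 * T * g ^ 2 * m0 * w1.r * y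
    - 6 * T * g ^ 2 * m1 * w0.r * y + 6 * T * w0.l * m0 ^ 2 * s2 * y + T * w0.l * s2 * x ^ 2 * y
    + T * w0.l * s2 * y ^ 3 + 373 / 30 * T * w0.p * s2 * x ^ 2 * y
    + 373 / 30 * T * w0.p * s2 * y ^ 3 + 6 * T ^ 2 * w0.l * m0 ^ 2 * y
    - 17 * T ^ 2 * w0.l * x ^ 2 * y - 17 * T ^ 2 * w0.l * y ^ 3
    - 289 / 6 * T ^ 2 * w0.p * x ^ 2 * y - 289 / 6 * T ^ 2 * w0.p * y ^ 3
    + 18 / 5 * w0.X * m0 * s2 ^ 2 * x * y + 18 / 5 * w0.Y * m0 * s2 ^ 2 * y ^ 2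
    + 3 / 4 * g ^ 2 * w0.p * x ^ 2 * y + 3 / 4 * g ^ 2 * w0.p * y ^ 3
    + 6 * w0.l * m0 ^ 2 * s2 ^ 2 * y + 48 / 5 * w0.p * s2 ^ 2 * x ^ 2 * y
    + 48 / 5 * w0.p * s2 ^ 2 * y ^ 3 + 1 / 2 * S * g * w1.jy * x ^ 2
    + 1 / 2 * S * g * w1.jy * y ^ 2 + 17 * T * g * m0 * w1.r * y + 17 * T * g * m1 * w0.r * y
    - g * m0 * w1.r * s2 * y - g * m1 * w0.r * s2 * y - 11 / 6 * g * w0.p * x ^ 2 * y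
    - 11 / 6 * g * w0.p * y ^ 3 - 27579 / 10 * w0.D * x ^ 2 * y - 27579 / 10 * w0.D * y ^ 3
    + 6 * S * w1.X * x * y + 24 / 5 * S * w1.Y * x ^ 2 - 6 / 5 * S * w1.Y * y ^ 2
    - 24 / 5 * S * w1.jy * x ^ 2 - 24 / 5 * S * w1.jy * y ^ 2 + 6 * T * w0.l * m1 * y
    + 6 * T * w1.l * m0 * y - 7 / 5 * w0.X * m0 * x * y + 18 / 5 * w1.X * s2 * x * y
    - 2 / 5 * w0.Y * m0 * x ^ 2 - 4 / 5 * w0.Y * m0 * y ^ 2 + 18 / 5 * w1.Y * s2 * y ^ 2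
    - 3 / 2 * w0.l * m0 ^ 2 * y + 6 * w0.l * m1 * s2 * y - 1 / 12 * w0.l * x ^ 2 * y
    - 1 / 12 * w0.l * y ^ 3 + 6 * w1.l * m0 * s2 * y + 48 / 5 * m0 * w1.r * s2 * y
    + 48 / 5 * m1 * w0.r * s2 * y - 161 / 72 * w0.p * x ^ 2 * y - 161 / 72 * w0.p * y ^ 3
    + 6 * g * w0.jy * m2 + 6 * g * w1.jy * m1 + 6 * g * w2.jy * m0 - 17 * w0.jy * m2
    - 17 * w1.jy * m1 - 17 * w2.jy * m0 + 6 * w2.l * y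

/-- The increments of `XX`, `XY`, `q` at order two. -/
def theta2 (g S T s2 s3 s4 x y m0 m1 m2 : ℂ) (w0 w1 w2 : Macro) : Fin 4 → ℂ :=
  ![theta2_XX g S T s2 s3 s4 x y m0 w0 w1 w2,
    theta2_XY g S T s2 s3 s4 x y m0 w0 w1 w2,
    theta2_qx g S T s2 x y m0 m1 m2 w0 w1 w2,
    theta2_qy g S T s2 x y m0 m1 m2 w0 w1 w2]

/-- The conservation laws at order zero. -/
structure Row0 (g x y m0 : ℂ) (w0 : Macro) : Prop where
  mass : m0 * w0.r + x * w0.jx + y * w0.jy = 0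
  momX : m0 * w0.jx + x * w0.p = 0
  momY : m0 * w0.jy + y * w0.p = 0
  energy : g * (x * w0.jx + y * w0.jy) + m0 * w0.p = 0

/-- The conservation laws at order one. -/
structure Row1 (g S T x y m0 m1 : ℂ) (w0 w1 : Macro) : Prop where
  mass : m0 * w1.r + m1 * w0.r + x * w1.jx + y * w1.jy = 0
  momX : m0 * w1.jx + m1 * w0.jx + 1 / 2 * S * g * (x ^ 2 + y ^ 2) * w0.jx + x * w1.p = 0
  momY : m0 * w1.jy + m1 * w0.jy + 1 / 2 * S * g * (x ^ 2 + y ^ 2) * w0.jy + y * w1.p = 0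
  energy : g * (x * w1.jx + y * w1.jy) + m0 * w1.p + m1 * w0.p
    + T * (x ^ 2 + y ^ 2) * (w0.l + (17 / 6 - g) * w0.p) = 0

section

variable (g S T s2 s3 s4 x y m0 m1 m2 m3 : ℂ) (w w0 w1 w2 w3 : Macro)

lemma moments_0 : moments g w 0 =
      w.r := rfl
lemma moments_1 : moments g w 1 =
      w.jx := rfl
lemma moments_2 : moments g w 2 =
      w.jy := rfl
lemma moments_3 : moments g w 3 =
      34 * w.p - 60 * w.r := rfl
lemma moments_4 : moments g w 4 =
      0 := rfl
lemma moments_5 : moments g w 5 =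
      0 := rfl
lemma moments_6 : moments g w 6 =
      6 * g * w.jx - 17 * w.jx := rfl
lemma moments_7 : moments g w 7 =
      6 * g * w.jy - 17 * w.jy := rfl
lemma moments_8 : moments g w 8 =
      -(7 / 2 * g * w.jx) + w.X + 31 / 6 * w.jx := rfl
lemma moments_9 : moments g w 9 =
      -(7 / 2 * g * w.jy) + w.Y + 31 / 6 * w.jy := rfl
lemma moments_10 : moments g w 10 =
      185 / 8 * g * w.jx - 31 / 2 * w.X - 149 / 6 * w.jx := rfl
lemma moments_11 : moments g w 11 =
      185 / 8 * g * w.jy - 31 / 2 * w.Y - 149 / 6 * w.jy := rfl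
lemma moments_12 : moments g w 12 =
      0 := rfl
lemma moments_13 : moments g w 13 =
      0 := rfl
lemma moments_14 : moments g w 14 =
      218 * w.l - 1054 / 3 * w.p + 620 * w.r := rfl
lemma moments_15 : moments g w 15 =
      33912977 * w.D - 37595 / 2 * w.l - 32147 / 4 * w.p - 16740 * w.r := rfl
lemma moments_16 : moments g w 16 =
      9193 * w.F + 8185 / 48 * w.l + 50225 / 288 * w.p + 84 * w.r := rfl

lemma relaxSigma_0 : relaxSigma S T s2 s3 s4 0 =
      0 := rfl
lemma relaxSigma_1 : relaxSigma S T s2 s3 s4 1 =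
      0 := rfl
lemma relaxSigma_2 : relaxSigma S T s2 s3 s4 2 =
      0 := rfl
lemma relaxSigma_3 : relaxSigma S T s2 s3 s4 3 =
      0 := rfl
lemma relaxSigma_4 : relaxSigma S T s2 s3 s4 4 =
      S := rfl
lemma relaxSigma_5 : relaxSigma S T s2 s3 s4 5 =
      S := rfl
lemma relaxSigma_6 : relaxSigma S T s2 s3 s4 6 =
      T := rfl
lemma relaxSigma_7 : relaxSigma S T s2 s3 s4 7 =
      T := rfl
lemma relaxSigma_8 : relaxSigma S T s2 s3 s4 8 =
      T := rfl
lemma relaxSigma_9 : relaxSigma S T s2 s3 s4 9 =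
      T := rfl
lemma relaxSigma_10 : relaxSigma S T s2 s3 s4 10 =
      T := rfl
lemma relaxSigma_11 : relaxSigma S T s2 s3 s4 11 =
      T := rfl
lemma relaxSigma_12 : relaxSigma S T s2 s3 s4 12 =
      S := rfl
lemma relaxSigma_13 : relaxSigma S T s2 s3 s4 13 =
      S := rfl
lemma relaxSigma_14 : relaxSigma S T s2 s3 s4 14 =
      s2 := rfl
lemma relaxSigma_15 : relaxSigma S T s2 s3 s4 15 =
      s3 := rfl
lemma relaxSigma_16 : relaxSigma S T s2 s3 s4 16 =
      s4 := rfl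

lemma theta0_0 : theta0 g x y m0 w0 0 =
      0 := rfl
lemma theta0_1 : theta0 g x y m0 w0 1 =
      0 := rfl
lemma theta0_2 : theta0 g x y m0 w0 2 =
      0 := rfl
lemma theta0_3 : theta0 g x y m0 w0 3 =
      0 := rfl
lemma theta0_4 : theta0 g x y m0 w0 4 =
      -2 * g * w0.jy * y - g * m0 * w0.r := rfl
lemma theta0_5 : theta0 g x y m0 w0 5 =
      1 / 2 * g * w0.jx * y + 1 / 2 * g * w0.jy * x := rfl
lemma theta0_6 : theta0 g x y m0 w0 6 =
      -6 * g * w0.p * x + 6 * w0.l * x + 17 * w0.p * x := rfl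
lemma theta0_7 : theta0 g x y m0 w0 7 =
      -6 * g * w0.p * y + 6 * w0.l * y + 17 * w0.p * y := rfl
lemma theta0_8 : theta0 g x y m0 w0 8 =
      7 / 2 * g * w0.p * x + 9193 * w0.D * x + w0.X * m0 - 7 / 2 * w0.l * x
      - 119 / 12 * w0.p * x := rfl
lemma theta0_9 : theta0 g x y m0 w0 9 =
      7 / 2 * g * w0.p * y + 9193 * w0.D * y + w0.Y * m0 - 7 / 2 * w0.l * y
      - 119 / 12 * w0.p * y := rfl
lemma theta0_10 : theta0 g x y m0 w0 10 =
      -(185 / 8 * g * w0.p * x) + 51646 * w0.D * x + 2790 * w0.F * x - 31 / 2 * w0.X * m0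
      + 185 / 8 * w0.l * x + 3145 / 48 * w0.p * x := rfl
lemma theta0_11 : theta0 g x y m0 w0 11 =
      -(185 / 8 * g * w0.p * y) + 51646 * w0.D * y + 2790 * w0.F * y - 31 / 2 * w0.Y * m0
      + 185 / 8 * w0.l * y + 3145 / 48 * w0.p * y := rfl
lemma theta0_12 : theta0 g x y m0 w0 12 =
      -(37 / 6 * g * w0.jy * y) - 37 / 12 * g * m0 * w0.r - 17 / 15 * w0.X * x
      + 17 / 15 * w0.Y * y + 136 / 15 * w0.jy * y + 68 / 15 * m0 * w0.r := rfl
lemma theta0_13 : theta0 g x y m0 w0 13 =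
      -(7 / 12 * g * w0.jx * y) - 7 / 12 * g * w0.jy * x + 17 / 15 * w0.X * y
      + 17 / 15 * w0.Y * x - 17 / 15 * w0.jx * y - 17 / 15 * w0.jy * x := rfl
lemma theta0_14 : theta0 g x y m0 w0 14 =
      -(109 / 3 * g * m0 * w0.r) + 654 / 5 * w0.X * x + 654 / 5 * w0.Y * y + 218 * w0.l * m0
      + 1744 / 5 * m0 * w0.r := rfl
lemma theta0_15 : theta0 g x y m0 w0 15 =
      -(15502 / 3 * g * m0 * w0.r) + 33912977 * w0.D * m0 - 2479 / 3 * w0.X * x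
      - 2479 / 3 * w0.Y * y - 37595 / 2 * w0.l * m0 - 22698 * m0 * w0.r := rfl
lemma theta0_16 : theta0 g x y m0 w0 16 =
      36905 / 288 * g * m0 * w0.r + 9193 * w0.F * m0 - 31 * w0.X * x - 31 * w0.Y * y
      + 8185 / 48 * w0.l * m0 + 401 / 3 * m0 * w0.r := rfl

lemma theta1_0 : theta1 g S T s2 s3 s4 x y m0 m1 w0 w1 0 =
      0 := rfl
lemma theta1_1 : theta1 g S T s2 s3 s4 x y m0 m1 w0 w1 1 =
      0 := rfl
lemma theta1_2 : theta1 g S T s2 s3 s4 x y m0 m1 w0 w1 2 =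
      0 := rfl
lemma theta1_3 : theta1 g S T s2 s3 s4 x y m0 m1 w0 w1 3 =
      0 := rfl
lemma theta1_4 : theta1 g S T s2 s3 s4 x y m0 m1 w0 w1 4 =
      -S * g * w0.p * x ^ 2 + S * g * w0.p * y ^ 2 - T * g * w0.p * x ^ 2 + T * g * w0.p * y ^ 2
      - 10020 * w0.D * T * x ^ 2 + 10020 * w0.D * T * y ^ 2 - 144 * w0.F * T * x ^ 2
      + 144 * w0.F * T * y ^ 2 + T * w0.l * x ^ 2 - T * w0.l * y ^ 2 + 17 / 6 * T * w0.p * x ^ 2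
      - 17 / 6 * T * w0.p * y ^ 2 + g * w1.jx * x - g * w1.jy * y := rfl
lemma theta1_5 : theta1 g S T s2 s3 s4 x y m0 m1 w0 w1 5 =
      -S * g * w0.p * x * y - T * g * w0.p * x * y + 10020 * w0.D * T * x * y
      + 144 * w0.F * T * x * y + T * w0.l * x * y + 17 / 6 * T * w0.p * x * y
      + 1 / 2 * g * w1.jx * y + 1 / 2 * g * w1.jy * x := rfl
lemma theta1_6 : theta1 g S T s2 s3 s4 x y m0 m1 w0 w1 6 =
      -6 * T * g ^ 2 * m0 * w0.r * x + 1 / 2 * S * g * w0.jx * y ^ 2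
      - 1 / 2 * S * g * w0.jy * x * y - 1 / 2 * S * g * m0 * w0.r * x
      + 17 * T * g * m0 * w0.r * x - g * m0 * w0.r * s2 * x - 6 / 5 * S * w0.X * x ^ 2
      + 24 / 5 * S * w0.X * y ^ 2 + 6 * S * w0.Y * x * y - 24 / 5 * S * w0.jx * y ^ 2
      + 24 / 5 * S * w0.jy * x * y + 24 / 5 * S * m0 * w0.r * x + 6 * T * w0.l * m0 * x
      + 18 / 5 * w0.X * s2 * x ^ 2 + 18 / 5 * w0.Y * s2 * x * y + 6 * w0.l * m0 * s2 * x
      + 48 / 5 * m0 * w0.r * s2 * x + 6 * g * w0.jx * m1 + 6 * g * w1.jx * m0 - 17 * w0.jx * m1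
      - 17 * w1.jx * m0 + 6 * w1.l * x := rfl
lemma theta1_7 : theta1 g S T s2 s3 s4 x y m0 m1 w0 w1 7 =
      -6 * T * g ^ 2 * m0 * w0.r * y + 1 / 2 * S * g * w0.jy * x ^ 2
      + 1 / 2 * S * g * w0.jy * y ^ 2 + 17 * T * g * m0 * w0.r * y - g * m0 * w0.r * s2 * y
      + 6 * S * w0.X * x * y + 24 / 5 * S * w0.Y * x ^ 2 - 6 / 5 * S * w0.Y * y ^ 2
      - 24 / 5 * S * w0.jy * x ^ 2 - 24 / 5 * S * w0.jy * y ^ 2 + 6 * T * w0.l * m0 * y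
      + 18 / 5 * w0.X * s2 * x * y + 18 / 5 * w0.Y * s2 * y ^ 2 + 6 * w0.l * m0 * s2 * y
      + 48 / 5 * m0 * w0.r * s2 * y + 6 * g * w0.jy * m1 + 6 * g * w1.jy * m0 - 17 * w0.jy * m1
      - 17 * w1.jy * m0 + 6 * w1.l * y := rfl
lemma theta1_8 : theta1 g S T s2 s3 s4 x y m0 m1 w0 w1 8 =
      7 / 2 * T * g ^ 2 * m0 * w0.r * x + 1 / 3 * S * g * w0.jx * y ^ 2
      + 43 / 6 * S * g * w0.jy * x * y + 41 / 12 * S * g * m0 * w0.r * x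
      - 119 / 12 * T * g * m0 * w0.r * x - 981 / 3689 * g * m0 * w0.r * s2 * x
      - 15502 / 11067 * g * m0 * w0.r * s3 * x + 9193 * w0.D * T * m0 * x
      + 9193 * w0.D * m0 * s3 * x + 13 / 15 * S * w0.X * x ^ 2 - 2 / 15 * S * w0.X * y ^ 2
      - S * w0.Y * x * y + 2 / 15 * S * w0.jx * y ^ 2 - 34 / 5 * S * w0.jy * x * y
      - 52 / 15 * S * m0 * w0.r * x + T * w0.X * m0 ^ 2 - 7 / 2 * T * w0.l * m0 * x
      + 17658 / 18445 * w0.X * s2 * x ^ 2 - 2479 / 11067 * w0.X * s3 * x ^ 2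
      + 17658 / 18445 * w0.Y * s2 * x * y - 2479 / 11067 * w0.Y * s3 * x * y
      + 5886 / 3689 * w0.l * m0 * s2 * x - 37595 / 7378 * w0.l * m0 * s3 * x
      + 47088 / 18445 * m0 * w0.r * s2 * x - 22698 / 3689 * m0 * w0.r * s3 * x
      - 7 / 2 * g * w0.jx * m1 - 7 / 2 * g * w1.jx * m0 + 9193 * w1.D * x + w0.X * m1
      + w1.X * m0 + 31 / 6 * w0.jx * m1 + 31 / 6 * w1.jx * m0 - 7 / 2 * w1.l * x
      - 19 / 4 * w1.p * x := rfl
lemma theta1_9 : theta1 g S T s2 s3 s4 x y m0 m1 w0 w1 9 =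
      7 / 2 * T * g ^ 2 * m0 * w0.r * y + 1 / 3 * S * g * w0.jy * x ^ 2
      - 43 / 6 * S * g * w0.jy * y ^ 2 - 15 / 4 * S * g * m0 * w0.r * y
      - 119 / 12 * T * g * m0 * w0.r * y - 981 / 3689 * g * m0 * w0.r * s2 * y
      - 15502 / 11067 * g * m0 * w0.r * s3 * y + 9193 * w0.D * T * m0 * y
      + 9193 * w0.D * m0 * s3 * y - S * w0.X * x * y - 2 / 15 * S * w0.Y * x ^ 2
      + 13 / 15 * S * w0.Y * y ^ 2 + 2 / 15 * S * w0.jy * x ^ 2 + 34 / 5 * S * w0.jy * y ^ 2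
      + 10 / 3 * S * m0 * w0.r * y + T * w0.Y * m0 ^ 2 - 7 / 2 * T * w0.l * m0 * y
      + 17658 / 18445 * w0.X * s2 * x * y - 2479 / 11067 * w0.X * s3 * x * y
      + 17658 / 18445 * w0.Y * s2 * y ^ 2 - 2479 / 11067 * w0.Y * s3 * y ^ 2
      + 5886 / 3689 * w0.l * m0 * s2 * y - 37595 / 7378 * w0.l * m0 * s3 * y
      + 47088 / 18445 * m0 * w0.r * s2 * y - 22698 / 3689 * m0 * w0.r * s3 * y
      - 7 / 2 * g * w0.jy * m1 - 7 / 2 * g * w1.jy * m0 + 9193 * w1.D * y + w0.Y * m1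
      + w1.Y * m0 + 31 / 6 * w0.jy * m1 + 31 / 6 * w1.jy * m0 - 7 / 2 * w1.l * y
      - 19 / 4 * w1.p * y := rfl
lemma theta1_10 : theta1 g S T s2 s3 s4 x y m0 m1 w0 w1 10 =
      -(185 / 8 * T * g ^ 2 * m0 * w0.r * x) + 29 / 6 * S * g * w0.jx * y ^ 2
      - 29 / 6 * S * g * w0.jy * x * y - 29 / 6 * S * g * m0 * w0.r * x
      + 3145 / 48 * T * g * m0 * w0.r * x - 217028 / 27579 * g * m0 * w0.r * s3 * x
      + 5720275 / 147088 * g * m0 * w0.r * s4 * x + 51646 * w0.D * T * m0 * x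
      + 51646 * w0.D * m0 * s3 * x + 2790 * w0.F * T * m0 * x + 2790 * w0.F * m0 * s4 * x
      - 10 / 3 * S * w0.X * x ^ 2 - 22 / 3 * S * w0.X * y ^ 2 - 4 * S * w0.Y * x * y
      + 22 / 3 * S * w0.jx * y ^ 2 + 34 * S * w0.jy * x * y + 40 / 3 * S * m0 * w0.r * x
      - 31 / 2 * T * w0.X * m0 ^ 2 + 185 / 8 * T * w0.l * m0 * x
      - 34706 / 27579 * w0.X * s3 * x ^ 2 - 86490 / 9193 * w0.X * s4 * x ^ 2
      - 34706 / 27579 * w0.Y * s3 * x * y - 86490 / 9193 * w0.Y * s4 * x * y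
      - 263165 / 9193 * w0.l * m0 * s3 * x + 3806025 / 73544 * w0.l * m0 * s4 * x
      - 317772 / 9193 * m0 * w0.r * s3 * x + 372930 / 9193 * m0 * w0.r * s4 * x
      + 185 / 8 * g * w0.jx * m1 + 185 / 8 * g * w1.jx * m0 + 51646 * w1.D * x + 2790 * w1.F * x
      - 31 / 2 * w0.X * m1 - 31 / 2 * w1.X * m0 - 149 / 6 * w0.jx * m1 - 149 / 6 * w1.jx * m0
      + 185 / 8 * w1.l * x + 651 / 16 * w1.p * x := rfl
lemma theta1_11 : theta1 g S T s2 s3 s4 x y m0 m1 w0 w1 11 =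
      -(185 / 8 * T * g ^ 2 * m0 * w0.r * y) + 29 / 6 * S * g * w0.jy * x ^ 2
      + 29 / 6 * S * g * w0.jy * y ^ 2 + 3145 / 48 * T * g * m0 * w0.r * y
      - 217028 / 27579 * g * m0 * w0.r * s3 * y + 5720275 / 147088 * g * m0 * w0.r * s4 * y
      + 51646 * w0.D * T * m0 * y + 51646 * w0.D * m0 * s3 * y + 2790 * w0.F * T * m0 * y
      + 2790 * w0.F * m0 * s4 * y - 4 * S * w0.X * x * y - 22 / 3 * S * w0.Y * x ^ 2
      - 10 / 3 * S * w0.Y * y ^ 2 + 22 / 3 * S * w0.jy * x ^ 2 - 34 * S * w0.jy * y ^ 2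
      - 62 / 3 * S * m0 * w0.r * y - 31 / 2 * T * w0.Y * m0 ^ 2 + 185 / 8 * T * w0.l * m0 * y
      - 34706 / 27579 * w0.X * s3 * x * y - 86490 / 9193 * w0.X * s4 * x * y
      - 34706 / 27579 * w0.Y * s3 * y ^ 2 - 86490 / 9193 * w0.Y * s4 * y ^ 2
      - 263165 / 9193 * w0.l * m0 * s3 * y + 3806025 / 73544 * w0.l * m0 * s4 * y
      - 317772 / 9193 * m0 * w0.r * s3 * y + 372930 / 9193 * m0 * w0.r * s4 * y
      + 185 / 8 * g * w0.jy * m1 + 185 / 8 * g * w1.jy * m0 + 51646 * w1.D * y + 2790 * w1.F * y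
      - 31 / 2 * w0.Y * m1 - 31 / 2 * w1.Y * m0 - 149 / 6 * w0.jy * m1 - 149 / 6 * w1.jy * m0
      + 185 / 8 * w1.l * y + 651 / 16 * w1.p * y := rfl
lemma theta1_12 : theta1 g S T s2 s3 s4 x y m0 m1 w0 w1 12 =
      -(37 / 12 * S * g * w0.p * x ^ 2) + 37 / 12 * S * g * w0.p * y ^ 2
      - 37 / 12 * T * g * w0.p * x ^ 2 + 37 / 12 * T * g * w0.p * y ^ 2
      - 17302 / 5 * w0.D * T * x ^ 2 + 17302 / 5 * w0.D * T * y ^ 2 + 100 * w0.F * T * x ^ 2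
      - 100 * w0.F * T * y ^ 2 - 17 / 15 * S * w0.X * m0 * x + 17 / 15 * S * w0.Y * m0 * y
      + 68 / 15 * S * w0.p * x ^ 2 - 68 / 15 * S * w0.p * y ^ 2 - 17 / 15 * T * w0.X * m0 * x
      + 17 / 15 * T * w0.Y * m0 * y + 37 / 12 * T * w0.l * x ^ 2 - 37 / 12 * T * w0.l * y ^ 2
      + 629 / 72 * T * w0.p * x ^ 2 - 629 / 72 * T * w0.p * y ^ 2 + 37 / 12 * g * w1.jx * x
      - 37 / 12 * g * w1.jy * y - 17 / 15 * w1.X * x + 17 / 15 * w1.Y * y - 68 / 15 * w1.jx * x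
      + 68 / 15 * w1.jy * y := rfl
lemma theta1_13 : theta1 g S T s2 s3 s4 x y m0 m1 w0 w1 13 =
      7 / 6 * S * g * w0.p * x * y + 7 / 6 * T * g * w0.p * x * y - 48896 / 5 * w0.D * T * x * y
      - 440 * w0.F * T * x * y + 17 / 15 * S * w0.X * m0 * y + 17 / 15 * S * w0.Y * m0 * x
      + 34 / 15 * S * w0.p * x * y + 17 / 15 * T * w0.X * m0 * y + 17 / 15 * T * w0.Y * m0 * x
      - 7 / 6 * T * w0.l * x * y - 119 / 36 * T * w0.p * x * y - 7 / 12 * g * w1.jx * y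
      - 7 / 12 * g * w1.jy * x + 17 / 15 * w1.X * y + 17 / 15 * w1.Y * x - 17 / 15 * w1.jx * y
      - 17 / 15 * w1.jy * x := rfl
lemma theta1_14 : theta1 g S T s2 s3 s4 x y m0 m1 w0 w1 14 =
      315 * T * g * w0.p * x ^ 2 + 315 * T * g * w0.p * y ^ 2 - 109 / 3 * g * w0.p * s2 * x ^ 2
      - 109 / 3 * g * w0.p * s2 * y ^ 2 + 6012222 / 5 * w0.D * T * x ^ 2
      + 6012222 / 5 * w0.D * T * y ^ 2 + 654 / 5 * T * w0.X * m0 * x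
      + 654 / 5 * T * w0.Y * m0 * y - 315 * T * w0.l * x ^ 2 - 315 * T * w0.l * y ^ 2
      - 1785 / 2 * T * w0.p * x ^ 2 - 1785 / 2 * T * w0.p * y ^ 2 + 654 / 5 * w0.X * m0 * s2 * x
      + 654 / 5 * w0.Y * m0 * s2 * y + 218 * w0.l * m0 ^ 2 * s2 + 1744 / 5 * w0.p * s2 * x ^ 2
      + 1744 / 5 * w0.p * s2 * y ^ 2 - 315 * g * w1.jx * x - 315 * g * w1.jy * y
      + 654 / 5 * w1.X * x + 654 / 5 * w1.Y * y + 1356 / 5 * w1.jx * x + 1356 / 5 * w1.jy * y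
      + 218 * w0.l * m1 + 218 * w1.l * m0 - 1054 / 3 * m0 * w1.p + 620 * m0 * w1.r
      - 1054 / 3 * m1 * w0.p + 620 * m1 * w0.r := rfl
lemma theta1_15 : theta1 g S T s2 s3 s4 x y m0 m1 w0 w1 15 =
      34433 / 12 * T * g * w0.p * x ^ 2 + 34433 / 12 * T * g * w0.p * y ^ 2
      - 15502 / 3 * g * w0.p * s3 * x ^ 2 - 15502 / 3 * g * w0.p * s3 * y ^ 2
      + 28340526 * w0.D * T * x ^ 2 + 28340526 * w0.D * T * y ^ 2
      + 33912977 * w0.D * m0 ^ 2 * s3 + 516460 * w0.F * T * x ^ 2 + 516460 * w0.F * T * y ^ 2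
      - 2479 / 3 * T * w0.X * m0 * x - 2479 / 3 * T * w0.Y * m0 * y
      - 34433 / 12 * T * w0.l * x ^ 2 - 34433 / 12 * T * w0.l * y ^ 2
      - 585361 / 72 * T * w0.p * x ^ 2 - 585361 / 72 * T * w0.p * y ^ 2
      - 2479 / 3 * w0.X * m0 * s3 * x - 2479 / 3 * w0.Y * m0 * s3 * y
      - 37595 / 2 * w0.l * m0 ^ 2 * s3 - 22698 * w0.p * s3 * x ^ 2 - 22698 * w0.p * s3 * y ^ 2
      - 34433 / 12 * g * w1.jx * x - 34433 / 12 * g * w1.jy * y + 33912977 * w0.D * m1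
      + 33912977 * w1.D * m0 - 2479 / 3 * w1.X * x - 2479 / 3 * w1.Y * y + 5958 * w1.jx * x
      + 5958 * w1.jy * y - 37595 / 2 * w0.l * m1 - 37595 / 2 * w1.l * m0 - 32147 / 4 * m0 * w1.p
      - 16740 * m0 * w1.r - 32147 / 4 * m1 * w0.p - 16740 * m1 * w0.r := rfl
lemma theta1_16 : theta1 g S T s2 s3 s4 x y m0 m1 w0 w1 16 =
      -(185 / 4 * T * g * w0.p * x ^ 2) - 185 / 4 * T * g * w0.p * y ^ 2
      + 36905 / 288 * g * w0.p * s4 * x ^ 2 + 36905 / 288 * g * w0.p * s4 * y ^ 2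
      + 103292 * w0.D * T * x ^ 2 + 103292 * w0.D * T * y ^ 2 + 5580 * w0.F * T * x ^ 2
      + 5580 * w0.F * T * y ^ 2 + 9193 * w0.F * m0 ^ 2 * s4 - 31 * T * w0.X * m0 * x
      - 31 * T * w0.Y * m0 * y + 185 / 4 * T * w0.l * x ^ 2 + 185 / 4 * T * w0.l * y ^ 2
      + 3145 / 24 * T * w0.p * x ^ 2 + 3145 / 24 * T * w0.p * y ^ 2 - 31 * w0.X * m0 * s4 * x
      - 31 * w0.Y * m0 * s4 * y + 8185 / 48 * w0.l * m0 ^ 2 * s4 + 401 / 3 * w0.p * s4 * x ^ 2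
      + 401 / 3 * w0.p * s4 * y ^ 2 + 185 / 4 * g * w1.jx * x + 185 / 4 * g * w1.jy * y
      + 9193 * w0.F * m1 + 9193 * w1.F * m0 - 31 * w1.X * x - 31 * w1.Y * y
      - 149 / 3 * w1.jx * x - 149 / 3 * w1.jy * y + 8185 / 48 * w0.l * m1
      + 8185 / 48 * w1.l * m0 + 50225 / 288 * m0 * w1.p + 84 * m0 * w1.r
      + 50225 / 288 * m1 * w0.p + 84 * m1 * w0.r := rfl

end

/-! ### Conservation laws and increments at orders zero and one. -/

variable {g S T s2 s3 s4 x y m0 m1 m2 m3 : ℂ} {w0 w1 w2 w3 : Macro}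

/-- The row of `E` is replaced by its combination with the row of `ρ` that gives `p`. In this
variable the momentum flux at equilibrium is just `p`, and the energy flux is `g j`: the equations
of linear acoustics. -/
lemma row0_iff {t0 : Fin 17 → ℂ}
    (h0 : t0 = advect x y (moments g w0) + m0 • moments g w0) :
    (∀ a, t0 (consIdx a) = 0) ↔ Row0 g x y m0 w0 := by
  have e0 : t0 0 = m0 * w0.r + x * w0.jx + y * w0.jy := by
    rw [h0]
    simp only [Pi.add_apply, Pi.smul_apply, smul_eq_mul, advect_0, moments_0, moments_1, moments_2]
    ring
  have e1 : t0 1 = m0 * w0.jx + x * w0.p := by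
    rw [h0]
    simp only [Pi.add_apply, Pi.smul_apply, smul_eq_mul, advect_1, moments_0, moments_1, moments_2,
      moments_3, moments_4, moments_5]
    ring
  have e2 : t0 2 = m0 * w0.jy + y * w0.p := by
    rw [h0]
    simp only [Pi.add_apply, Pi.smul_apply, smul_eq_mul, advect_2, moments_0, moments_1, moments_2,
      moments_3, moments_4, moments_5]
    ring
  have e3 : 1 / 34 * t0 3 + 30 / 17 * t0 0
      = g * (x * w0.jx + y * w0.jy) + m0 * w0.p := by
    rw [h0]
    simp only [Pi.add_apply, Pi.smul_apply, smul_eq_mul, advect_0, advect_3, moments_0, moments_1,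
      moments_2, moments_3, moments_6, moments_7]
    ring
  constructor
  · intro h
    have h0 : t0 0 = 0 := h 0
    have h1 : t0 1 = 0 := h 1
    have h2 : t0 2 = 0 := h 2
    have h3 : t0 3 = 0 := h 3
    exact ⟨e0 ▸ h0, e1 ▸ h1, e2 ▸ h2, by rw [← e3, h0, h3]; ring⟩
  · intro h
    have z0 : t0 0 = 0 := e0.trans h.mass
    have z1 : t0 1 = 0 := e1.trans h.momX
    have z2 : t0 2 = 0 := e2.trans h.momY
    have z3 : t0 3 = 0 := by linear_combination 34 * e3 + 34 * h.energy - 60 * z0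
    intro a
    fin_cases a
    exacts [z0, z1, z2, z3]

/-- Eliminates the divergence between energy and mass: on a propagating mode `p = g r`. -/
lemma Row0.energy' (h : Row0 g x y m0 w0) : m0 * w0.p = g * m0 * w0.r := by
  linear_combination h.energy - g * h.mass

/-- The wave equation, from mass and the divergence of momentum. -/
lemma Row0.mass' (h : Row0 g x y m0 w0) : m0 ^ 2 * w0.r = (x ^ 2 + y ^ 2) * w0.p := by
  linear_combination m0 * h.mass - x * h.momX - y * h.momY

/-- The recursion is brought to a normal form modulo the laws of order zero. The coefficients in
each `linear_combination` are the multipliers of those laws in the reduction. -/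
lemma theta0_eq {t0 : Fin 17 → ℂ}
    (h0 : t0 = advect x y (moments g w0) + m0 • moments g w0) (h : Row0 g x y m0 w0) :
    t0 = theta0 g x y m0 w0 := by
  have hc := (row0_iff h0).2 h
  have hr0 := h.mass
  have hx0 := h.momX
  have hy0 := h.momY
  have hp0 := h.energy'
  funext k
  revert k
  apply forall_fin17
  · exact hc 0
  · exact hc 1
  · exact hc 2
  · exact hc 3
  · rw [h0]
    simp only [Pi.add_apply, Pi.smul_apply, smul_eq_mul, advect_4, moments_0, moments_1,
        moments_2, moments_3, moments_4, moments_5, moments_6, moments_7, moments_8, moments_9,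
        moments_10, moments_11, moments_12, moments_13, moments_14, moments_15, moments_16,
        theta0_4]
    linear_combination (g) * hr0
  · rw [h0]
    simp only [Pi.add_apply, Pi.smul_apply, smul_eq_mul, advect_5, moments_0, moments_1,
        moments_2, moments_3, moments_4, moments_5, moments_6, moments_7, moments_8, moments_9,
        moments_10, moments_11, moments_12, moments_13, moments_14, moments_15, moments_16,
        theta0_5]
    linear_combination 0
  · rw [h0]
    simp only [Pi.add_apply, Pi.smul_apply, smul_eq_mul, advect_6, moments_0, moments_1,
        moments_2, moments_3, moments_4, moments_5, moments_6, moments_7, moments_8, moments_9,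
        moments_10, moments_11, moments_12, moments_13, moments_14, moments_15, moments_16,
        theta0_6]
    linear_combination (6 * g - 17) * hx0
  · rw [h0]
    simp only [Pi.add_apply, Pi.smul_apply, smul_eq_mul, advect_7, moments_0, moments_1,
        moments_2, moments_3, moments_4, moments_5, moments_6, moments_7, moments_8, moments_9,
        moments_10, moments_11, moments_12, moments_13, moments_14, moments_15, moments_16,
        theta0_7]
    linear_combination (6 * g - 17) * hy0
  · rw [h0]
    simp only [Pi.add_apply, Pi.smul_apply, smul_eq_mul, advect_8, moments_0, moments_1,
        moments_2, moments_3, moments_4, moments_5, moments_6, moments_7, moments_8, moments_9,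
        moments_10, moments_11, moments_12, moments_13, moments_14, moments_15, moments_16,
        theta0_8]
    linear_combination (-(7 / 2 * g) + 31 / 6) * hx0
  · rw [h0]
    simp only [Pi.add_apply, Pi.smul_apply, smul_eq_mul, advect_9, moments_0, moments_1,
        moments_2, moments_3, moments_4, moments_5, moments_6, moments_7, moments_8, moments_9,
        moments_10, moments_11, moments_12, moments_13, moments_14, moments_15, moments_16,
        theta0_9]
    linear_combination (-(7 / 2 * g) + 31 / 6) * hy0
  · rw [h0]
    simp only [Pi.add_apply, Pi.smul_apply, smul_eq_mul, advect_10, moments_0, moments_1,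
        moments_2, moments_3, moments_4, moments_5, moments_6, moments_7, moments_8, moments_9,
        moments_10, moments_11, moments_12, moments_13, moments_14, moments_15, moments_16,
        theta0_10]
    linear_combination (185 / 8 * g - 149 / 6) * hx0
  · rw [h0]
    simp only [Pi.add_apply, Pi.smul_apply, smul_eq_mul, advect_11, moments_0, moments_1,
        moments_2, moments_3, moments_4, moments_5, moments_6, moments_7, moments_8, moments_9,
        moments_10, moments_11, moments_12, moments_13, moments_14, moments_15, moments_16,
        theta0_11]
    linear_combination (185 / 8 * g - 149 / 6) * hy0
  · rw [h0]
    simp only [Pi.add_apply, Pi.smul_apply, smul_eq_mul, advect_12, moments_0, moments_1,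
        moments_2, moments_3, moments_4, moments_5, moments_6, moments_7, moments_8, moments_9,
        moments_10, moments_11, moments_12, moments_13, moments_14, moments_15, moments_16,
        theta0_12]
    linear_combination (37 / 12 * g - 68 / 15) * hr0
  · rw [h0]
    simp only [Pi.add_apply, Pi.smul_apply, smul_eq_mul, advect_13, moments_0, moments_1,
        moments_2, moments_3, moments_4, moments_5, moments_6, moments_7, moments_8, moments_9,
        moments_10, moments_11, moments_12, moments_13, moments_14, moments_15, moments_16,
        theta0_13]
    linear_combination 0
  · rw [h0]
    simp only [Pi.add_apply, Pi.smul_apply, smul_eq_mul, advect_14, moments_0, moments_1,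
        moments_2, moments_3, moments_4, moments_5, moments_6, moments_7, moments_8, moments_9,
        moments_10, moments_11, moments_12, moments_13, moments_14, moments_15, moments_16,
        theta0_14]
    linear_combination (-(1054 / 3)) * hp0 +
      (-315 * g + 1356 / 5) * hr0
  · rw [h0]
    simp only [Pi.add_apply, Pi.smul_apply, smul_eq_mul, advect_15, moments_0, moments_1,
        moments_2, moments_3, moments_4, moments_5, moments_6, moments_7, moments_8, moments_9,
        moments_10, moments_11, moments_12, moments_13, moments_14, moments_15, moments_16,
        theta0_15]
    linear_combination (-(32147 / 4)) * hp0 +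
      (-(34433 / 12 * g) + 5958) * hr0
  · rw [h0]
    simp only [Pi.add_apply, Pi.smul_apply, smul_eq_mul, advect_16, moments_0, moments_1,
        moments_2, moments_3, moments_4, moments_5, moments_6, moments_7, moments_8, moments_9,
        moments_10, moments_11, moments_12, moments_13, moments_14, moments_15, moments_16,
        theta0_16]
    linear_combination (50225 / 288) * hp0 +
      (185 / 4 * g - 149 / 3) * hr0

/-- Dissipation appears here. Relaxation of `XX, XY` contributes the viscous term `S g q j / 2`,
relaxation of the vector `q` the diffusion `T q (l + (17/6 - g) p)`, with `q` standing for `x² + y²`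
in both. -/
lemma row1_iff {t1 v1 : Fin 17 → ℂ}
    (hv1 : v1 = moments g w1 + relaxSigma S T s2 s3 s4 * theta0 g x y m0 w0)
    (h1 : t1 = advect x y v1 + m0 • v1 + m1 • moments g w0) (h : Row0 g x y m0 w0) :
    (∀ a, t1 (consIdx a) = 0) ↔ Row1 g S T x y m0 m1 w0 w1 := by
  have hr0 := h.mass
  have hx0 := h.momX
  have hy0 := h.momY
  have hp0 := h.energy'
  have hm0 := h.mass'
  have e0 : t1 0 = m0 * w1.r + m1 * w0.r + x * w1.jx + y * w1.jy := by
    rw [h1, hv1]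
    simp only [Pi.add_apply, Pi.smul_apply, Pi.mul_apply, smul_eq_mul, advect_0, advect_0,
      moments_0, moments_1, moments_2, moments_3, moments_4, moments_5, moments_6, moments_7,
          relaxSigma_0, relaxSigma_1, relaxSigma_2, relaxSigma_3, relaxSigma_4, relaxSigma_5,
          relaxSigma_6, relaxSigma_7, theta0_0, theta0_1, theta0_2, theta0_3, theta0_4, theta0_5,
          theta0_6, theta0_7]
    linear_combination 0
  have e1 : t1 1 = m0 * w1.jx + m1 * w0.jx + 1 / 2 * S * g * (x ^ 2 + y ^ 2) * w0.jx
      + x * w1.p := by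
    rw [h1, hv1]
    simp only [Pi.add_apply, Pi.smul_apply, Pi.mul_apply, smul_eq_mul, advect_0, advect_1,
      moments_0, moments_1, moments_2, moments_3, moments_4, moments_5, moments_6, moments_7,
          relaxSigma_0, relaxSigma_1, relaxSigma_2, relaxSigma_3, relaxSigma_4, relaxSigma_5,
          relaxSigma_6, relaxSigma_7, theta0_0, theta0_1, theta0_2, theta0_3, theta0_4, theta0_5,
          theta0_6, theta0_7]
    linear_combination (-(1 / 2 * S * g * x)) * hr0
  have e2 : t1 2 = m0 * w1.jy + m1 * w0.jy + 1 / 2 * S * g * (x ^ 2 + y ^ 2) * w0.jy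
      + y * w1.p := by
    rw [h1, hv1]
    simp only [Pi.add_apply, Pi.smul_apply, Pi.mul_apply, smul_eq_mul, advect_0, advect_2,
      moments_0, moments_1, moments_2, moments_3, moments_4, moments_5, moments_6, moments_7,
          relaxSigma_0, relaxSigma_1, relaxSigma_2, relaxSigma_3, relaxSigma_4, relaxSigma_5,
          relaxSigma_6, relaxSigma_7, theta0_0, theta0_1, theta0_2, theta0_3, theta0_4, theta0_5,
          theta0_6, theta0_7]
    linear_combination (1 / 2 * S * g * y) * hr0
  have e3 : 1 / 34 * t1 3 + 30 / 17 * t1 0 = g * (x * w1.jx + y * w1.jy) + m0 * w1.p + m1 * w0.p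
        + T * (x ^ 2 + y ^ 2) * (w0.l + (17 / 6 - g) * w0.p) := by
    rw [h1, hv1]
    simp only [Pi.add_apply, Pi.smul_apply, Pi.mul_apply, smul_eq_mul, advect_0, advect_3,
      moments_0, moments_1, moments_2, moments_3, moments_4, moments_5, moments_6, moments_7,
          relaxSigma_0, relaxSigma_1, relaxSigma_2, relaxSigma_3, relaxSigma_4, relaxSigma_5,
          relaxSigma_6, relaxSigma_7, theta0_0, theta0_1, theta0_2, theta0_3, theta0_4, theta0_5,
          theta0_6, theta0_7]
    linear_combination 0
  constructor
  · intro h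
    have h0 : t1 0 = 0 := h 0
    have h1 : t1 1 = 0 := h 1
    have h2 : t1 2 = 0 := h 2
    have h3 : t1 3 = 0 := h 3
    exact ⟨e0 ▸ h0, e1 ▸ h1, e2 ▸ h2, by rw [← e3, h0, h3]; ring⟩
  · intro h
    have z0 : t1 0 = 0 := e0.trans h.mass
    have z1 : t1 1 = 0 := e1.trans h.momX
    have z2 : t1 2 = 0 := e2.trans h.momY
    have z3 : t1 3 = 0 := by linear_combination 34 * e3 + 34 * h.energy - 60 * z0
    intro a
    fin_cases a
    exacts [z0, z1, z2, z3]

/-- The first four components vanish by the laws of order one; reduction of the others needs only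
the laws of order zero. -/
lemma theta1_eq {t1 v1 : Fin 17 → ℂ}
    (hv1 : v1 = moments g w1 + relaxSigma S T s2 s3 s4 * theta0 g x y m0 w0)
    (h1 : t1 = advect x y v1 + m0 • v1 + m1 • moments g w0) (h : Row0 g x y m0 w0)
    (h' : Row1 g S T x y m0 m1 w0 w1) :
    t1 = theta1 g S T s2 s3 s4 x y m0 m1 w0 w1 := by
  have hc := (row1_iff hv1 h1 h).2 h'
  have hr0 := h.mass
  have hx0 := h.momX
  have hy0 := h.momY
  have hp0 := h.energy'
  have hm0 := h.mass'
  funext k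
  revert k
  apply forall_fin17
  · exact hc 0
  · exact hc 1
  · exact hc 2
  · exact hc 3
  · rw [h1, hv1]
    simp only [Pi.add_apply, Pi.smul_apply, Pi.mul_apply, smul_eq_mul, advect_4, moments_0,
        moments_1, moments_2, moments_3, moments_4, moments_5, moments_6, moments_7, moments_8,
        moments_9, moments_10, moments_11, moments_12, moments_13, moments_14, moments_15,
        moments_16,
      relaxSigma_0, relaxSigma_1, relaxSigma_2, relaxSigma_3, relaxSigma_4, relaxSigma_5,
          relaxSigma_6, relaxSigma_7, relaxSigma_8, relaxSigma_9, relaxSigma_10, relaxSigma_11,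
          relaxSigma_12, relaxSigma_13, relaxSigma_14, relaxSigma_15, relaxSigma_16, theta0_0,
          theta0_1, theta0_2, theta0_3, theta0_4, theta0_5, theta0_6, theta0_7, theta0_8,
          theta0_9, theta0_10, theta0_11, theta0_12, theta0_13, theta0_14, theta0_15, theta0_16,
          theta1_4]
    linear_combination (-S * g) * hm0 +
      (-2 * S * g * y) * hy0
  · rw [h1, hv1]
    simp only [Pi.add_apply, Pi.smul_apply, Pi.mul_apply, smul_eq_mul, advect_5, moments_0,
        moments_1, moments_2, moments_3, moments_4, moments_5, moments_6, moments_7, moments_8,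
        moments_9, moments_10, moments_11, moments_12, moments_13, moments_14, moments_15,
        moments_16,
      relaxSigma_0, relaxSigma_1, relaxSigma_2, relaxSigma_3, relaxSigma_4, relaxSigma_5,
          relaxSigma_6, relaxSigma_7, relaxSigma_8, relaxSigma_9, relaxSigma_10, relaxSigma_11,
          relaxSigma_12, relaxSigma_13, relaxSigma_14, relaxSigma_15, relaxSigma_16, theta0_0,
          theta0_1, theta0_2, theta0_3, theta0_4, theta0_5, theta0_6, theta0_7, theta0_8,
          theta0_9, theta0_10, theta0_11, theta0_12, theta0_13, theta0_14, theta0_15, theta0_16,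
          theta1_5]
    linear_combination (1 / 2 * S * g * y) * hx0 +
      (1 / 2 * S * g * x) * hy0
  · rw [h1, hv1]
    simp only [Pi.add_apply, Pi.smul_apply, Pi.mul_apply, smul_eq_mul, advect_6, moments_0,
        moments_1, moments_2, moments_3, moments_4, moments_5, moments_6, moments_7, moments_8,
        moments_9, moments_10, moments_11, moments_12, moments_13, moments_14, moments_15,
        moments_16,
      relaxSigma_0, relaxSigma_1, relaxSigma_2, relaxSigma_3, relaxSigma_4, relaxSigma_5,
          relaxSigma_6, relaxSigma_7, relaxSigma_8, relaxSigma_9, relaxSigma_10, relaxSigma_11,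
          relaxSigma_12, relaxSigma_13, relaxSigma_14, relaxSigma_15, relaxSigma_16, theta0_0,
          theta0_1, theta0_2, theta0_3, theta0_4, theta0_5, theta0_6, theta0_7, theta0_8,
          theta0_9, theta0_10, theta0_11, theta0_12, theta0_13, theta0_14, theta0_15, theta0_16,
          theta1_6]
    linear_combination (-6 * T * g * x + 17 * T * x) * hp0
  · rw [h1, hv1]
    simp only [Pi.add_apply, Pi.smul_apply, Pi.mul_apply, smul_eq_mul, advect_7, moments_0,
        moments_1, moments_2, moments_3, moments_4, moments_5, moments_6, moments_7, moments_8,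
        moments_9, moments_10, moments_11, moments_12, moments_13, moments_14, moments_15,
        moments_16,
      relaxSigma_0, relaxSigma_1, relaxSigma_2, relaxSigma_3, relaxSigma_4, relaxSigma_5,
          relaxSigma_6, relaxSigma_7, relaxSigma_8, relaxSigma_9, relaxSigma_10, relaxSigma_11,
          relaxSigma_12, relaxSigma_13, relaxSigma_14, relaxSigma_15, relaxSigma_16, theta0_0,
          theta0_1, theta0_2, theta0_3, theta0_4, theta0_5, theta0_6, theta0_7, theta0_8,
          theta0_9, theta0_10, theta0_11, theta0_12, theta0_13, theta0_14, theta0_15, theta0_16,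
          theta1_7]
    linear_combination (-6 * T * g * y + 17 * T * y) * hp0 +
      (1 / 2 * S * g * y - 24 / 5 * S * y) * hr0
  · rw [h1, hv1]
    simp only [Pi.add_apply, Pi.smul_apply, Pi.mul_apply, smul_eq_mul, advect_8, moments_0,
        moments_1, moments_2, moments_3, moments_4, moments_5, moments_6, moments_7, moments_8,
        moments_9, moments_10, moments_11, moments_12, moments_13, moments_14, moments_15,
        moments_16,
      relaxSigma_0, relaxSigma_1, relaxSigma_2, relaxSigma_3, relaxSigma_4, relaxSigma_5,
          relaxSigma_6, relaxSigma_7, relaxSigma_8, relaxSigma_9, relaxSigma_10, relaxSigma_11,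
          relaxSigma_12, relaxSigma_13, relaxSigma_14, relaxSigma_15, relaxSigma_16, theta0_0,
          theta0_1, theta0_2, theta0_3, theta0_4, theta0_5, theta0_6, theta0_7, theta0_8,
          theta0_9, theta0_10, theta0_11, theta0_12, theta0_13, theta0_14, theta0_15, theta0_16,
          theta1_8]
    linear_combination (7 / 2 * T * g * x - 119 / 12 * T * x) * hp0
  · rw [h1, hv1]
    simp only [Pi.add_apply, Pi.smul_apply, Pi.mul_apply, smul_eq_mul, advect_9, moments_0,
        moments_1, moments_2, moments_3, moments_4, moments_5, moments_6, moments_7, moments_8,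
        moments_9, moments_10, moments_11, moments_12, moments_13, moments_14, moments_15,
        moments_16,
      relaxSigma_0, relaxSigma_1, relaxSigma_2, relaxSigma_3, relaxSigma_4, relaxSigma_5,
          relaxSigma_6, relaxSigma_7, relaxSigma_8, relaxSigma_9, relaxSigma_10, relaxSigma_11,
          relaxSigma_12, relaxSigma_13, relaxSigma_14, relaxSigma_15, relaxSigma_16, theta0_0,
          theta0_1, theta0_2, theta0_3, theta0_4, theta0_5, theta0_6, theta0_7, theta0_8,
          theta0_9, theta0_10, theta0_11, theta0_12, theta0_13, theta0_14, theta0_15, theta0_16,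
          theta1_9]
    linear_combination (7 / 2 * T * g * y - 119 / 12 * T * y) * hp0 +
      (1 / 3 * S * g * y + 2 / 15 * S * y) * hr0
  · rw [h1, hv1]
    simp only [Pi.add_apply, Pi.smul_apply, Pi.mul_apply, smul_eq_mul, advect_10, moments_0,
        moments_1, moments_2, moments_3, moments_4, moments_5, moments_6, moments_7, moments_8,
        moments_9, moments_10, moments_11, moments_12, moments_13, moments_14, moments_15,
        moments_16,
      relaxSigma_0, relaxSigma_1, relaxSigma_2, relaxSigma_3, relaxSigma_4, relaxSigma_5,
          relaxSigma_6, relaxSigma_7, relaxSigma_8, relaxSigma_9, relaxSigma_10, relaxSigma_11,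
          relaxSigma_12, relaxSigma_13, relaxSigma_14, relaxSigma_15, relaxSigma_16, theta0_0,
          theta0_1, theta0_2, theta0_3, theta0_4, theta0_5, theta0_6, theta0_7, theta0_8,
          theta0_9, theta0_10, theta0_11, theta0_12, theta0_13, theta0_14, theta0_15, theta0_16,
          theta1_10]
    linear_combination (-(185 / 8 * T * g * x) + 3145 / 48 * T * x) * hp0
  · rw [h1, hv1]
    simp only [Pi.add_apply, Pi.smul_apply, Pi.mul_apply, smul_eq_mul, advect_11, moments_0,
        moments_1, moments_2, moments_3, moments_4, moments_5, moments_6, moments_7, moments_8,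
        moments_9, moments_10, moments_11, moments_12, moments_13, moments_14, moments_15,
        moments_16,
      relaxSigma_0, relaxSigma_1, relaxSigma_2, relaxSigma_3, relaxSigma_4, relaxSigma_5,
          relaxSigma_6, relaxSigma_7, relaxSigma_8, relaxSigma_9, relaxSigma_10, relaxSigma_11,
          relaxSigma_12, relaxSigma_13, relaxSigma_14, relaxSigma_15, relaxSigma_16, theta0_0,
          theta0_1, theta0_2, theta0_3, theta0_4, theta0_5, theta0_6, theta0_7, theta0_8,
          theta0_9, theta0_10, theta0_11, theta0_12, theta0_13, theta0_14, theta0_15, theta0_16,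
          theta1_11]
    linear_combination (-(185 / 8 * T * g * y) + 3145 / 48 * T * y) * hp0 +
      (29 / 6 * S * g * y + 22 / 3 * S * y) * hr0
  · rw [h1, hv1]
    simp only [Pi.add_apply, Pi.smul_apply, Pi.mul_apply, smul_eq_mul, advect_12, moments_0,
        moments_1, moments_2, moments_3, moments_4, moments_5, moments_6, moments_7, moments_8,
        moments_9, moments_10, moments_11, moments_12, moments_13, moments_14, moments_15,
        moments_16,
      relaxSigma_0, relaxSigma_1, relaxSigma_2, relaxSigma_3, relaxSigma_4, relaxSigma_5,
          relaxSigma_6, relaxSigma_7, relaxSigma_8, relaxSigma_9, relaxSigma_10, relaxSigma_11,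
          relaxSigma_12, relaxSigma_13, relaxSigma_14, relaxSigma_15, relaxSigma_16, theta0_0,
          theta0_1, theta0_2, theta0_3, theta0_4, theta0_5, theta0_6, theta0_7, theta0_8,
          theta0_9, theta0_10, theta0_11, theta0_12, theta0_13, theta0_14, theta0_15, theta0_16,
          theta1_12]
    linear_combination (-(37 / 12 * S * g) + 68 / 15 * S) * hm0 +
      (-(37 / 6 * S * g * y) + 136 / 15 * S * y) * hy0
  · rw [h1, hv1]
    simp only [Pi.add_apply, Pi.smul_apply, Pi.mul_apply, smul_eq_mul, advect_13, moments_0,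
        moments_1, moments_2, moments_3, moments_4, moments_5, moments_6, moments_7, moments_8,
        moments_9, moments_10, moments_11, moments_12, moments_13, moments_14, moments_15,
        moments_16,
      relaxSigma_0, relaxSigma_1, relaxSigma_2, relaxSigma_3, relaxSigma_4, relaxSigma_5,
          relaxSigma_6, relaxSigma_7, relaxSigma_8, relaxSigma_9, relaxSigma_10, relaxSigma_11,
          relaxSigma_12, relaxSigma_13, relaxSigma_14, relaxSigma_15, relaxSigma_16, theta0_0,
          theta0_1, theta0_2, theta0_3, theta0_4, theta0_5, theta0_6, theta0_7, theta0_8,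
          theta0_9, theta0_10, theta0_11, theta0_12, theta0_13, theta0_14, theta0_15, theta0_16,
          theta1_13]
    linear_combination (-(7 / 12 * S * g * y) - 17 / 15 * S * y) * hx0 +
      (-(7 / 12 * S * g * x) - 17 / 15 * S * x) * hy0
  · rw [h1, hv1]
    simp only [Pi.add_apply, Pi.smul_apply, Pi.mul_apply, smul_eq_mul, advect_14, moments_0,
        moments_1, moments_2, moments_3, moments_4, moments_5, moments_6, moments_7, moments_8,
        moments_9, moments_10, moments_11, moments_12, moments_13, moments_14, moments_15,
        moments_16,
      relaxSigma_0, relaxSigma_1, relaxSigma_2, relaxSigma_3, relaxSigma_4, relaxSigma_5,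
          relaxSigma_6, relaxSigma_7, relaxSigma_8, relaxSigma_9, relaxSigma_10, relaxSigma_11,
          relaxSigma_12, relaxSigma_13, relaxSigma_14, relaxSigma_15, relaxSigma_16, theta0_0,
          theta0_1, theta0_2, theta0_3, theta0_4, theta0_5, theta0_6, theta0_7, theta0_8,
          theta0_9, theta0_10, theta0_11, theta0_12, theta0_13, theta0_14, theta0_15, theta0_16,
          theta1_14]
    linear_combination (-(109 / 3 * g * s2) + 1744 / 5 * s2) * hm0
  · rw [h1, hv1]
    simp only [Pi.add_apply, Pi.smul_apply, Pi.mul_apply, smul_eq_mul, advect_15, moments_0,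
        moments_1, moments_2, moments_3, moments_4, moments_5, moments_6, moments_7, moments_8,
        moments_9, moments_10, moments_11, moments_12, moments_13, moments_14, moments_15,
        moments_16,
      relaxSigma_0, relaxSigma_1, relaxSigma_2, relaxSigma_3, relaxSigma_4, relaxSigma_5,
          relaxSigma_6, relaxSigma_7, relaxSigma_8, relaxSigma_9, relaxSigma_10, relaxSigma_11,
          relaxSigma_12, relaxSigma_13, relaxSigma_14, relaxSigma_15, relaxSigma_16, theta0_0,
          theta0_1, theta0_2, theta0_3, theta0_4, theta0_5, theta0_6, theta0_7, theta0_8,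
          theta0_9, theta0_10, theta0_11, theta0_12, theta0_13, theta0_14, theta0_15, theta0_16,
          theta1_15]
    linear_combination (-(15502 / 3 * g * s3) - 22698 * s3) * hm0
  · rw [h1, hv1]
    simp only [Pi.add_apply, Pi.smul_apply, Pi.mul_apply, smul_eq_mul, advect_16, moments_0,
        moments_1, moments_2, moments_3, moments_4, moments_5, moments_6, moments_7, moments_8,
        moments_9, moments_10, moments_11, moments_12, moments_13, moments_14, moments_15,
        moments_16,
      relaxSigma_0, relaxSigma_1, relaxSigma_2, relaxSigma_3, relaxSigma_4, relaxSigma_5,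
          relaxSigma_6, relaxSigma_7, relaxSigma_8, relaxSigma_9, relaxSigma_10, relaxSigma_11,
          relaxSigma_12, relaxSigma_13, relaxSigma_14, relaxSigma_15, relaxSigma_16, theta0_0,
          theta0_1, theta0_2, theta0_3, theta0_4, theta0_5, theta0_6, theta0_7, theta0_8,
          theta0_9, theta0_10, theta0_11, theta0_12, theta0_13, theta0_14, theta0_15, theta0_16,
          theta1_16]
    linear_combination (36905 / 288 * g * s4 + 401 / 3 * s4) * hm0

/-! ### Conservation laws and increments at order two. -/

set_option linter.unusedSimpArgs false

variable {g S T s2 s3 s4 x y m0 m1 m2 m3 : ℂ} {w0 w1 w2 w3 : Macro}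

lemma Row1.energy' (h : Row0 g x y m0 w0) (h' : Row1 g S T x y m0 m1 w0 w1) :
    m0 * w1.p = T * g * w0.p * x ^ 2 + T * g * w0.p * y ^ 2 - T * w0.l * x ^ 2 - T * w0.l * y ^ 2
      - 17 / 6 * T * w0.p * x ^ 2 - 17 / 6 * T * w0.p * y ^ 2 + g * m0 * w1.r + g * m1 * w0.r
      - m1 * w0.p := by
  have hr0 := h.mass
  have hp0 := h.energy'
  have hm0 := h.mass'
  have hr1 := h'.mass
  have he1 := h'.energy
  linear_combination he1 - g * hr1 + 0

/-- The wave equation at order one; the viscous term of the momentum is rewritten with the mass law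
of order zero. -/
lemma Row1.mass' (h : Row0 g x y m0 w0) (h' : Row1 g S T x y m0 m1 w0 w1) :
    m0 ^ 2 * w1.r = (x ^ 2 + y ^ 2) * w1.p - 2 * m0 * m1 * w0.r
      - 1 / 2 * S * g * (x ^ 2 + y ^ 2) * m0 * w0.r := by
  linear_combination m0 * h'.mass - x * h'.momX - y * h'.momY
    + (m1 + 1 / 2 * S * g * (x ^ 2 + y ^ 2)) * h.mass

set_option maxHeartbeats 2000000 in
-- Only `XX`, `XY` and `q` are computed at this order: besides the conserved moments themselves,
-- they are the only moments that `advect` sends into conserved ones, so the laws of order three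
-- need no more.
lemma theta2_eq {t2 v1 v2 : Fin 17 → ℂ}
    (hST : S * T = 1 / 12) (hv1 : v1 = moments g w1 + relaxSigma S T s2 s3 s4 * theta0 g x y m0 w0)
    (hv2 : v2 = moments g w2
      + relaxSigma S T s2 s3 s4 * theta1 g S T s2 s3 s4 x y m0 m1 w0 w1)
    (h2 : t2 = advect x y v2 + m0 • v2 + m1 • v1 + m2 • moments g w0
      - (1 / 12 : ℂ) • (advect x y (advect x y (theta0 g x y m0 w0) + m0 • theta0 g x y m0 w0)
        + m0 • (advect x y (theta0 g x y m0 w0) + m0 • theta0 g x y m0 w0)))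
    (h : Row0 g x y m0 w0) (h' : Row1 g S T x y m0 m1 w0 w1) (i : Fin 4) :
    t2 (Fin.natAdd 4 (Fin.castLE (by norm_num) i : Fin 13)) =
      theta2 g S T s2 s3 s4 x y m0 m1 m2 w0 w1 w2 i := by
  have hr0 := h.mass
  have hx0 := h.momX
  have hy0 := h.momY
  have hp0 := h.energy'
  have hm0 := h.mass'
  have hr1 := h'.mass
  have hx1 := h'.momX
  have hy1 := h'.momY
  have hp1 := h'.energy' h
  have hm1 := h'.mass' h
  rw [h2, hv2, hv1]
  fin_cases i
  · change _ = theta2_XX g S T s2 s3 s4 x y m0 w0 w1 w2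
    change (_ : Fin 17 → ℂ) 4 = _
    simp only [Pi.add_apply, Pi.sub_apply, Pi.smul_apply, Pi.mul_apply, smul_eq_mul, advect_0,
        advect_1, advect_2, advect_3, advect_4, advect_5, advect_6, advect_7, advect_8, advect_9,
        advect_10, advect_11, advect_12, advect_13, advect_14, advect_15, advect_16, moments_0,
        moments_1, moments_2, moments_3, moments_4, moments_5, moments_6, moments_7, moments_8,
        moments_9, moments_10, moments_11, moments_12, moments_13, moments_14, moments_15,
        moments_16,
      relaxSigma_0, relaxSigma_1, relaxSigma_2, relaxSigma_3, relaxSigma_4, relaxSigma_5,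
          relaxSigma_6, relaxSigma_7, relaxSigma_8, relaxSigma_9, relaxSigma_10, relaxSigma_11,
          relaxSigma_12, relaxSigma_13, relaxSigma_14, relaxSigma_15, relaxSigma_16, theta0_0,
          theta0_1, theta0_2, theta0_3, theta0_4, theta0_5, theta0_6, theta0_7, theta0_8,
          theta0_9, theta0_10, theta0_11, theta0_12, theta0_13, theta0_14, theta0_15, theta0_16,
          theta1_0, theta1_1, theta1_2, theta1_3, theta1_4, theta1_5, theta1_6, theta1_7,
          theta1_8, theta1_9, theta1_10, theta1_11, theta1_12, theta1_13, theta1_14, theta1_15,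
          theta1_16, theta2_XX, theta2_XY, theta2_qx, theta2_qy]
    linear_combination (1 / 12 * g * m0) * hm0 +
      (1 / 6 * g * m0 * y) * hy0 +
      (-S ^ 2 * g * x ^ 2 + S ^ 2 * g * y ^ 2 + 1 / 6 * g * x ^ 2 - 1 / 6 * g * y ^ 2
      - 17 / 72 * x ^ 2 + 17 / 72 * y ^ 2) * hp0 +
      (g ^ 2 * w0.jy * x ^ 2 * y + g ^ 2 * w0.jy * y ^ 3 + 1 / 2 * g ^ 2 * m0 * w0.r * x ^ 2
      + 1 / 2 * g ^ 2 * m0 * w0.r * y ^ 2 - 17 / 30 * g * w0.jx * x * y ^ 2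
      - 6 * g * w0.jy * x ^ 2 * y - 197 / 30 * g * w0.jy * y ^ 3 - g * m0 * w0.p * x ^ 2
      + g * m0 * w0.p * y ^ 2 - 3 * g * m0 * w0.r * x ^ 2 - 107 / 30 * g * m0 * w0.r * y ^ 2
      - 10020 * w0.D * m0 * x ^ 2 + 10020 * w0.D * m0 * y ^ 2 - 144 * w0.F * m0 * x ^ 2
      + 144 * w0.F * m0 * y ^ 2 - 2 / 5 * w0.X * x * y ^ 2 - 2 / 5 * w0.X * x ^ 3
      + 2 / 5 * w0.Y * x ^ 2 * y + 2 / 5 * w0.Y * y ^ 3 + 16 / 5 * w0.jy * x ^ 2 * y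
      + 16 / 5 * w0.jy * y ^ 3 + w0.l * m0 * x ^ 2 - w0.l * m0 * y ^ 2
      + 17 / 6 * m0 * w0.p * x ^ 2 - 17 / 6 * m0 * w0.p * y ^ 2 + 8 / 5 * m0 * w0.r * x ^ 2
      + 8 / 5 * m0 * w0.r * y ^ 2) * hST +
      (S * g * m0 + T * g * m0 - 17 / 15 * T * m0) * hr1 +
      (-S * g - T * g + 17 / 15 * T) * hm1 +
      (-2 * S * g * y - 2 * T * g * y + 34 / 15 * T * y) * hy1 +
      (T * g * m1 - 17 / 360 * g * y ^ 2 - 17 / 15 * T * m1) * hr0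
  · change _ = theta2_XY g S T s2 s3 s4 x y m0 w0 w1 w2
    change (_ : Fin 17 → ℂ) 5 = _
    simp only [Pi.add_apply, Pi.sub_apply, Pi.smul_apply, Pi.mul_apply, smul_eq_mul, advect_0,
        advect_1, advect_2, advect_3, advect_4, advect_5, advect_6, advect_7, advect_8, advect_9,
        advect_10, advect_11, advect_12, advect_13, advect_14, advect_15, advect_16, moments_0,
        moments_1, moments_2, moments_3, moments_4, moments_5, moments_6, moments_7, moments_8,
        moments_9, moments_10, moments_11, moments_12, moments_13, moments_14, moments_15,
        moments_16,
      relaxSigma_0, relaxSigma_1, relaxSigma_2, relaxSigma_3, relaxSigma_4, relaxSigma_5,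
          relaxSigma_6, relaxSigma_7, relaxSigma_8, relaxSigma_9, relaxSigma_10, relaxSigma_11,
          relaxSigma_12, relaxSigma_13, relaxSigma_14, relaxSigma_15, relaxSigma_16, theta0_0,
          theta0_1, theta0_2, theta0_3, theta0_4, theta0_5, theta0_6, theta0_7, theta0_8,
          theta0_9, theta0_10, theta0_11, theta0_12, theta0_13, theta0_14, theta0_15, theta0_16,
          theta1_0, theta1_1, theta1_2, theta1_3, theta1_4, theta1_5, theta1_6, theta1_7,
          theta1_8, theta1_9, theta1_10, theta1_11, theta1_12, theta1_13, theta1_14, theta1_15,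
          theta1_16, theta2_XX, theta2_XY, theta2_qx, theta2_qy]
    linear_combination (-(1 / 24 * g * m0 * y)) * hx0 +
      (-(1 / 24 * g * m0 * x)) * hy0 +
      (-(1 / 4 * S ^ 2 * g ^ 2 * x * y) - 1 / 48 * g ^ 2 * x * y - 11 / 360 * g * x * y
      + 1 / 15 * x * y) * hr0 +
      (-S ^ 2 * g * x * y + 1 / 6 * g * x * y - 17 / 72 * x * y) * hp0 +
      (-(1 / 4 * g ^ 2 * w0.jx * x ^ 2 * y) - 1 / 4 * g ^ 2 * w0.jx * y ^ 3
      - 1 / 4 * g ^ 2 * w0.jy * x * y ^ 2 - 1 / 4 * g ^ 2 * w0.jy * x ^ 3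
      + 17 / 15 * g * w0.jx * x ^ 2 * y + 3 / 2 * g * w0.jx * y ^ 3
      + 17 / 15 * g * w0.jy * x * y ^ 2 + 3 / 2 * g * w0.jy * x ^ 3 - g * m0 * w0.p * x * y
      - 11 / 30 * g * m0 * w0.r * x * y + 10020 * w0.D * m0 * x * y + 144 * w0.F * m0 * x * y
      + 4 / 5 * w0.X * x ^ 2 * y + 4 / 5 * w0.X * y ^ 3 + 4 / 5 * w0.Y * x * y ^ 2
      + 4 / 5 * w0.Y * x ^ 3 - 4 / 5 * w0.jx * y ^ 3 - 4 / 5 * w0.jy * x ^ 3 + w0.l * m0 * x * y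
      + 17 / 6 * m0 * w0.p * x * y + 4 / 5 * m0 * w0.r * x * y) * hST +
      (1 / 2 * S * g * y + 1 / 2 * T * g * y - 34 / 15 * T * y) * hx1 +
      (1 / 2 * S * g * x + 1 / 2 * T * g * x - 34 / 15 * T * x) * hy1
  · change _ = theta2_qx g S T s2 x y m0 m1 m2 w0 w1 w2
    change (_ : Fin 17 → ℂ) 6 = _
    simp only [Pi.add_apply, Pi.sub_apply, Pi.smul_apply, Pi.mul_apply, smul_eq_mul, advect_0,
        advect_1, advect_2, advect_3, advect_4, advect_5, advect_6, advect_7, advect_8, advect_9,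
        advect_10, advect_11, advect_12, advect_13, advect_14, advect_15, advect_16, moments_0,
        moments_1, moments_2, moments_3, moments_4, moments_5, moments_6, moments_7, moments_8,
        moments_9, moments_10, moments_11, moments_12, moments_13, moments_14, moments_15,
        moments_16,
      relaxSigma_0, relaxSigma_1, relaxSigma_2, relaxSigma_3, relaxSigma_4, relaxSigma_5,
          relaxSigma_6, relaxSigma_7, relaxSigma_8, relaxSigma_9, relaxSigma_10, relaxSigma_11,
          relaxSigma_12, relaxSigma_13, relaxSigma_14, relaxSigma_15, relaxSigma_16, theta0_0,
          theta0_1, theta0_2, theta0_3, theta0_4, theta0_5, theta0_6, theta0_7, theta0_8,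
          theta0_9, theta0_10, theta0_11, theta0_12, theta0_13, theta0_14, theta0_15, theta0_16,
          theta1_0, theta1_1, theta1_2, theta1_3, theta1_4, theta1_5, theta1_6, theta1_7,
          theta1_8, theta1_9, theta1_10, theta1_11, theta1_12, theta1_13, theta1_14, theta1_15,
          theta1_16, theta2_XX, theta2_XY, theta2_qx, theta2_qy]
    linear_combination (1 / 2 * g * m0 * x - 17 / 12 * m0 * x) * hp0 +
      (-6 * T ^ 2 * g ^ 2 * x - T * g * s2 * x + 17 * T ^ 2 * g * x + 48 / 5 * T * s2 * x
      + 3 / 4 * g ^ 2 * x - 23 / 12 * g * x - 2 * x) * hm0 +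
      (-(1 / 4 * g ^ 2 * y ^ 2) + 2 / 3 * g * y ^ 2 + 2 / 5 * y ^ 2) * hx0 +
      (1 / 4 * g ^ 2 * x * y - 2 / 3 * g * x * y - 2 / 5 * x * y) * hy0 +
      (-3 * g ^ 2 * w0.jx * m0 * x ^ 2 - 3 * g ^ 2 * w0.jx * m0 * y ^ 2
      + 17 / 2 * g * w0.jx * m0 * x ^ 2 + 9 * g * w0.jx * m0 * y ^ 2
      - 1 / 2 * g * w0.jy * m0 * x * y - 1 / 2 * g * m0 ^ 2 * w0.r * x
      - 1 / 2 * g * w0.p * x * y ^ 2 - 1 / 2 * g * w0.p * x ^ 3 - 29628 / 5 * w0.D * x * y ^ 2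
      + 120192 / 5 * w0.D * x ^ 3 - 1512 * w0.F * x * y ^ 2 + 504 * w0.F * x ^ 3
      - 12 / 5 * w0.X * m0 * x ^ 2 + 48 / 5 * w0.X * m0 * y ^ 2 + 12 * w0.Y * m0 * x * y
      - 24 / 5 * w0.jx * m0 * y ^ 2 + 24 / 5 * w0.jy * m0 * x * y + 1 / 2 * w0.l * x * y ^ 2
      + 1 / 2 * w0.l * x ^ 3 + 24 / 5 * m0 ^ 2 * w0.r * x + 17 / 12 * w0.p * x * y ^ 2
      + 17 / 12 * w0.p * x ^ 3) * hST +
      (6 * T * g * m0 - 17 * T * m0) * hx1 +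
      (-(1 / 4 * g ^ 2 * m0 * x) + 17 / 24 * g * m0 * x) * hr0 +
      (-6 * T * g * x + 17 * T * x - 1054 / 109 * s2 * x) * hp1 +
      (1 / 2 * S * g * x - 945 / 109 * g * s2 * x - 24 / 5 * S * x + 4068 / 545 * s2 * x) * hr1
  · change _ = theta2_qy g S T s2 x y m0 m1 m2 w0 w1 w2
    change (_ : Fin 17 → ℂ) 7 = _
    simp only [Pi.add_apply, Pi.sub_apply, Pi.smul_apply, Pi.mul_apply, smul_eq_mul, advect_0,
        advect_1, advect_2, advect_3, advect_4, advect_5, advect_6, advect_7, advect_8, advect_9,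
        advect_10, advect_11, advect_12, advect_13, advect_14, advect_15, advect_16, moments_0,
        moments_1, moments_2, moments_3, moments_4, moments_5, moments_6, moments_7, moments_8,
        moments_9, moments_10, moments_11, moments_12, moments_13, moments_14, moments_15,
        moments_16,
      relaxSigma_0, relaxSigma_1, relaxSigma_2, relaxSigma_3, relaxSigma_4, relaxSigma_5,
          relaxSigma_6, relaxSigma_7, relaxSigma_8, relaxSigma_9, relaxSigma_10, relaxSigma_11,
          relaxSigma_12, relaxSigma_13, relaxSigma_14, relaxSigma_15, relaxSigma_16, theta0_0,
          theta0_1, theta0_2, theta0_3, theta0_4, theta0_5, theta0_6, theta0_7, theta0_8,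
          theta0_9, theta0_10, theta0_11, theta0_12, theta0_13, theta0_14, theta0_15, theta0_16,
          theta1_0, theta1_1, theta1_2, theta1_3, theta1_4, theta1_5, theta1_6, theta1_7,
          theta1_8, theta1_9, theta1_10, theta1_11, theta1_12, theta1_13, theta1_14, theta1_15,
          theta1_16, theta2_XX, theta2_XY, theta2_qx, theta2_qy]
    linear_combination (1 / 2 * g * m0 * y - 17 / 12 * m0 * y) * hp0 +
      (-6 * T ^ 2 * g ^ 2 * y - T * g * s2 * y + 17 * T ^ 2 * g * y + 48 / 5 * T * s2 * y
      + 1 / 2 * g ^ 2 * y - 5 / 4 * g * y - 8 / 5 * y) * hm0 +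
      (-(1 / 12 * g * m0 * y) + 4 / 5 * m0 * y) * hr0 +
      (-(1 / 4 * g ^ 2 * x ^ 2) - 1 / 4 * g ^ 2 * y ^ 2 + 2 / 3 * g * x ^ 2 + 2 / 3 * g * y ^ 2
      + 2 / 5 * x ^ 2 + 2 / 5 * y ^ 2) * hy0 +
      (-3 * g ^ 2 * w0.jy * m0 * x ^ 2 - 3 * g ^ 2 * w0.jy * m0 * y ^ 2
      + 9 * g * w0.jy * m0 * x ^ 2 + 9 * g * w0.jy * m0 * y ^ 2 - 1 / 2 * g * w0.p * x ^ 2 * y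
      - 1 / 2 * g * w0.p * y ^ 3 - 29628 / 5 * w0.D * x ^ 2 * y + 120192 / 5 * w0.D * y ^ 3
      - 1512 * w0.F * x ^ 2 * y + 504 * w0.F * y ^ 3 + 12 * w0.X * m0 * x * y
      + 48 / 5 * w0.Y * m0 * x ^ 2 - 12 / 5 * w0.Y * m0 * y ^ 2 - 24 / 5 * w0.jy * m0 * x ^ 2
      - 24 / 5 * w0.jy * m0 * y ^ 2 + 1 / 2 * w0.l * x ^ 2 * y + 1 / 2 * w0.l * y ^ 3
      + 17 / 12 * w0.p * x ^ 2 * y + 17 / 12 * w0.p * y ^ 3) * hST +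
      (6 * T * g * m0 - 17 * T * m0) * hy1 +
      (-6 * T * g * y + 17 * T * y - 1054 / 109 * s2 * y) * hp1 +
      (-(945 / 109 * g * s2 * y) + 4068 / 545 * s2 * y) * hr1

set_option maxHeartbeats 1000000 in
/-- The conservation law of mass at order two. -/
def massLaw2 (g q x y m0 m1 m2 : ℂ) (w0 w1 w2 : Macro) : ℂ :=
  1 / 24 * g * m0 * q * w0.r + m0 * w2.r + m1 * w1.r + m2 * w0.r + w2.div x y

set_option maxHeartbeats 2000000 in
lemma massLaw2_eq {t2 v1 v2 : Fin 17 → ℂ}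
    (hv1 : v1 = moments g w1 + relaxSigma S T s2 s3 s4 * theta0 g x y m0 w0)
    (hv2 : v2 = moments g w2
      + relaxSigma S T s2 s3 s4 * theta1 g S T s2 s3 s4 x y m0 m1 w0 w1)
    (h2 : t2 = advect x y v2 + m0 • v2 + m1 • v1 + m2 • moments g w0
      - (1 / 12 : ℂ) • (advect x y (advect x y (theta0 g x y m0 w0) + m0 • theta0 g x y m0 w0)
        + m0 • (advect x y (theta0 g x y m0 w0) + m0 • theta0 g x y m0 w0)))
    (h : Row0 g x y m0 w0) (h' : Row1 g S T x y m0 m1 w0 w1)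
    {q : ℂ} (hq : x ^ 2 + y ^ 2 = q) :
    t2 0 = massLaw2 g q x y m0 m1 m2 w0 w1 w2 := by
  subst hq
  have hr0 := h.mass
  have hx0 := h.momX
  have hy0 := h.momY
  have hp0 := h.energy'
  have hm0 := h.mass'
  have hr1 := h'.mass
  have hx1 := h'.momX
  have hy1 := h'.momY
  have hp1 := h'.energy' h
  have hm1 := h'.mass' h
  rw [h2, hv2, hv1]
  simp only [Pi.add_apply, Pi.sub_apply, Pi.smul_apply, Pi.mul_apply, smul_eq_mul, advect_0,
      advect_1, advect_2, advect_3, advect_4, advect_5, advect_6, advect_7, advect_8, advect_9,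
      advect_10, advect_11, advect_12, advect_13, advect_14, advect_15, advect_16, moments_0,
      moments_1, moments_2, moments_3, moments_4, moments_5, moments_6, moments_7, moments_8,
      moments_9, moments_10, moments_11, moments_12, moments_13, moments_14, moments_15, moments_16,
      relaxSigma_0, relaxSigma_1, relaxSigma_2, relaxSigma_3, relaxSigma_4, relaxSigma_5,
          relaxSigma_6, relaxSigma_7, relaxSigma_8, relaxSigma_9, relaxSigma_10, relaxSigma_11,
          relaxSigma_12, relaxSigma_13, relaxSigma_14, relaxSigma_15, relaxSigma_16, theta0_0,
          theta0_1, theta0_2, theta0_3, theta0_4, theta0_5, theta0_6, theta0_7, theta0_8,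
          theta0_9, theta0_10, theta0_11, theta0_12, theta0_13, theta0_14, theta0_15, theta0_16,
          theta1_0, theta1_1, theta1_2, theta1_3, theta1_4, theta1_5, theta1_6, theta1_7,
          theta1_8, theta1_9, theta1_10, theta1_11, theta1_12, theta1_13, theta1_14, theta1_15,
          theta1_16, theta2_XX, theta2_XY, theta2_qx, theta2_qy]
  simp only [massLaw2, Macro.div, Macro.curl]
  linear_combination (-(1 / 12 * g * y ^ 2)) * hr0

set_option maxHeartbeats 1000000 in
/-- The divergence of the conservation law of momentum at order two. -/
def divLaw2 (g S q x y m0 m1 m2 : ℂ) (w0 w1 w2 : Macro) : ℂ :=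
  -(1 / 2 * S ^ 2 * g * w0.p * q ^ 2) - 1 / 2 * S * g * m0 * q * w1.r
  - 1 / 2 * S * g * m1 * q * w0.r + 1 / 6 * g * w0.p * q ^ 2 - 1 / 12 * w0.l * q ^ 2
  - m0 * m1 * w1.r - m0 * m2 * w0.r - m1 ^ 2 * w0.r - 17 / 72 * w0.p * q ^ 2 + w2.div x y * m0
  + w2.p * q

set_option maxHeartbeats 2000000 in
-- The role of `S T = 1/12` is visible in its multiplier, which contains the quartic anisotropic
-- terms in `D` and `F`: they come once with `S T` from two successive relaxations and once with
-- `1/12` from the hyperbolic tangent, and cancel.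
lemma divLaw2_eq {t2 v1 v2 : Fin 17 → ℂ}
    (hST : S * T = 1 / 12) (hv1 : v1 = moments g w1 + relaxSigma S T s2 s3 s4 * theta0 g x y m0 w0)
    (hv2 : v2 = moments g w2
      + relaxSigma S T s2 s3 s4 * theta1 g S T s2 s3 s4 x y m0 m1 w0 w1)
    (h2 : t2 = advect x y v2 + m0 • v2 + m1 • v1 + m2 • moments g w0
      - (1 / 12 : ℂ) • (advect x y (advect x y (theta0 g x y m0 w0) + m0 • theta0 g x y m0 w0)
        + m0 • (advect x y (theta0 g x y m0 w0) + m0 • theta0 g x y m0 w0)))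
    (h : Row0 g x y m0 w0) (h' : Row1 g S T x y m0 m1 w0 w1)
    {q : ℂ} (hq : x ^ 2 + y ^ 2 = q) :
    x * t2 1 + y * t2 2 = divLaw2 g S q x y m0 m1 m2 w0 w1 w2 := by
  subst hq
  have hr0 := h.mass
  have hx0 := h.momX
  have hy0 := h.momY
  have hp0 := h.energy'
  have hm0 := h.mass'
  have hr1 := h'.mass
  have hx1 := h'.momX
  have hy1 := h'.momY
  have hp1 := h'.energy' h
  have hm1 := h'.mass' h
  rw [h2, hv2, hv1]
  simp only [Pi.add_apply, Pi.sub_apply, Pi.smul_apply, Pi.mul_apply, smul_eq_mul, advect_0,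
      advect_1, advect_2, advect_3, advect_4, advect_5, advect_6, advect_7, advect_8, advect_9,
      advect_10, advect_11, advect_12, advect_13, advect_14, advect_15, advect_16, moments_0,
      moments_1, moments_2, moments_3, moments_4, moments_5, moments_6, moments_7, moments_8,
      moments_9, moments_10, moments_11, moments_12, moments_13, moments_14, moments_15, moments_16,
      relaxSigma_0, relaxSigma_1, relaxSigma_2, relaxSigma_3, relaxSigma_4, relaxSigma_5,
          relaxSigma_6, relaxSigma_7, relaxSigma_8, relaxSigma_9, relaxSigma_10, relaxSigma_11,
          relaxSigma_12, relaxSigma_13, relaxSigma_14, relaxSigma_15, relaxSigma_16, theta0_0,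
          theta0_1, theta0_2, theta0_3, theta0_4, theta0_5, theta0_6, theta0_7, theta0_8,
          theta0_9, theta0_10, theta0_11, theta0_12, theta0_13, theta0_14, theta0_15, theta0_16,
          theta1_0, theta1_1, theta1_2, theta1_3, theta1_4, theta1_5, theta1_6, theta1_7,
          theta1_8, theta1_9, theta1_10, theta1_11, theta1_12, theta1_13, theta1_14, theta1_15,
          theta1_16, theta2_XX, theta2_XY, theta2_qx, theta2_qy]
  simp only [divLaw2, Macro.div, Macro.curl]
  linear_combination (1 / 12 * g * x ^ 2 + 1 / 12 * g * y ^ 2) * hm0 +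
      (-(1 / 6 * g * m0 * y ^ 2) + m2) * hr0 +
      (1 / 2 * S * g * x ^ 2 + 1 / 2 * S * g * y ^ 2 + m1) * hr1 +
      (-g * w0.p * x ^ 2 * y ^ 2 - 1 / 2 * g * w0.p * x ^ 4 - 1 / 2 * g * w0.p * y ^ 4
      + 30060 * w0.D * x ^ 2 * y ^ 2 - 5010 * w0.D * x ^ 4 - 5010 * w0.D * y ^ 4
      + 432 * w0.F * x ^ 2 * y ^ 2 - 72 * w0.F * x ^ 4 - 72 * w0.F * y ^ 4
      + w0.l * x ^ 2 * y ^ 2 + 1 / 2 * w0.l * x ^ 4 + 1 / 2 * w0.l * y ^ 4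
      + 17 / 6 * w0.p * x ^ 2 * y ^ 2 + 17 / 12 * w0.p * x ^ 4 + 17 / 12 * w0.p * y ^ 4) * hST

set_option maxHeartbeats 1000000 in
/-- The curl of the conservation law of momentum at order two. -/
def curlLaw2 (g S q x y m0 m1 m2 : ℂ) (w0 w1 w2 : Macro) : ℂ :=
  1 / 2 * S * w1.curl x y * g * q + w0.curl x y * m2 + w1.curl x y * m1 + w2.curl x y * m0

set_option maxHeartbeats 2000000 in
-- The same cancellation by `S T = 1/12` removes `D` and `F` altogether, and the law involves only
-- curls.
lemma curlLaw2_eq {t2 v1 v2 : Fin 17 → ℂ}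
    (hST : S * T = 1 / 12) (hv1 : v1 = moments g w1 + relaxSigma S T s2 s3 s4 * theta0 g x y m0 w0)
    (hv2 : v2 = moments g w2
      + relaxSigma S T s2 s3 s4 * theta1 g S T s2 s3 s4 x y m0 m1 w0 w1)
    (h2 : t2 = advect x y v2 + m0 • v2 + m1 • v1 + m2 • moments g w0
      - (1 / 12 : ℂ) • (advect x y (advect x y (theta0 g x y m0 w0) + m0 • theta0 g x y m0 w0)
        + m0 • (advect x y (theta0 g x y m0 w0) + m0 • theta0 g x y m0 w0)))
    (h : Row0 g x y m0 w0) (h' : Row1 g S T x y m0 m1 w0 w1)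
    {q : ℂ} (hq : x ^ 2 + y ^ 2 = q) :
    x * t2 2 - y * t2 1 = curlLaw2 g S q x y m0 m1 m2 w0 w1 w2 := by
  subst hq
  have hr0 := h.mass
  have hx0 := h.momX
  have hy0 := h.momY
  have hp0 := h.energy'
  have hm0 := h.mass'
  have hr1 := h'.mass
  have hx1 := h'.momX
  have hy1 := h'.momY
  have hp1 := h'.energy' h
  have hm1 := h'.mass' h
  rw [h2, hv2, hv1]
  simp only [Pi.add_apply, Pi.sub_apply, Pi.smul_apply, Pi.mul_apply, smul_eq_mul, advect_0,
      advect_1, advect_2, advect_3, advect_4, advect_5, advect_6, advect_7, advect_8, advect_9,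
      advect_10, advect_11, advect_12, advect_13, advect_14, advect_15, advect_16, moments_0,
      moments_1, moments_2, moments_3, moments_4, moments_5, moments_6, moments_7, moments_8,
      moments_9, moments_10, moments_11, moments_12, moments_13, moments_14, moments_15, moments_16,
      relaxSigma_0, relaxSigma_1, relaxSigma_2, relaxSigma_3, relaxSigma_4, relaxSigma_5,
          relaxSigma_6, relaxSigma_7, relaxSigma_8, relaxSigma_9, relaxSigma_10, relaxSigma_11,
          relaxSigma_12, relaxSigma_13, relaxSigma_14, relaxSigma_15, relaxSigma_16, theta0_0,
          theta0_1, theta0_2, theta0_3, theta0_4, theta0_5, theta0_6, theta0_7, theta0_8,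
          theta0_9, theta0_10, theta0_11, theta0_12, theta0_13, theta0_14, theta0_15, theta0_16,
          theta1_0, theta1_1, theta1_2, theta1_3, theta1_4, theta1_5, theta1_6, theta1_7,
          theta1_8, theta1_9, theta1_10, theta1_11, theta1_12, theta1_13, theta1_14, theta1_15,
          theta1_16, theta2_XX, theta2_XY, theta2_qx, theta2_qy]
  simp only [curlLaw2, Macro.div, Macro.curl]
  linear_combination (1 / 12 * g * y ^ 3) * hx0 +
      (-(1 / 12 * g * m0 * x * y)) * hr0 +
      (-(1 / 6 * g * x * y ^ 2) - 1 / 12 * g * x ^ 3) * hy0 +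
      (-(1 / 12 * g * x * y)) * hm0 +
      (-20040 * w0.D * x * y ^ 3 + 20040 * w0.D * x ^ 3 * y - 288 * w0.F * x * y ^ 3
      + 288 * w0.F * x ^ 3 * y) * hST

set_option maxHeartbeats 1000000 in
/-- The conservation law of energy at order two. -/
def energyLaw2 (g T s2 q x y m0 m1 m2 : ℂ) (w0 w1 w2 : Macro) : ℂ :=
  -T ^ 2 * g ^ 2 * m0 * q * w0.r - 1 / 6 * T * g * m0 * q * w0.r * s2
  + 17 / 6 * T ^ 2 * g * m0 * q * w0.r + 3 / 5 * T * w0.X * q * s2 * x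
  + 3 / 5 * T * w0.Y * q * s2 * y + T * w0.l * m0 * q * s2 + 8 / 5 * T * m0 * q * w0.r * s2
  + T ^ 2 * w0.l * m0 * q + 5 / 24 * g ^ 2 * m0 * q * w0.r - T * g * w1.p * q
  - 11 / 24 * g * m0 * q * w0.r + T * w1.l * q + 17 / 6 * T * w1.p * q - 1 / 20 * w0.X * q * x
  - 1 / 20 * w0.Y * q * y - 1 / 4 * w0.l * m0 * q - 2 / 15 * m0 * q * w0.r + w2.div x y * g
  + m0 * w2.p + m1 * w1.p + m2 * w0.p

set_option maxHeartbeats 2000000 in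
-- At this order `X` and `Y` survive only through `x X + y Y`, with the factor `(3/5 T s2 - 1/20)
-- q`. This factor is the one that must be kept away from zero in the second part.
lemma energyLaw2_eq {t2 v1 v2 : Fin 17 → ℂ}
    (hST : S * T = 1 / 12) (hv1 : v1 = moments g w1 + relaxSigma S T s2 s3 s4 * theta0 g x y m0 w0)
    (hv2 : v2 = moments g w2
      + relaxSigma S T s2 s3 s4 * theta1 g S T s2 s3 s4 x y m0 m1 w0 w1)
    (h2 : t2 = advect x y v2 + m0 • v2 + m1 • v1 + m2 • moments g w0
      - (1 / 12 : ℂ) • (advect x y (advect x y (theta0 g x y m0 w0) + m0 • theta0 g x y m0 w0)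
        + m0 • (advect x y (theta0 g x y m0 w0) + m0 • theta0 g x y m0 w0)))
    (h : Row0 g x y m0 w0) (h' : Row1 g S T x y m0 m1 w0 w1)
    {q : ℂ} (hq : x ^ 2 + y ^ 2 = q) :
    1 / 34 * t2 3 + 30 / 17 * t2 0 = energyLaw2 g T s2 q x y m0 m1 m2 w0 w1 w2 := by
  subst hq
  have hr0 := h.mass
  have hx0 := h.momX
  have hy0 := h.momY
  have hp0 := h.energy'
  have hm0 := h.mass'
  have hr1 := h'.mass
  have hx1 := h'.momX
  have hy1 := h'.momY
  have hp1 := h'.energy' h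
  have hm1 := h'.mass' h
  rw [h2, hv2, hv1]
  simp only [Pi.add_apply, Pi.sub_apply, Pi.smul_apply, Pi.mul_apply, smul_eq_mul, advect_0,
      advect_1, advect_2, advect_3, advect_4, advect_5, advect_6, advect_7, advect_8, advect_9,
      advect_10, advect_11, advect_12, advect_13, advect_14, advect_15, advect_16, moments_0,
      moments_1, moments_2, moments_3, moments_4, moments_5, moments_6, moments_7, moments_8,
      moments_9, moments_10, moments_11, moments_12, moments_13, moments_14, moments_15, moments_16,
      relaxSigma_0, relaxSigma_1, relaxSigma_2, relaxSigma_3, relaxSigma_4, relaxSigma_5,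
          relaxSigma_6, relaxSigma_7, relaxSigma_8, relaxSigma_9, relaxSigma_10, relaxSigma_11,
          relaxSigma_12, relaxSigma_13, relaxSigma_14, relaxSigma_15, relaxSigma_16, theta0_0,
          theta0_1, theta0_2, theta0_3, theta0_4, theta0_5, theta0_6, theta0_7, theta0_8,
          theta0_9, theta0_10, theta0_11, theta0_12, theta0_13, theta0_14, theta0_15, theta0_16,
          theta1_0, theta1_1, theta1_2, theta1_3, theta1_4, theta1_5, theta1_6, theta1_7,
          theta1_8, theta1_9, theta1_10, theta1_11, theta1_12, theta1_13, theta1_14, theta1_15,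
          theta1_16, theta2_XX, theta2_XY, theta2_qx, theta2_qy]
  simp only [energyLaw2, Macro.div, Macro.curl]
  linear_combination (1 / 6 * g * x ^ 2 + 1 / 6 * g * y ^ 2 - 17 / 36 * x ^ 2
      - 17 / 36 * y ^ 2) * hp0 +
      (T * g * m1 - 35 / 144 * g * y ^ 2 - 17 / 6 * T * m1 + 1 / 15 * y ^ 2) * hr0 +
      (1 / 2 * g ^ 2 * m0 * w0.r * x ^ 2 + 1 / 2 * g ^ 2 * m0 * w0.r * y ^ 2
      + 1 / 12 * g * w0.jx * x * y ^ 2 + 1 / 12 * g * w0.jy * y ^ 3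
      - 3 / 2 * g * m0 * w0.r * x ^ 2 - 17 / 12 * g * m0 * w0.r * y ^ 2
      + 9 / 5 * w0.X * x * y ^ 2 - 1 / 5 * w0.X * x ^ 3 + 9 / 5 * w0.Y * x ^ 2 * y
      - 1 / 5 * w0.Y * y ^ 3 - 4 / 5 * w0.jx * x * y ^ 2 - 4 / 5 * w0.jy * y ^ 3
      + 4 / 5 * m0 * w0.r * x ^ 2) * hST +
      (T * g * m0 - 17 / 6 * T * m0) * hr1 +
      (-T * g + 17 / 6 * T) * hm1

/-! ### Conservation laws at order three. -/

set_option maxHeartbeats 1000000 in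
/-- The conservation law of mass at order three. -/
def massLaw3 (g S T q x y m0 m1 m2 m3 : ℂ) (w0 w1 w2 w3 : Macro) : ℂ :=
  3340 * w0.D * T * x ^ 4 + 48 * w0.F * T * x ^ 4 - 3340 * w0.D * T * q * x ^ 2
  - 48 * w0.F * T * q * x ^ 2 + 1 / 24 * S * g * w0.p * q ^ 2 + 1 / 24 * T * g * w0.p * q ^ 2
  + 835 / 2 * w0.D * T * q ^ 2 + 6 * w0.F * T * q ^ 2 - 1 / 24 * T * w0.l * q ^ 2
  - 17 / 144 * T * w0.p * q ^ 2 + 1 / 24 * g * m0 * q * w1.r + 1 / 24 * g * m1 * q * w0.r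
  + m0 * w3.r + m1 * w2.r + m2 * w1.r + m3 * w0.r + w3.div x y

set_option maxHeartbeats 2000000 in
-- The only direction-dependent polynomial is `x⁴ - q x² = -x² y²`, and it multiplies `D` and `F`.
lemma massLaw3_eq {t2 t3 v1 v2 v3 : Fin 17 → ℂ}
    (hv1 : v1 = moments g w1 + relaxSigma S T s2 s3 s4 * theta0 g x y m0 w0)
    (hv2 : v2 = moments g w2
      + relaxSigma S T s2 s3 s4 * theta1 g S T s2 s3 s4 x y m0 m1 w0 w1)
    (hv3 : v3 = moments g w3 + relaxSigma S T s2 s3 s4 * t2)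
    (ht2 : ∀ i : Fin 4, t2 (Fin.natAdd 4 (Fin.castLE (by norm_num) i : Fin 13)) =
      theta2 g S T s2 s3 s4 x y m0 m1 m2 w0 w1 w2 i)
    (h3 : t3 = advect x y v3 + m0 • v3 + m1 • v2 + m2 • v1 + m3 • moments g w0
      - (1 / 12 : ℂ) • (advect x y (advect x y (theta1 g S T s2 s3 s4 x y m0 m1 w0 w1)
          + m0 • theta1 g S T s2 s3 s4 x y m0 m1 w0 w1)
        + m0 • (advect x y (theta1 g S T s2 s3 s4 x y m0 m1 w0 w1)
          + m0 • theta1 g S T s2 s3 s4 x y m0 m1 w0 w1)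
        + (2 * m1) • (advect x y (theta0 g x y m0 w0) + m0 • theta0 g x y m0 w0)))
    (h : Row0 g x y m0 w0) (h' : Row1 g S T x y m0 m1 w0 w1)
    {q : ℂ} (hq : x ^ 2 + y ^ 2 = q) :
    t3 0 = massLaw3 g S T q x y m0 m1 m2 m3 w0 w1 w2 w3 := by
  subst hq
  have hr0 := h.mass
  have hx0 := h.momX
  have hy0 := h.momY
  have hp0 := h.energy'
  have hm0 := h.mass'
  have hr1 := h'.mass
  have hx1 := h'.momX
  have hy1 := h'.momY
  have hp1 := h'.energy' h
  have hm1 := h'.mass' h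
  have e4 := ht2 0
  have e5 := ht2 1
  have e6 := ht2 2
  have e7 := ht2 3
  change t2 4 = theta2_XX g S T s2 s3 s4 x y m0 w0 w1 w2 at e4
  change t2 5 = theta2_XY g S T s2 s3 s4 x y m0 w0 w1 w2 at e5
  change t2 6 = theta2_qx g S T s2 x y m0 m1 m2 w0 w1 w2 at e6
  change t2 7 = theta2_qy g S T s2 x y m0 m1 m2 w0 w1 w2 at e7
  rw [h3, hv3, hv2, hv1]
  simp only [Pi.add_apply, Pi.sub_apply, Pi.smul_apply, Pi.mul_apply, smul_eq_mul, advect_0,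
      advect_1, advect_2, advect_3, advect_4, advect_5, advect_6, advect_7, advect_8, advect_9,
      advect_10, advect_11, advect_12, advect_13, advect_14, advect_15, advect_16, moments_0,
      moments_1, moments_2, moments_3, moments_4, moments_5, moments_6, moments_7, moments_8,
      moments_9, moments_10, moments_11, moments_12, moments_13, moments_14, moments_15, moments_16,
      relaxSigma_0, relaxSigma_1, relaxSigma_2, relaxSigma_3, relaxSigma_4, relaxSigma_5,
          relaxSigma_6, relaxSigma_7, relaxSigma_8, relaxSigma_9, relaxSigma_10, relaxSigma_11,
          relaxSigma_12, relaxSigma_13, relaxSigma_14, relaxSigma_15, relaxSigma_16, theta0_0,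
          theta0_1, theta0_2, theta0_3, theta0_4, theta0_5, theta0_6, theta0_7, theta0_8,
          theta0_9, theta0_10, theta0_11, theta0_12, theta0_13, theta0_14, theta0_15, theta0_16,
          theta1_0, theta1_1, theta1_2, theta1_3, theta1_4, theta1_5, theta1_6, theta1_7,
          theta1_8, theta1_9, theta1_10, theta1_11, theta1_12, theta1_13, theta1_14, theta1_15,
          theta1_16, e4, e5, e6, e7, theta2_XX, theta2_XY, theta2_qx, theta2_qy]
  simp only [massLaw3, Macro.div, Macro.curl]
  linear_combination (-(1 / 24 * g * x ^ 2) - 1 / 24 * g * y ^ 2) * hr1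

set_option maxHeartbeats 1000000 in
/-- The divergence of the conservation law of momentum at order three. -/
def divLaw3 (g S T s2 q x y m0 m1 m2 m3 : ℂ) (w0 w1 w2 w3 : Macro) : ℂ :=
  -(1 / 4 * S ^ 3 * g ^ 2 * m0 * q ^ 2 * w0.r) + 6680 * w0.D * S * m0 * x ^ 4
  + 6680 * w0.D * T * m0 * x ^ 4 + 96 * w0.F * S * m0 * x ^ 4 + 96 * w0.F * T * m0 * x ^ 4
  + 1 / 3 * S * w0.X * x ^ 5 + 1 / 3 * S * w0.Y * x ^ 4 * y
  + 1 / 12 * S * g ^ 2 * m0 * q ^ 2 * w0.r + 1 / 6 * T * g ^ 2 * m0 * q ^ 2 * w0.r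
  - 6680 * w0.D * S * m0 * q * x ^ 2 - 6680 * w0.D * T * m0 * q * x ^ 2
  - 96 * w0.F * S * m0 * q * x ^ 2 - 96 * w0.F * T * m0 * q * x ^ 2
  - 2 / 3 * S * w0.Y * q * x ^ 2 * y + 5 / 36 * S * g * m0 * q ^ 2 * w0.r
  - 1 / 2 * S ^ 2 * g * w1.p * q ^ 2 - 17 / 36 * T * g * m0 * q ^ 2 * w0.r
  + 1 / 72 * g * m0 * q ^ 2 * w0.r * s2 + 835 * w0.D * S * m0 * q ^ 2
  + 835 * w0.D * T * m0 * q ^ 2 + 12 * w0.F * S * m0 * q ^ 2 + 12 * w0.F * T * m0 * q ^ 2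
  - 17 / 60 * S * w0.X * q ^ 2 * x + 1 / 20 * S * w0.Y * q ^ 2 * y
  - 1 / 12 * S * w0.l * m0 * q ^ 2 - 1 / 5 * S * m0 * q ^ 2 * w0.r
  - 1 / 6 * T * w0.l * m0 * q ^ 2 - 1 / 20 * w0.X * q ^ 2 * s2 * x
  - 1 / 20 * w0.Y * q ^ 2 * s2 * y - 1 / 12 * w0.l * m0 * q ^ 2 * s2
  - 2 / 15 * m0 * q ^ 2 * w0.r * s2 + 1 / 2 * S * w2.div x y * g * q + 1 / 6 * g * w1.p * q ^ 2
  - 1 / 12 * w1.l * q ^ 2 - m0 * m2 * w1.r - m0 * m3 * w0.r - m1 * m2 * w0.r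
  - 17 / 72 * w1.p * q ^ 2 + w2.div x y * m1 + w3.div x y * m0 + w3.p * q

set_option maxHeartbeats 2000000 in
-- `S T = 1/12` removes the rates `s3` and `s4` entirely, together with the fields `D`, `F` of order
-- one. Anisotropy remains only in the terms in `D`, `F`, `X`, `Y` of order zero.
lemma divLaw3_eq {t2 t3 v1 v2 v3 : Fin 17 → ℂ}
    (hST : S * T = 1 / 12) (hv1 : v1 = moments g w1 + relaxSigma S T s2 s3 s4 * theta0 g x y m0 w0)
    (hv2 : v2 = moments g w2
      + relaxSigma S T s2 s3 s4 * theta1 g S T s2 s3 s4 x y m0 m1 w0 w1)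
    (hv3 : v3 = moments g w3 + relaxSigma S T s2 s3 s4 * t2)
    (ht2 : ∀ i : Fin 4, t2 (Fin.natAdd 4 (Fin.castLE (by norm_num) i : Fin 13)) =
      theta2 g S T s2 s3 s4 x y m0 m1 m2 w0 w1 w2 i)
    (h3 : t3 = advect x y v3 + m0 • v3 + m1 • v2 + m2 • v1 + m3 • moments g w0
      - (1 / 12 : ℂ) • (advect x y (advect x y (theta1 g S T s2 s3 s4 x y m0 m1 w0 w1)
          + m0 • theta1 g S T s2 s3 s4 x y m0 m1 w0 w1)
        + m0 • (advect x y (theta1 g S T s2 s3 s4 x y m0 m1 w0 w1)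
          + m0 • theta1 g S T s2 s3 s4 x y m0 m1 w0 w1)
        + (2 * m1) • (advect x y (theta0 g x y m0 w0) + m0 • theta0 g x y m0 w0)))
    (h : Row0 g x y m0 w0) (h' : Row1 g S T x y m0 m1 w0 w1)
    {q : ℂ} (hq : x ^ 2 + y ^ 2 = q) :
    x * t3 1 + y * t3 2 = divLaw3 g S T s2 q x y m0 m1 m2 m3 w0 w1 w2 w3 := by
  subst hq
  have hr0 := h.mass
  have hx0 := h.momX
  have hy0 := h.momY
  have hp0 := h.energy'
  have hm0 := h.mass'
  have hr1 := h'.mass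
  have hx1 := h'.momX
  have hy1 := h'.momY
  have hp1 := h'.energy' h
  have hm1 := h'.mass' h
  have e4 := ht2 0
  have e5 := ht2 1
  have e6 := ht2 2
  have e7 := ht2 3
  change t2 4 = theta2_XX g S T s2 s3 s4 x y m0 w0 w1 w2 at e4
  change t2 5 = theta2_XY g S T s2 s3 s4 x y m0 w0 w1 w2 at e5
  change t2 6 = theta2_qx g S T s2 x y m0 m1 m2 w0 w1 w2 at e6
  change t2 7 = theta2_qy g S T s2 x y m0 m1 m2 w0 w1 w2 at e7
  rw [h3, hv3, hv2, hv1]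
  simp only [Pi.add_apply, Pi.sub_apply, Pi.smul_apply, Pi.mul_apply, smul_eq_mul, advect_0,
      advect_1, advect_2, advect_3, advect_4, advect_5, advect_6, advect_7, advect_8, advect_9,
      advect_10, advect_11, advect_12, advect_13, advect_14, advect_15, advect_16, moments_0,
      moments_1, moments_2, moments_3, moments_4, moments_5, moments_6, moments_7, moments_8,
      moments_9, moments_10, moments_11, moments_12, moments_13, moments_14, moments_15, moments_16,
      relaxSigma_0, relaxSigma_1, relaxSigma_2, relaxSigma_3, relaxSigma_4, relaxSigma_5,
          relaxSigma_6, relaxSigma_7, relaxSigma_8, relaxSigma_9, relaxSigma_10, relaxSigma_11,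
          relaxSigma_12, relaxSigma_13, relaxSigma_14, relaxSigma_15, relaxSigma_16, theta0_0,
          theta0_1, theta0_2, theta0_3, theta0_4, theta0_5, theta0_6, theta0_7, theta0_8,
          theta0_9, theta0_10, theta0_11, theta0_12, theta0_13, theta0_14, theta0_15, theta0_16,
          theta1_0, theta1_1, theta1_2, theta1_3, theta1_4, theta1_5, theta1_6, theta1_7,
          theta1_8, theta1_9, theta1_10, theta1_11, theta1_12, theta1_13, theta1_14, theta1_15,
          theta1_16, e4, e5, e6, e7, theta2_XX, theta2_XY, theta2_qx, theta2_qy]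
  simp only [divLaw3, Macro.div, Macro.curl]
  linear_combination (-(1 / 2 * S ^ 3 * g ^ 2 * y ^ 4) - 1 / 24 * S * g ^ 2 * y ^ 4
      + 1 / 60 * S * g * x ^ 2 * y ^ 2 - 11 / 120 * S * g * y ^ 4 + 1 / 15 * S * x ^ 2 * y ^ 2
      + 1 / 5 * S * y ^ 4 - 1 / 8 * g * m1 * x ^ 2 - 7 / 24 * g * m1 * y ^ 2
      + 17 / 60 * m1 * x ^ 2 + 17 / 30 * m1 * y ^ 2 + m3) * hr0 +
      (-(5 / 24 * g * m0 * x ^ 2) - 5 / 24 * g * m0 * y ^ 2 + 17 / 60 * m0 * x ^ 2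
      + 17 / 30 * m0 * y ^ 2 + m2) * hr1 +
      (-T * g ^ 2 * m0 * w0.r * x ^ 2 * y ^ 2 - 1 / 2 * T * g ^ 2 * m0 * w0.r * x ^ 4
      - 1 / 2 * T * g ^ 2 * m0 * w0.r * y ^ 4 + 17 / 6 * T * g * m0 * w0.r * x ^ 2 * y ^ 2
      + 17 / 12 * T * g * m0 * w0.r * x ^ 4 + 17 / 12 * T * g * m0 * w0.r * y ^ 4
      - 17797 / 11067 * g * m0 * w0.r * s2 * x ^ 2 * y ^ 2
      + 3473 / 22134 * g * m0 * w0.r * s2 * x ^ 4 + 3473 / 22134 * g * m0 * w0.r * s2 * y ^ 4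
      - 155330040 / 33912977 * g * m0 * w0.r * s3 * x ^ 2 * y ^ 2
      + 25888340 / 33912977 * g * m0 * w0.r * s3 * x ^ 4
      + 25888340 / 33912977 * g * m0 * w0.r * s3 * y ^ 4
      + 110715 / 18386 * g * m0 * w0.r * s4 * x ^ 2 * y ^ 2
      - 36905 / 36772 * g * m0 * w0.r * s4 * x ^ 4 - 36905 / 36772 * g * m0 * w0.r * s4 * y ^ 4
      + 30060 * w0.D * T * m0 * x ^ 2 * y ^ 2 - 5010 * w0.D * T * m0 * x ^ 4
      - 5010 * w0.D * T * m0 * y ^ 4 + 30060 * w0.D * m0 * s3 * x ^ 2 * y ^ 2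
      - 5010 * w0.D * m0 * s3 * x ^ 4 - 5010 * w0.D * m0 * s3 * y ^ 4
      + 432 * w0.F * T * m0 * x ^ 2 * y ^ 2 - 72 * w0.F * T * m0 * x ^ 4
      - 72 * w0.F * T * m0 * y ^ 4 + 432 * w0.F * m0 * s4 * x ^ 2 * y ^ 2
      - 72 * w0.F * m0 * s4 * x ^ 4 - 72 * w0.F * m0 * s4 * y ^ 4
      + T * w0.l * m0 * x ^ 2 * y ^ 2 + 1 / 2 * T * w0.l * m0 * x ^ 4
      + 1 / 2 * T * w0.l * m0 * y ^ 4 - 10419 / 18445 * w0.X * s2 * x * y ^ 4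
      + 106782 / 18445 * w0.X * s2 * x ^ 3 * y ^ 2 - 10419 / 18445 * w0.X * s2 * x ^ 5
      + 4139930 / 33912977 * w0.X * s3 * x * y ^ 4
      - 24839580 / 33912977 * w0.X * s3 * x ^ 3 * y ^ 2 + 4139930 / 33912977 * w0.X * s3 * x ^ 5
      + 2232 / 9193 * w0.X * s4 * x * y ^ 4 - 13392 / 9193 * w0.X * s4 * x ^ 3 * y ^ 2
      + 2232 / 9193 * w0.X * s4 * x ^ 5 + 106782 / 18445 * w0.Y * s2 * x ^ 2 * y ^ 3
      - 10419 / 18445 * w0.Y * s2 * x ^ 4 * y - 10419 / 18445 * w0.Y * s2 * y ^ 5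
      - 24839580 / 33912977 * w0.Y * s3 * x ^ 2 * y ^ 3
      + 4139930 / 33912977 * w0.Y * s3 * x ^ 4 * y + 4139930 / 33912977 * w0.Y * s3 * y ^ 5
      - 13392 / 9193 * w0.Y * s4 * x ^ 2 * y ^ 3 + 2232 / 9193 * w0.Y * s4 * x ^ 4 * y
      + 2232 / 9193 * w0.Y * s4 * y ^ 5 + 35594 / 3689 * w0.l * m0 * s2 * x ^ 2 * y ^ 2
      - 3473 / 3689 * w0.l * m0 * s2 * x ^ 4 - 3473 / 3689 * w0.l * m0 * s2 * y ^ 4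
      - 565052850 / 33912977 * w0.l * m0 * s3 * x ^ 2 * y ^ 2
      + 94175475 / 33912977 * w0.l * m0 * s3 * x ^ 4
      + 94175475 / 33912977 * w0.l * m0 * s3 * y ^ 4
      + 73665 / 9193 * w0.l * m0 * s4 * x ^ 2 * y ^ 2 - 24555 / 18386 * w0.l * m0 * s4 * x ^ 4
      - 24555 / 18386 * w0.l * m0 * s4 * y ^ 4 + 284752 / 18445 * m0 * w0.r * s2 * x ^ 2 * y ^ 2
      - 27784 / 18445 * m0 * w0.r * s2 * x ^ 4 - 27784 / 18445 * m0 * w0.r * s2 * y ^ 4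
      - 682301880 / 33912977 * m0 * w0.r * s3 * x ^ 2 * y ^ 2
      + 113716980 / 33912977 * m0 * w0.r * s3 * x ^ 4
      + 113716980 / 33912977 * m0 * w0.r * s3 * y ^ 4
      + 57744 / 9193 * m0 * w0.r * s4 * x ^ 2 * y ^ 2 - 9624 / 9193 * m0 * w0.r * s4 * x ^ 4
      - 9624 / 9193 * m0 * w0.r * s4 * y ^ 4 - g * w1.p * x ^ 2 * y ^ 2
      - 1 / 2 * g * w1.p * x ^ 4 - 1 / 2 * g * w1.p * y ^ 4 + 30060 * w1.D * x ^ 2 * y ^ 2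
      - 5010 * w1.D * x ^ 4 - 5010 * w1.D * y ^ 4 + 432 * w1.F * x ^ 2 * y ^ 2
      - 72 * w1.F * x ^ 4 - 72 * w1.F * y ^ 4 + w1.l * x ^ 2 * y ^ 2 + 1 / 2 * w1.l * x ^ 4
      + 1 / 2 * w1.l * y ^ 4 + 17 / 6 * w1.p * x ^ 2 * y ^ 2 + 17 / 12 * w1.p * x ^ 4
      + 17 / 12 * w1.p * y ^ 4) * hST +
      (1 / 6 * S * g * x ^ 2 * y ^ 2 + 1 / 12 * S * g * x ^ 4 + 1 / 12 * S * g * y ^ 4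
      + 1 / 6 * T * g * x ^ 2 * y ^ 2 + 1 / 12 * T * g * x ^ 4 + 1 / 12 * T * g * y ^ 4
      - 17 / 36 * T * x ^ 2 * y ^ 2 - 17 / 72 * T * x ^ 4 - 17 / 72 * T * y ^ 4) * hp0 +
      (5 / 24 * g * x ^ 2 + 5 / 24 * g * y ^ 2 - 17 / 60 * x ^ 2 - 17 / 30 * y ^ 2) * hm1 +
      (17 / 60 * x ^ 2 * y - 17 / 60 * y ^ 3) * hy1

set_option maxHeartbeats 1000000 in
/-- The curl of the conservation law of momentum at order three. -/
def curlLaw3 (g S T q x y m0 m1 m2 m3 : ℂ) (w0 w1 w2 w3 : Macro) : ℂ :=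
  -(1 / 4 * S ^ 3 * w0.curl x y * g ^ 2 * q ^ 2) - 6680 * w0.D * S * m0 * x ^ 3 * y
  - 6680 * w0.D * T * m0 * x ^ 3 * y - 96 * w0.F * S * m0 * x ^ 3 * y
  - 96 * w0.F * T * m0 * x ^ 3 * y - 1 / 3 * S * w0.X * x ^ 4 * y + 1 / 3 * S * w0.Y * x ^ 5
  + 3340 * w0.D * S * m0 * q * x * y + 3340 * w0.D * T * m0 * q * x * y
  + 48 * w0.F * S * m0 * q * x * y + 48 * w0.F * T * m0 * q * x * y
  - 2 / 3 * S * w0.Y * q * x ^ 3 + 1 / 24 * S * w0.curl x y * g ^ 2 * q ^ 2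
  + 1 / 15 * S * w0.X * q ^ 2 * y + 4 / 15 * S * w0.Y * q ^ 2 * x
  - 1 / 8 * S * w0.curl x y * g * q ^ 2 + 1 / 15 * S * w0.curl x y * q ^ 2
  + 1 / 2 * S * w2.curl x y * g * q + w0.curl x y * m3 + w1.curl x y * m2 + w2.curl x y * m1
  + w3.curl x y * m0

set_option maxHeartbeats 2000000 in
-- Here even `s2` disappears. For vanishing `D`, `F`, `X`, `Y` the law relates curls alone, so shear
-- decouples from density and pressure.
lemma curlLaw3_eq {t2 t3 v1 v2 v3 : Fin 17 → ℂ}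
    (hST : S * T = 1 / 12) (hv1 : v1 = moments g w1 + relaxSigma S T s2 s3 s4 * theta0 g x y m0 w0)
    (hv2 : v2 = moments g w2
      + relaxSigma S T s2 s3 s4 * theta1 g S T s2 s3 s4 x y m0 m1 w0 w1)
    (hv3 : v3 = moments g w3 + relaxSigma S T s2 s3 s4 * t2)
    (ht2 : ∀ i : Fin 4, t2 (Fin.natAdd 4 (Fin.castLE (by norm_num) i : Fin 13)) =
      theta2 g S T s2 s3 s4 x y m0 m1 m2 w0 w1 w2 i)
    (h3 : t3 = advect x y v3 + m0 • v3 + m1 • v2 + m2 • v1 + m3 • moments g w0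
      - (1 / 12 : ℂ) • (advect x y (advect x y (theta1 g S T s2 s3 s4 x y m0 m1 w0 w1)
          + m0 • theta1 g S T s2 s3 s4 x y m0 m1 w0 w1)
        + m0 • (advect x y (theta1 g S T s2 s3 s4 x y m0 m1 w0 w1)
          + m0 • theta1 g S T s2 s3 s4 x y m0 m1 w0 w1)
        + (2 * m1) • (advect x y (theta0 g x y m0 w0) + m0 • theta0 g x y m0 w0)))
    (h : Row0 g x y m0 w0) (h' : Row1 g S T x y m0 m1 w0 w1)
    {q : ℂ} (hq : x ^ 2 + y ^ 2 = q) :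
    x * t3 2 - y * t3 1 = curlLaw3 g S T q x y m0 m1 m2 m3 w0 w1 w2 w3 := by
  subst hq
  have hr0 := h.mass
  have hx0 := h.momX
  have hy0 := h.momY
  have hp0 := h.energy'
  have hm0 := h.mass'
  have hr1 := h'.mass
  have hx1 := h'.momX
  have hy1 := h'.momY
  have hp1 := h'.energy' h
  have hm1 := h'.mass' h
  have e4 := ht2 0
  have e5 := ht2 1
  have e6 := ht2 2
  have e7 := ht2 3
  change t2 4 = theta2_XX g S T s2 s3 s4 x y m0 w0 w1 w2 at e4
  change t2 5 = theta2_XY g S T s2 s3 s4 x y m0 w0 w1 w2 at e5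
  change t2 6 = theta2_qx g S T s2 x y m0 m1 m2 w0 w1 w2 at e6
  change t2 7 = theta2_qy g S T s2 x y m0 m1 m2 w0 w1 w2 at e7
  rw [h3, hv3, hv2, hv1]
  simp only [Pi.add_apply, Pi.sub_apply, Pi.smul_apply, Pi.mul_apply, smul_eq_mul, advect_0,
      advect_1, advect_2, advect_3, advect_4, advect_5, advect_6, advect_7, advect_8, advect_9,
      advect_10, advect_11, advect_12, advect_13, advect_14, advect_15, advect_16, moments_0,
      moments_1, moments_2, moments_3, moments_4, moments_5, moments_6, moments_7, moments_8,
      moments_9, moments_10, moments_11, moments_12, moments_13, moments_14, moments_15, moments_16,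
      relaxSigma_0, relaxSigma_1, relaxSigma_2, relaxSigma_3, relaxSigma_4, relaxSigma_5,
          relaxSigma_6, relaxSigma_7, relaxSigma_8, relaxSigma_9, relaxSigma_10, relaxSigma_11,
          relaxSigma_12, relaxSigma_13, relaxSigma_14, relaxSigma_15, relaxSigma_16, theta0_0,
          theta0_1, theta0_2, theta0_3, theta0_4, theta0_5, theta0_6, theta0_7, theta0_8,
          theta0_9, theta0_10, theta0_11, theta0_12, theta0_13, theta0_14, theta0_15, theta0_16,
          theta1_0, theta1_1, theta1_2, theta1_3, theta1_4, theta1_5, theta1_6, theta1_7,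
          theta1_8, theta1_9, theta1_10, theta1_11, theta1_12, theta1_13, theta1_14, theta1_15,
          theta1_16, e4, e5, e6, e7, theta2_XX, theta2_XY, theta2_qx, theta2_qy]
  simp only [curlLaw3, Macro.div, Macro.curl]
  linear_combination (-(3 / 4 * S ^ 3 * g ^ 2 * x * y ^ 3) - 1 / 4 * S ^ 3 * g ^ 2 * x ^ 3 * y
      + 1 / 24 * S * g ^ 2 * x ^ 3 * y - 7 / 30 * S * g * x * y ^ 3 - 1 / 8 * S * g * x ^ 3 * y
      + 1 / 5 * S * x * y ^ 3 + 1 / 15 * S * x ^ 3 * y - 1 / 24 * g * m1 * x * y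
      + 17 / 180 * m1 * x * y) * hr0 +
      (1 / 8 * g * y ^ 3 - 17 / 90 * y ^ 3) * hx1 +
      (-(1 / 4 * g * x * y ^ 2) - 1 / 8 * g * x ^ 3 - 17 / 90 * x * y ^ 2 + 17 / 90 * x ^ 3) * hy1 +
      (1 / 8 * g * m0 * x * y + 17 / 180 * m0 * x * y) * hr1 +
      (-(1 / 8 * g * x * y) - 17 / 180 * x * y) * hm1 +
      (3545 / 3689 * g * m0 * w0.r * s2 * x * y ^ 3
      - 3545 / 3689 * g * m0 * w0.r * s2 * x ^ 3 * y
      + 103553360 / 33912977 * g * m0 * w0.r * s3 * x * y ^ 3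
      - 103553360 / 33912977 * g * m0 * w0.r * s3 * x ^ 3 * y
      - 36905 / 9193 * g * m0 * w0.r * s4 * x * y ^ 3
      + 36905 / 9193 * g * m0 * w0.r * s4 * x ^ 3 * y - 20040 * w0.D * T * m0 * x * y ^ 3
      + 20040 * w0.D * T * m0 * x ^ 3 * y - 20040 * w0.D * m0 * s3 * x * y ^ 3
      + 20040 * w0.D * m0 * s3 * x ^ 3 * y - 288 * w0.F * T * m0 * x * y ^ 3
      + 288 * w0.F * T * m0 * x ^ 3 * y - 288 * w0.F * m0 * s4 * x * y ^ 3
      + 288 * w0.F * m0 * s4 * x ^ 3 * y - 12762 / 3689 * w0.X * s2 * x ^ 2 * y ^ 3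
      + 12762 / 3689 * w0.X * s2 * x ^ 4 * y + 16559720 / 33912977 * w0.X * s3 * x ^ 2 * y ^ 3
      - 16559720 / 33912977 * w0.X * s3 * x ^ 4 * y + 8928 / 9193 * w0.X * s4 * x ^ 2 * y ^ 3
      - 8928 / 9193 * w0.X * s4 * x ^ 4 * y - 12762 / 3689 * w0.Y * s2 * x * y ^ 4
      + 12762 / 3689 * w0.Y * s2 * x ^ 3 * y ^ 2 + 16559720 / 33912977 * w0.Y * s3 * x * y ^ 4
      - 16559720 / 33912977 * w0.Y * s3 * x ^ 3 * y ^ 2 + 8928 / 9193 * w0.Y * s4 * x * y ^ 4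
      - 8928 / 9193 * w0.Y * s4 * x ^ 3 * y ^ 2 - 21270 / 3689 * w0.l * m0 * s2 * x * y ^ 3
      + 21270 / 3689 * w0.l * m0 * s2 * x ^ 3 * y
      + 376701900 / 33912977 * w0.l * m0 * s3 * x * y ^ 3
      - 376701900 / 33912977 * w0.l * m0 * s3 * x ^ 3 * y
      - 49110 / 9193 * w0.l * m0 * s4 * x * y ^ 3 + 49110 / 9193 * w0.l * m0 * s4 * x ^ 3 * y
      - 34032 / 3689 * m0 * w0.r * s2 * x * y ^ 3 + 34032 / 3689 * m0 * w0.r * s2 * x ^ 3 * y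
      + 454867920 / 33912977 * m0 * w0.r * s3 * x * y ^ 3
      - 454867920 / 33912977 * m0 * w0.r * s3 * x ^ 3 * y
      - 38496 / 9193 * m0 * w0.r * s4 * x * y ^ 3 + 38496 / 9193 * m0 * w0.r * s4 * x ^ 3 * y
      - 20040 * w1.D * x * y ^ 3 + 20040 * w1.D * x ^ 3 * y - 288 * w1.F * x * y ^ 3
      + 288 * w1.F * x ^ 3 * y) * hST

set_option maxHeartbeats 1000000 in
/-- The conservation law of energy at order three. -/
def energyLaw3 (g S T s2 q x y m0 m1 m2 m3 : ℂ) (w0 w1 w2 w3 : Macro) : ℂ :=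
  -2 * T ^ 3 * g ^ 2 * w0.p * q ^ 2 + 3 / 5 * T * w0.X * m0 * q * s2 ^ 2 * x
  + 3 / 5 * T * w0.Y * m0 * q * s2 ^ 2 * y - 1 / 6 * T * g * w0.p * q ^ 2 * s2 ^ 2
  + T * w0.l * m0 ^ 2 * q * s2 ^ 2 + 6 / 5 * T ^ 2 * w0.X * m0 * q * s2 * x
  + 6 / 5 * T ^ 2 * w0.Y * m0 * q * s2 * y - 1 / 3 * T ^ 2 * g * w0.p * q ^ 2 * s2
  - T ^ 2 * g ^ 2 * m0 * q * w1.r - T ^ 2 * g ^ 2 * m1 * q * w0.r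
  + T ^ 2 * w0.l * m0 ^ 2 * q * s2 + T ^ 3 * g * w0.l * q ^ 2
  + 17 / 2 * T ^ 3 * g * w0.p * q ^ 2 + T ^ 3 * w0.l * m0 ^ 2 * q + 8631 * w0.D * T * x ^ 4
  + 27579 / 5 * w0.D * T ^ 2 * q ^ 2 * s2 + 80 * w0.F * T * x ^ 4
  + 1 / 3 * S * w0.X * m0 * x ^ 3 - 1 / 3 * S * w0.Y * m0 * x ^ 2 * y
  - 1 / 12 * S * g ^ 2 * w0.p * q ^ 2 + 1 / 3 * T * w0.X * m0 * x ^ 3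
  - 1 / 3 * T * w0.Y * m0 * x ^ 2 * y - 1 / 6 * T * g * m0 * q * w1.r * s2
  - 1 / 6 * T * g * m1 * q * w0.r * s2 + 11 / 24 * T * g ^ 2 * w0.p * q ^ 2
  + 8 / 5 * T * w0.p * q ^ 2 * s2 ^ 2 + 17 / 6 * T ^ 2 * g * m0 * q * w1.r
  + 17 / 6 * T ^ 2 * g * m1 * q * w0.r + 1 / 6 * T ^ 2 * w0.l * q ^ 2 * s2
  + 373 / 180 * T ^ 2 * w0.p * q ^ 2 * s2 - 17 / 6 * T ^ 3 * w0.l * q ^ 2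
  - 289 / 36 * T ^ 3 * w0.p * q ^ 2 - 8631 * w0.D * T * q * x ^ 2 - 80 * w0.F * T * q * x ^ 2
  - 3 / 10 * S * w0.X * m0 * q * x + 1 / 30 * S * w0.Y * m0 * q * y
  + 53 / 144 * S * g * w0.p * q ^ 2 - 1 / 2 * T * w0.X * m0 * q * x
  + 3 / 5 * T * w1.X * q * s2 * x - 1 / 6 * T * w0.Y * m0 * q * y
  + 3 / 5 * T * w1.Y * q * s2 * y - 1 / 6 * T * g * w0.l * q ^ 2 - T * g * m0 * m1 * w1.r
  - T * g * m0 * m2 * w0.r - T * g * m1 ^ 2 * w0.r - 19 / 12 * T * g * w0.p * q ^ 2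
  - 5 / 12 * T * w0.l * m0 ^ 2 * q + T * w0.l * m1 * q * s2 + T * w1.l * m0 * q * s2
  + 8 / 5 * T * m0 * q * w1.r * s2 + 8 / 5 * T * m1 * q * w0.r * s2 + T ^ 2 * w0.l * m1 * q
  + T ^ 2 * w1.l * m0 * q - 3 / 20 * w0.X * m0 * q * s2 * x - 3 / 20 * w0.Y * m0 * q * s2 * y
  + 1 / 24 * g * w0.p * q ^ 2 * s2 + 1 / 6 * g ^ 2 * m0 * q * w1.r
  + 1 / 6 * g ^ 2 * m1 * q * w0.r - 1 / 4 * w0.l * m0 ^ 2 * q * s2 - 281 / 4 * w0.D * T * q ^ 2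
  + 10 * w0.F * T * q ^ 2 - 2 / 15 * S * w0.p * q ^ 2 + T * w2.div x y * g * m0
  + 23 / 72 * T * w0.l * q ^ 2 + 17 / 6 * T * m0 * m1 * w1.r + 17 / 6 * T * m0 * m2 * w0.r
  + 17 / 6 * T * m1 ^ 2 * w0.r + 247 / 432 * T * w0.p * q ^ 2 - 49 / 144 * g * m0 * q * w1.r
  - 49 / 144 * g * m1 * q * w0.r - 2 / 5 * w0.p * q ^ 2 * s2 - 17 / 6 * T * w2.div x y * m0
  + T * w2.l * q - 1 / 20 * w1.X * q * x - 1 / 20 * w1.Y * q * y - 1 / 4 * w0.l * m1 * q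
  - 1 / 4 * w1.l * m0 * q - 2 / 15 * m0 * q * w1.r - 2 / 15 * m1 * q * w0.r + w3.div x y * g
  + m0 * w3.p + m1 * w2.p + m2 * w1.p + m3 * w0.p

set_option maxHeartbeats 2000000 in
-- Terms carrying `s2` involve `X` and `Y` only through `x X + y Y`. Once this combination is the
-- same in two directions, they cancel in a comparison of those directions.
lemma energyLaw3_eq {t2 t3 v1 v2 v3 : Fin 17 → ℂ}
    (hST : S * T = 1 / 12) (hv1 : v1 = moments g w1 + relaxSigma S T s2 s3 s4 * theta0 g x y m0 w0)
    (hv2 : v2 = moments g w2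
      + relaxSigma S T s2 s3 s4 * theta1 g S T s2 s3 s4 x y m0 m1 w0 w1)
    (hv3 : v3 = moments g w3 + relaxSigma S T s2 s3 s4 * t2)
    (ht2 : ∀ i : Fin 4, t2 (Fin.natAdd 4 (Fin.castLE (by norm_num) i : Fin 13)) =
      theta2 g S T s2 s3 s4 x y m0 m1 m2 w0 w1 w2 i)
    (h3 : t3 = advect x y v3 + m0 • v3 + m1 • v2 + m2 • v1 + m3 • moments g w0
      - (1 / 12 : ℂ) • (advect x y (advect x y (theta1 g S T s2 s3 s4 x y m0 m1 w0 w1)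
          + m0 • theta1 g S T s2 s3 s4 x y m0 m1 w0 w1)
        + m0 • (advect x y (theta1 g S T s2 s3 s4 x y m0 m1 w0 w1)
          + m0 • theta1 g S T s2 s3 s4 x y m0 m1 w0 w1)
        + (2 * m1) • (advect x y (theta0 g x y m0 w0) + m0 • theta0 g x y m0 w0)))
    (h : Row0 g x y m0 w0) (h' : Row1 g S T x y m0 m1 w0 w1)
    {q : ℂ} (hq : x ^ 2 + y ^ 2 = q) :
    1 / 34 * t3 3 + 30 / 17 * t3 0 = energyLaw3 g S T s2 q x y m0 m1 m2 m3 w0 w1 w2 w3 := by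
  subst hq
  have hr0 := h.mass
  have hx0 := h.momX
  have hy0 := h.momY
  have hp0 := h.energy'
  have hm0 := h.mass'
  have hr1 := h'.mass
  have hx1 := h'.momX
  have hy1 := h'.momY
  have hp1 := h'.energy' h
  have hm1 := h'.mass' h
  have e4 := ht2 0
  have e5 := ht2 1
  have e6 := ht2 2
  have e7 := ht2 3
  change t2 4 = theta2_XX g S T s2 s3 s4 x y m0 w0 w1 w2 at e4
  change t2 5 = theta2_XY g S T s2 s3 s4 x y m0 w0 w1 w2 at e5
  change t2 6 = theta2_qx g S T s2 x y m0 m1 m2 w0 w1 w2 at e6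
  change t2 7 = theta2_qy g S T s2 x y m0 m1 m2 w0 w1 w2 at e7
  rw [h3, hv3, hv2, hv1]
  simp only [Pi.add_apply, Pi.sub_apply, Pi.smul_apply, Pi.mul_apply, smul_eq_mul, advect_0,
      advect_1, advect_2, advect_3, advect_4, advect_5, advect_6, advect_7, advect_8, advect_9,
      advect_10, advect_11, advect_12, advect_13, advect_14, advect_15, advect_16, moments_0,
      moments_1, moments_2, moments_3, moments_4, moments_5, moments_6, moments_7, moments_8,
      moments_9, moments_10, moments_11, moments_12, moments_13, moments_14, moments_15, moments_16,
      relaxSigma_0, relaxSigma_1, relaxSigma_2, relaxSigma_3, relaxSigma_4, relaxSigma_5,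
          relaxSigma_6, relaxSigma_7, relaxSigma_8, relaxSigma_9, relaxSigma_10, relaxSigma_11,
          relaxSigma_12, relaxSigma_13, relaxSigma_14, relaxSigma_15, relaxSigma_16, theta0_0,
          theta0_1, theta0_2, theta0_3, theta0_4, theta0_5, theta0_6, theta0_7, theta0_8,
          theta0_9, theta0_10, theta0_11, theta0_12, theta0_13, theta0_14, theta0_15, theta0_16,
          theta1_0, theta1_1, theta1_2, theta1_3, theta1_4, theta1_5, theta1_6, theta1_7,
          theta1_8, theta1_9, theta1_10, theta1_11, theta1_12, theta1_13, theta1_14, theta1_15,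
          theta1_16, e4, e5, e6, e7, theta2_XX, theta2_XY, theta2_qx, theta2_qy]
  simp only [energyLaw3, Macro.div, Macro.curl]
  linear_combination (-(1 / 12 * S * g ^ 2 * x ^ 2) - 1 / 12 * S * g ^ 2 * y ^ 2
      + 1 / 6 * T * g ^ 2 * x ^ 2
      + 1 / 6 * T * g ^ 2 * y ^ 2 + 1 / 4 * S * g * x ^ 2 + 1 / 4 * S * g * y ^ 2
      - 17 / 36 * T * g * x ^ 2 - 17 / 36 * T * g * y ^ 2 + 1 / 36 * g * s2 * x ^ 2
      + 1 / 36 * g * s2 * y ^ 2 - 2 / 15 * S * x ^ 2 - 2 / 15 * S * y ^ 2 - 4 / 15 * s2 * x ^ 2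
      - 4 / 15 * s2 * y ^ 2) * hm0 +
      (1 / 6 * g * x ^ 2 + 1 / 6 * g * y ^ 2 - 221 / 654 * x ^ 2 - 221 / 654 * y ^ 2) * hp1 +
      (-(1 / 72 * S * g * m0 * y ^ 2) + 2 / 15 * S * m0 * y ^ 2 + T * g * m2
      - 1 / 6 * g * m0 * m1 - 17 / 6 * T * m2 + 17 / 36 * m0 * m1) * hr0 +
      (T * g * m1 - 1 / 6 * g * m0 ^ 2 - 1 / 218 * g * x ^ 2 + 37 / 15696 * g * y ^ 2
      - 17 / 6 * T * m1 + 17 / 36 * m0 ^ 2 - 121 / 3270 * x ^ 2 - 113 / 1090 * y ^ 2) * hr1 +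
      (1 / 6 * g * m0 - 17 / 36 * m0) * hm1 +
      (-(1 / 6 * S * g * w0.p * x ^ 2 * y ^ 2) - 1 / 12 * S * g * w0.p * x ^ 4
      - 1 / 12 * S * g * w0.p * y ^ 4 + 9 / 5 * S * w0.X * m0 * x * y ^ 2
      - 1 / 5 * S * w0.X * m0 * x ^ 3 + 9 / 5 * S * w0.Y * m0 * x ^ 2 * y
      - 1 / 5 * S * w0.Y * m0 * y ^ 3 + 8 / 5 * S * w0.p * x ^ 2 * y ^ 2
      + 4 / 5 * S * w0.p * x ^ 4 + 4 / 5 * S * w0.p * y ^ 4 + 1 / 12 * g * w1.jx * x * y ^ 2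
      + 1 / 12 * g * w1.jy * y ^ 3 - 1 / 12 * g * m0 * w1.r * x ^ 2
      - 1 / 12 * g * m1 * w0.r * x ^ 2 + 9 / 5 * w1.X * x * y ^ 2 - 1 / 5 * w1.X * x ^ 3
      + 9 / 5 * w1.Y * x ^ 2 * y - 1 / 5 * w1.Y * y ^ 3 - 4 / 5 * w1.jx * x * y ^ 2
      - 4 / 5 * w1.jy * y ^ 3 + 4 / 5 * m0 * w1.r * x ^ 2 + 4 / 5 * m1 * w0.r * x ^ 2) * hST

/-! ### Equivalence between expansions and conservation laws. -/

/-- The conservation laws at order two. -/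
structure Row2 (g S T s2 q x y m0 m1 m2 : ℂ) (w0 w1 w2 : Macro) : Prop where
  mass : massLaw2 g q x y m0 m1 m2 w0 w1 w2 = 0
  div : divLaw2 g S q x y m0 m1 m2 w0 w1 w2 = 0
  curl : curlLaw2 g S q x y m0 m1 m2 w0 w1 w2 = 0
  energy : energyLaw2 g T s2 q x y m0 m1 m2 w0 w1 w2 = 0

/-- The conservation laws at order three. -/
structure Row3 (g S T s2 q x y m0 m1 m2 m3 : ℂ) (w0 w1 w2 w3 : Macro) : Prop where
  mass : massLaw3 g S T q x y m0 m1 m2 m3 w0 w1 w2 w3 = 0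
  div : divLaw3 g S T s2 q x y m0 m1 m2 m3 w0 w1 w2 w3 = 0
  curl : curlLaw3 g S T q x y m0 m1 m2 m3 w0 w1 w2 w3 = 0
  energy : energyLaw3 g S T s2 q x y m0 m1 m2 m3 w0 w1 w2 w3 = 0

/-- The equilibrium `Q` in terms of the macroscopic fields. -/
structure IsClosure (g : ℂ) (Q : Matrix (Fin 17) (Fin 4) ℂ) (C : ℂ → ℂ → ℂ → ℂ → Macro) :
    Prop where
  r : ∀ r jx jy p, (C r jx jy p).r = r
  jx : ∀ r jx jy p, (C r jx jy p).jx = jx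
  jy : ∀ r jx jy p, (C r jx jy p).jy = jy
  p : ∀ r jx jy p, (C r jx jy p).p = p
  eq : ∀ r jx jy p, ∀ k : Fin 17, 4 ≤ (k : ℕ) →
    Q k 0 * r + Q k 1 * jx + Q k 2 * jy + Q k 3 * (34 * p - 60 * r) = moments g (C r jx jy p) k

/-- The macroscopic fields of a moment vector. -/
def macroOf (C : ℂ → ℂ → ℂ → ℂ → Macro) (v : Fin 17 → ℂ) : Macro :=
  C (v 0) (v 1) (v 2) ((v 3 + 60 * v 0) / 34)

variable {g S T s2 s3 s4 x y q : ℂ} {Q : Matrix (Fin 17) (Fin 4) ℂ}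
  {C : ℂ → ℂ → ℂ → ℂ → Macro} {sig : Fin 17 → ℂ} {m : Fin 4 → ℂ} {psi theta : Fin 4 → Fin 17 → ℂ}

lemma IsClosure.moments_macroOf (hC : IsClosure g Q C) (v : Fin 17 → ℂ) (a : Fin 4) :
    moments g (macroOf C v) (consIdx a) = v (consIdx a) := by
  fin_cases a
  · exact hC.r ..
  · exact hC.jx ..
  · exact hC.jy ..
  · change 34 * (macroOf C v).p - 60 * (macroOf C v).r = v 3
    rw [macroOf, hC.p, hC.r]
    ring

lemma IsClosure.equilibrium_eq (hC : IsClosure g Q C) (v : Fin 17 → ℂ) (k : Fin 17)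
    (hk : 4 ≤ (k : ℕ)) : equilibrium Q v k = moments g (macroOf C v) k := by
  rw [macroOf, ← hC.eq _ _ _ _ k hk, equilibrium]
  ring

lemma relaxSigma_consIdx (a : Fin 4) : relaxSigma S T s2 s3 s4 (consIdx a) = 0 := by
  fin_cases a <;> rfl

lemma IsExpansion.psi_zero_eq_moments (hC : IsClosure g Q C)
    (h : IsExpansion x y sig Q m psi theta) : psi 0 = moments g (macroOf C (psi 0)) := by
  funext k
  rcases consIdx_or k with ⟨a, rfl⟩ | hk
  · exact (hC.moments_macroOf _ a).symm
  · rw [h.relax0 k hk, hC.equilibrium_eq _ k hk]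

lemma IsExpansion.psi_succ_eq_moments (hC : IsClosure g Q C)
    (hsig : ∀ k : Fin 17, 4 ≤ (k : ℕ) → sig k = relaxSigma S T s2 s3 s4 k)
    (h : IsExpansion x y sig Q m psi theta) (n : Fin 3) :
    psi n.succ = moments g (macroOf C (psi n.succ))
      + relaxSigma S T s2 s3 s4 * theta n.castSucc := by
  funext k
  rw [Pi.add_apply, Pi.mul_apply]
  rcases consIdx_or k with ⟨a, rfl⟩ | hk
  · rw [hC.moments_macroOf, relaxSigma_consIdx, zero_mul, add_zero]
  · rw [h.relax n k hk, hC.equilibrium_eq _ k hk, hsig k hk]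

/-- The conservation laws that the macroscopic fields of an expansion satisfy. -/
structure Rows (g S T s2 q x y : ℂ) (m : Fin 4 → ℂ) (w : Fin 4 → Macro) : Prop where
  row0 : Row0 g x y (m 0) (w 0)
  row1 : Row1 g S T x y (m 0) (m 1) (w 0) (w 1)
  row2 : Row2 g S T s2 q x y (m 0) (m 1) (m 2) (w 0) (w 1) (w 2)
  row3 : Row3 g S T s2 q x y (m 0) (m 1) (m 2) (m 3) (w 0) (w 1) (w 2) (w 3)

/-- The elimination proceeds by order: the laws of one order put its increments in closed form, and
relaxation then expresses the next half-sum through macroscopic fields. -/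
lemma IsExpansion.rows (hC : IsClosure g Q C) (hST : S * T = 1 / 12)
    (hsig : ∀ k : Fin 17, 4 ≤ (k : ℕ) → sig k = relaxSigma S T s2 s3 s4 k)
    (hq : x ^ 2 + y ^ 2 = q) (h : IsExpansion x y sig Q m psi theta) :
    Rows g S T s2 q x y m (fun n => macroOf C (psi n)) := by
  have p0 := h.psi_zero_eq_moments hC
  have p1 := h.psi_succ_eq_moments hC hsig 0
  have p2 := h.psi_succ_eq_moments hC hsig 1
  have p3 := h.psi_succ_eq_moments hC hsig 2
  have t0 := h.theta0
  rw [p0] at t0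
  have r0 := (row0_iff t0).1 (h.conserved 0)
  have e0 := theta0_eq t0 r0
  change psi 1 = moments g (macroOf C (psi 1)) + relaxSigma S T s2 s3 s4 * theta 0 at p1
  rw [e0] at p1
  have t1 := h.theta1
  rw [p0] at t1
  have r1 := (row1_iff p1 t1 r0).1 (h.conserved 1)
  have e1 := theta1_eq p1 t1 r0 r1
  change psi 2 = moments g (macroOf C (psi 2)) + relaxSigma S T s2 s3 s4 * theta 1 at p2
  rw [e1] at p2
  have t2 := h.theta2
  rw [p0, e0] at t2
  change psi 3 = moments g (macroOf C (psi 3)) + relaxSigma S T s2 s3 s4 * theta 2 at p3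
  have t3 := h.theta3
  rw [p0, e0, e1] at t3
  have c0 : theta 2 0 = 0 := h.conserved 2 0
  have c1 : theta 2 1 = 0 := h.conserved 2 1
  have c2 : theta 2 2 = 0 := h.conserved 2 2
  have c3 : theta 2 3 = 0 := h.conserved 2 3
  have d0 : theta 3 0 = 0 := h.conserved 3 0
  have d1 : theta 3 1 = 0 := h.conserved 3 1
  have d2 : theta 3 2 = 0 := h.conserved 3 2
  have d3 : theta 3 3 = 0 := h.conserved 3 3
  have e2 := theta2_eq hST p1 p2 t2 r0 r1
  refine ⟨r0, r1, ⟨?_, ?_, ?_, ?_⟩, ⟨?_, ?_, ?_, ?_⟩⟩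
  · rw [← massLaw2_eq p1 p2 t2 r0 r1 hq, c0]
  · rw [← divLaw2_eq hST p1 p2 t2 r0 r1 hq, c1, c2]; ring
  · rw [← curlLaw2_eq hST p1 p2 t2 r0 r1 hq, c1, c2]; ring
  · rw [← energyLaw2_eq hST p1 p2 t2 r0 r1 hq, c0, c3]; ring
  · rw [← massLaw3_eq p1 p2 p3 e2 t3 r0 r1 hq, d0]
  · rw [← divLaw3_eq hST p1 p2 p3 e2 t3 r0 r1 hq, d1, d2]; ring
  · rw [← curlLaw3_eq hST p1 p2 p3 e2 t3 r0 r1 hq, d1, d2]; ring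
  · rw [← energyLaw3_eq hST p1 p2 p3 e2 t3 r0 r1 hq, d0, d3]; ring

/-- Divergence and curl recover both components of a vector because the determinant of that system
is `q`. -/
lemma forall_consIdx_of_laws {t : Fin 17 → ℂ} (hq : x ^ 2 + y ^ 2 = q) (hq0 : q ≠ 0)
    (h0 : t 0 = 0) (h1 : x * t 1 + y * t 2 = 0) (h2 : x * t 2 - y * t 1 = 0)
    (h3 : 1 / 34 * t 3 + 30 / 17 * t 0 = 0) (a : Fin 4) : t (consIdx a) = 0 := by
  have z1 : t 1 = 0 := by
    refine (mul_eq_zero.1 (?_ : q * t 1 = 0)).resolve_left hq0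
    linear_combination x * h1 - y * h2 - t 1 * hq
  have z2 : t 2 = 0 := by
    refine (mul_eq_zero.1 (?_ : q * t 2 = 0)).resolve_left hq0
    linear_combination y * h1 + x * h2 - t 2 * hq
  have z3 : t 3 = 0 := by linear_combination 34 * h3 - 60 * h0
  fin_cases a
  exacts [h0, z1, z2, z3]

/-- Half-sums are defined as equilibrium plus `σ` times the preceding increment. The recursion and
the relaxation then hold by construction, and the laws say exactly that the increments have no
conserved part. -/
lemma Rows.exists_isExpansion (hC : IsClosure g Q C) (hST : S * T = 1 / 12)
    (hsig : ∀ k : Fin 17, 4 ≤ (k : ℕ) → sig k = relaxSigma S T s2 s3 s4 k)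
    (hq : x ^ 2 + y ^ 2 = q) (hq0 : q ≠ 0) {w : Fin 4 → Macro}
    (hw : ∀ n, w n = C (w n).r (w n).jx (w n).jy (w n).p) (h : Rows g S T s2 q x y m w) :
    ∃ psi theta : Fin 4 → Fin 17 → ℂ, IsExpansion x y sig Q m psi theta ∧
      psi 0 = moments g (w 0) := by
  have p1 : moments g (w 1) + relaxSigma S T s2 s3 s4 * theta0 g x y (m 0) (w 0)
    = moments g (w 1) + relaxSigma S T s2 s3 s4 * theta0 g x y (m 0) (w 0) := rfl
  have p2 : moments g (w 2) + relaxSigma S T s2 s3 s4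
      * theta1 g S T s2 s3 s4 x y (m 0) (m 1) (w 0) (w 1)
    = moments g (w 2) + relaxSigma S T s2 s3 s4
      * theta1 g S T s2 s3 s4 x y (m 0) (m 1) (w 0) (w 1) := rfl
  have e0 := theta0_eq rfl h.row0
  have e1 := theta1_eq p1 rfl h.row0 h.row1
  set v1 := moments g (w 1) + relaxSigma S T s2 s3 s4 * theta0 g x y (m 0) (w 0) with hv1
  set v2 := moments g (w 2) + relaxSigma S T s2 s3 s4
      * theta1 g S T s2 s3 s4 x y (m 0) (m 1) (w 0) (w 1) with hv2
  obtain ⟨t2, ht2⟩ : ∃ t2, t2 = advect x y v2 + m 0 • v2 + m 1 • v1 + m 2 • moments g (w 0)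
      - (1 / 12 : ℂ) • (advect x y (advect x y (theta0 g x y (m 0) (w 0))
          + m 0 • theta0 g x y (m 0) (w 0))
        + m 0 • (advect x y (theta0 g x y (m 0) (w 0)) + m 0 • theta0 g x y (m 0) (w 0))) :=
    ⟨_, rfl⟩
  obtain ⟨v3, hv3⟩ : ∃ v3, v3 = moments g (w 3) + relaxSigma S T s2 s3 s4 * t2 := ⟨_, rfl⟩
  obtain ⟨t3, ht3⟩ : ∃ t3, t3 = advect x y v3 + m 0 • v3 + m 1 • v2 + m 2 • v1
      + m 3 • moments g (w 0)
      - (1 / 12 : ℂ) • (advect x y (advect x y (theta1 g S T s2 s3 s4 x y (m 0) (m 1) (w 0) (w 1))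
          + m 0 • theta1 g S T s2 s3 s4 x y (m 0) (m 1) (w 0) (w 1))
        + m 0 • (advect x y (theta1 g S T s2 s3 s4 x y (m 0) (m 1) (w 0) (w 1))
          + m 0 • theta1 g S T s2 s3 s4 x y (m 0) (m 1) (w 0) (w 1))
        + (2 * m 1) • (advect x y (theta0 g x y (m 0) (w 0))
          + m 0 • theta0 g x y (m 0) (w 0))) := ⟨_, rfl⟩
  have e2 := theta2_eq hST hv1 hv2 ht2 h.row0 h.row1
  have c0 : ∀ a, theta0 g x y (m 0) (w 0) (consIdx a) = 0 := fun a => by fin_cases a <;> rfl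
  have c1 : ∀ a, theta1 g S T s2 s3 s4 x y (m 0) (m 1) (w 0) (w 1) (consIdx a) = 0 :=
    fun a => by fin_cases a <;> rfl
  have c2 : ∀ a, t2 (consIdx a) = 0 := forall_consIdx_of_laws hq hq0
    ((massLaw2_eq hv1 hv2 ht2 h.row0 h.row1 hq).trans h.row2.mass)
    ((divLaw2_eq hST hv1 hv2 ht2 h.row0 h.row1 hq).trans h.row2.div)
    ((curlLaw2_eq hST hv1 hv2 ht2 h.row0 h.row1 hq).trans h.row2.curl)
    ((energyLaw2_eq hST hv1 hv2 ht2 h.row0 h.row1 hq).trans h.row2.energy)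
  have c3 : ∀ a, t3 (consIdx a) = 0 := forall_consIdx_of_laws hq hq0
    ((massLaw3_eq hv1 hv2 hv3 e2 ht3 h.row0 h.row1 hq).trans h.row3.mass)
    ((divLaw3_eq hST hv1 hv2 hv3 e2 ht3 h.row0 h.row1 hq).trans h.row3.div)
    ((curlLaw3_eq hST hv1 hv2 hv3 e2 ht3 h.row0 h.row1 hq).trans h.row3.curl)
    ((energyLaw3_eq hST hv1 hv2 hv3 e2 ht3 h.row0 h.row1 hq).trans h.row3.energy)
  -- Adding `σ θ` does not change the conserved moments, so the equilibrium part is still `moments g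
  -- (w n)`.
  have heq : ∀ n, ∀ v : Fin 17 → ℂ, (∀ a, v (consIdx a) = moments g (w n) (consIdx a)) →
      ∀ k : Fin 17, 4 ≤ (k : ℕ) → equilibrium Q v k = moments g (w n) k := by
    intro n v hv k hk
    have v0 : v 0 = (w n).r := hv 0
    have v1 : v 1 = (w n).jx := hv 1
    have v2 : v 2 = (w n).jy := hv 2
    have v3 : v 3 = 34 * (w n).p - 60 * (w n).r := hv 3
    rw [hC.equilibrium_eq v k hk, hw n, macroOf, v0, v1, v2, v3]
    congr 2
    ring
  have hcons : ∀ n, ∀ t : Fin 17 → ℂ, ∀ a,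
      (moments g (w n) + relaxSigma S T s2 s3 s4 * t) (consIdx a)
          = moments g (w n) (consIdx a) := by
    intro n t a
    rw [Pi.add_apply, Pi.mul_apply, relaxSigma_consIdx, zero_mul, add_zero]
  refine ⟨![moments g (w 0), v1, v2, v3],
    ![theta0 g x y (m 0) (w 0), theta1 g S T s2 s3 s4 x y (m 0) (m 1) (w 0) (w 1), t2, t3],
    ⟨e0.symm, e1.symm, ht2, ht3, ?_, ?_, ?_⟩, rfl⟩
  · intro n a
    fin_cases n
    exacts [c0 a, c1 a, c2 a, c3 a]
  · exact fun k hk => (heq 0 _ (fun _ => rfl) k hk).symm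
  · intro n k hk
    rw [hsig k hk]
    fin_cases n
    · exact congrArg (· + _) (heq 1 _ (hcons 1 _) k hk).symm
    · exact congrArg (· + _) (heq 2 _ (hcons 2 _) k hk).symm
    · change v3 k = equilibrium Q v3 k + _
      rw [heq 3 v3 (by rw [hv3]; exact hcons 3 _) k hk, hv3]
      rfl

/-! ### The equilibria as closures of the macroscopic fields. -/

/-- The coefficients of the isotropic equilibria of the moments `q, r, τ, XX_e, XY_e`. -/
def TensorCoeffs.isotropic (lam c0 : ℝ) : TensorCoeffs where
  qx0 := 0
  qxx := c1 lam c0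
  qxy := 0
  qxE := 0
  qy0 := 0
  qyy := c1 lam c0
  qyE := 0
  cx0 := 0
  cxx := (31 - 21 * (c0 ^ 2 / lam ^ 2)) / 6
  cxy := 0
  cxE := 0
  cy0 := 0
  cyx := 0
  cyy := (31 - 21 * (c0 ^ 2 / lam ^ 2)) / 6
  cyE := 0
  xix := 0
  xiy := 0

/-- The offset `249 c₀²/λ² - 442` in the equilibrium of `τ` is such that the diagonal coefficient
giving `c₂` for `r` gives `c₃` for `τ`. -/
lemma isotropicEquilibrium_eq {lam : ℝ} (hlam : 0 < lam) (c0 : ℝ) (a : ScalarCoeffs) :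
    isotropicEquilibrium lam c0 a = generalEquilibrium lam c0 a (.isotropic lam c0) := by
  have h : lam ≠ 0 := hlam.ne'
  ext k b
  revert k
  apply forall_fin17 <;> fin_cases b <;>
    simp [isotropicEquilibrium, generalEquilibrium, TensorCoeffs.isotropic, c2, c3] <;>
    field_simp <;> ring

/-- The deviation of `alpha3` from its isotropic value. -/
def ScalarCoeffs.dev3r (a : ScalarCoeffs) : ℝ := a.alpha3 + 5 / 436 * (2696442 + 7519 * a.alpha2)

/-- The deviation of `beta3` from its isotropic value. -/
def ScalarCoeffs.dev3E (a : ScalarCoeffs) : ℝ := a.beta3 + 1 / 2616 * (2949247 + 225570 * a.beta2)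

/-- The deviation of `alpha4` from its isotropic value. -/
def ScalarCoeffs.dev4r (a : ScalarCoeffs) : ℝ :=
  a.alpha4 - 1 / 177888 * (69687842 + 139145 * a.alpha2)

/-- The deviation of `beta4` from its isotropic value. -/
def ScalarCoeffs.dev4E (a : ScalarCoeffs) : ℝ := a.beta4 - 5 / 355776 * (940101 + 55658 * a.beta2)

lemma alphaRelations_iff (a : ScalarCoeffs) :
    AlphaRelations a ↔ a.dev3r = 0 ∧ a.dev3E = 0 ∧ a.dev4r = 0 ∧ a.dev4E = 0 := by
  simp only [AlphaRelations, ScalarCoeffs.dev3r, ScalarCoeffs.dev3E, ScalarCoeffs.dev4r,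
    ScalarCoeffs.dev4E]
  constructor <;> rintro ⟨h1, h2, h3, h4⟩ <;> refine ⟨?_, ?_, ?_, ?_⟩ <;> linarith

/-- The coefficient of `ρ` in the macroscopic field `l`. -/
def ScalarCoeffs.lr (a : ScalarCoeffs) : ℝ := (a.alpha2 - 60 * a.beta2 - 620) / 218

/-- The coefficient of `p` in the macroscopic field `l`. -/
def ScalarCoeffs.lp (a : ScalarCoeffs) : ℝ := (1054 + 102 * a.beta2) / 654

/-- The macroscopic fields as functions of the conserved moments. -/
def closure (g : ℝ) (a : ScalarCoeffs) (v : TensorCoeffs) (r jx jy p : ℂ) : Macro where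
  r := r
  jx := jx
  jy := jy
  p := p
  l := a.lr * r + a.lp * p
  D := (a.dev3r * r + a.dev3E * (34 * p - 60 * r)) / 33912977
  F := (a.dev4r * r + a.dev4E * (34 * p - 60 * r)) / 9193
  X := v.cx0 * r + (v.cxx - (31 - 21 * g) / 6) * jx + v.cxy * jy + v.cxE * (34 * p - 60 * r)
  Y := v.cy0 * r + v.cyx * jx + (v.cyy - (31 - 21 * g) / 6) * jy + v.cyE * (34 * p - 60 * r)

/-- Once `q`, `XX_e` and `XY_e` have their isotropic equilibria, all remaining freedom is carried by
`l`, `D`, `F`, `X`, `Y`. The tie between `τ` and `r` is what allows one pair `X, Y` to serve both.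
-/
lemma isClosure_closure {lam : ℝ} (hlam : 0 < lam) (c0 : ℝ) (a : ScalarCoeffs) (v : TensorCoeffs)
    (hx0 : v.qx0 = 0) (hxx : v.qxx = c1 lam c0) (hxy : v.qxy = 0) (hxE : v.qxE = 0)
    (hy0 : v.qy0 = 0) (hyy : v.qyy = c1 lam c0) (hyE : v.qyE = 0) (hxi : v.xix = 0)
    (hxj : v.xiy = 0) :
    IsClosure ((c0 ^ 2 / lam ^ 2 : ℝ) : ℂ) (scaledEquilibrium lam (generalEquilibrium lam c0 a v))
      (closure (c0 ^ 2 / lam ^ 2) a v) := by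
  have h : (lam : ℂ) ≠ 0 := by exact_mod_cast hlam.ne'
  refine ⟨fun _ _ _ _ => rfl, fun _ _ _ _ => rfl, fun _ _ _ _ => rfl, fun _ _ _ _ => rfl, ?_⟩
  intro r jx jy p k
  revert k
  apply forall_fin17 <;> intro hk <;> first
    | (exfalso; revert hk; decide)
    | (simp only [moments_4, moments_5, moments_6, moments_7, moments_8, moments_9, moments_10,
        moments_11, moments_12, moments_13, moments_14, moments_15, moments_16]
       simp [scaledEquilibrium, generalEquilibrium, momentDegree, consIdx, closure, hx0, hxx, hxy,
        hxE, hy0, hyy, hyE, hxi, hxj, c1, ScalarCoeffs.lr, ScalarCoeffs.lp, ScalarCoeffs.dev3r,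
        ScalarCoeffs.dev3E, ScalarCoeffs.dev4r, ScalarCoeffs.dev4E]
       try field_simp
       try ring)

section

variable {g S T s2 q x y m0 m1 : ℂ} {w0 w1 : Macro}

lemma Row0.div_law (hq : x ^ 2 + y ^ 2 = q) (h : Row0 g x y m0 w0) :
    m0 * w0.div x y + q * w0.p = 0 := by
  simp only [Macro.div]
  linear_combination x * h.momX + y * h.momY - w0.p * hq

lemma Row0.curl_law (h : Row0 g x y m0 w0) : m0 * w0.curl x y = 0 := by
  simp only [Macro.curl]
  linear_combination x * h.momY - y * h.momX

lemma Row0.mass_law (h : Row0 g x y m0 w0) : m0 * w0.r + w0.div x y = 0 := by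
  simp only [Macro.div]
  linear_combination h.mass

lemma Row1.mass_law (h : Row1 g S T x y m0 m1 w0 w1) :
    m0 * w1.r + m1 * w0.r + w1.div x y = 0 := by
  simp only [Macro.div]
  linear_combination h.mass

lemma Row1.div_law (hq : x ^ 2 + y ^ 2 = q) (h : Row1 g S T x y m0 m1 w0 w1) :
    m0 * w1.div x y + m1 * w0.div x y + 1 / 2 * S * g * q * w0.div x y + q * w1.p = 0 := by
  subst hq
  simp only [Macro.div]
  linear_combination x * h.momX + y * h.momY

lemma Row1.curl_law (hq : x ^ 2 + y ^ 2 = q) (h : Row1 g S T x y m0 m1 w0 w1) :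
    m0 * w1.curl x y + m1 * w0.curl x y + 1 / 2 * S * g * q * w0.curl x y = 0 := by
  subst hq
  simp only [Macro.curl]
  linear_combination x * h.momY - y * h.momX

lemma Row1.energy_law (hq : x ^ 2 + y ^ 2 = q) (h : Row1 g S T x y m0 m1 w0 w1) :
    g * w1.div x y + m0 * w1.p + m1 * w0.p + T * q * (w0.l + (17 / 6 - g) * w0.p) = 0 := by
  subst hq
  exact h.energy

lemma eq_zero_of_div_curl {u v : ℂ} (hq : x ^ 2 + y ^ 2 = q) (hq0 : q ≠ 0)
    (h1 : x * u + y * v = 0) (h2 : x * v - y * u = 0) : u = 0 ∧ v = 0 := by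
  constructor
  · refine (mul_eq_zero.1 (?_ : q * u = 0)).resolve_left hq0
    linear_combination x * h1 - y * h2 - u * hq
  · refine (mul_eq_zero.1 (?_ : q * v = 0)).resolve_left hq0
    linear_combination y * h1 + x * h2 - v * hq

lemma Row0.of_laws (hq : x ^ 2 + y ^ 2 = q) (hq0 : q ≠ 0) (hm : m0 * w0.r + w0.div x y = 0)
    (hd : m0 * w0.div x y + q * w0.p = 0) (hc : m0 * w0.curl x y = 0)
    (he : g * w0.div x y + m0 * w0.p = 0) : Row0 g x y m0 w0 := by
  simp only [Macro.div, Macro.curl] at *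
  obtain ⟨h1, h2⟩ := eq_zero_of_div_curl (u := m0 * w0.jx + x * w0.p)
    (v := m0 * w0.jy + y * w0.p) hq hq0 (by linear_combination hd + w0.p * hq)
    (by linear_combination hc)
  exact ⟨by linear_combination hm, h1, h2, he⟩

lemma Row1.of_laws (hq : x ^ 2 + y ^ 2 = q) (hq0 : q ≠ 0)
    (hm : m0 * w1.r + m1 * w0.r + w1.div x y = 0)
    (hd : m0 * w1.div x y + m1 * w0.div x y + 1 / 2 * S * g * q * w0.div x y + q * w1.p = 0)
    (hc : m0 * w1.curl x y + m1 * w0.curl x y + 1 / 2 * S * g * q * w0.curl x y = 0)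
    (he : g * w1.div x y + m0 * w1.p + m1 * w0.p + T * q * (w0.l + (17 / 6 - g) * w0.p) = 0) :
    Row1 g S T x y m0 m1 w0 w1 := by
  subst hq
  simp only [Macro.div, Macro.curl] at *
  obtain ⟨h1, h2⟩ := eq_zero_of_div_curl
    (u := m0 * w1.jx + m1 * w0.jx + 1 / 2 * S * g * (x ^ 2 + y ^ 2) * w0.jx + x * w1.p)
    (v := m0 * w1.jy + m1 * w0.jy + 1 / 2 * S * g * (x ^ 2 + y ^ 2) * w0.jy + y * w1.p) rfl hq0
    (by linear_combination hd) (by linear_combination hc)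
  exact ⟨by linear_combination hm, h1, h2, he⟩

end

/-! ### Sufficiency: construction of the four modes. -/

/-- The macroscopic fields with the given density, divergence and curl of the momentum, and
pressure, in an isotropic scheme. -/
def waveFields (A B q x y r d c p : ℂ) : Macro where
  r := r
  jx := (x * d - y * c) / q
  jy := (y * d + x * c) / q
  p := p
  l := A * r + B * p
  D := 0
  F := 0
  X := 0
  Y := 0

variable {A B g S T s2 q x y r d c p : ℂ}

lemma waveFields_div (hq : x ^ 2 + y ^ 2 = q) (hq0 : q ≠ 0) :
    (waveFields A B q x y r d c p).div x y = d := by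
  simp only [Macro.div, waveFields]
  field_simp
  linear_combination d * hq

lemma waveFields_curl (hq : x ^ 2 + y ^ 2 = q) (hq0 : q ≠ 0) :
    (waveFields A B q x y r d c p).curl x y = c := by
  simp only [Macro.curl, waveFields]
  field_simp
  linear_combination c * hq

lemma waveFields_r : (waveFields A B q x y r d c p).r = r := rfl
lemma waveFields_p : (waveFields A B q x y r d c p).p = p := rfl
lemma waveFields_l : (waveFields A B q x y r d c p).l = A * r + B * p := rfl
lemma waveFields_D : (waveFields A B q x y r d c p).D = 0 := rfl
lemma waveFields_F : (waveFields A B q x y r d c p).F = 0 := rfl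
lemma waveFields_X : (waveFields A B q x y r d c p).X = 0 := rfl
lemma waveFields_Y : (waveFields A B q x y r d c p).Y = 0 := rfl

/-- A pure curl, constant in the time step, satisfies every law but those of the curl. These fix
`m1` and `m3`, and at order two give a zero correction. -/
lemma exists_shear (g S T s2 A B : ℂ) (hq0 : q ≠ 0) : ∃ m1 m3 : ℂ, ∀ x y : ℂ, x ^ 2 + y ^ 2 = q →
    Rows g S T s2 q x y ![0, m1, 0, m3] ![waveFields A B q x y 0 0 1 0,
      waveFields A B q x y 0 0 0 0, waveFields A B q x y 0 0 0 0,
          waveFields A B q x y 0 0 0 0] := by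
  refine ⟨-(1 / 2 * S * g * q), -(-(1 / 4) * S ^ 3 * g ^ 2 * q ^ 2 + 1 / 24 * S * g ^ 2 * q ^ 2
    - 1 / 8 * S * g * q ^ 2 + 1 / 15 * S * q ^ 2), fun x y hq => ⟨?_, ?_, ?_, ?_⟩⟩
  · apply Row0.of_laws hq hq0 <;> simp [waveFields_div hq hq0, waveFields_curl hq hq0, waveFields_r,
      waveFields_p]
  · apply Row1.of_laws hq hq0 <;> simp [waveFields_div hq hq0, waveFields_curl hq hq0, waveFields_r,
      waveFields_p, waveFields_l]
  · constructor <;> simp [waveFields_div hq hq0, waveFields_curl hq hq0, waveFields_r, waveFields_p,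
      waveFields_l, waveFields_X, waveFields_Y, massLaw2, divLaw2, curlLaw2, energyLaw2]
  · constructor <;> simp [waveFields_div hq hq0, waveFields_curl hq hq0, waveFields_r, waveFields_p,
      waveFields_l, waveFields_X, waveFields_Y, waveFields_D, waveFields_F, massLaw3, divLaw3,
      curlLaw3, energyLaw3]

/-- With the density normalized to one, the system is triangular: energy and mass give `m1`, the
divergence law of order two gives the pressure `p2`, the energy law of order three gives `d3`, and
the mass law gives `m3`. -/
lemma exists_thermal (S T s2 A B : ℂ) (hg : g ≠ 0) (hq0 : q ≠ 0) :
    ∃ m1 m3 p2 d3 : ℂ, ∀ x y : ℂ, x ^ 2 + y ^ 2 = q →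
      Rows g S T s2 q x y ![0, m1, 0, m3] ![waveFields A B q x y 1 0 0 0,
        waveFields A B q x y 0 (-m1) 0 0, waveFields A B q x y 0 0 0 p2,
        waveFields A B q x y 0 d3 0 0] := by
  obtain ⟨m1, hm1⟩ : ∃ m1, -(g * m1) + T * q * A = 0 := ⟨T * q * A / g, by field_simp; ring⟩
  -- The direction `(1, 0)` and the normalization `1` in the fields are placeholders. With vanishing
  -- deviations the law sees the fields only through `r`, the divergence and `p`, so the value found
  -- here serves every direction, while `q` keeps its actual value.
  obtain ⟨p2, hp2⟩ : ∃ p2, divLaw2 g S q 1 0 0 m1 0 (waveFields A B 1 1 0 1 0 0 0)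
      (waveFields A B 1 1 0 0 (-m1) 0 0) (waveFields A B 1 1 0 0 0 0 p2) = 0 := by
    refine ⟨(1 / 2 * S * g * m1 * q + 1 / 12 * A * q ^ 2 + m1 ^ 2) / q, ?_⟩
    simp [divLaw2, waveFields, Macro.div]
    field_simp
    ring_nf
  obtain ⟨K, hK⟩ : ∃ K, K = energyLaw3 g S T s2 q 1 0 0 m1 0 0 (waveFields A B 1 1 0 1 0 0 0)
    (waveFields A B 1 1 0 0 (-m1) 0 0) (waveFields A B 1 1 0 0 0 0 p2)
    (waveFields A B 1 1 0 0 0 0 0) := ⟨_, rfl⟩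
  obtain ⟨d3, hd3⟩ : ∃ d3, K + g * d3 = 0 := ⟨-K / g, by field_simp; ring⟩
  refine ⟨m1, 1 / 24 * T * A * q ^ 2 - 1 / 24 * g * m1 * q - d3, p2, d3, fun x y hq => ⟨?_, ?_,
      ?_, ?_⟩⟩
  · apply Row0.of_laws hq hq0 <;> simp [waveFields_div hq hq0, waveFields_curl hq hq0, waveFields_r,
      waveFields_p]
  · apply Row1.of_laws hq hq0 <;> simp [waveFields_div hq hq0, waveFields_curl hq hq0, waveFields_r,
      waveFields_p, waveFields_l, hm1]
  · constructor <;> simp [waveFields_div hq hq0, waveFields_curl hq hq0, waveFields_r, waveFields_p,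
      waveFields_l, waveFields_X, waveFields_Y, massLaw2, curlLaw2, energyLaw2]
    simp [divLaw2, waveFields_r, waveFields_p, waveFields_l, waveFields_div] at hp2 ⊢
    linear_combination hp2
  · constructor <;> simp [waveFields_div hq hq0, waveFields_curl hq hq0, waveFields_r, waveFields_p,
      waveFields_l, waveFields_X, waveFields_Y, waveFields_D, waveFields_F, massLaw3, divLaw3,
      curlLaw3]
    · ring
    · simp [energyLaw3, waveFields, Macro.div] at hK
      rw [hK] at hd3
      simp [energyLaw3, waveFields_div hq hq0, waveFields_r, waveFields_p, waveFields_l,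
        waveFields_X, waveFields_Y, waveFields_D, waveFields_F]
      linear_combination hd3

/-- The divergence law contains the difference and the energy law the sum of two unknowns, a
correction of the divergence and one of the decay rate; the system has determinant `2 h g`. -/
lemma exists_pair {h g : ℂ} (hh : h ≠ 0) (hg : g ≠ 0) (U V : ℂ) :
    ∃ a b : ℂ, U + h * (a - b) = 0 ∧ V + g * (a + b) = 0 :=
  ⟨(-(U / h) - V / g) / 2, (U / h - V / g) / 2, by field_simp; ring, by field_simp; ring⟩

variable {g S T s2 q : ℂ}

set_option maxHeartbeats 2000000 in
-- Factors `m0` are distributed by parity, and only `m0 ^ 2 = g q` is used. The same constants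
-- therefore serve both signs of `m0`, which produces the pattern `±c₀`, `p₃`, `±p̃₃`, `p̄₃` of the
-- two acoustic modes. The pressure is normalized to `g`; at each order divergence and energy give
-- the corrections of momentum and rate, then mass gives the density.
lemma exists_acoustic (S T s2 A B : ℂ) (hg : g ≠ 0) (hq0 : q ≠ 0) :
    ∃ m1 N2 m3 R1 D1 R2 D2 R3 D3 : ℂ, ∀ x y m0 : ℂ, x ^ 2 + y ^ 2 = q → m0 ^ 2 = g * q →
      Rows g S T s2 q x y ![m0, m1, m0 * N2, m3] ![waveFields A B q x y 1 (-m0) 0 g,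
        waveFields A B q x y (m0 * R1) D1 0 0, waveFields A B q x y R2 (m0 * D2) 0 0,
        waveFields A B q x y (m0 * R3) D3 0 0] := by
  obtain ⟨D1, m1, h1d, h1e⟩ := exists_pair one_ne_zero hg (-(1 / 2 * S * g * q))
    (T * q * (A + B * g + (17 / 6 - g) * g))
  obtain ⟨R1, h1m⟩ : ∃ R1, g * q * R1 + m1 + D1 = 0 :=
    ⟨-(m1 + D1) / (g * q), by field_simp; ring⟩
  obtain ⟨D2, N2, h2d, h2e⟩ := exists_pair (mul_ne_zero hg hq0) hg
    (-(1 / 2 * R1 * S * g ^ 2 * q ^ 2) - 1 / 2 * S ^ 2 * g ^ 2 * q ^ 2 - 1 / 12 * B * g * q ^ 2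
      - R1 * g * m1 * q - 1 / 2 * S * g * m1 * q + 1 / 6 * g ^ 2 * q ^ 2 - 1 / 12 * A * q ^ 2
      - 17 / 72 * g * q ^ 2 - m1 ^ 2)
    (B * T * g * q * s2 + B * T ^ 2 * g * q - T ^ 2 * g ^ 2 * q + A * R1 * T * q
      + A * T * q * s2 + A * T ^ 2 * q - 1 / 6 * T * g * q * s2 + 17 / 6 * T ^ 2 * g * q
      - 1 / 4 * B * g * q + 8 / 5 * T * q * s2 + 5 / 24 * g ^ 2 * q - 1 / 4 * A * q
      - 11 / 24 * g * q - 2 / 15 * q)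
  obtain ⟨R2, h2m⟩ : ∃ R2, R2 + (R1 * m1 + 1 / 24 * g * q + D2 + N2) = 0 := ⟨_, neg_add_cancel _⟩
  -- The two polynomials are the known parts of the divergence law, divided by `m0`, and of the
  -- energy law, with `m0 ^ 2` replaced by `g q`.
  obtain ⟨D3, m3, h3d, h3e⟩ := exists_pair one_ne_zero hg
    (-(1 / 4 * S ^ 3 * g ^ 2 * q ^ 2) - 1 / 12 * B * S * g * q ^ 2 - 1 / 6 * B * T * g * q ^ 2
      - 1 / 12 * B * g * q ^ 2 * s2 + 1 / 12 * S * g ^ 2 * q ^ 2 + 1 / 6 * T * g ^ 2 * q ^ 2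
      - 1 / 12 * A * R1 * q ^ 2 - 1 / 12 * A * S * q ^ 2 - 1 / 6 * A * T * q ^ 2
      - 1 / 12 * A * q ^ 2 * s2 + 1 / 2 * D2 * S * g * q - N2 * R1 * g * q
      + 5 / 36 * S * g * q ^ 2 - 17 / 36 * T * g * q ^ 2 + 1 / 72 * g * q ^ 2 * s2
      - 1 / 5 * S * q ^ 2 - 2 / 15 * q ^ 2 * s2 + D2 * m1 - N2 * m1)
    (B * T * g ^ 2 * q ^ 2 * s2 ^ 2 + B * T ^ 2 * g ^ 2 * q ^ 2 * s2
      + 2 * B * T ^ 3 * g ^ 2 * q ^ 2 - R1 * T ^ 2 * g ^ 3 * q ^ 2 - 2 * T ^ 3 * g ^ 3 * q ^ 2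
      + A * R1 * T * g * q ^ 2 * s2 + A * R1 * T ^ 2 * g * q ^ 2 + A * T * g * q ^ 2 * s2 ^ 2
      + A * T ^ 2 * g * q ^ 2 * s2 + 2 * A * T ^ 3 * g * q ^ 2
      + 1 / 6 * B * T ^ 2 * g * q ^ 2 * s2 - 17 / 6 * B * T ^ 3 * g * q ^ 2
      - 1 / 6 * R1 * T * g ^ 2 * q ^ 2 * s2 + 17 / 6 * R1 * T ^ 2 * g ^ 2 * q ^ 2
      - 1 / 6 * T * g ^ 2 * q ^ 2 * s2 ^ 2 - 1 / 3 * T ^ 2 * g ^ 2 * q ^ 2 * s2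
      + 17 / 2 * T ^ 3 * g ^ 2 * q ^ 2 + 1 / 6 * A * T ^ 2 * q ^ 2 * s2
      - 17 / 6 * A * T ^ 3 * q ^ 2 + B * T * g * m1 * q * s2 - 7 / 12 * B * T * g ^ 2 * q ^ 2
      + B * T ^ 2 * g * m1 * q - 1 / 4 * B * g ^ 2 * q ^ 2 * s2
      + 8 / 5 * R1 * T * g * q ^ 2 * s2 - R1 * T * g ^ 2 * m1 * q + 1 / 6 * R1 * g ^ 3 * q ^ 2
      - 1 / 12 * S * g ^ 3 * q ^ 2 + 8 / 5 * T * g * q ^ 2 * s2 ^ 2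
      + 11 / 24 * T * g ^ 3 * q ^ 2 + 373 / 180 * T ^ 2 * g * q ^ 2 * s2
      - T ^ 2 * g ^ 2 * m1 * q - 289 / 36 * T ^ 3 * g * q ^ 2 - 1 / 4 * A * R1 * g * q ^ 2
      - 7 / 12 * A * T * g * q ^ 2 + A * T * m1 * q * s2 + A * T ^ 2 * m1 * q
      - 1 / 4 * A * g * q ^ 2 * s2 + 23 / 72 * B * T * g * q ^ 2 + D2 * T * g ^ 2 * q
      - N2 * T * g ^ 2 * q + 17 / 6 * R1 * T * g * m1 * q - 49 / 144 * R1 * g ^ 2 * q ^ 2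
      + 53 / 144 * S * g ^ 2 * q ^ 2 - 1 / 6 * T * g * m1 * q * s2 - 19 / 12 * T * g ^ 2 * q ^ 2
      + 17 / 6 * T ^ 2 * g * m1 * q + 1 / 24 * g ^ 2 * q ^ 2 * s2 + A * R2 * T * q
      + 23 / 72 * A * T * q ^ 2 - 1 / 4 * B * g * m1 * q - 17 / 6 * D2 * T * g * q
      + 17 / 6 * N2 * T * g * q - 2 / 15 * R1 * g * q ^ 2 - 2 / 15 * S * g * q ^ 2
      - T * g * m1 ^ 2 + 247 / 432 * T * g * q ^ 2 + 8 / 5 * T * m1 * q * s2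
      - 2 / 5 * g * q ^ 2 * s2 + 1 / 6 * g ^ 2 * m1 * q - 1 / 4 * A * m1 * q
      + 17 / 6 * T * m1 ^ 2 - 49 / 144 * g * m1 * q - 2 / 15 * m1 * q)
  obtain ⟨R3, h3m⟩ : ∃ R3,
      g * q * R3 + (-(1 / 24 * B * T * g * q ^ 2) + 1 / 24 * R1 * g ^ 2 * q ^ 2
          + 1 / 24 * S * g ^ 2 * q ^ 2
      + 1 / 24 * T * g ^ 2 * q ^ 2 - 1 / 24 * A * T * q ^ 2 + N2 * R1 * g * q
      - 17 / 144 * T * g * q ^ 2 + 1 / 24 * g * m1 * q + R2 * m1 + D3 + m3) = 0 :=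
    ⟨-(-(1 / 24 * B * T * g * q ^ 2) + 1 / 24 * R1 * g ^ 2 * q ^ 2 + 1 / 24 * S * g ^ 2 * q ^ 2
      + 1 / 24 * T * g ^ 2 * q ^ 2 - 1 / 24 * A * T * q ^ 2 + N2 * R1 * g * q
      - 17 / 144 * T * g * q ^ 2 + 1 / 24 * g * m1 * q + R2 * m1 + D3 + m3) / (g * q),
          by field_simp; ring⟩
  refine ⟨m1, N2, m3, R1, D1, R2, D2, R3, D3, fun x y m0 hq hm0 => ⟨?_, ?_, ?_, ?_⟩⟩
  · change Row0 g x y m0 (waveFields A B q x y 1 (-m0) 0 g)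
    apply Row0.of_laws hq hq0 <;> simp only [waveFields_div hq hq0, waveFields_curl hq hq0,
      waveFields_r, waveFields_p]
    · ring
    · linear_combination -hm0
    · ring
    · ring
  · change Row1 g S T x y m0 m1 (waveFields A B q x y 1 (-m0) 0 g)
      (waveFields A B q x y (m0 * R1) D1 0 0)
    apply Row1.of_laws hq hq0 <;> simp only [waveFields_div hq hq0, waveFields_curl hq hq0,
      waveFields_r, waveFields_p, waveFields_l]
    · linear_combination h1m + R1 * hm0
    · linear_combination m0 * h1d
    · ring
    · linear_combination h1e
  · change Row2 g S T s2 q x y m0 m1 (m0 * N2) (waveFields A B q x y 1 (-m0) 0 g)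
      (waveFields A B q x y (m0 * R1) D1 0 0) (waveFields A B q x y R2 (m0 * D2) 0 0)
    constructor <;> simp only [waveFields_div hq hq0, waveFields_curl hq hq0, waveFields_r,
      waveFields_p, waveFields_l, waveFields_X, waveFields_Y, massLaw2, divLaw2, curlLaw2,
      energyLaw2]
    · linear_combination m0 * h2m
    · linear_combination h2d + (-(1 / 2 * R1 * S * g * q) - R1 * m1 + D2 - N2) * hm0
    · ring
    · linear_combination m0 * h2e
  · change Row3 g S T s2 q x y m0 m1 (m0 * N2) m3 (waveFields A B q x y 1 (-m0) 0 g)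
      (waveFields A B q x y (m0 * R1) D1 0 0) (waveFields A B q x y R2 (m0 * D2) 0 0)
      (waveFields A B q x y (m0 * R3) D3 0 0)
    constructor <;> simp only [waveFields_div hq hq0, waveFields_curl hq hq0, waveFields_r,
      waveFields_p, waveFields_l, waveFields_X, waveFields_Y, waveFields_D, waveFields_F,
      massLaw3, divLaw3, curlLaw3, energyLaw3]
    · linear_combination h3m + (1 / 24 * R1 * g * q + N2 * R1 + R3) * hm0
    · linear_combination m0 * h3d + (-N2 * R1 * m0) * hm0
    · ring
    · linear_combination h3e + (B * T * g * q * s2 ^ 2 + B * T ^ 2 * g * q * s2 + B * T ^ 3 * g * q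
        - R1 * T ^ 2 * g ^ 2 * q + A * R1 * T * q * s2 + A * R1 * T ^ 2 * q + A * T * q * s2 ^ 2
        + A * T ^ 2 * q * s2 + A * T ^ 3 * q - 1 / 6 * R1 * T * g * q * s2
        + 17 / 6 * R1 * T ^ 2 * g * q - 5 / 12 * B * T * g * q - 1 / 4 * B * g * q * s2
        - R1 * T * g * m1 + 8 / 5 * R1 * T * q * s2 + 1 / 6 * R1 * g ^ 2 * q
        - 1 / 4 * A * R1 * q - 5 / 12 * A * T * q - 1 / 4 * A * q * s2 + D2 * T * g - N2 * T * g
        + 17 / 6 * R1 * T * m1 - 49 / 144 * R1 * g * q - 17 / 6 * D2 * T + 17 / 6 * N2 * T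
        - 2 / 15 * R1 * q) * hm0

lemma sigmaC_eq_relaxSigma {R : Rates} (hS : SigmaRelations R) (k : Fin 17) (hk : 4 ≤ (k : ℕ)) :
    sigmaC R k = relaxSigma (sigma R.s5 : ℝ) (sigma R.s7 : ℝ) (sigma R.sE2 : ℝ)
      (sigma R.sE3 : ℝ) (sigma R.sE4 : ℝ) k := by
  obtain ⟨h9, h13, h15⟩ := hS
  revert hk
  revert k
  apply forall_fin17 <;> intro hk <;> first
    | (exfalso; revert hk; decide)
    | rfl
    | exact congrArg _ h9
    | exact congrArg _ h13
    | exact congrArg _ h15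

lemma waveVector_sq (lam : ℝ) (k : EuclideanSpace ℝ (Fin 2)) :
    (-(Complex.I * lam * k 0)) ^ 2 + (-(Complex.I * lam * k 1)) ^ 2
      = -((lam ^ 2 * ‖k‖ ^ 2 : ℝ) : ℂ) := by
  rw [EuclideanSpace.norm_sq_eq]
  simp only [Fin.sum_univ_two, Real.norm_eq_abs, sq_abs]
  push_cast
  linear_combination ((lam : ℂ) ^ 2 * (k 0 : ℂ) ^ 2 + (lam : ℂ) ^ 2 * (k 1 : ℂ) ^ 2) * Complex.I_sq

/-- Under (A), and when `X` and `Y` vanish, the closure leaves only `l = A r + B p`, which is the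
form assumed in the construction of the modes. -/
lemma waveFields_eq_closure {g : ℝ} {a : ScalarCoeffs} (hA : AlphaRelations a) {v : TensorCoeffs}
    (hv : ∀ r jx jy p, (closure g a v r jx jy p).X = 0 ∧ (closure g a v r jx jy p).Y = 0)
    (q x y r d c p : ℂ) :
    let w := waveFields a.lr a.lp q x y r d c p
    w = closure g a v w.r w.jx w.jy w.p := by
  intro w
  obtain ⟨h1, h2, h3, h4⟩ := (alphaRelations_iff a).1 hA
  have hX := hv w.r w.jx w.jy w.p
  simp only [closure] at hX
  simp only [closure, hX, h1, h2, h3, h4]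
  simp [w, waveFields]

/-- The curl isolates the shear mode, the divergence separates the two acoustic modes since `m ≠ 0`,
the pressure their sum since `g ≠ 0`, and the density the thermal mode. -/
lemma linearIndependent_modes {m g q x y : ℂ} (hq : x ^ 2 + y ^ 2 = q) (hq0 : q ≠ 0) (hm : m ≠ 0)
    (hg : g ≠ 0) {A B : ℂ} : LinearIndependent ℂ (fun j : Fin 4 => consLin (moments g
      (![waveFields A B q x y 0 0 1 0, waveFields A B q x y 1 0 0 0,
        waveFields A B q x y 1 (-m) 0 g, waveFields A B q x y 1 m 0 g] j))) := by
  rw [Fintype.linearIndependent_iff]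
  intro c hc
  have h0 := congrFun hc 0
  have h1 := congrFun hc 1
  have h2 := congrFun hc 2
  have h3 := congrFun hc 3
  simp only [Finset.sum_apply, Fin.sum_univ_four, Pi.smul_apply, smul_eq_mul, Pi.zero_apply] at *
  change c 0 * 0 + c 1 * 1 + c 2 * 1 + c 3 * 1 = 0 at h0
  change c 0 * ((x * 0 - y * 1) / q) + c 1 * ((x * 0 - y * 0) / q)
    + c 2 * ((x * -m - y * 0) / q) + c 3 * ((x * m - y * 0) / q) = 0 at h1
  change c 0 * ((y * 0 + x * 1) / q) + c 1 * ((y * 0 + x * 0) / q)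
    + c 2 * ((y * -m + x * 0) / q) + c 3 * ((y * m + x * 0) / q) = 0 at h2
  change c 0 * (34 * 0 - 60 * 0) + c 1 * (34 * 0 - 60 * 1) + c 2 * (34 * g - 60 * 1)
    + c 3 * (34 * g - 60 * 1) = 0 at h3
  have e0 : c 0 = 0 := by
    have : c 0 = x * (c 0 * ((y * 0 + x * 1) / q) + c 1 * ((y * 0 + x * 0) / q)
      + c 2 * ((y * -m + x * 0) / q) + c 3 * ((y * m + x * 0) / q))
      - y * (c 0 * ((x * 0 - y * 1) / q) + c 1 * ((x * 0 - y * 0) / q)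
      + c 2 * ((x * -m - y * 0) / q) + c 3 * ((x * m - y * 0) / q)) := by
      field_simp
      linear_combination -(c 0) * hq
    rw [this, h1, h2]
    ring
  have e1 : m * (c 3 - c 2) = 0 := by
    have : m * (c 3 - c 2) = x * (c 0 * ((x * 0 - y * 1) / q) + c 1 * ((x * 0 - y * 0) / q)
      + c 2 * ((x * -m - y * 0) / q) + c 3 * ((x * m - y * 0) / q))
      + y * (c 0 * ((y * 0 + x * 1) / q) + c 1 * ((y * 0 + x * 0) / q)
      + c 2 * ((y * -m + x * 0) / q) + c 3 * ((y * m + x * 0) / q)) := by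
      field_simp
      linear_combination -(m * (c 3 - c 2)) * hq
    rw [this, h1, h2]
    ring
  have e2 : c 3 - c 2 = 0 := (mul_eq_zero.1 e1).resolve_left hm
  have e3 : c 2 + c 3 = 0 := by
    refine (mul_eq_zero.1 (?_ : g * (c 2 + c 3) = 0)).resolve_left hg
    linear_combination 1 / 34 * h3 + 30 / 17 * h0
  intro i
  fin_cases i
  · exact e0
  · change c 1 = 0
    linear_combination h0 - e3
  · change c 2 = 0
    linear_combination (e3 - e2) / 2
  · change c 3 = 0
    linear_combination (e3 + e2) / 2

/-- For the zero wave vector nothing is advected and every equilibrium is stationary. The generic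
construction does not apply, as it divides by `q`. -/
lemma exists_isExpansion_zero {sig : Fin 17 → ℂ} (Q : Matrix (Fin 17) (Fin 4) ℂ) :
    ∃ psi theta : Fin 4 → Fin 4 → Fin 17 → ℂ, LinearIndependent ℂ (fun j => consLin (psi j 0)) ∧
      ∀ j, IsExpansion 0 0 sig Q 0 (psi j) (theta j) := by
  have hadv : ∀ v : Fin 17 → ℂ, advect 0 0 v = 0 := by
    intro v
    funext k
    revert k
    apply forall_fin17 <;> simp [advect]
  refine ⟨fun j => ![equilibriumLin Q (Pi.single j 1), 0, 0, 0], 0, ?_, fun j =>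
    ⟨?_, ?_, ?_, ?_, fun _ _ => rfl, ?_, ?_⟩⟩
  · convert (Pi.basisFun ℂ (Fin 4)).linearIndependent using 2 with j
    rw [Pi.basisFun_apply]
    funext a
    simp [consLin, equilibriumLin, consIdx]
  · simp [hadv]
  · simp [hadv]
  · simp [hadv]
  · simp [hadv]
  · intro k hk
    change equilibriumLin Q (Pi.single j 1) k
      = equilibrium Q (equilibriumLin Q (Pi.single j 1)) k
    simp only [equilibriumLin, LinearMap.coe_mk, AddHom.coe_mk, not_lt.2 hk, dite_false,
      Fin.sum_univ_four, equilibrium]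
    rfl
  · intro n k hk
    fin_cases n <;> simp [equilibrium]

lemma TensorCoeffs.isotropic_XY {lam c0 : ℝ} (a : ScalarCoeffs) (r jx jy p : ℂ) :
    (closure (c0 ^ 2 / lam ^ 2) a (.isotropic lam c0) r jx jy p).X = 0 ∧
      (closure (c0 ^ 2 / lam ^ 2) a (.isotropic lam c0) r jx jy p).Y = 0 := by
  constructor <;> simp [closure, TensorCoeffs.isotropic]

lemma isClosure_isotropic {lam : ℝ} (hlam : 0 < lam) (c0 : ℝ) (a : ScalarCoeffs) :
    IsClosure ((c0 ^ 2 / lam ^ 2 : ℝ) : ℂ)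
      (scaledEquilibrium lam (isotropicEquilibrium lam c0 a))
      (closure (c0 ^ 2 / lam ^ 2) a (.isotropic lam c0)) := by
  rw [isotropicEquilibrium_eq hlam]
  exact isClosure_closure hlam c0 a _ rfl rfl rfl rfl rfl rfl rfl rfl rfl

lemma soundSpeed_sq {lam : ℝ} (hlam : 0 < lam) (c0 kappa : ℝ) :
    (c0 * (Complex.I * kappa) : ℂ) ^ 2
      = ((c0 ^ 2 / lam ^ 2 : ℝ) : ℂ) * -((lam ^ 2 * kappa ^ 2 : ℝ) : ℂ) := by
  have h : (lam : ℂ) ≠ 0 := by exact_mod_cast hlam.ne'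
  push_cast
  field_simp
  linear_combination (c0 : ℂ) ^ 2 * (kappa : ℂ) ^ 2 * Complex.I_sq

theorem fourthOrderIsotropic_isotropicEquilibrium {lam c0 : ℝ} (hlam : 0 < lam) (hc0 : 0 < c0)
    {R : Rates} (hR : R.Admissible) {a : ScalarCoeffs}
    (h57 : sigma R.s5 * sigma R.s7 = 1 / 12) (hS : SigmaRelations R) (hA : AlphaRelations a) :
    FourthOrderIsotropic lam c0 R (isotropicEquilibrium lam c0 a) := by
  rw [fourthOrderIsotropic_iff hlam hR]
  -- Isotropy is a choice of coefficients for each length that works for all directions at once.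
  suffices key : ∀ kappa : ℝ, ∃ p pt pb : Fin 3 → ℂ, ∀ k : EuclideanSpace ℝ (Fin 2), ‖k‖ = kappa →
      ∃ psi theta : Fin 4 → Fin 4 → Fin 17 → ℂ,
        LinearIndependent ℂ (fun j => consLin (psi j 0)) ∧
        ∀ j, IsExpansion (-(Complex.I * lam * k 0)) (-(Complex.I * lam * k 1)) (sigmaC R)
          (scaledEquilibrium lam (isotropicEquilibrium lam c0 a)) (modeCoeff c0 kappa p pt pb j)
          (psi j) (theta j) by
    choose p pt pb h using key
    exact ⟨p, pt, pb, fun k => h ‖k‖ k rfl⟩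
  intro kappa
  rcases eq_or_ne kappa 0 with rfl | hkappa
  · refine ⟨0, 0, 0, fun k hk => ?_⟩
    rw [norm_eq_zero] at hk
    subst hk
    obtain ⟨psi, theta, hli, h⟩ := exists_isExpansion_zero (sig := sigmaC R)
      (scaledEquilibrium lam (isotropicEquilibrium lam c0 a))
    refine ⟨psi, theta, hli, fun j => ?_⟩
    convert h j using 1
    · simp
    · simp
    · fin_cases j <;> funext n <;> fin_cases n <;> simp [modeCoeff]
  set q : ℂ := -((lam ^ 2 * kappa ^ 2 : ℝ) : ℂ) with hqdef
  set g : ℂ := ((c0 ^ 2 / lam ^ 2 : ℝ) : ℂ) with hgdef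
  have hq0 : q ≠ 0 := by
    rw [hqdef, neg_ne_zero, Complex.ofReal_ne_zero]
    positivity
  have hg : g ≠ 0 := by
    rw [hgdef, Complex.ofReal_ne_zero]
    positivity
  have hm0 : (c0 * (Complex.I * kappa) : ℂ) ^ 2 = g * q := soundSpeed_sq hlam c0 kappa
  have hm : (c0 * (Complex.I * kappa) : ℂ) ≠ 0 := by
    intro h
    rw [h] at hm0
    exact mul_ne_zero hg hq0 (by rw [← hm0]; ring)
  set S : ℂ := ((sigma R.s5 : ℝ) : ℂ)
  set T : ℂ := ((sigma R.s7 : ℝ) : ℂ)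
  set s2 : ℂ := ((sigma R.sE2 : ℝ) : ℂ)
  set A : ℂ := (a.lr : ℂ)
  set B : ℂ := (a.lp : ℂ)
  have hST : S * T = 1 / 12 := by
    have := congrArg (fun t : ℝ => (t : ℂ)) h57
    push_cast at this
    exact this
  obtain ⟨m1s, m3s, hs⟩ := exists_shear g S T s2 A B hq0
  obtain ⟨m1t, m3t, p2, d3, ht⟩ := exists_thermal S T s2 A B hg hq0
  obtain ⟨m1, N2, m3, R1, D1, R2, D2, R3, D3, ha⟩ := exists_acoustic S T s2 A B hg hq0
  refine ⟨![m1s, m1t, m1], ![0, 0, c0 * (Complex.I * kappa) * N2], ![m3s, m3t, m3],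
    fun k hk => ?_⟩
  set x : ℂ := -(Complex.I * lam * k 0)
  set y : ℂ := -(Complex.I * lam * k 1)
  have hq : x ^ 2 + y ^ 2 = q := by rw [hqdef, ← hk, waveVector_sq]
  have hC := isClosure_isotropic hlam c0 a
  have hsig := sigmaC_eq_relaxSigma hS
  have hw := waveFields_eq_closure hA (TensorCoeffs.isotropic_XY (lam := lam) (c0 := c0) a) q x y
  obtain ⟨psi0, theta0, h0, e0⟩ := (hs x y hq).exists_isExpansion hC hST hsig hq hq0
    (fun n => by fin_cases n <;> exact hw _ _ _ _)
  obtain ⟨psi1, theta1, h1, e1⟩ := (ht x y hq).exists_isExpansion hC hST hsig hq hq0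
    (fun n => by fin_cases n <;> exact hw _ _ _ _)
  obtain ⟨psi2, theta2, h2, e2⟩ := (ha x y _ hq hm0).exists_isExpansion hC hST hsig hq hq0
    (fun n => by fin_cases n <;> exact hw _ _ _ _)
  obtain ⟨psi3, theta3, h3, e3⟩ := (ha x y (-(c0 * (Complex.I * kappa))) hq
    (by rw [neg_sq, hm0])).exists_isExpansion hC hST hsig hq hq0
    (fun n => by fin_cases n <;> exact hw _ _ _ _)
  refine ⟨![psi0, psi1, psi2, psi3], ![theta0, theta1, theta2, theta3], ?_, fun j => ?_⟩
  · convert linearIndependent_modes hq hq0 hm hg (A := A) (B := B) using 2 with j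
    fin_cases j
    · exact congrArg consLin e0
    · exact congrArg consLin e1
    · exact congrArg consLin e2
    · refine congrArg consLin (e3.trans ?_)
      rw [neg_neg]
      rfl
  · fin_cases j
    · exact h0
    · exact h1
    · exact h2
    · rw [neg_mul] at h3
      exact h3

/-! ### Necessity: normalized modes of an isotropic scheme. -/

section

variable {g S T x y q A B : ℂ} {Q : Matrix (Fin 17) (Fin 4) ℂ}
  {C : ℂ → ℂ → ℂ → ℂ → Macro} {sig : Fin 17 → ℂ} {m : Fin 4 → ℂ} {psi theta : Fin 4 → Fin 17 → ℂ}

/-- The fluxes of the conserved moments involve only `ρ, j, E, XX, XY, q`. -/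
lemma advect_consIdx_congr {u v : Fin 17 → ℂ} (h : ∀ k : Fin 17, (k : ℕ) < 8 → u k = v k)
    (a : Fin 4) : advect x y u (consIdx a) = advect x y v (consIdx a) := by
  have h0 : u 0 = v 0 := h 0 (by decide)
  have h1 : u 1 = v 1 := h 1 (by decide)
  have h2 : u 2 = v 2 := h 2 (by decide)
  have h3 : u 3 = v 3 := h 3 (by decide)
  have h4 : u 4 = v 4 := h 4 (by decide)
  have h5 : u 5 = v 5 := h 5 (by decide)
  have h6 : u 6 = v 6 := h 6 (by decide)
  have h7 : u 7 = v 7 := h 7 (by decide)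
  fin_cases a
  · change advect x y u 0 = advect x y v 0
    simp only [advect_0, h1, h2]
  · change advect x y u 1 = advect x y v 1
    simp only [advect_1, h0, h3, h4, h5]
  · change advect x y u 2 = advect x y v 2
    simp only [advect_2, h0, h3, h4, h5]
  · change advect x y u 3 = advect x y v 3
    simp only [advect_3, h1, h2, h6, h7]

/-- The laws of order at most one see only the rates of `XX, XY` and `q`, so they are available
before (S) is known. -/
lemma IsExpansion.row0_row1 (hC : IsClosure g Q C) (h4 : sig 4 = S) (h5 : sig 5 = S)
    (h6 : sig 6 = T) (h7 : sig 7 = T) (h : IsExpansion x y sig Q m psi theta) :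
    Row0 g x y (m 0) (macroOf C (psi 0)) ∧
      Row1 g S T x y (m 0) (m 1) (macroOf C (psi 0)) (macroOf C (psi 1)) := by
  have p0 := h.psi_zero_eq_moments hC
  have t0 := h.theta0
  rw [p0] at t0
  have r0 := (row0_iff t0).1 (h.conserved 0)
  have e0 := theta0_eq t0 r0
  -- The rates of `E₂, E₃, E₄` are immaterial at this order and are set to zero.
  refine ⟨r0, (row1_iff (S := S) (T := T) (s2 := 0) (s3 := 0) (s4 := 0) rfl rfl r0).1 fun a => ?_⟩
  have t1 : theta 1 (consIdx a) = 0 := h.conserved 1 a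
  have hv : ∀ k : Fin 17, (k : ℕ) < 8 → psi 1 k = (moments g (macroOf C (psi 1))
      + relaxSigma S T 0 0 0 * D2Q17.theta0 g x y (m 0) (macroOf C (psi 0))) k := by
    intro k hk
    rw [Pi.add_apply, Pi.mul_apply]
    rcases consIdx_or k with ⟨b, rfl⟩ | hk4
    · rw [hC.moments_macroOf, relaxSigma_consIdx, zero_mul, add_zero]
    · have hr : psi 1 k = equilibrium Q (psi 1) k + sig k * theta 0 k := h.relax 0 k hk4
      rw [hr, hC.equilibrium_eq _ k hk4, e0]
      congr 2
      obtain ⟨n, hn⟩ := k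
      simp only at hk hk4
      interval_cases n
      exacts [h4, h5, h6, h7]
  have t1' := h.theta1
  rw [p0] at t1'
  refine Eq.trans ?_ t1
  rw [t1']
  simp only [Pi.add_apply, Pi.smul_apply]
  rw [advect_consIdx_congr hv, hv (consIdx a) (lt_of_lt_of_le a.2 (by norm_num))]
  rfl

/-- At order one, the modes that do not propagate are shear or thermal modes. -/
lemma Row1.vortical {m1 : ℂ} {w0 w1 : Macro} (hq : x ^ 2 + y ^ 2 = q) (hq0 : q ≠ 0)
    (h0 : Row0 g x y 0 w0) (h1 : Row1 g S T x y 0 m1 w0 w1) (hl : w0.l = A * w0.r + B * w0.p) :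
    w0.p = 0 ∧ w0.div x y = 0 ∧ (m1 + 1 / 2 * S * g * q) * w0.curl x y = 0 ∧
      (g * m1 - T * q * A) * w0.r = 0 := by
  have hd : w0.div x y = 0 := by linear_combination h0.mass_law
  have hp : w0.p = 0 := (mul_eq_zero.1 (by linear_combination h0.div_law hq)).resolve_left hq0
  refine ⟨hp, hd, by linear_combination h1.curl_law hq, ?_⟩
  have e := h1.energy_law hq
  rw [hl, hp] at e
  linear_combination g * h1.mass_law - e

/-- A normalized shear mode. -/
structure IsShearMode (x y : ℂ) (w : Fin 4 → Macro) : Prop where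
  r : (w 0).r = 0
  p : (w 0).p = 0
  div : (w 0).div x y = 0
  curl : (w 0).curl x y = 1
  curl1 : (w 1).curl x y = 0
  curl2 : (w 2).curl x y = 0
  curl3 : (w 3).curl x y = 0

/-- A normalized thermal mode. -/
structure IsThermalMode (x y : ℂ) (w : Fin 4 → Macro) : Prop where
  r : (w 0).r = 1
  p : (w 0).p = 0
  div : (w 0).div x y = 0
  curl : (w 0).curl x y = 0
  r1 : (w 1).r = 0
  r2 : (w 2).r = 0
  r3 : (w 3).r = 0

/-- A normalized acoustic mode. -/
structure IsAcousticMode (w : Fin 4 → Macro) : Prop where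
  p : (w 0).p = 1
  p1 : (w 1).p = 0
  p2 : (w 2).p = 0
  p3 : (w 3).p = 0

/-- The density of a moment vector. -/
def densityLin : (Fin 17 → ℂ) →ₗ[ℂ] ℂ := LinearMap.proj 0

/-- The pressure of a moment vector. -/
def pressureLin : (Fin 17 → ℂ) →ₗ[ℂ] ℂ :=
  (1 / 34 : ℂ) • LinearMap.proj 3 + (60 / 34 : ℂ) • LinearMap.proj 0

/-- The curl of the momentum of a moment vector. -/
def curlLin (x y : ℂ) : (Fin 17 → ℂ) →ₗ[ℂ] ℂ := x • LinearMap.proj 2 - y • LinearMap.proj 1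

/-- The divergence of the momentum of a moment vector. -/
def divLin (x y : ℂ) : (Fin 17 → ℂ) →ₗ[ℂ] ℂ := x • LinearMap.proj 1 + y • LinearMap.proj 2

lemma IsClosure.macroOf_r (hC : IsClosure g Q C) (v : Fin 17 → ℂ) :
    (macroOf C v).r = densityLin v := hC.r ..

lemma IsClosure.macroOf_p (hC : IsClosure g Q C) (v : Fin 17 → ℂ) :
    (macroOf C v).p = pressureLin v := by
  rw [macroOf, hC.p]
  simp only [pressureLin, LinearMap.add_apply, LinearMap.smul_apply, LinearMap.proj_apply,
    smul_eq_mul]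
  ring

lemma IsClosure.macroOf_curl (hC : IsClosure g Q C) (v : Fin 17 → ℂ) :
    (macroOf C v).curl x y = curlLin x y v := by
  simp only [Macro.curl, macroOf, hC.jx, hC.jy, curlLin, LinearMap.sub_apply,
    LinearMap.smul_apply, LinearMap.proj_apply, smul_eq_mul]

lemma IsClosure.macroOf_div (hC : IsClosure g Q C) (v : Fin 17 → ℂ) :
    (macroOf C v).div x y = divLin x y v := by
  simp only [Macro.div, macroOf, hC.jx, hC.jy, divLin, LinearMap.add_apply,
    LinearMap.smul_apply, LinearMap.proj_apply, smul_eq_mul]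

lemma IsClosure.exists_isShearMode (hC : IsClosure g Q C)
    (h : IsExpansion x y sig Q m psi theta) (hr : densityLin (psi 0) = 0)
    (hp : pressureLin (psi 0) = 0) (hd : divLin x y (psi 0) = 0) (hc : curlLin x y (psi 0) ≠ 0) :
    ∃ psi' theta', IsExpansion x y sig Q m psi' theta' ∧
      IsShearMode x y (fun n => macroOf C (psi' n)) := by
  obtain ⟨psi', theta', h', e0, l0, l1, l2, l3⟩ := h.normalize (curlLin x y) hc 1
  refine ⟨psi', theta', h', ⟨?_, ?_, ?_, ?_, ?_, ?_, ?_⟩⟩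
  · rw [hC.macroOf_r, e0, map_smul, hr, smul_zero]
  · rw [hC.macroOf_p, e0, map_smul, hp, smul_zero]
  · rw [hC.macroOf_div, e0, map_smul, hd, smul_zero]
  all_goals rw [hC.macroOf_curl]; assumption

lemma IsClosure.exists_isThermalMode (hC : IsClosure g Q C)
    (h : IsExpansion x y sig Q m psi theta) (hr : densityLin (psi 0) ≠ 0)
    (hp : pressureLin (psi 0) = 0) (hd : divLin x y (psi 0) = 0) (hc : curlLin x y (psi 0) = 0) :
    ∃ psi' theta', IsExpansion x y sig Q m psi' theta' ∧
      IsThermalMode x y (fun n => macroOf C (psi' n)) := by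
  obtain ⟨psi', theta', h', e0, l0, l1, l2, l3⟩ := h.normalize densityLin hr 1
  refine ⟨psi', theta', h', ⟨?_, ?_, ?_, ?_, ?_, ?_, ?_⟩⟩
  · rw [hC.macroOf_r, l0]
  · rw [hC.macroOf_p, e0, map_smul, hp, smul_zero]
  · rw [hC.macroOf_div, e0, map_smul, hd, smul_zero]
  · rw [hC.macroOf_curl, e0, map_smul, hc, smul_zero]
  all_goals rw [hC.macroOf_r]; assumption

lemma IsClosure.exists_isAcousticMode (hC : IsClosure g Q C)
    (h : IsExpansion x y sig Q m psi theta) (hp : pressureLin (psi 0) ≠ 0) :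
    ∃ psi' theta', IsExpansion x y sig Q m psi' theta' ∧
      IsAcousticMode (fun n => macroOf C (psi' n)) := by
  obtain ⟨psi', theta', h', e0, l0, l1, l2, l3⟩ := h.normalize pressureLin hp 1
  refine ⟨psi', theta', h', ⟨?_, ?_, ?_, ?_⟩⟩
  all_goals rw [hC.macroOf_p]; assumption

lemma consLin_eq_zero (hq : x ^ 2 + y ^ 2 = q) (hq0 : q ≠ 0) {v : Fin 17 → ℂ}
    (hr : densityLin v = 0) (hp : pressureLin v = 0) (hd : divLin x y v = 0)
    (hc : curlLin x y v = 0) : consLin v = 0 := by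
  simp only [densityLin, pressureLin, divLin, curlLin, LinearMap.add_apply, LinearMap.sub_apply,
    LinearMap.smul_apply, LinearMap.proj_apply, smul_eq_mul] at hr hp hd hc
  obtain ⟨h1, h2⟩ := eq_zero_of_div_curl hq hq0 hd hc
  funext a
  fin_cases a
  exacts [hr, h1, h2, by change v 3 = 0; linear_combination 34 * hp - 60 * hr]

end

/-- A shear mode and a thermal mode at order zero. -/
lemma shear_and_thermal {x y q g mu nu : ℂ} {psi psi' : Fin 17 → ℂ} (hq : x ^ 2 + y ^ 2 = q)
    (hq0 : q ≠ 0) (hli : LinearIndependent ℂ ![consLin psi, consLin psi'])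
    (hp : pressureLin psi = 0) (hd : divLin x y psi = 0) (hp' : pressureLin psi' = 0)
    (hd' : divLin x y psi' = 0) (hg : g ≠ 0) {m m' : ℂ} (hmn : mu ≠ nu)
    (hs : (m - mu) * curlLin x y psi = 0) (ht : g * (m - nu) * densityLin psi = 0)
    (hs' : (m' - mu) * curlLin x y psi' = 0) (ht' : g * (m' - nu) * densityLin psi' = 0) :
    (m = mu → densityLin psi = 0 ∧ curlLin x y psi ≠ 0 ∧
      densityLin psi' ≠ 0 ∧ curlLin x y psi' = 0) ∧
    (m ≠ mu → densityLin psi' = 0 ∧ curlLin x y psi' ≠ 0 ∧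
      densityLin psi ≠ 0 ∧ curlLin x y psi = 0) := by
  have hne : consLin psi ≠ 0 := hli.ne_zero 0
  have hne' : consLin psi' ≠ 0 := hli.ne_zero 1
  have hpair := LinearIndependent.pair_iff.1 hli
  -- Pressure and divergence vanish on both vectors, so a combination that also kills density and
  -- curl is zero, against independence.
  have hnot : ∀ a b : ℂ, a ≠ 0 → a * densityLin psi + b * densityLin psi' = 0 →
      a * curlLin x y psi + b * curlLin x y psi' = 0 → False := by
    intro a b ha h1 h2
    refine ha (hpair a b ?_).1
    rw [← map_smul, ← map_smul, ← map_add]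
    apply consLin_eq_zero hq hq0
    · simpa using h1
    · simp [hp, hp']
    · simp [hd, hd']
    · simpa using h2
  constructor
  · intro hm
    have hr : densityLin psi = 0 := by
      refine (mul_eq_zero.1 ht).resolve_left (mul_ne_zero hg ?_)
      rw [hm]
      exact sub_ne_zero.2 hmn
    have hc : curlLin x y psi ≠ 0 := fun hc => hne (consLin_eq_zero hq hq0 hr hp hd hc)
    have hr' : densityLin psi' ≠ 0 := by
      intro hr'
      refine hnot (curlLin x y psi') (-curlLin x y psi) ?_ (by rw [hr, hr']; ring) (by ring)
      exact fun hc' => hne' (consLin_eq_zero hq hq0 hr' hp' hd' hc')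
    refine ⟨hr, hc, hr', (mul_eq_zero.1 hs').resolve_left ?_⟩
    have hm' : m' - nu = 0 :=
      ((mul_eq_zero.1 ((mul_eq_zero.1 ht').resolve_right hr'))).resolve_left hg
    rw [sub_eq_zero.1 hm']
    exact sub_ne_zero.2 hmn.symm
  · intro hm
    have hc : curlLin x y psi = 0 := (mul_eq_zero.1 hs).resolve_left (sub_ne_zero.2 hm)
    have hr : densityLin psi ≠ 0 := fun hr => hne (consLin_eq_zero hq hq0 hr hp hd hc)
    have hc' : curlLin x y psi' ≠ 0 := by
      intro hc'
      refine hnot (densityLin psi') (-densityLin psi) ?_ (by ring) (by rw [hc, hc']; ring)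
      exact fun hr' => hne' (consLin_eq_zero hq hq0 hr' hp' hd' hc')
    refine ⟨(mul_eq_zero.1 ht').resolve_left (mul_ne_zero hg ?_), hc', hr, hc⟩
    rw [sub_eq_zero.1 ((mul_eq_zero.1 hs').resolve_right hc')]
    exact sub_ne_zero.2 hmn

/-- At order one a non-propagating mode has the shear rate `mu` if its curl is nonzero and the
thermal rate `nu` if its density is nonzero. By `hsplit` these rates differ, so each of the two
modes is purely shear or purely thermal. -/
lemma exists_modes {lam c0 : ℝ} (hlam : 0 < lam) (hc0 : 0 < c0) {R : Rates} (hR : R.Admissible)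
    {Eq : Matrix (Fin 17) (Fin 4) ℝ} {g : ℂ} (hg : g = ((c0 ^ 2 / lam ^ 2 : ℝ) : ℂ))
    {C : ℂ → ℂ → ℂ → ℂ → Macro} (hC : IsClosure g (scaledEquilibrium lam Eq) C) {A B : ℂ}
    (hl : ∀ r jx jy p, (C r jx jy p).l = A * r + B * p)
    (hsplit : g * (1 / 2 * (sigma R.s5 : ℝ) * g) + (sigma R.s7 : ℝ) * A ≠ 0)
    (hiso : FourthOrderIsotropic lam c0 R Eq) {kappa : ℝ} (hk0 : kappa ≠ 0) :
    ∃ ms mt ma : Fin 4 → ℂ, ms 0 = 0 ∧ mt 0 = 0 ∧ ma 0 = c0 * (Complex.I * kappa) ∧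
      ∀ k : EuclideanSpace ℝ (Fin 2), ‖k‖ = kappa →
        (∃ psi theta, IsExpansion (-(Complex.I * lam * k 0)) (-(Complex.I * lam * k 1))
          (sigmaC R) (scaledEquilibrium lam Eq) ms psi theta ∧
          IsShearMode (-(Complex.I * lam * k 0)) (-(Complex.I * lam * k 1))
            (fun n => macroOf C (psi n))) ∧
        (∃ psi theta, IsExpansion (-(Complex.I * lam * k 0)) (-(Complex.I * lam * k 1))
          (sigmaC R) (scaledEquilibrium lam Eq) mt psi theta ∧
          IsThermalMode (-(Complex.I * lam * k 0)) (-(Complex.I * lam * k 1))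
            (fun n => macroOf C (psi n))) ∧
        (∃ psi theta, IsExpansion (-(Complex.I * lam * k 0)) (-(Complex.I * lam * k 1))
          (sigmaC R) (scaledEquilibrium lam Eq) ma psi theta ∧
          IsAcousticMode (fun n => macroOf C (psi n))) := by
  obtain ⟨p, pt, pb, h⟩ := (fourthOrderIsotropic_iff hlam hR Eq c0).1 hiso
  set q : ℂ := -((lam ^ 2 * kappa ^ 2 : ℝ) : ℂ) with hqdef
  have hq0 : q ≠ 0 := by
    rw [hqdef, neg_ne_zero, Complex.ofReal_ne_zero]
    positivity
  have hg0 : g ≠ 0 := by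
    rw [hg, Complex.ofReal_ne_zero]
    positivity
  have hma : (c0 * (Complex.I * kappa) : ℂ) ≠ 0 := by
    refine mul_ne_zero ?_ (mul_ne_zero Complex.I_ne_zero ?_)
    · exact_mod_cast hc0.ne'
    · exact_mod_cast hk0
  set S : ℂ := ((sigma R.s5 : ℝ) : ℂ)
  set T : ℂ := ((sigma R.s7 : ℝ) : ℂ)
  set mu : ℂ := -(1 / 2 * S * g * q) with hmu
  set nu : ℂ := T * q * A / g with hnu
  have hmn : mu ≠ nu := by
    intro e
    rw [hmu, hnu, eq_div_iff hg0] at e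
    exact mul_ne_zero hq0 hsplit (by linear_combination -e)
  have key : ∀ k : EuclideanSpace ℝ (Fin 2), ‖k‖ = kappa → ∃ psi theta : Fin 4 → Fin 4 → Fin 17 → ℂ,
      (∀ j, IsExpansion (-(Complex.I * lam * k 0)) (-(Complex.I * lam * k 1))
          (sigmaC R) (scaledEquilibrium lam Eq)
          (modeCoeff c0 kappa (p kappa) (pt kappa) (pb kappa) j) (psi j) (theta j)) ∧
      (∀ j : Fin 4, (j : ℕ) < 2 → pressureLin (psi j 0) = 0 ∧
        divLin (-(Complex.I * lam * k 0)) (-(Complex.I * lam * k 1)) (psi j 0) = 0) ∧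
      pressureLin (psi 2 0) ≠ 0 ∧
      (p kappa 0 = mu → densityLin (psi 0 0) = 0 ∧
        curlLin (-(Complex.I * lam * k 0)) (-(Complex.I * lam * k 1)) (psi 0 0) ≠ 0 ∧
        densityLin (psi 1 0) ≠ 0 ∧
        curlLin (-(Complex.I * lam * k 0)) (-(Complex.I * lam * k 1)) (psi 1 0) = 0) ∧
      (p kappa 0 ≠ mu → densityLin (psi 1 0) = 0 ∧
        curlLin (-(Complex.I * lam * k 0)) (-(Complex.I * lam * k 1)) (psi 1 0) ≠ 0 ∧
        densityLin (psi 0 0) ≠ 0 ∧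
        curlLin (-(Complex.I * lam * k 0)) (-(Complex.I * lam * k 1)) (psi 0 0) = 0) := by
    intro k hk
    obtain ⟨psi, theta, hli, hexp⟩ := h k
    rw [hk] at hexp
    set x : ℂ := -(Complex.I * lam * k 0)
    set y : ℂ := -(Complex.I * lam * k 1)
    have hq : x ^ 2 + y ^ 2 = q := by rw [hqdef, ← hk, waveVector_sq]
    have hrow := fun j => (hexp j).row0_row1 (S := S) (T := T) hC rfl rfl rfl rfl
    have hl' : ∀ v, (macroOf C v).l = A * (macroOf C v).r + B * (macroOf C v).p := fun v => by
      simp only [macroOf, hl, hC.r, hC.p]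
    have hv : ∀ j : Fin 4, ∀ m1, modeCoeff c0 kappa (p kappa) (pt kappa) (pb kappa) j 0 = 0 →
        modeCoeff c0 kappa (p kappa) (pt kappa) (pb kappa) j 1 = m1 →
        pressureLin (psi j 0) = 0 ∧ divLin x y (psi j 0) = 0 ∧
        (m1 - mu) * curlLin x y (psi j 0) = 0 ∧ g * (m1 - nu) * densityLin (psi j 0) = 0 := by
      intro j m1 e0 e1
      have hr := hrow j
      rw [e0, e1] at hr
      obtain ⟨h1, h2, h3, h4⟩ := hr.2.vortical hq hq0 hr.1 (hl' _)
      rw [hC.macroOf_p] at h1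
      rw [hC.macroOf_div] at h2
      rw [hC.macroOf_curl] at h3
      rw [hC.macroOf_r] at h4
      refine ⟨h1, h2, by rw [hmu]; linear_combination h3, ?_⟩
      rw [hnu, mul_sub, mul_div_cancel₀ _ hg0]
      exact h4
    obtain ⟨v1, v2, v3, v4⟩ := hv 0 (p kappa 0) rfl rfl
    obtain ⟨u1, u2, u3, u4⟩ := hv 1 (p kappa 1) rfl rfl
    have hli2 : LinearIndependent ℂ ![consLin (psi 0 0), consLin (psi 1 0)] := by
      have := hli.comp ![(0 : Fin 4), 1] (by decide)
      convert this using 1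
      funext i
      fin_cases i <;> rfl
    refine ⟨psi, theta, hexp, ?_, ?_,
      shear_and_thermal hq hq0 hli2 v1 v2 u1 u2 hg0 hmn v3 v4 u3 u4⟩
    · intro j hj
      obtain ⟨n, hn⟩ := j
      simp only at hj
      interval_cases n
      exacts [⟨v1, v2⟩, ⟨u1, u2⟩]
    · intro hp
      have hr := (hrow 2).1
      have hm0 : modeCoeff c0 kappa (p kappa) (pt kappa) (pb kappa) 2 0
          = c0 * (Complex.I * kappa) := rfl
      rw [hm0] at hr
      have e1 := hr.div_law hq
      have e2 := hr.curl_law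
      have e3 := hr.mass_law
      rw [hC.macroOf_p, hC.macroOf_div, hp] at e1
      rw [hC.macroOf_curl] at e2
      rw [hC.macroOf_r, hC.macroOf_div] at e3
      have hd : divLin x y (psi 2 0) = 0 :=
        (mul_eq_zero.1 (by linear_combination e1)).resolve_left hma
      have hc := (mul_eq_zero.1 e2).resolve_left hma
      have hr : densityLin (psi 2 0) = 0 :=
        (mul_eq_zero.1 (by linear_combination e3 - hd)).resolve_left hma
      exact hli.ne_zero 2 (consLin_eq_zero hq hq0 hr hp hd hc)
  -- Which of the two modes is the shear mode depends on `kappa` alone, because `p` does; the same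
  -- labelling, hence the same rates, is valid in every direction.
  by_cases hp : p kappa 0 = mu
  · refine ⟨modeCoeff c0 kappa (p kappa) (pt kappa) (pb kappa) 0,
      modeCoeff c0 kappa (p kappa) (pt kappa) (pb kappa) 1,
      modeCoeff c0 kappa (p kappa) (pt kappa) (pb kappa) 2, rfl, rfl, rfl, fun k hk => ?_⟩
    obtain ⟨psi, theta, hexp, hv, ha, h1, -⟩ := key k hk
    obtain ⟨h1, h2, h3, h4⟩ := h1 hp
    exact ⟨hC.exists_isShearMode (hexp 0) h1 (hv 0 (by decide)).1 (hv 0 (by decide)).2 h2,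
      hC.exists_isThermalMode (hexp 1) h3 (hv 1 (by decide)).1 (hv 1 (by decide)).2 h4,
      hC.exists_isAcousticMode (hexp 2) ha⟩
  · refine ⟨modeCoeff c0 kappa (p kappa) (pt kappa) (pb kappa) 1,
      modeCoeff c0 kappa (p kappa) (pt kappa) (pb kappa) 0,
      modeCoeff c0 kappa (p kappa) (pt kappa) (pb kappa) 2, rfl, rfl, rfl, fun k hk => ?_⟩
    obtain ⟨psi, theta, hexp, hv, ha, -, h1⟩ := key k hk
    obtain ⟨h1, h2, h3, h4⟩ := h1 hp
    exact ⟨hC.exists_isShearMode (hexp 1) h1 (hv 1 (by decide)).1 (hv 1 (by decide)).2 h2,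
      hC.exists_isThermalMode (hexp 0) h3 (hv 0 (by decide)).1 (hv 0 (by decide)).2 h4,
      hC.exists_isAcousticMode (hexp 2) ha⟩

/-! ### Comparison of two directions at orders two and three. -/

/-- The anisotropic part of the decay rate of an acoustic mode at order three. -/
def acousticDefect (g S T q x y m0 D F X Y : ℂ) : ℂ :=
  m0 * (T * (8631 * D + 80 * F) * (x ^ 4 - q * x ^ 2)
      + m0 * (1 / 3 * (S + T) * (X * x ^ 3 - Y * x ^ 2 * y)
        + q * (-(3 / 10) * S * X * x + 1 / 30 * S * Y * y - 1 / 2 * T * X * x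
          - 1 / 6 * T * Y * y)))
    - g * (m0 * (S + T) * (6680 * D + 96 * F) * (x ^ 4 - q * x ^ 2)
      + S * (1 / 3 * (X * x ^ 5 + Y * x ^ 4 * y) - 2 / 3 * Y * q * x ^ 2 * y
        - 17 / 60 * X * q ^ 2 * x + 1 / 20 * Y * q ^ 2 * y))

/-- The anisotropic part of the decay rate of a shear mode at order three. -/
def shearDefect (S q x y X Y : ℂ) : ℂ :=
  S * (-(1 / 3) * X * x ^ 4 * y + 1 / 3 * Y * x ^ 5 - 2 / 3 * Y * q * x ^ 3
    + 1 / 15 * X * q ^ 2 * y + 4 / 15 * Y * q ^ 2 * x)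

variable {g S T s2 q x y x' y' A B : ℂ} {m : Fin 4 → ℂ} {w w' : Fin 4 → Macro}

/-- For a normalized shear mode with `D = F = 0`, the curl law of order three is `m 3` plus terms in
`q` plus the defect; all but the defect are common to both directions. -/
lemma IsShearMode.defect_eq (h : Rows g S T s2 q x y m w) (h' : Rows g S T s2 q x' y' m w')
    (hm : m 0 = 0) (hs : IsShearMode x y w) (hs' : IsShearMode x' y' w')
    (hD : (w 0).D = 0 ∧ (w 0).F = 0) (hD' : (w' 0).D = 0 ∧ (w' 0).F = 0) :
    shearDefect S q x y (w 0).X (w 0).Y = shearDefect S q x' y' (w' 0).X (w' 0).Y := by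
  have e := h.row3.curl
  have e' := h'.row3.curl
  simp only [curlLaw3, hs.curl, hs.curl1, hs.curl2, hs.curl3, hs'.curl, hs'.curl1, hs'.curl2,
    hs'.curl3, hm, hD.1, hD.2, hD'.1, hD'.2] at e e'
  simp only [shearDefect]
  linear_combination e - e'

lemma IsThermalMode.fields (hq : x ^ 2 + y ^ 2 = q) (hq0 : q ≠ 0)
    (h : Rows g S T s2 q x y m w) (hm : m 0 = 0) (ht : IsThermalMode x y w)
    (hl : (w 0).l = A * (w 0).r + B * (w 0).p) :
    (w 1).div x y = -m 1 ∧ (w 1).p = 0 ∧ (w 2).div x y = -m 2 ∧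
      q * (w 2).p = m 1 ^ 2 + 1 / 2 * S * g * m 1 * q + 1 / 12 * A * q ^ 2 := by
  have a1 := h.row1.mass_law
  have a2 := h.row1.div_law hq
  have a3 := h.row2.mass
  have a4 := h.row2.div
  rw [ht.p, ht.r] at hl
  rw [hm, ht.r] at a1
  rw [hm, ht.div] at a2
  simp only [massLaw2, hm, ht.r, ht.r1] at a3
  simp only [divLaw2, hm, ht.r, ht.p, hl, ht.r1] at a4
  exact ⟨by linear_combination a1, (mul_eq_zero.1 (by linear_combination a2)).resolve_left hq0,
    by linear_combination a3, by linear_combination a4⟩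

/-- The right-hand side does not depend on direction. This makes `x X + y Y` constant on a circle of
wave vectors when its coefficient is nonzero. -/
lemma IsThermalMode.order_two (hq : x ^ 2 + y ^ 2 = q) (hq0 : q ≠ 0)
    (h : Rows g S T s2 q x y m w) (hm : m 0 = 0) (ht : IsThermalMode x y w)
    (hl : ∀ n, (w n).l = A * (w n).r + B * (w n).p) :
    (3 / 5 * T * s2 - 1 / 20) * q * (x * (w 0).X + y * (w 0).Y) = g * m 2 := by
  obtain ⟨d1, p1, d2, p2⟩ := ht.fields hq hq0 h hm (hl 0)
  have l1 := hl 1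
  rw [ht.r1, p1] at l1
  have e := h.row2.energy
  simp only [energyLaw2, hm, ht.r, ht.p, p1, d2, l1] at e
  linear_combination e

/-- The divergence of order three is unknown in each direction; energy minus `g` times mass
eliminates it and leaves the quartic defect. -/
lemma IsThermalMode.defect_eq (hq : x ^ 2 + y ^ 2 = q) (hq' : x' ^ 2 + y' ^ 2 = q) (hq0 : q ≠ 0)
    (h : Rows g S T s2 q x y m w) (h' : Rows g S T s2 q x' y' m w') (hm : m 0 = 0)
    (ht : IsThermalMode x y w) (ht' : IsThermalMode x' y' w')
    (hl : ∀ n, (w n).l = A * (w n).r + B * (w n).p)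
    (hl' : ∀ n, (w' n).l = A * (w' n).r + B * (w' n).p)
    (hX : ∀ n, (w n).X = 0 ∧ (w n).Y = 0) (hX' : ∀ n, (w' n).X = 0 ∧ (w' n).Y = 0)
    (hD : (w' 0).D = (w 0).D) (hF : (w' 0).F = (w 0).F) :
    T * ((8631 - 3340 * g) * (w 0).D + (80 - 48 * g) * (w 0).F)
      * ((x ^ 4 - q * x ^ 2) - (x' ^ 4 - q * x' ^ 2)) = 0 := by
  obtain ⟨d1, p1, d2, p2⟩ := ht.fields hq hq0 h hm (hl 0)
  obtain ⟨d1', p1', d2', p2'⟩ := ht'.fields hq' hq0 h' hm (hl' 0)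
  have p2e : (w' 2).p = (w 2).p := mul_left_cancel₀ hq0 (p2'.trans p2.symm)
  have l0 := hl 0
  have l1 := hl 1
  have l2 := hl 2
  have l0' := hl' 0
  have l1' := hl' 1
  have l2' := hl' 2
  rw [ht.p, ht.r] at l0
  rw [ht'.p, ht'.r] at l0'
  rw [p1, ht.r1] at l1
  rw [p1', ht'.r1] at l1'
  rw [ht.r2] at l2
  rw [ht'.r2, p2e] at l2'
  have e1 := h.row3.energy
  have e2 := h.row3.mass
  have e1' := h'.row3.energy
  have e2' := h'.row3.mass
  simp only [energyLaw3, massLaw3, hm, ht.r, ht.p, ht.r1, ht.r2, d2, p1, l0, l1, l2, hX,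
    ht'.r, ht'.p, ht'.r1, ht'.r2, d2', p1', p2e, l0', l1', l2', hX', hD, hF] at e1 e2 e1' e2'
  linear_combination e1 - g * e2 - e1' + g * e2'

/-- The low order fields of an acoustic mode do not depend on the direction. -/
lemma IsAcousticMode.fields (hq : x ^ 2 + y ^ 2 = q) (hq' : x' ^ 2 + y' ^ 2 = q)
    (hm : m 0 ≠ 0) (h : Row0 g x y (m 0) (w 0)) (h' : Row0 g x' y' (m 0) (w' 0))
    (h1 : Row1 g S T x y (m 0) (m 1) (w 0) (w 1))
    (h1' : Row1 g S T x' y' (m 0) (m 1) (w' 0) (w' 1))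
    (ha : IsAcousticMode w) (ha' : IsAcousticMode w') :
    (w' 0).div x' y' = (w 0).div x y ∧ (w' 0).r = (w 0).r ∧ (w' 1).div x' y' = (w 1).div x y ∧
      (w' 1).r = (w 1).r := by
  have a1 := h.div_law hq
  have a1' := h'.div_law hq'
  rw [ha.p] at a1
  rw [ha'.p] at a1'
  have d0 : (w' 0).div x' y' = (w 0).div x y :=
    mul_left_cancel₀ hm (by linear_combination a1' - a1)
  have r0 : (w' 0).r = (w 0).r :=
    mul_left_cancel₀ hm (by linear_combination h'.mass_law - h.mass_law - d0)
  have b1 := h1.div_law hq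
  have b1' := h1'.div_law hq'
  rw [ha.p1] at b1
  rw [ha'.p1, d0] at b1'
  have d1 : (w' 1).div x' y' = (w 1).div x y :=
    mul_left_cancel₀ hm (by linear_combination b1' - b1)
  have c1' := h1'.mass_law
  rw [r0, d1] at c1'
  exact ⟨d0, r0, d1, mul_left_cancel₀ hm (by linear_combination c1' - h1.mass_law)⟩

/-- The combination `m0 · energy - g · divergence` eliminates the unknown divergence of order two.
With the pressure normalized, everything else is common to both directions except `x X + y Y`. -/
lemma IsAcousticMode.order_two (hq : x ^ 2 + y ^ 2 = q) (hq' : x' ^ 2 + y' ^ 2 = q) (hq0 : q ≠ 0)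
    (hm : m 0 ≠ 0) (h : Rows g S T s2 q x y m w) (h' : Rows g S T s2 q x' y' m w')
    (ha : IsAcousticMode w) (ha' : IsAcousticMode w')
    (hl : ∀ n, (w n).l = A * (w n).r + B * (w n).p)
    (hl' : ∀ n, (w' n).l = A * (w' n).r + B * (w' n).p) (hs2 : 3 / 5 * T * s2 - 1 / 20 ≠ 0) :
    x' * (w' 0).X + y' * (w' 0).Y = x * (w 0).X + y * (w 0).Y := by
  obtain ⟨d0, r0, d1, r1⟩ := ha.fields hq hq' hm h.row0 h'.row0 h.row1 h'.row1 ha'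
  have l0' := hl' 0
  rw [r0, ha'.p] at l0'
  have l0 := hl 0
  rw [ha.p] at l0
  have l1' := hl' 1
  rw [r1, ha'.p1] at l1'
  have l1 := hl 1
  rw [ha.p1] at l1
  have e1 := h.row2.energy
  have e2 := h.row2.div
  have e1' := h'.row2.energy
  have e2' := h'.row2.div
  simp only [energyLaw2, divLaw2, ha.p, ha.p1, ha.p2, l0, l1, ha'.p, ha'.p1, ha'.p2, r0, r1, l0',
    l1'] at e1 e2 e1' e2'
  refine mul_left_cancel₀ (mul_ne_zero hm (mul_ne_zero hs2 hq0)) ?_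
  linear_combination m 0 * (e1' - e1) - g * (e2' - e2)

/-- The same elimination one order higher. The hypotheses on `x X + y Y` at orders zero and one
remove the terms that depend on `s2`. -/
lemma IsAcousticMode.defect_eq (hq : x ^ 2 + y ^ 2 = q) (hq' : x' ^ 2 + y' ^ 2 = q)
    (hm : m 0 ≠ 0) (h : Rows g S T s2 q x y m w) (h' : Rows g S T s2 q x' y' m w')
    (ha : IsAcousticMode w) (ha' : IsAcousticMode w')
    (hl : ∀ n, (w n).l = A * (w n).r + B * (w n).p)
    (hl' : ∀ n, (w' n).l = A * (w' n).r + B * (w' n).p)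
    (hD : (w' 0).D = (w 0).D) (hF : (w' 0).F = (w 0).F)
    (hX0 : x' * (w' 0).X + y' * (w' 0).Y = x * (w 0).X + y * (w 0).Y)
    (hX1 : x' * (w' 1).X + y' * (w' 1).Y = x * (w 1).X + y * (w 1).Y) :
    acousticDefect g S T q x' y' (m 0) (w 0).D (w 0).F (w' 0).X (w' 0).Y
      = acousticDefect g S T q x y (m 0) (w 0).D (w 0).F (w 0).X (w 0).Y := by
  obtain ⟨d0, r0, d1, r1⟩ := ha.fields hq hq' hm h.row0 h'.row0 h.row1 h'.row1 ha'
  have l0' := hl' 0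
  rw [r0, ha'.p] at l0'
  have l0 := hl 0
  rw [ha.p] at l0
  have l1' := hl' 1
  rw [r1, ha'.p1] at l1'
  have l1 := hl 1
  rw [ha.p1] at l1
  have d2 : (w' 2).div x' y' = (w 2).div x y := by
    have e2 := h.row2.div
    have e2' := h'.row2.div
    simp only [divLaw2, ha.p, ha.p2, l0, ha'.p, ha'.p2, r0, r1, l0'] at e2 e2'
    exact mul_left_cancel₀ hm (by linear_combination e2' - e2)
  have r2 : (w' 2).r = (w 2).r := by
    have e2 := h.row2.mass
    have e2' := h'.row2.mass
    simp only [massLaw2, r0, r1, d2] at e2 e2'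
    exact mul_left_cancel₀ hm (by linear_combination e2' - e2)
  have l2' := hl' 2
  rw [r2, ha'.p2] at l2'
  have l2 := hl 2
  rw [ha.p2] at l2
  have e1 := h.row3.energy
  have e2 := h.row3.div
  have e1' := h'.row3.energy
  have e2' := h'.row3.div
  simp only [energyLaw3, divLaw3, ha.p, ha.p1, ha.p2, ha.p3, l0, l1, l2, ha'.p, ha'.p1, ha'.p2,
    ha'.p3, r0, r1, r2, d2, l0', l1', l2', hD, hF] at e1 e2 e1' e2'
  simp only [acousticDefect]
  linear_combination m 0 * (e1' - e1) - g * (e2' - e2)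
    - m 0 * (m 0 * (3 / 5 * T * q * s2 ^ 2 + 6 / 5 * T ^ 2 * q * s2 - 3 / 20 * q * s2)) * hX0
    - m 0 * q * (3 / 5 * T * s2 - 1 / 20) * hX1 - g * (1 / 20 * q ^ 2 * s2) * hX0

/-! ### The shear mode along an axis and along a diagonal, for arbitrary rates. -/

/-- The streaming operator in a sector of six moments `(u, s, q, r, t, e)` that contains one
component of the momentum. -/
structure Sector where
  a : Fin 4 → ℂ
  b : Fin 3 → ℂ
  c : Fin 3 → ℂ
  f : Fin 3 → ℂ

/-- The action of the streaming operator of a sector. -/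
def Sector.step (G : Sector) (X : ℂ) (v : Fin 6 → ℂ) : Fin 6 → ℂ :=
  ![X * v 1, X * (G.a 0 * v 0 + G.a 1 * v 2 + G.a 2 * v 3 + G.a 3 * v 4),
    X * (G.b 0 * v 1 + G.c 0 * v 5), X * (G.b 1 * v 1 + G.c 1 * v 5),
    X * (G.b 2 * v 1 + G.c 2 * v 5), X * (G.f 0 * v 2 + G.f 1 * v 3 + G.f 2 * v 4)]

/-- The decay rate at order three of the shear mode in a sector; `P = X ^ 2`, and `k` gives the
equilibria of `q, r, t`. -/
def Sector.rate (G : Sector) (S T s9 s15 s13 P : ℂ) (k : Fin 3 → ℂ) : ℂ :=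
  let al := G.a 0 + G.a 1 * k 0 + G.a 2 * k 1 + G.a 3 * k 2
  let de := G.f 0 * k 0 + G.f 1 * k 1 + G.f 2 * k 2
  let Q : Fin 3 → ℂ := fun i => P * (G.b i * S * al + G.c i * s13 * de) - P * S * al * k i;
  -(P * S * (G.a 1 * T * Q 0 + G.a 2 * s9 * Q 1 + G.a 3 * s15 * Q 2 - P * S * al * (S * al)
      - P / 12 * (G.a 0 * al + G.a 1 * (G.b 0 * al + G.c 0 * de)
        + G.a 2 * (G.b 1 * al + G.c 1 * de) + G.a 3 * (G.b 2 * al + G.c 2 * de))))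
    + P / 12 * (G.a 1 * Q 0 + G.a 2 * Q 1 + G.a 3 * Q 2) - P * S * al * P * al / 6

/-- The projection of an expansion with `m 0 = 0` on a sector. -/
structure SectorExpansion (G : Sector) (X : ℂ) (S T s9 s15 s13 : ℂ) (k : Fin 3 → ℂ)
    (m : Fin 4 → ℂ) (v t : Fin 4 → Fin 6 → ℂ) : Prop where
  theta0 : t 0 = G.step X (v 0)
  theta1 : t 1 = G.step X (v 1) + m 1 • v 0
  theta2 : t 2 = G.step X (v 2) + m 1 • v 1 + m 2 • v 0
    - (1 / 12 : ℂ) • G.step X (G.step X (t 0))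
  theta3 : t 3 = G.step X (v 3) + m 1 • v 2 + m 2 • v 1 + m 3 • v 0
    - (1 / 12 : ℂ) • (G.step X (G.step X (t 1)) + (2 * m 1) • G.step X (t 0))
  conserved : ∀ n, t n 0 = 0
  relax0 : v 0 = ![v 0 0, 0, k 0 * v 0 0, k 1 * v 0 0, k 2 * v 0 0, 0]
  relax : ∀ n : Fin 3, v n.succ = ![v n.succ 0, S * t n.castSucc 1,
    k 0 * v n.succ 0 + T * t n.castSucc 2, k 1 * v n.succ 0 + s9 * t n.castSucc 3,
    k 2 * v n.succ 0 + s15 * t n.castSucc 4, s13 * t n.castSucc 5]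

variable {G : Sector} {X S T s9 s15 s13 : ℂ} {k : Fin 3 → ℂ} {m : Fin 4 → ℂ}
  {v t : Fin 4 → Fin 6 → ℂ}

/-- Streaming exchanges `{u, q, r, t}` with `{s, e}`. After normalization even orders of `v` lie in
the first group and odd ones, up to the order used, in the second, so `m 2 = 0` and the conservation
of `u` at orders one and three gives `m 1` and `m 3`. -/
lemma SectorExpansion.rate_eq (h : SectorExpansion G X S T s9 s15 s13 k m v t) (h0 : v 0 0 ≠ 0)
    (h1 : v 1 0 = 0) (h2 : v 2 0 = 0) (h3 : v 3 0 = 0) :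
    m 3 = G.rate S T s9 s15 s13 (X ^ 2) k := by
  have r1 := h.relax 0
  have r2 := h.relax 1
  have r3 := h.relax 2
  change v 1 = ![v 1 0, S * t 0 1, k 0 * v 1 0 + T * t 0 2, k 1 * v 1 0 + s9 * t 0 3,
    k 2 * v 1 0 + s15 * t 0 4, s13 * t 0 5] at r1
  change v 2 = ![v 2 0, S * t 1 1, k 0 * v 2 0 + T * t 1 2, k 1 * v 2 0 + s9 * t 1 3,
    k 2 * v 2 0 + s15 * t 1 4, s13 * t 1 5] at r2
  change v 3 = ![v 3 0, S * t 2 1, k 0 * v 3 0 + T * t 2 2, k 1 * v 3 0 + s9 * t 2 3,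
    k 2 * v 3 0 + s15 * t 2 4, s13 * t 2 5] at r3
  rw [h1] at r1
  rw [h2] at r2
  rw [h3] at r3
  have v0 := h.relax0
  set u := v 0 0
  set al := G.a 0 + G.a 1 * k 0 + G.a 2 * k 1 + G.a 3 * k 2 with hal
  set de := G.f 0 * k 0 + G.f 1 * k 1 + G.f 2 * k 2 with hde
  have e0 : t 0 = ![0, X * al * u, 0, 0, 0, X * de * u] := by
    rw [h.theta0, v0]
    funext i
    fin_cases i <;> simp [Sector.step, al, de] <;> ring
  have r1' : v 1 = ![0, S * (X * al * u), 0, 0, 0, s13 * (X * de * u)] := by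
    rw [r1, e0]
    funext i
    fin_cases i <;> simp
  have m1 : m 1 = -(X ^ 2 * S * al) := by
    have e := h.conserved 1
    rw [h.theta1, r1', v0] at e
    simp [Sector.step] at e
    exact mul_right_cancel₀ h0 (by linear_combination e)
  have e1 : t 1 = ![0, 0, (X ^ 2 * (G.b 0 * S * al + G.c 0 * s13 * de) + m 1 * k 0) * u,
      (X ^ 2 * (G.b 1 * S * al + G.c 1 * s13 * de) + m 1 * k 1) * u,
      (X ^ 2 * (G.b 2 * S * al + G.c 2 * s13 * de) + m 1 * k 2) * u, 0] := by
    rw [h.theta1, r1', v0]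
    funext i
    fin_cases i
    · simp [Sector.step, m1]; ring
    all_goals simp [Sector.step]
    all_goals ring
  have r2' : v 2 = ![0, 0, T * t 1 2, s9 * t 1 3, s15 * t 1 4, 0] := by
    rw [r2, e1]
    funext i
    fin_cases i <;> simp
  have m2 : m 2 * u = 0 := by
    have e := h.conserved 2
    rw [h.theta2, r2', r1', v0, e0] at e
    simpa [Sector.step] using e
  have m2' : m 2 = 0 := (mul_eq_zero.1 m2).resolve_right h0
  have e2 : t 2 1 = X * (G.a 1 * (T * t 1 2) + G.a 2 * (s9 * t 1 3) + G.a 3 * (s15 * t 1 4))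
      + m 1 * (S * (X * al * u)) - 1 / 12 * (X * (G.a 0 * (X * (X * al * u))
        + G.a 1 * (X * (G.b 0 * (X * al * u) + G.c 0 * (X * de * u)))
        + G.a 2 * (X * (G.b 1 * (X * al * u) + G.c 1 * (X * de * u)))
        + G.a 3 * (X * (G.b 2 * (X * al * u) + G.c 2 * (X * de * u))))) := by
    rw [h.theta2, r2', r1', v0, e0]
    simp [Sector.step]
  have e := h.conserved 3
  rw [h.theta3, r3, r2', r1', v0, m2', e0] at e
  simp [Sector.step] at e
  rw [e2, e1] at e
  simp at e
  refine mul_right_cancel₀ h0 ?_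
  simp only [Sector.rate, ← hal, ← hde]
  rw [m1] at e
  linear_combination e

/-- The shear sector at a wave vector along an axis. -/
def axisSector : Sector where
  a := ![34 / 15, 101 / 465, 2 / 5, 4 / 155]
  b := ![101 / 17, 9 / 17, 36 / 17]
  c := ![72 / 17, -(2 / 17), -(110 / 17)]
  f := ![24 / 155, -(4 / 45), -(22 / 279)]

/-- The shear sector at a wave vector along the diagonal. -/
def diagonalSector : Sector where
  a := ![17 / 15, -(47 / 465), -(4 / 5), -(8 / 155)]
  b := ![-(94 / 17), -(36 / 17), -(144 / 17)]
  c := ![36 / 17, -(26 / 17), 100 / 17]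
  f := ![6 / 155, -(26 / 45), 10 / 279]

/-- The projection on the shear sector along an axis. -/
def axisProj : (Fin 17 → ℂ) →ₗ[ℂ] (Fin 6 → ℂ) where
  toFun v := ![v 2, v 5, v 7, v 9, v 11, v 13]
  map_add' u v := by simp
  map_smul' c v := by simp

/-- The projection on the shear sector along the diagonal. -/
def diagonalProj : (Fin 17 → ℂ) →ₗ[ℂ] (Fin 6 → ℂ) where
  toFun v := ![v 1 - v 2, v 4, v 6 - v 7, v 8 - v 9, v 10 - v 11, v 12]
  map_add' u v := by
    funext i
    fin_cases i <;> simp <;> ring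
  map_smul' c v := by
    funext i
    fin_cases i <;> simp <;> ring

/-- A wave vector along the first axis is fixed by the reflection of the second coordinate. The six
moments are those odd under this reflection, hence streaming preserves them. -/
lemma axisProj_advect (X : ℂ) (v : Fin 17 → ℂ) :
    axisProj (advect X 0 v) = axisSector.step X (axisProj v) := by
  funext i
  fin_cases i <;> simp [axisProj, Sector.step, axisSector, advect_2, advect_5, advect_7, advect_9,
    advect_11, advect_13] <;> ring

/-- Along the diagonal the symmetry is the exchange of coordinates, and the six combinations are the
antisymmetric ones. -/
lemma diagonalProj_advect (X : ℂ) (v : Fin 17 → ℂ) :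
    diagonalProj (advect X X v) = diagonalSector.step X (diagonalProj v) := by
  funext i
  fin_cases i <;> simp [diagonalProj, Sector.step, diagonalSector, advect_1, advect_2, advect_4,
    advect_6, advect_7, advect_8, advect_9, advect_10, advect_11, advect_12] <;> ring

/-- The coefficients of the equilibria of `q, r, τ`. -/
def vectorCoeff (g : ℂ) : Fin 3 → ℂ := ![6 * g - 17, (31 - 21 * g) / 6, (555 * g - 596) / 24]

section

variable {g S T s9 s13 s15 x y X : ℂ} {Q : Matrix (Fin 17) (Fin 4) ℂ}
  {C : ℂ → ℂ → ℂ → ℂ → Macro} {sig : Fin 17 → ℂ} {m : Fin 4 → ℂ} {psi theta : Fin 4 → Fin 17 → ℂ}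

lemma IsExpansion.sectorExpansion {G : Sector} {k : Fin 3 → ℂ} (π : (Fin 17 → ℂ) →ₗ[ℂ] (Fin 6 → ℂ))
    (hπ : ∀ v, π (advect x y v) = G.step X (π v)) (h : IsExpansion x y sig Q m psi theta)
    (hm : m 0 = 0) (hc : ∀ n, π (theta n) 0 = 0)
    (h0 : π (psi 0) = ![π (psi 0) 0, 0, k 0 * π (psi 0) 0, k 1 * π (psi 0) 0,
      k 2 * π (psi 0) 0, 0])
    (h1 : ∀ n : Fin 3, π (psi n.succ) = ![π (psi n.succ) 0, S * π (theta n.castSucc) 1,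
      k 0 * π (psi n.succ) 0 + T * π (theta n.castSucc) 2,
      k 1 * π (psi n.succ) 0 + s9 * π (theta n.castSucc) 3,
      k 2 * π (psi n.succ) 0 + s15 * π (theta n.castSucc) 4, s13 * π (theta n.castSucc) 5]) :
    SectorExpansion G X S T s9 s15 s13 k m (fun n => π (psi n)) (fun n => π (theta n)) := by
  refine ⟨?_, ?_, ?_, ?_, hc, h0, h1⟩
  · simp only [h.theta0, hm, zero_smul, add_zero, hπ]
  · simp only [h.theta1, hm, zero_smul, add_zero, hπ, map_add, map_smul]
  · simp only [h.theta2, hm, zero_smul, add_zero, hπ, map_add, map_sub, map_smul]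
  · simp only [h.theta3, hm, zero_smul, add_zero, hπ, map_add, map_sub, map_smul]

lemma IsExpansion.relax_eq (hC : IsClosure g Q C) (h : IsExpansion x y sig Q m psi theta)
    (n : Fin 3) {k : Fin 17} (hk : 4 ≤ (k : ℕ)) {s c : ℂ} (hs : sig k = s)
    (hc : moments g (macroOf C (psi n.succ)) k = c) :
    psi n.succ k = c + s * theta n.castSucc k := by
  rw [h.relax n k hk, hC.equilibrium_eq _ k hk, hs, hc]

lemma IsExpansion.relax0_eq (hC : IsClosure g Q C) (h : IsExpansion x y sig Q m psi theta)
    {k : Fin 17} (hk : 4 ≤ (k : ℕ)) {c : ℂ} (hc : moments g (macroOf C (psi 0)) k = c) :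
    psi 0 k = c := by
  rw [h.relax0 k hk, hC.equilibrium_eq _ k hk, hc]

lemma IsClosure.moments_vector (hC : IsClosure g Q C)
    (hX : ∀ r jx jy p, (C r jx jy p).X = 0 ∧ (C r jx jy p).Y = 0) (v : Fin 17 → ℂ) (i : Fin 3)
    (b : Fin 2) : moments g (macroOf C v) ⟨6 + 2 * i + b, by omega⟩
      = vectorCoeff g i * v ⟨1 + b, by omega⟩ := by
  have e1 : (macroOf C v).X = 0 := (hX ..).1
  have e2 : (macroOf C v).Y = 0 := (hX ..).2
  have e3 : (macroOf C v).jx = v 1 := hC.jx ..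
  have e4 : (macroOf C v).jy = v 2 := hC.jy ..
  fin_cases i <;> fin_cases b <;> simp [moments, vectorCoeff, e1, e2, e3, e4] <;> ring

lemma IsExpansion.axis_rate (hC : IsClosure g Q C)
    (hX : ∀ r jx jy p, (C r jx jy p).X = 0 ∧ (C r jx jy p).Y = 0) (h5 : sig 5 = S) (h7 : sig 7 = T)
    (h9 : sig 9 = s9) (h11 : sig 11 = s15) (h13 : sig 13 = s13)
    (h : IsExpansion x 0 sig Q m psi theta) (hm : m 0 = 0)
    (hs : IsShearMode x 0 (fun n => macroOf C (psi n))) :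
    m 3 = axisSector.rate S T s9 s15 s13 (x ^ 2) (vectorCoeff g) := by
  have m7 := fun v => hC.moments_vector hX v 0 1
  have m9 := fun v => hC.moments_vector hX v 1 1
  have m11 := fun v => hC.moments_vector hX v 2 1
  have e := h.sectorExpansion (G := axisSector) (k := vectorCoeff g) (S := S) (T := T) (s9 := s9)
    (s15 := s15) (s13 := s13) axisProj (axisProj_advect x) hm (fun n => h.conserved n 2) ?_ ?_
  · have hcurl : ∀ n, (macroOf C (psi n)).curl x 0 = x * psi n 2 := fun n => by
      simp [Macro.curl, macroOf, hC.jy]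
    have c0 := (hcurl 0).symm.trans hs.curl
    have hx : x ≠ 0 := left_ne_zero_of_mul_eq_one c0
    exact e.rate_eq (right_ne_zero_of_mul_eq_one c0)
      ((mul_eq_zero.1 ((hcurl 1).symm.trans hs.curl1)).resolve_left hx)
      ((mul_eq_zero.1 ((hcurl 2).symm.trans hs.curl2)).resolve_left hx)
      ((mul_eq_zero.1 ((hcurl 3).symm.trans hs.curl3)).resolve_left hx)
  · funext i
    fin_cases i
    · rfl
    · exact h.relax0_eq hC (by decide) rfl
    · exact h.relax0_eq hC (by decide) (m7 _)
    · exact h.relax0_eq hC (by decide) (m9 _)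
    · exact h.relax0_eq hC (by decide) (m11 _)
    · exact h.relax0_eq hC (by decide) rfl
  · intro n
    funext i
    fin_cases i
    · rfl
    · exact (h.relax_eq hC n (by decide) h5 rfl).trans (zero_add _)
    · exact h.relax_eq hC n (by decide) h7 (m7 _)
    · exact h.relax_eq hC n (by decide) h9 (m9 _)
    · exact h.relax_eq hC n (by decide) h11 (m11 _)
    · exact (h.relax_eq hC n (by decide) h13 rfl).trans (zero_add _)

lemma IsExpansion.diagonal_rate (hC : IsClosure g Q C)
    (hX : ∀ r jx jy p, (C r jx jy p).X = 0 ∧ (C r jx jy p).Y = 0) (h4 : sig 4 = S)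
    (h6 : sig 6 = T) (h7 : sig 7 = T) (h8 : sig 8 = s9) (h9 : sig 9 = s9) (h10 : sig 10 = s15)
    (h11 : sig 11 = s15) (h12 : sig 12 = s13)
    (h : IsExpansion x x sig Q m psi theta) (hm : m 0 = 0)
    (hs : IsShearMode x x (fun n => macroOf C (psi n))) :
    m 3 = diagonalSector.rate S T s9 s15 s13 (x ^ 2) (vectorCoeff g) := by
  have m6 := fun v => hC.moments_vector hX v 0 0
  have m7 := fun v => hC.moments_vector hX v 0 1
  have m8 := fun v => hC.moments_vector hX v 1 0
  have m9 := fun v => hC.moments_vector hX v 1 1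
  have m10 := fun v => hC.moments_vector hX v 2 0
  have m11 := fun v => hC.moments_vector hX v 2 1
  have e := h.sectorExpansion (G := diagonalSector) (k := vectorCoeff g) (S := S) (T := T)
    (s9 := s9) (s15 := s15) (s13 := s13) diagonalProj (diagonalProj_advect x) hm
    (fun n => sub_eq_zero.2 ((h.conserved n 1).trans (h.conserved n 2).symm)) ?_ ?_
  · have hcurl : ∀ n, (macroOf C (psi n)).curl x x = -x * (psi n 1 - psi n 2) := fun n => by
      simp only [Macro.curl, macroOf, hC.jx, hC.jy]
      ring
    have c0 := (hcurl 0).symm.trans hs.curl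
    have hx : -x ≠ 0 := left_ne_zero_of_mul_eq_one c0
    exact e.rate_eq (right_ne_zero_of_mul_eq_one c0)
      ((mul_eq_zero.1 ((hcurl 1).symm.trans hs.curl1)).resolve_left hx)
      ((mul_eq_zero.1 ((hcurl 2).symm.trans hs.curl2)).resolve_left hx)
      ((mul_eq_zero.1 ((hcurl 3).symm.trans hs.curl3)).resolve_left hx)
  · have aux : ∀ {k l : Fin 17} {c u v : ℂ}, psi 0 k = c * u → psi 0 l = c * v →
        psi 0 k - psi 0 l = c * (u - v) := fun h1 h2 => by rw [h1, h2]; ring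
    funext i
    fin_cases i
    · rfl
    · exact h.relax0_eq hC (by decide) rfl
    · exact aux (h.relax0_eq hC (by decide) (m6 _)) (h.relax0_eq hC (by decide) (m7 _))
    · exact aux (h.relax0_eq hC (by decide) (m8 _)) (h.relax0_eq hC (by decide) (m9 _))
    · exact aux (h.relax0_eq hC (by decide) (m10 _)) (h.relax0_eq hC (by decide) (m11 _))
    · exact h.relax0_eq hC (by decide) rfl
  · intro n
    have aux : ∀ {k l : Fin 17} {c s u v : ℂ}, psi n.succ k = c * u + s * theta n.castSucc k →
        psi n.succ l = c * v + s * theta n.castSucc l → psi n.succ k - psi n.succ l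
          = c * (u - v) + s * (theta n.castSucc k - theta n.castSucc l) :=
      fun h1 h2 => by rw [h1, h2]; ring
    funext i
    fin_cases i
    · rfl
    · exact (h.relax_eq hC n (by decide) h4 rfl).trans (zero_add _)
    · exact aux (h.relax_eq hC n (by decide) h6 (m6 _)) (h.relax_eq hC n (by decide) h7 (m7 _))
    · exact aux (h.relax_eq hC n (by decide) h8 (m8 _)) (h.relax_eq hC n (by decide) h9 (m9 _))
    · exact aux (h.relax_eq hC n (by decide) h10 (m10 _)) (h.relax_eq hC n (by decide) h11 (m11 _))
    · exact (h.relax_eq hC n (by decide) h12 rfl).trans (zero_add _)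

end

/-! ### First part: the rates of the vector moments. -/

lemma quadratic_eq_zero {A B C : ℂ} {a b c : ℂ} (hab : a ≠ b) (hac : a ≠ c) (hbc : b ≠ c)
    (h1 : A * a ^ 2 + B * a + C = 0) (h2 : A * b ^ 2 + B * b + C = 0)
    (h3 : A * c ^ 2 + B * c + C = 0) : A = 0 ∧ B = 0 ∧ C = 0 := by
  have e1 : A * (a + b) + B = 0 :=
    mul_left_cancel₀ (sub_ne_zero.2 hab) (by linear_combination h1 - h2)
  have e2 : A * (a + c) + B = 0 :=
    mul_left_cancel₀ (sub_ne_zero.2 hac) (by linear_combination h1 - h3)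
  have hA : A = 0 := mul_left_cancel₀ (sub_ne_zero.2 hbc) (by linear_combination e1 - e2)
  have hB : B = 0 := by linear_combination e1 - (a + b) * hA
  exact ⟨hA, hB, by linear_combination h1 - a ^ 2 * hA - a * hB⟩

/-- A polynomial of degree two vanishes if it vanishes at all positive squares but one. -/
lemma quadratic_eq_zero_of_generic {A B C : ℂ} {s z : ℝ} (hs : 0 < s)
    (h : ∀ c : ℝ, 0 < c → c ^ 4 * s ≠ z → A * ((c ^ 2 : ℝ) : ℂ) ^ 2 + B * ((c ^ 2 : ℝ) : ℂ) + C
        = 0) :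
    A = 0 ∧ B = 0 ∧ C = 0 := by
  have key : ∀ a b c : ℝ, 0 < a → a < b → b < c → a ^ 4 * s ≠ z → b ^ 4 * s ≠ z → c ^ 4 * s ≠ z →
      A = 0 ∧ B = 0 ∧ C = 0 := by
    intro a b c ha hab hbc h1 h2 h3
    have hb := ha.trans hab
    have hc := hb.trans hbc
    have l1 : a ^ 2 < b ^ 2 := by gcongr
    have l2 : b ^ 2 < c ^ 2 := by gcongr
    refine quadratic_eq_zero ?_ ?_ ?_ (h a ha h1) (h b hb h2) (h c hc h3) <;>
      rw [Ne, Complex.ofReal_inj]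
    exacts [l1.ne, (l1.trans l2).ne, l2.ne]
  -- At most one of `1, 2, 3, 4` can be excluded, since `c ↦ c⁴ s` is injective on positive numbers;
  -- three points remain.
  by_cases h1 : (1 : ℝ) ^ 4 * s = z
  · apply key 2 3 4 <;> first | (intro e; linarith) | norm_num
  · by_cases h2 : (2 : ℝ) ^ 4 * s = z
    · apply key 1 3 4 <;> first | exact h1 | (intro e; linarith) | norm_num
    · by_cases h3 : (3 : ℝ) ^ 4 * s = z
      · apply key 1 2 4 <;> first | exact h1 | exact h2 | (intro e; linarith) | norm_num
      · apply key 1 2 3 <;> first | exact h1 | exact h2 | exact h3 | norm_num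

/-- Condition (*) in the variables `g = c₀²/λ²` and `lr`: the form in which the order-one shear and
thermal rates are compared. -/
lemma splits_iff {lam c0 : ℝ} (hlam : 0 < lam) (hc0 : 0 < c0) (R : Rates) (a : ScalarCoeffs) :
    Splits lam c0 R a ↔ c0 ^ 2 / lam ^ 2 * (1 / 2 * sigma R.s5 * (c0 ^ 2 / lam ^ 2))
      + sigma R.s7 * a.lr ≠ 0 := by
  rw [Splits, ← sub_ne_zero]
  have e : c0 ^ 2 / 2 * sigma R.s5 - lam ^ 4 / (218 * c0 ^ 2) * (60 * a.beta2 + 620 - a.alpha2)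
      * sigma R.s7 = lam ^ 4 / c0 ^ 2 * (c0 ^ 2 / lam ^ 2
        * (1 / 2 * sigma R.s5 * (c0 ^ 2 / lam ^ 2)) + sigma R.s7 * a.lr) := by
    rw [ScalarCoeffs.lr]
    field_simp
    ring
  rw [e, Ne, mul_eq_zero, not_or]
  have : lam ^ 4 / c0 ^ 2 ≠ 0 := by positivity
  tauto

lemma Splits.complex {lam c0 : ℝ} (hlam : 0 < lam) (hc0 : 0 < c0) {R : Rates} {a : ScalarCoeffs}
    (h : Splits lam c0 R a) : ((c0 ^ 2 / lam ^ 2 : ℝ) : ℂ)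
      * (1 / 2 * (sigma R.s5 : ℝ) * ((c0 ^ 2 / lam ^ 2 : ℝ) : ℂ)) + (sigma R.s7 : ℝ) * (a.lr : ℂ)
        ≠ 0 := by
  have := (splits_iff hlam hc0 R a).1 h
  contrapose! this
  apply Complex.ofReal_injective
  push_cast at this ⊢
  exact this

/-- With `c = c₀/λ`, splitting fails at no more than one value of `c⁴` when `σ₅ > 0`; this matches
the exceptional set in `quadratic_eq_zero_of_generic`. -/
lemma splits_scaled {lam c : ℝ} (hlam : 0 < lam) (hc : 0 < c) {R : Rates} {a : ScalarCoeffs}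
    (h : c ^ 4 * (1 / 2 * sigma R.s5) ≠ -(sigma R.s7 * a.lr)) : Splits lam (c * lam) R a := by
  rw [splits_iff hlam (mul_pos hc hlam)]
  have e : (c * lam) ^ 2 / lam ^ 2 = c ^ 2 := by field_simp
  rw [e]
  contrapose! h
  linear_combination h

lemma sigma_pos {s : ℝ} (h : s ∈ Set.Ioo (0 : ℝ) 2) : 0 < sigma s := by
  have := one_div_lt_one_div_of_lt h.1 h.2
  rw [sigma]
  linarith

/-- For equal `q`, the squared component is `q` along an axis and `q / 2` along a diagonal. The
difference is quadratic in `g`, because the equilibria are affine in `g`. -/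
lemma rate_sub_rate (g S T s9 s15 s13 q : ℂ) :
    axisSector.rate S T s9 s15 s13 q (vectorCoeff g)
      - diagonalSector.rate S T s9 s15 s13 (q / 2) (vectorCoeff g) = q ^ 2 *
      (S ^ 2 * (249 / 310 * T + 37 / 62 * s15 - 7 / 5 * s9) * g ^ 2
        + (3917 / 10540 * S * T * s13 - 524 / 1581 * S * s13 * s15 + 467 / 510 * S * s13 * s9
          - 5863 / 2108 * S ^ 2 * T - 4418 / 7905 * S ^ 2 * s15 + 608 / 255 * S ^ 2 * s9
          + 65 / 816 * S - 65 / 816 * s13) * g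
        + S * s13 * (996 / 775 * T + 24 / 155 * s15 - 36 / 25 * s9)) := by
  simp [Sector.rate, axisSector, diagonalSector, vectorCoeff]
  ring

lemma shear_condition {lam c0 : ℝ} (hlam : 0 < lam) (hc0 : 0 < c0) {R : Rates}
    (hR : R.Admissible) {a : ScalarCoeffs} (hsp : Splits lam c0 R a)
    (hiso : FourthOrderIsotropic lam c0 R (isotropicEquilibrium lam c0 a)) {g : ℂ}
    (hg : g = ((c0 ^ 2 / lam ^ 2 : ℝ) : ℂ)) :
    axisSector.rate (sigma R.s5 : ℝ) (sigma R.s7 : ℝ) (sigma R.s9 : ℝ) (sigma R.s15 : ℝ)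
        (sigma R.s13 : ℝ) (-(2 * lam ^ 2)) (vectorCoeff g)
      = diagonalSector.rate (sigma R.s5 : ℝ) (sigma R.s7 : ℝ) (sigma R.s9 : ℝ) (sigma R.s15 : ℝ)
        (sigma R.s13 : ℝ) (-(2 * lam ^ 2) / 2) (vectorCoeff g) := by
  have hC := isClosure_isotropic hlam c0 a
  obtain ⟨ms, _, _, h0, _, _, h⟩ := exists_modes hlam hc0 hR rfl hC (A := a.lr) (B := a.lp)
    (fun _ _ _ _ => rfl) (hsp.complex hlam hc0) hiso
    (Real.sqrt_ne_zero'.2 (two_pos : (0 : ℝ) < 2))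
  rw [← hg] at hC
  -- An axis vector and a diagonal vector of the same length `√2`.
  obtain ⟨psi, theta, he, hs⟩ := (h !₂[√2, 0] (by simp [EuclideanSpace.norm_eq])).1
  obtain ⟨psi', theta', he', hs'⟩ := (h !₂[1, 1] (by
    simp [EuclideanSpace.norm_eq]; norm_num)).1
  have e1 : -(Complex.I * lam * ((!₂[√2, 0] : EuclideanSpace ℝ (Fin 2)) 1 : ℝ)) = 0 := by simp
  have e2 : -(Complex.I * lam * ((!₂[1, 1] : EuclideanSpace ℝ (Fin 2)) 1 : ℝ))
    = -(Complex.I * lam * ((!₂[1, 1] : EuclideanSpace ℝ (Fin 2)) 0 : ℝ)) := by simp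
  rw [e1] at he hs
  rw [e2] at he' hs'
  have f1 := he.axis_rate hC (TensorCoeffs.isotropic_XY a) rfl rfl rfl rfl rfl h0 hs
  have f2 := he'.diagonal_rate hC (TensorCoeffs.isotropic_XY a) rfl rfl rfl rfl rfl rfl rfl rfl
    h0 hs'
  have r2 : ((√2 : ℝ) : ℂ) ^ 2 = 2 := by
    rw [← Complex.ofReal_pow, Real.sq_sqrt two_pos.le]
    simp
  have s1 : (-(Complex.I * lam * ((!₂[√2, 0] : EuclideanSpace ℝ (Fin 2)) 0 : ℝ))) ^ 2
      = -(2 * lam ^ 2) := by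
    simp only [Matrix.cons_val_zero]
    linear_combination -(lam : ℂ) ^ 2 * r2 + lam ^ 2 * (√2 : ℝ) ^ 2 * Complex.I_sq
  have s2 : (-(Complex.I * lam * ((!₂[1, 1] : EuclideanSpace ℝ (Fin 2)) 0 : ℝ))) ^ 2
      = -(2 * lam ^ 2) / 2 := by
    simp only [Matrix.cons_val_zero, Complex.ofReal_one]
    linear_combination lam ^ 2 * Complex.I_sq
  rw [s1] at f1
  rw [s2] at f2
  exact f1.symm.trans f2

/-- The coefficients of `g²` and of `1` give two independent linear equations for `σ₉` and `σ₁₅`,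
solved by `σ₇`. The middle coefficient is not needed. -/
lemma sigma_eq_of_isotropic {lam : ℝ} (hlam : 0 < lam) {R : Rates} (hR : R.Admissible)
    {a : ScalarCoeffs} (hiso : ∀ c0 : ℝ, 0 < c0 → Splits lam c0 R a →
      FourthOrderIsotropic lam c0 R (isotropicEquilibrium lam c0 a)) :
    sigma R.s9 = sigma R.s7 ∧ sigma R.s15 = sigma R.s7 := by
  have hS := sigma_pos hR.1
  have hW := sigma_pos hR.2.2.2.1
  have key := quadratic_eq_zero_of_generic (s := 1 / 2 * sigma R.s5) (z := -(sigma R.s7 * a.lr))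
    (by positivity) (fun c hc hz => by
      have hsp := splits_scaled hlam hc hz
      have e := shear_condition hlam (mul_pos hc hlam) hR hsp (hiso _ (mul_pos hc hlam) hsp)
        (g := ((c ^ 2 : ℝ) : ℂ)) (by rw [Complex.ofReal_inj]; field_simp)
      rw [← sub_eq_zero, rate_sub_rate] at e
      refine (mul_eq_zero.1 e).resolve_left (pow_ne_zero _ (neg_ne_zero.2
        (mul_ne_zero two_ne_zero (pow_ne_zero _ ?_))))
      exact_mod_cast hlam.ne')
  obtain ⟨hA, -, hC⟩ := key
  have hA' : sigma R.s5 ^ 2 * (249 / 310 * sigma R.s7 + 37 / 62 * sigma R.s15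
    - 7 / 5 * sigma R.s9) = 0 := Complex.ofReal_injective (by push_cast; exact hA)
  have hC' : sigma R.s5 * sigma R.s13 * (996 / 775 * sigma R.s7 + 24 / 155 * sigma R.s15
    - 36 / 25 * sigma R.s9) = 0 := Complex.ofReal_injective (by push_cast; exact hC)
  have e1 := (mul_eq_zero.1 hA').resolve_left (by positivity)
  have e2 := (mul_eq_zero.1 hC').resolve_left (by positivity)
  constructor <;> linarith

/-! ### First part: the rate of the tensor moments. -/

section

variable {g S T s2 s3 s4 del x y q A B : ℂ} {Q : Matrix (Fin 17) (Fin 4) ℂ}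
  {C : ℂ → ℂ → ℂ → ℂ → Macro} {sig : Fin 17 → ℂ} {m : Fin 4 → ℂ} {psi theta : Fin 4 → Fin 17 → ℂ}

/-- The laws of order two when the rate of `XX_e, XY_e` differs from the rate of `XX, XY`. -/
lemma IsExpansion.laws_of_tensor_rate (hC : IsClosure g Q C) (hST : S * T = 1 / 12)
    (hsig : ∀ k : Fin 17, 4 ≤ (k : ℕ) → k ≠ 12 → k ≠ 13 → sig k = relaxSigma S T s2 s3 s4 k)
    (h12 : sig 12 = S + del) (h13 : sig 13 = S + del)
    (hq : x ^ 2 + y ^ 2 = q) (h : IsExpansion x y sig Q m psi theta) :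
    divLaw2 g S q x y (m 0) (m 1) (m 2) (macroOf C (psi 0)) (macroOf C (psi 1))
      (macroOf C (psi 2)) = 0 ∧
    energyLaw2 g T s2 q x y (m 0) (m 1) (m 2) (macroOf C (psi 0)) (macroOf C (psi 1))
      (macroOf C (psi 2)) + T * del
        * (3 / 17 * (x ^ 2 - y ^ 2) * D2Q17.theta0 g x y (m 0) (macroOf C (psi 0)) 12
          + 24 / 17 * (x * y) * D2Q17.theta0 g x y (m 0) (macroOf C (psi 0)) 13) = 0 := by
  obtain ⟨r0, r1⟩ := h.row0_row1 hC (S := S) (T := T) (hsig 4 (by decide) (by decide) (by decide))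
    (hsig 5 (by decide) (by decide) (by decide)) (hsig 6 (by decide) (by decide) (by decide))
    (hsig 7 (by decide) (by decide) (by decide))
  have p0 := h.psi_zero_eq_moments hC
  have t0 := h.theta0
  have t1 := h.theta1
  have t2 := h.theta2
  have c1 := h.conserved 2 1
  have c2 := h.conserved 2 2
  have c3 := h.conserved 2 3
  have c0 := h.conserved 2 0
  change theta 2 0 = 0 at c0
  change theta 2 1 = 0 at c1
  change theta 2 2 = 0 at c2
  change theta 2 3 = 0 at c3
  rw [p0] at t0 t1 t2
  have e0 := theta0_eq t0 r0
  set w0 := macroOf C (psi 0)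
  set w1 := macroOf C (psi 1) with hw1
  set w2 := macroOf C (psi 2) with hw2
  set z := D2Q17.theta0 g x y (m 0) w0
  obtain ⟨v1, hv1⟩ : ∃ v1, v1 = moments g w1 + relaxSigma S T s2 s3 s4 * z := ⟨_, rfl⟩
  obtain ⟨u1, hu1⟩ : ∃ u1, u1 = advect x y v1 + m 0 • v1 + m 1 • moments g w0 := ⟨_, rfl⟩
  have e1 := theta1_eq hv1 hu1 r0 r1
  obtain ⟨v2, hv2⟩ : ∃ v2, v2 = moments g w2 + relaxSigma S T s2 s3 s4
    * D2Q17.theta1 g S T s2 s3 s4 x y (m 0) (m 1) w0 w1 := ⟨_, rfl⟩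
  obtain ⟨u2, hu2⟩ : ∃ u2, u2 = advect x y v2 + m 0 • v2 + m 1 • v1 + m 2 • moments g w0
      - (1 / 12 : ℂ) • (advect x y (advect x y z + m 0 • z) + m 0 • (advect x y z + m 0 • z)) :=
    ⟨_, rfl⟩
  have f1 := divLaw2_eq hST hv1 hv2 hu2 r0 r1 hq
  have f2 := energyLaw2_eq hST hv1 hv2 hu2 r0 r1 hq
  have hpsi : ∀ (n : Fin 3) (k : Fin 17) (t : Fin 17 → ℂ) (d : ℂ),
      theta n.castSucc k = t k + d → k ≠ 12 → k ≠ 13 →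
      psi n.succ k = (moments g (macroOf C (psi n.succ)) + relaxSigma S T s2 s3 s4 * t) k
        + relaxSigma S T s2 s3 s4 k * d := by
    intro n k t d ht k12 k13
    rw [Pi.add_apply, Pi.mul_apply]
    rcases consIdx_or k with ⟨b, rfl⟩ | hk
    · rw [hC.moments_macroOf, relaxSigma_consIdx, zero_mul, zero_mul, add_zero, add_zero]
    · rw [h.relax n k hk, hC.equilibrium_eq _ k hk, hsig k hk k12 k13, ht]
      ring
  have hv1' : ∀ k : Fin 17, k ≠ 12 → k ≠ 13 → psi 1 k = v1 k := by
    intro k k12 k13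
    rw [hv1]
    exact (hpsi 0 k z 0 (by rw [add_zero]; exact congrFun e0 k) k12 k13).trans
      (by simp [hw1])
  have hz12 : psi 1 12 = v1 12 + del * z 12 := by
    have : psi 1 12 = moments g w1 12 + (S + del) * theta 0 12 :=
      h.relax_eq hC 0 (by decide) h12 rfl
    rw [this, hv1, Pi.add_apply, Pi.mul_apply, e0, relaxSigma_12]
    ring
  have hz13 : psi 1 13 = v1 13 + del * z 13 := by
    have : psi 1 13 = moments g w1 13 + (S + del) * theta 0 13 :=
      h.relax_eq hC 0 (by decide) h13 rfl
    rw [this, hv1, Pi.add_apply, Pi.mul_apply, e0, relaxSigma_13]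
    ring
  have ne : ∀ {k : Fin 17}, (k : ℕ) < 12 → k ≠ 12 ∧ k ≠ 13 := by
    intro k hk
    constructor <;> rintro rfl <;> revert hk <;> decide
  have hv1c : ∀ k : Fin 17, (k : ℕ) < 12 → psi 1 k = v1 k := fun k hk => hv1' k (ne hk).1 (ne hk).2
  have hth : ∀ k : Fin 17, theta 1 k = u1 k + (advect x y (psi 1) k - advect x y v1 k
      + m 0 * (psi 1 k - v1 k)) := by
    intro k
    rw [t1, hu1]
    simp only [Pi.add_apply, Pi.smul_apply, smul_eq_mul]
    ring
  have h14 : psi 1 14 = v1 14 := hv1' 14 (by decide) (by decide)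
  have d4 : theta 1 4 = u1 4 := by
    rw [hth, advect_4, advect_4, hv1c 1 (by decide), hv1c 2 (by decide), hv1c 4 (by decide),
      hv1c 6 (by decide), hv1c 7 (by decide), hv1c 8 (by decide), hv1c 9 (by decide),
      hv1c 10 (by decide), hv1c 11 (by decide)]
    ring
  have d5 : theta 1 5 = u1 5 := by
    rw [hth, advect_5, advect_5, hv1c 1 (by decide), hv1c 2 (by decide), hv1c 5 (by decide),
      hv1c 6 (by decide), hv1c 7 (by decide), hv1c 8 (by decide), hv1c 9 (by decide),
      hv1c 10 (by decide), hv1c 11 (by decide)]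
    ring
  -- Among `XX, XY, q`, only `q` receives flux from `XX_e, XY_e`. The change of rate thus reaches
  -- the energy law of order two through one more relaxation, with factor `T del`, and leaves the
  -- momentum laws unchanged.
  have d6 : theta 1 6 = u1 6 + del * (18 / 17 * x * z 12 + 72 / 17 * y * z 13) := by
    rw [hth, advect_6, advect_6, hv1c 3 (by decide), hv1c 4 (by decide), hv1c 5 (by decide),
      hv1c 6 (by decide), h14, hz12, hz13]
    ring
  have d7 : theta 1 7 = u1 7 + del * (-(18 / 17) * y * z 12 + 72 / 17 * x * z 13) := by
    rw [hth, advect_7, advect_7, hv1c 3 (by decide), hv1c 4 (by decide), hv1c 5 (by decide),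
      hv1c 7 (by decide), h14, hz12, hz13]
    ring
  rw [e1] at d4 d5 d6 d7
  have g4 : psi 2 4 = v2 4 := by
    rw [hv2]
    exact (hpsi 1 4 (D2Q17.theta1 g S T s2 s3 s4 x y (m 0) (m 1) w0 w1) 0
      (by rw [add_zero]; exact d4) (by decide) (by decide)).trans (by simp [hw2])
  have g5 : psi 2 5 = v2 5 := by
    rw [hv2]
    exact (hpsi 1 5 (D2Q17.theta1 g S T s2 s3 s4 x y (m 0) (m 1) w0 w1) 0
      (by rw [add_zero]; exact d5) (by decide) (by decide)).trans (by simp [hw2])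
  have g6 : psi 2 6 = v2 6 + T * (del * (18 / 17 * x * z 12 + 72 / 17 * y * z 13)) := by
    rw [hv2]
    exact hpsi 1 6 (D2Q17.theta1 g S T s2 s3 s4 x y (m 0) (m 1) w0 w1) _ d6
      (by decide) (by decide)
  have g7 : psi 2 7 = v2 7 + T * (del * (-(18 / 17) * y * z 12 + 72 / 17 * x * z 13)) := by
    rw [hv2]
    exact hpsi 1 7 (D2Q17.theta1 g S T s2 s3 s4 x y (m 0) (m 1) w0 w1) _ d7
      (by decide) (by decide)
  have gc : ∀ a, psi 2 (consIdx a) = v2 (consIdx a) := by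
    intro a
    rw [hv2, Pi.add_apply, Pi.mul_apply, relaxSigma_consIdx, zero_mul, add_zero,
      hC.moments_macroOf]
  have g0 : psi 2 0 = v2 0 := gc 0
  have g1 : psi 2 1 = v2 1 := gc 1
  have g2 : psi 2 2 = v2 2 := gc 2
  have g3 : psi 2 3 = v2 3 := gc 3
  have hk : ∀ k : Fin 17, (k : ℕ) < 12 → theta 2 k = u2 k + (advect x y (psi 2) k
      - advect x y v2 k + m 0 * (psi 2 k - v2 k)) := by
    intro k hk
    rw [t2, hu2, e0]
    simp only [Pi.add_apply, Pi.sub_apply, Pi.smul_apply, smul_eq_mul, hv1c k hk]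
    ring
  have k0 : u2 0 = 0 := by
    rw [← c0, hk 0 (by decide), advect_0, advect_0, g0, g1, g2]
    ring
  have k1 : u2 1 = 0 := by
    rw [← c1, hk 1 (by decide), advect_1, advect_1, g0, g1, g3, g4, g5]
    ring
  have k2 : u2 2 = 0 := by
    rw [← c2, hk 2 (by decide), advect_2, advect_2, g0, g2, g3, g4, g5]
    ring
  have k3 := hk 3 (by decide)
  rw [c3, advect_3, advect_3, g1, g2, g3, g6, g7] at k3
  rw [k1, k2] at f1
  rw [k0] at f2
  refine ⟨by rw [← f1]; ring, ?_⟩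
  rw [← f2]
  linear_combination -1 / 34 * k3

/-- The momentum of an acoustic wave is parallel to the wave vector. Substituting this in the flux
of `XX_e, XY_e` leaves a function of `q` plus a multiple of the anisotropic quartic `x⁴ - q x²`. -/
lemma tensor_flux {j j' a : ℂ} (hj : (x ^ 2 + y ^ 2) * j = a * x)
    (hj' : (x ^ 2 + y ^ 2) * j' = a * y) :
    (x ^ 2 + y ^ 2) * (3 / 17 * (x ^ 2 - y ^ 2)
        * (-(37 / 6 * g * j' * y) + 37 / 12 * g * a + 136 / 15 * j' * y - 68 / 15 * a)
      + 24 / 17 * (x * y) * (-(7 / 12 * g * j * y) - 7 / 12 * g * j' * x - 17 / 15 * j * y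
        - 17 / 15 * j' * x)) = 65 / 17 * g * a * (x ^ 4 - (x ^ 2 + y ^ 2) * x ^ 2)
      + (37 / 68 * g - 4 / 5) * a * (x ^ 2 + y ^ 2) ^ 2 := by
  linear_combination (3 / 17 * (x ^ 2 - y ^ 2) * (-(37 / 6) * g * y + 136 / 15 * y)
    + 24 / 17 * (x * y) * (-(7 / 12) * g * x - 17 / 15 * x)) * hj'
    + 24 / 17 * (x * y) * (-(7 / 12) * g * y - 17 / 15 * y) * hj

/-- The anisotropic part of an acoustic mode at order two. -/
lemma IsAcousticMode.tensor_rate {x' y' : ℂ} (hq : x ^ 2 + y ^ 2 = q) (hq' : x' ^ 2 + y' ^ 2 = q)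
    (hq0 : q ≠ 0) (hm : m 0 ≠ 0) {w w' : Fin 4 → Macro}
    (h0 : Row0 g x y (m 0) (w 0)) (h0' : Row0 g x' y' (m 0) (w' 0))
    (h1 : Row1 g S T x y (m 0) (m 1) (w 0) (w 1))
    (h1' : Row1 g S T x' y' (m 0) (m 1) (w' 0) (w' 1))
    (hd : divLaw2 g S q x y (m 0) (m 1) (m 2) (w 0) (w 1) (w 2) = 0)
    (hd' : divLaw2 g S q x' y' (m 0) (m 1) (m 2) (w' 0) (w' 1) (w' 2) = 0)
    (he : energyLaw2 g T s2 q x y (m 0) (m 1) (m 2) (w 0) (w 1) (w 2) + T * del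
      * (3 / 17 * (x ^ 2 - y ^ 2) * theta0 g x y (m 0) (w 0) 12
        + 24 / 17 * (x * y) * theta0 g x y (m 0) (w 0) 13) = 0)
    (he' : energyLaw2 g T s2 q x' y' (m 0) (m 1) (m 2) (w' 0) (w' 1) (w' 2) + T * del
      * (3 / 17 * (x' ^ 2 - y' ^ 2) * theta0 g x' y' (m 0) (w' 0) 12
        + 24 / 17 * (x' * y') * theta0 g x' y' (m 0) (w' 0) 13) = 0)
    (ha : IsAcousticMode w) (ha' : IsAcousticMode w')
    (hl : ∀ n, (w n).l = A * (w n).r + B * (w n).p)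
    (hl' : ∀ n, (w' n).l = A * (w' n).r + B * (w' n).p)
    (hX : (w 0).X = 0 ∧ (w 0).Y = 0) (hX' : (w' 0).X = 0 ∧ (w' 0).Y = 0) :
    g * T * del * ((x ^ 4 - q * x ^ 2) - (x' ^ 4 - q * x' ^ 2)) = 0 := by
  obtain ⟨d0, r0, d1, r1⟩ := ha.fields hq hq' hm h0 h0' h1 h1' ha'
  have l0' := hl' 0
  rw [r0, ha'.p] at l0'
  have l0 := hl 0
  rw [ha.p] at l0
  have l1' := hl' 1
  rw [r1, ha'.p1] at l1'
  have l1 := hl 1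
  rw [ha.p1] at l1
  have cu : (w 0).curl x y = 0 := (mul_eq_zero.1 h0.curl_law).resolve_left hm
  have cu' : (w' 0).curl x' y' = 0 := (mul_eq_zero.1 h0'.curl_law).resolve_left hm
  have dv := h0.mass_law
  have dv' := h0'.mass_law
  rw [r0] at dv'
  -- An acoustic mode of unit pressure cannot have zero density, otherwise mass and divergence would
  -- give `q = 0`.
  have mr : m 0 * (w 0).r ≠ 0 := by
    intro e
    have := h0.div_law hq
    rw [ha.p] at this
    exact hq0 (by linear_combination this - m 0 * dv + m 0 * e)
  have jx : q * (w 0).jx = -(m 0 * (w 0).r) * x := by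
    simp only [Macro.curl, Macro.div] at cu dv
    linear_combination x * dv - y * cu - (w 0).jx * hq
  have jy : q * (w 0).jy = -(m 0 * (w 0).r) * y := by
    simp only [Macro.curl, Macro.div] at cu dv
    linear_combination y * dv + x * cu - (w 0).jy * hq
  have jx' : q * (w' 0).jx = -(m 0 * (w 0).r) * x' := by
    simp only [Macro.curl, Macro.div] at cu' dv'
    linear_combination x' * dv' - y' * cu' - (w' 0).jx * hq'
  have jy' : q * (w' 0).jy = -(m 0 * (w 0).r) * y' := by
    simp only [Macro.curl, Macro.div] at cu' dv'
    linear_combination y' * dv' + x' * cu' - (w' 0).jy * hq'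
  simp only [theta0_12, theta0_13, hX, hX', r0] at he he'
  simp only [energyLaw2, divLaw2, ha.p, ha.p1, ha.p2, l0, l1, ha'.p, ha'.p1, ha'.p2, r0, r1, l0',
    l1', hX, hX'] at he he' hd hd'
  have key : m 0 * (w 0).r * m 0 * (g * T * del * ((x ^ 4 - q * x ^ 2) - (x' ^ 4 - q * x' ^ 2)))
      = 0 := by
    have f := tensor_flux (g := g) (hq ▸ jx) (hq ▸ jy)
    have f' := tensor_flux (g := g) (hq' ▸ jx') (hq' ▸ jy')
    rw [hq] at f
    rw [hq'] at f'
    linear_combination 17 / 65 * (-q * (m 0 * (he - he') - g * (hd - hd'))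
      + m 0 * T * del * (f - f'))
  exact (mul_eq_zero.1 key).resolve_left (mul_ne_zero mr hm)

end

lemma sigmaC_eq_relaxSigma_of_ne {R : Rates} (h9 : sigma R.s9 = sigma R.s7)
    (h15 : sigma R.s15 = sigma R.s7) (k : Fin 17) (hk : 4 ≤ (k : ℕ)) (h12 : k ≠ 12)
    (h13 : k ≠ 13) : sigmaC R k = relaxSigma (sigma R.s5 : ℝ) (sigma R.s7 : ℝ)
      (sigma R.sE2 : ℝ) (sigma R.sE3 : ℝ) (sigma R.sE4 : ℝ) k := by
  revert hk h12 h13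
  revert k
  apply forall_fin17 <;> intro hk h12 h13 <;> first
    | (exfalso; revert hk; decide)
    | exact absurd rfl h12
    | exact absurd rfl h13
    | rfl
    | exact congrArg (fun t : ℝ => (t : ℂ)) h9
    | exact congrArg (fun t : ℝ => (t : ℂ)) h15

lemma norm_five_zero : ‖(!₂[5, 0] : EuclideanSpace ℝ (Fin 2))‖ = 5 := by
  simp [EuclideanSpace.norm_eq]

lemma norm_three_four : ‖(!₂[3, 4] : EuclideanSpace ℝ (Fin 2))‖ = 5 := by
  rw [EuclideanSpace.norm_eq, Real.sqrt_eq_iff_mul_self_eq_of_pos (by norm_num)]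
  simp
  norm_num

/-- Since `x⁴ - q x² = -x² y²`, the quartic vanishes on the axis and equals `-144 λ⁴` at `(3, 4)`, a
vector of the same length. -/
lemma defect_ne_zero {lam : ℝ} (hlam : 0 < lam) (q : ℂ)
    (hq : (-(Complex.I * lam * ((!₂[3, 4] : EuclideanSpace ℝ (Fin 2)) 0 : ℝ))) ^ 2
      + (-(Complex.I * lam * ((!₂[3, 4] : EuclideanSpace ℝ (Fin 2)) 1 : ℝ))) ^ 2 = q)
    (hq' : (-(Complex.I * lam * ((!₂[5, 0] : EuclideanSpace ℝ (Fin 2)) 0 : ℝ))) ^ 2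
      + (-(Complex.I * lam * ((!₂[5, 0] : EuclideanSpace ℝ (Fin 2)) 1 : ℝ))) ^ 2 = q) :
    (-(Complex.I * lam * ((!₂[3, 4] : EuclideanSpace ℝ (Fin 2)) 0 : ℝ))) ^ 4
        - q * (-(Complex.I * lam * ((!₂[3, 4] : EuclideanSpace ℝ (Fin 2)) 0 : ℝ))) ^ 2
      - ((-(Complex.I * lam * ((!₂[5, 0] : EuclideanSpace ℝ (Fin 2)) 0 : ℝ))) ^ 4
        - q * (-(Complex.I * lam * ((!₂[5, 0] : EuclideanSpace ℝ (Fin 2)) 0 : ℝ))) ^ 2) ≠ 0 := by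
  have h : (lam : ℂ) ≠ 0 := by exact_mod_cast hlam.ne'
  have e : -(144 * (lam : ℂ) ^ 4) ≠ 0 := by simpa using h
  convert e using 1
  nth_rewrite 1 [← hq]
  rw [← hq']
  simp
  linear_combination (-144 * (lam : ℂ) ^ 4 * (Complex.I ^ 2 - 1)) * Complex.I_sq

lemma sq_scaled {lam : ℝ} (hlam : 0 < lam) (c : ℝ) : c ^ 2 = (c * lam) ^ 2 / lam ^ 2 := by
  field_simp

lemma macroOf_isotropic {lam c0 : ℝ} (a : ScalarCoeffs) (v : Fin 17 → ℂ) :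
    (macroOf (closure (c0 ^ 2 / lam ^ 2) a (.isotropic lam c0)) v).X = 0 ∧
      (macroOf (closure (c0 ^ 2 / lam ^ 2) a (.isotropic lam c0)) v).Y = 0 :=
  TensorCoeffs.isotropic_XY a ..

/-- The condition on the acoustic modes at order two. -/
lemma tensor_condition {lam c0 : ℝ} (hlam : 0 < lam) (hc0 : 0 < c0) {R : Rates}
    (hR : R.Admissible) {a : ScalarCoeffs} (h57 : sigma R.s5 * sigma R.s7 = 1 / 12)
    (h9 : sigma R.s9 = sigma R.s7) (h15 : sigma R.s15 = sigma R.s7) (hsp : Splits lam c0 R a)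
    (hiso : FourthOrderIsotropic lam c0 R (isotropicEquilibrium lam c0 a)) {g S T W : ℂ}
    (hg : g = ((c0 ^ 2 / lam ^ 2 : ℝ) : ℂ)) (hSe : S = (sigma R.s5 : ℝ))
    (hTe : T = (sigma R.s7 : ℝ)) (hWe : W = (sigma R.s13 : ℝ)) : g * T * (W - S) = 0 := by
  have hC := isClosure_isotropic hlam c0 a
  obtain ⟨_, _, ma, _, _, m0, h⟩ := exists_modes hlam hc0 hR rfl hC (A := a.lr) (B := a.lp)
    (fun _ _ _ _ => rfl) (hsp.complex hlam hc0) hiso (by norm_num : (5 : ℝ) ≠ 0)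
  rw [← hg] at hC
  obtain ⟨psi, theta, he, ha⟩ := (h !₂[3, 4] norm_three_four).2.2
  obtain ⟨psi', theta', he', ha'⟩ := (h !₂[5, 0] norm_five_zero).2.2
  have hq := waveVector_sq lam !₂[3, 4]
  have hq' := waveVector_sq lam !₂[5, 0]
  rw [norm_three_four] at hq
  rw [norm_five_zero] at hq'
  have hd := defect_ne_zero hlam _ hq hq'
  have hq0 : (-((lam ^ 2 * 5 ^ 2 : ℝ) : ℂ)) ≠ 0 := by
    rw [neg_ne_zero, Complex.ofReal_ne_zero]
    positivity
  have hm : ma 0 ≠ 0 := by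
    rw [m0]
    refine mul_ne_zero ?_ (mul_ne_zero Complex.I_ne_zero (by norm_num))
    exact_mod_cast hc0.ne'
  have hST : S * T = 1 / 12 := by
    have := congrArg (fun t : ℝ => (t : ℂ)) h57
    push_cast at this
    rw [hSe, hTe]
    exact this
  have hsig := sigmaC_eq_relaxSigma_of_ne h9 h15
  rw [← hSe, ← hTe] at hsig
  have h12 : sigmaC R 12 = S + (W - S) := by
    rw [hWe, add_sub_cancel]
    rfl
  have h13 : sigmaC R 13 = S + (W - S) := by
    rw [hWe, add_sub_cancel]
    rfl
  have r := he.row0_row1 hC hSe.symm hSe.symm hTe.symm hTe.symm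
  have r' := he'.row0_row1 hC hSe.symm hSe.symm hTe.symm hTe.symm
  have l := he.laws_of_tensor_rate hC hST hsig h12 h13 hq
  have l' := he'.laws_of_tensor_rate hC hST hsig h12 h13 hq'
  have f := ha.tensor_rate
    (w := fun n => macroOf (closure (c0 ^ 2 / lam ^ 2) a (.isotropic lam c0)) (psi n))
    (w' := fun n => macroOf (closure (c0 ^ 2 / lam ^ 2) a (.isotropic lam c0)) (psi' n))
    hq hq' hq0 hm r.1 r'.1 r.2 r'.2 l.1 l'.1 l.2 l'.2 ha'
    (A := a.lr) (B := a.lp) (fun _ => rfl) (fun _ => rfl) (macroOf_isotropic a _)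
    (macroOf_isotropic a _)
  exact (mul_eq_zero.1 f).resolve_right hd

/-- The condition `g σ₇ (σ₁₃ - σ₅) = 0` at one admissible sound velocity would suffice; genericity
only supplies a velocity at which splitting holds. -/
lemma tensor_rate_of_isotropic {lam : ℝ} (hlam : 0 < lam) {R : Rates} (hR : R.Admissible)
    {a : ScalarCoeffs} (h57 : sigma R.s5 * sigma R.s7 = 1 / 12) (h9 : sigma R.s9 = sigma R.s7)
    (h15 : sigma R.s15 = sigma R.s7) (hiso : ∀ c0 : ℝ, 0 < c0 → Splits lam c0 R a →
      FourthOrderIsotropic lam c0 R (isotropicEquilibrium lam c0 a)) :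
    sigma R.s13 = sigma R.s5 := by
  have hS := sigma_pos hR.1
  have hT := sigma_pos hR.2.1
  obtain ⟨-, k, -⟩ := quadratic_eq_zero_of_generic (s := 1 / 2 * sigma R.s5)
    (z := -(sigma R.s7 * a.lr)) (A := 0)
    (B := (sigma R.s7 : ℝ) * ((sigma R.s13 : ℝ) - (sigma R.s5 : ℝ))) (C := 0)
    (by positivity) (fun c hc hz => by
      have hsp := splits_scaled hlam hc hz
      have e := tensor_condition hlam (mul_pos hc hlam) hR h57 h9 h15 hsp
        (hiso _ (mul_pos hc hlam) hsp) (congrArg (fun t : ℝ => (t : ℂ)) (sq_scaled hlam c)) rfl rfl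
        rfl
      linear_combination e)
  have e : sigma R.s7 * (sigma R.s13 - sigma R.s5) = 0 :=
    Complex.ofReal_injective (by push_cast; exact k)
  exact sub_eq_zero.1 ((mul_eq_zero.1 e).resolve_left hT.ne')

/-! ### First part: the scalar equilibria. -/

/-- The conditions on the thermal and acoustic modes at order three. -/
lemma scalar_conditions {lam c0 : ℝ} (hlam : 0 < lam) (hc0 : 0 < c0) {R : Rates}
    (hR : R.Admissible) {a : ScalarCoeffs} (h57 : sigma R.s5 * sigma R.s7 = 1 / 12)
    (hS : SigmaRelations R) (hsp : Splits lam c0 R a)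
    (hiso : FourthOrderIsotropic lam c0 R (isotropicEquilibrium lam c0 a)) {g S T : ℂ}
    (hg : g = ((c0 ^ 2 / lam ^ 2 : ℝ) : ℂ)) (hSe : S = (sigma R.s5 : ℝ))
    (hTe : T = (sigma R.s7 : ℝ)) :
    T * ((8631 - 3340 * g) * ((a.dev3r - 60 * a.dev3E) / 33912977)
      + (80 - 48 * g) * ((a.dev4r - 60 * a.dev4E) / 9193)) = 0 ∧
    ∃ r : ℂ, ∀ D F : ℂ, D = (a.dev3r * r + a.dev3E * (34 - 60 * r)) / 33912977 →
      F = (a.dev4r * r + a.dev4E * (34 - 60 * r)) / 9193 →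
      T * (8631 * D + 80 * F) - g * ((S + T) * (6680 * D + 96 * F)) = 0 := by
  have hC := isClosure_isotropic hlam c0 a
  obtain ⟨_, mt, ma, _, t0, m0, h⟩ := exists_modes hlam hc0 hR rfl hC (A := a.lr) (B := a.lp)
    (fun _ _ _ _ => rfl) (hsp.complex hlam hc0) hiso (by norm_num : (5 : ℝ) ≠ 0)
  rw [← hg] at hC
  obtain ⟨-, ⟨chi, xi, hb, ht⟩, ⟨psi, theta, he, ha⟩⟩ := h !₂[3, 4] norm_three_four
  obtain ⟨-, ⟨chi', xi', hb', ht'⟩, ⟨psi', theta', he', ha'⟩⟩ := h !₂[5, 0] norm_five_zero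
  have hq := waveVector_sq lam !₂[3, 4]
  have hq' := waveVector_sq lam !₂[5, 0]
  rw [norm_three_four] at hq
  rw [norm_five_zero] at hq'
  have hd := defect_ne_zero hlam _ hq hq'
  have hq0 : (-((lam ^ 2 * 5 ^ 2 : ℝ) : ℂ)) ≠ 0 := by
    rw [neg_ne_zero, Complex.ofReal_ne_zero]
    positivity
  have hm : ma 0 ≠ 0 := by
    rw [m0]
    refine mul_ne_zero ?_ (mul_ne_zero Complex.I_ne_zero (by norm_num))
    exact_mod_cast hc0.ne'
  have hST : S * T = 1 / 12 := by
    have := congrArg (fun t : ℝ => (t : ℂ)) h57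
    push_cast at this
    rw [hSe, hTe]
    exact this
  have hsig := sigmaC_eq_relaxSigma hS
  rw [← hSe, ← hTe] at hsig
  have hX := macroOf_isotropic (lam := lam) (c0 := c0) a
  have l := he.rows hC hST hsig hq
  have l' := he'.rows hC hST hsig hq'
  have b := hb.rows hC hST hsig hq
  have b' := hb'.rows hC hST hsig hq'
  have hDF : ∀ v : Fin 17 → ℂ,
      let w := macroOf (closure (c0 ^ 2 / lam ^ 2) a (.isotropic lam c0)) v
      w.D = (a.dev3r * w.r + a.dev3E * (34 * w.p - 60 * w.r)) / 33912977 ∧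
      w.F = (a.dev4r * w.r + a.dev4E * (34 * w.p - 60 * w.r)) / 9193 := fun v => ⟨rfl, rfl⟩
  constructor
  · have e := (hDF (chi 0)).1
    have f := (hDF (chi 0)).2
    have e' := (hDF (chi' 0)).1
    have f' := (hDF (chi' 0)).2
    rw [ht.r, ht.p] at e f
    rw [ht'.r, ht'.p] at e' f'
    have := ht.defect_eq hq hq' hq0 b b' t0 ht' (A := a.lr) (B := a.lp) (fun n => rfl)
      (fun n => rfl) (fun n => hX _) (fun n => hX _) (e'.trans e.symm) (f'.trans f.symm)
    rw [e, f] at this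
    refine mul_right_cancel₀ hd ?_
    linear_combination this
  · have r0 := (ha.fields hq hq' hm l.row0 l'.row0 l.row1 l'.row1 ha').2.1
    have e := (hDF (psi 0)).1
    have f := (hDF (psi 0)).2
    have e' := (hDF (psi' 0)).1
    have f' := (hDF (psi' 0)).2
    rw [ha.p] at e f
    rw [ha'.p, r0] at e' f'
    -- The density of the acoustic mode is not evaluated: in the application it drops out of `D` and
    -- `F`.
    refine ⟨(macroOf (closure (c0 ^ 2 / lam ^ 2) a (.isotropic lam c0)) (psi 0)).r, ?_⟩
    intro D F hD hF
    have := ha.defect_eq hq hq' hm l l' ha' (A := a.lr) (B := a.lp) (fun n => rfl)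
      (fun n => rfl) (e'.trans e.symm) (f'.trans f.symm) (by simp only [hX, mul_zero])
      (by simp only [hX, mul_zero])
    simp only [acousticDefect, hX] at this
    rw [e, f, mul_one] at this
    rw [hD, hF]
    refine mul_right_cancel₀ (mul_ne_zero hm hd) ?_
    linear_combination -this

/-- Both conditions are affine in `g`, so each gives two equations in the two unknowns `D`, `F`. The
thermal mode has `r = 1, p = 0` and controls `dev r - 60 dev E`; the acoustic mode has `p = 1` and
then controls `dev E`. -/
lemma alphaRelations_of_isotropic {lam : ℝ} (hlam : 0 < lam) {R : Rates} (hR : R.Admissible)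
    {a : ScalarCoeffs} (h57 : sigma R.s5 * sigma R.s7 = 1 / 12) (hS : SigmaRelations R)
    (hiso : ∀ c0 : ℝ, 0 < c0 → Splits lam c0 R a →
      FourthOrderIsotropic lam c0 R (isotropicEquilibrium lam c0 a)) :
    AlphaRelations a := by
  have hS0 := sigma_pos hR.1
  have hT0 := sigma_pos hR.2.1
  have hT : ((sigma R.s7 : ℝ) : ℂ) ≠ 0 := by exact_mod_cast hT0.ne'
  have hSpT : ((sigma R.s5 : ℝ) : ℂ) + ((sigma R.s7 : ℝ) : ℂ) ≠ 0 := by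
    exact_mod_cast (add_pos hS0 hT0).ne'
  have hcond := fun (c : ℝ) (hc : 0 < c)
    (hz : c ^ 4 * (1 / 2 * sigma R.s5) ≠ -(sigma R.s7 * a.lr)) =>
      scalar_conditions hlam (mul_pos hc hlam) hR h57 hS (splits_scaled hlam hc hz)
        (hiso _ (mul_pos hc hlam) (splits_scaled hlam hc hz))
        (congrArg (fun t : ℝ => (t : ℂ)) (sq_scaled hlam c)) rfl rfl
  obtain ⟨-, k1, k2⟩ := quadratic_eq_zero_of_generic (s := 1 / 2 * sigma R.s5)
    (z := -(sigma R.s7 * a.lr)) (A := 0)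
    (B := -(3340 * ((a.dev3r - 60 * a.dev3E) / 33912977) + 48 * ((a.dev4r - 60 * a.dev4E) / 9193)))
    (C := 8631 * ((a.dev3r - 60 * a.dev3E) / 33912977) + 80 * ((a.dev4r - 60 * a.dev4E) / 9193))
    (by positivity) (fun c hc hz => by
      refine Eq.trans ?_ ((mul_eq_zero.1 (hcond c hc hz).1).resolve_left hT)
      ring)
  -- Cramer's rule with determinant `8631 · 48 - 80 · 3340 = 147088`.
  have u1 : (a.dev3r : ℂ) = 60 * a.dev3E := by
    linear_combination 33912977 / 147088 * (48 * k2 + 80 * k1)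
  have u2 : (a.dev4r : ℂ) = 60 * a.dev4E := by
    linear_combination 9193 / 147088 * (-3340 * k2 - 8631 * k1)
  obtain ⟨-, k3, k4⟩ := quadratic_eq_zero_of_generic (s := 1 / 2 * sigma R.s5)
    (z := -(sigma R.s7 * a.lr)) (A := 0)
    (B := -(((sigma R.s5 : ℝ) + (sigma R.s7 : ℝ))
      * (6680 * (34 * a.dev3E / 33912977) + 96 * (34 * a.dev4E / 9193))))
    (C := (sigma R.s7 : ℝ) * (8631 * (34 * a.dev3E / 33912977) + 80 * (34 * a.dev4E / 9193)))
    (by positivity) (fun c hc hz => by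
      -- By `u1` and `u2` the density cancels, leaving `D = 34 dev3E / 33912977` and `F = 34 dev4E /
      -- 9193`.
      obtain ⟨r, hr⟩ := (hcond c hc hz).2
      refine Eq.trans ?_ (hr (34 * a.dev3E / 33912977) (34 * a.dev4E / 9193)
        (by rw [u1]; ring) (by rw [u2]; ring))
      ring)
  have k3' := (mul_eq_zero.1 (neg_eq_zero.1 k3)).resolve_left hSpT
  have k4' := (mul_eq_zero.1 k4).resolve_left hT
  -- Cramer's rule again, with determinant `8631 · 96 - 80 · 6680 = 294176`.
  have u3 : (a.dev3E : ℂ) = 0 := by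
    linear_combination 33912977 / 34 / 294176 * (96 * k4' - 80 * k3')
  have u4 : (a.dev4E : ℂ) = 0 := by
    linear_combination 9193 / 34 / 294176 * (8631 * k3' - 6680 * k4')
  rw [u3, mul_zero] at u1
  rw [u4, mul_zero] at u2
  rw [alphaRelations_iff]
  exact ⟨by exact_mod_cast u1, by exact_mod_cast u3, by exact_mod_cast u2, by exact_mod_cast u4⟩

/-- Isotropy with the sound velocity left free. -/
theorem isotropic_iff_relations {lam : ℝ} (hlam : 0 < lam) {R : Rates} (hR : R.Admissible)
    (a : ScalarCoeffs) (h57 : sigma R.s5 * sigma R.s7 = 1 / 12) :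
    (∀ c0 : ℝ, 0 < c0 → Splits lam c0 R a →
        FourthOrderIsotropic lam c0 R (isotropicEquilibrium lam c0 a)) ↔
      SigmaRelations R ∧ AlphaRelations a := by
  refine ⟨fun h => ?_, fun h c0 hc0 _ =>
    fourthOrderIsotropic_isotropicEquilibrium hlam hc0 hR h57 h.1 h.2⟩
  obtain ⟨h9, h15⟩ := sigma_eq_of_isotropic hlam hR h
  have hS : SigmaRelations R := ⟨h9, tensor_rate_of_isotropic hlam hR h57 h9 h15 h, h15⟩
  exact ⟨hS, alphaRelations_of_isotropic hlam hR h57 hS h⟩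

/-! ### Second part, order zero: the equilibrium of `q`. -/

section

variable {g x y q : ℂ} {Q : Matrix (Fin 17) (Fin 4) ℂ} {sig : Fin 17 → ℂ} {m : Fin 4 → ℂ}
  {psi theta : Fin 4 → Fin 17 → ℂ}

lemma eq_zero_of_linearIndependent {w : Fin 4 → Fin 4 → ℂ} (hw : LinearIndependent ℂ w)
    {c : Fin 4 → ℂ} (h : ∀ j, w j ⬝ᵥ c = 0) : c = 0 := by
  have h1 : IsUnit (Matrix.of w) := Matrix.linearIndependent_rows_iff_isUnit.1 hw
  apply Matrix.mulVec_injective_iff_isUnit.2 h1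
  funext j
  rw [Matrix.mulVec_zero]
  exact h j

/-- The flux of energy at order zero. -/
lemma IsExpansion.energy_flux (h4 : ∀ a, Q 4 a = 0) (h5 : ∀ a, Q 5 a = 0)
    (h : IsExpansion x y sig Q m psi theta) (hq : x ^ 2 + y ^ 2 = q) (hq0 : q ≠ 0)
    (hm : m 0 = 0 ∨ m 0 ^ 2 = g * q) :
    (17 / 6 - g) * (x * psi 0 1 + y * psi 0 2) + 1 / 6 * (x * psi 0 6 + y * psi 0 7) = 0 := by
  have t0 := h.theta0
  have e4 := h.relax0 4 (by decide)
  have e5 := h.relax0 5 (by decide)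
  simp only [equilibrium, h4, h5, zero_mul, add_zero] at e4 e5
  have c0 : theta 0 0 = 0 := h.conserved 0 0
  have c1 : theta 0 1 = 0 := h.conserved 0 1
  have c2 : theta 0 2 = 0 := h.conserved 0 2
  have c3 : theta 0 3 = 0 := h.conserved 0 3
  rw [t0] at c0 c1 c2 c3
  simp only [Pi.add_apply, Pi.smul_apply, smul_eq_mul, advect_0, advect_1, advect_2, advect_3, e4,
    e5] at c0 c1 c2 c3
  set p := 30 / 17 * psi 0 0 + 1 / 34 * psi 0 3 with hp
  set d := x * psi 0 1 + y * psi 0 2 with hd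
  have k1 : m 0 * d + q * p = 0 := by
    rw [hp, hd, ← hq]
    linear_combination x * c1 + y * c2
  have k2 : m 0 * p + 17 / 6 * d + 1 / 6 * (x * psi 0 6 + y * psi 0 7) = 0 := by
    rw [hp, hd]
    linear_combination 1 / 34 * c3 + 30 / 17 * c0
  -- If `m 0 = 0`, mass gives zero divergence. Otherwise the momentum law and `m 0 ^ 2 = g q` give
  -- the acoustic energy balance, and the energy law must agree with it.
  rcases hm with hm | hm
  · rw [hm] at c0 k1 k2
    have : d = 0 := by linear_combination c0
    rw [this] at k2 ⊢
    linear_combination k2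
  · have e : g * d + m 0 * p = 0 := by
      refine (mul_eq_zero.1 (?_ : q * _ = 0)).resolve_left hq0
      linear_combination m 0 * k1 - d * hm
    linear_combination k2 - e

end

/-- The flux identity is linear in the conserved moments and holds for four independent vectors of
them, hence coefficient by coefficient. -/
lemma flux_of_isotropic {lam c0 : ℝ} (hlam : 0 < lam) {R : Rates}
    (hR : R.Admissible) {Eq : Matrix (Fin 17) (Fin 4) ℝ} (hiso : FourthOrderIsotropic lam c0 R Eq)
    (h4 : ∀ a, scaledEquilibrium lam Eq 4 a = 0) (h5 : ∀ a, scaledEquilibrium lam Eq 5 a = 0)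
    {k : EuclideanSpace ℝ (Fin 2)} (hk : k ≠ 0) (a : Fin 4) :
    (17 / 6 - ((c0 ^ 2 / lam ^ 2 : ℝ) : ℂ)) * ![0, (k 0 : ℂ), k 1, 0] a
      + 1 / 6 * (k 0 * scaledEquilibrium lam Eq 6 a + k 1 * scaledEquilibrium lam Eq 7 a) = 0 := by
  obtain ⟨p, pt, pb, h⟩ := (fourthOrderIsotropic_iff hlam hR Eq c0).1 hiso
  obtain ⟨psi, theta, hli, he⟩ := h k
  have hlam' : (lam : ℂ) ≠ 0 := by exact_mod_cast hlam.ne'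
  have hq := waveVector_sq lam k
  have hq0 : (-((lam ^ 2 * ‖k‖ ^ 2 : ℝ) : ℂ)) ≠ 0 := by
    rw [neg_ne_zero, Complex.ofReal_ne_zero]
    have := norm_pos_iff.2 hk
    positivity
  set Q := scaledEquilibrium lam Eq
  have hm : ∀ j, modeCoeff c0 ‖k‖ (p ‖k‖) (pt ‖k‖) (pb ‖k‖) j 0 = 0 ∨
      modeCoeff c0 ‖k‖ (p ‖k‖) (pt ‖k‖) (pb ‖k‖) j 0 ^ 2
        = ((c0 ^ 2 / lam ^ 2 : ℝ) : ℂ) * -((lam ^ 2 * ‖k‖ ^ 2 : ℝ) : ℂ) := by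
    intro j
    fin_cases j
    · exact Or.inl rfl
    · exact Or.inl rfl
    · exact Or.inr (soundSpeed_sq hlam c0 ‖k‖)
    · exact Or.inr ((neg_sq _).trans (soundSpeed_sq hlam c0 ‖k‖))
  have key := eq_zero_of_linearIndependent hli (c := fun a =>
    (17 / 6 - ((c0 ^ 2 / lam ^ 2 : ℝ) : ℂ)) * ![0, (k 0 : ℂ), k 1, 0] a
      + 1 / 6 * (k 0 * Q 6 a + k 1 * Q 7 a)) (fun j => by
    have e := (he j).energy_flux h4 h5 hq hq0 (hm j)
    rw [(he j).relax0 6 (by decide), (he j).relax0 7 (by decide)] at e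
    refine (mul_eq_zero.1 (?_ : -(Complex.I * lam) * _ = 0)).resolve_left
      (neg_ne_zero.2 (mul_ne_zero Complex.I_ne_zero hlam'))
    simp only [dotProduct, Fin.sum_univ_four, consLin, LinearMap.coe_mk, AddHom.coe_mk]
    refine _root_.Eq.trans ?_ e
    change _ * (psi j 0 0 * _ + psi j 0 1 * _ + psi j 0 2 * _ + psi j 0 3 * _) = _
    simp only [equilibrium, Matrix.cons_val_zero, Matrix.cons_val_one, Matrix.cons_val]
    ring)
  exact congrFun key a

lemma vector_equilibrium_of_isotropic {lam c0 : ℝ} (hlam : 0 < lam) {R : Rates}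
    (hR : R.Admissible) {a : ScalarCoeffs} {v : TensorCoeffs}
    (hiso : FourthOrderIsotropic lam c0 R (generalEquilibrium lam c0 a v)) :
    v.qx0 = 0 ∧ v.qxx = c1 lam c0 ∧ v.qxy = 0 ∧ v.qxE = 0 ∧ v.qy0 = 0 ∧ v.qyy = c1 lam c0 ∧
      v.qyE = 0 := by
  have hlam' : (lam : ℂ) ≠ 0 := by exact_mod_cast hlam.ne'
  have h1 := fun b => flux_of_isotropic hlam hR hiso
    (by intro b; fin_cases b <;> simp [scaledEquilibrium, generalEquilibrium])
    (by intro b; fin_cases b <;> simp [scaledEquilibrium, generalEquilibrium])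
    (k := !₂[1, 0]) (by intro h; simpa using congrArg (fun k => k 0) h) b
  have h2 := fun b => flux_of_isotropic hlam hR hiso
    (by intro b; fin_cases b <;> simp [scaledEquilibrium, generalEquilibrium])
    (by intro b; fin_cases b <;> simp [scaledEquilibrium, generalEquilibrium])
    (k := !₂[0, 1]) (by intro h; simpa using congrArg (fun k => k 1) h) b
  have a0 := h1 0
  have a1 := h1 1
  have a2 := h1 2
  have a3 := h1 3
  have b0 := h2 0
  have b2 := h2 2
  have b3 := h2 3
  simp [scaledEquilibrium, generalEquilibrium, momentDegree, consIdx, hlam'] at a0 a1 a2 a3 b0 b2 b3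
  have key : ∀ u : ℝ, 17 / 6 - (c0 : ℂ) ^ 2 / lam ^ 2 + 6⁻¹ * (u * lam / lam ^ 3) = 0 →
      u = c1 lam c0 := by
    intro u hu
    apply Complex.ofReal_injective
    rw [c1]
    push_cast
    field_simp at hu
    linear_combination hu
  exact ⟨a0, key _ a1, a2, a3, b0, key _ b2, b3⟩

/-! ### Second part, order one: the equilibria of `XX_e` and `XY_e`. -/

section

variable {g S T x y q A B e : ℂ} {Q Q0 : Matrix (Fin 17) (Fin 4) ℂ}
  {C : ℂ → ℂ → ℂ → ℂ → Macro} {sig : Fin 17 → ℂ} {m : Fin 4 → ℂ} {psi theta : Fin 4 → Fin 17 → ℂ}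

lemma IsExpansion.psi_eq_moments_of_ne (hC : IsClosure g Q0 C)
    (hQ : ∀ k : Fin 17, 4 ≤ (k : ℕ) → k ≠ 12 → k ≠ 13 → Q k = Q0 k)
    (h : IsExpansion x y sig Q m psi theta) {k : Fin 17} (h12 : k ≠ 12) (h13 : k ≠ 13) :
    psi 0 k = moments g (macroOf C (psi 0)) k := by
  rcases consIdx_or k with ⟨b, rfl⟩ | hk
  · rw [hC.moments_macroOf]
  · rw [h.relax0 k hk, ← hC.equilibrium_eq _ k hk, equilibrium, equilibrium, hQ k hk h12 h13]

/-- `XX_e` and `XY_e` do not enter the fluxes of conserved moments, so their equilibria are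
invisible at order zero. -/
lemma IsExpansion.row0_of_ne (hC : IsClosure g Q0 C)
    (hQ : ∀ k : Fin 17, 4 ≤ (k : ℕ) → k ≠ 12 → k ≠ 13 → Q k = Q0 k)
    (h : IsExpansion x y sig Q m psi theta) : Row0 g x y (m 0) (macroOf C (psi 0)) := by
  refine (row0_iff rfl).1 fun a => ?_
  have t0 := h.conserved 0 a
  rw [h.theta0, Pi.add_apply, Pi.smul_apply] at t0
  rw [Pi.add_apply, Pi.smul_apply, hC.moments_macroOf, ← t0]
  congr 1
  refine advect_consIdx_congr (fun k hk => (h.psi_eq_moments_of_ne hC hQ ?_ ?_).symm) a <;>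
    rintro rfl <;> revert hk <;> decide

/-- The laws of order one for any equilibria of `XX_e, XY_e`. -/
lemma IsExpansion.row1_of_ne (hC : IsClosure g Q0 C)
    (hQ : ∀ k : Fin 17, 4 ≤ (k : ℕ) → k ≠ 12 → k ≠ 13 → Q k = Q0 k)
    (h4 : sig 4 = S) (h5 : sig 5 = S) (h6 : sig 6 = T) (h7 : sig 7 = T)
    (he : 6 * (x ^ 2 + y ^ 2) * e = 18 / 17 * (x ^ 2 - y ^ 2) * psi 0 12
      + 144 / 17 * (x * y) * psi 0 13)
    (h : IsExpansion x y sig Q m psi theta) :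
    Row1 g S T x y (m 0) (m 1) { macroOf C (psi 0) with l := (macroOf C (psi 0)).l + e }
      (macroOf C (psi 1)) := by
  have r0 := h.row0_of_ne hC hQ
  set w0 := macroOf C (psi 0) with hw0
  set w1 := macroOf C (psi 1) with hw1
  -- The tensor equilibria act at order one only through the flux of `q` into the energy law, where
  -- their effect is a shift `e` of the field `l`.
  set w0' : Macro := { w0 with l := w0.l + e } with hw0'
  have r0' : Row0 g x y (m 0) w0' := ⟨r0.mass, r0.momX, r0.momY, r0.energy⟩
  have hz := theta0_eq (t0 := advect x y (moments g w0) + m 0 • moments g w0) rfl r0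
  have hm : moments g w0 12 = 0 ∧ moments g w0 13 = 0 := ⟨rfl, rfl⟩
  have p0 : ∀ k : Fin 17, k ≠ 12 → k ≠ 13 → psi 0 k = moments g w0 k :=
    fun k h12 h13 => h.psi_eq_moments_of_ne hC hQ h12 h13
  have q1 := p0 1 (by decide) (by decide)
  have q2 := p0 2 (by decide) (by decide)
  have q3 := p0 3 (by decide) (by decide)
  have q4 := p0 4 (by decide) (by decide)
  have q5 := p0 5 (by decide) (by decide)
  have q6 := p0 6 (by decide) (by decide)
  have q7 := p0 7 (by decide) (by decide)
  have q8 := p0 8 (by decide) (by decide)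
  have q9 := p0 9 (by decide) (by decide)
  have q10 := p0 10 (by decide) (by decide)
  have q11 := p0 11 (by decide) (by decide)
  have q14 := p0 14 (by decide) (by decide)
  have ht : ∀ k, theta 0 k = D2Q17.theta0 g x y (m 0) w0 k + (advect x y (psi 0) k
      - advect x y (moments g w0) k + m 0 * (psi 0 k - moments g w0 k)) := by
    intro k
    rw [← hz, h.theta0]
    simp only [Pi.add_apply, Pi.smul_apply, smul_eq_mul]
    ring
  have d4 : theta 0 4 = D2Q17.theta0 g x y (m 0) w0 4 := by
    rw [ht, advect_4, advect_4, q1, q2, q4, q6, q7, q8, q9, q10, q11]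
    ring
  have d5 : theta 0 5 = D2Q17.theta0 g x y (m 0) w0 5 := by
    rw [ht, advect_5, advect_5, q1, q2, q5, q6, q7, q8, q9, q10, q11]
    ring
  have d6 : theta 0 6 = D2Q17.theta0 g x y (m 0) w0 6
      + (18 / 17 * x * psi 0 12 + 72 / 17 * y * psi 0 13) := by
    rw [ht, advect_6, advect_6, q3, q4, q5, q6, q14, hm.1, hm.2]
    ring
  have d7 : theta 0 7 = D2Q17.theta0 g x y (m 0) w0 7
      + (-(18 / 17) * y * psi 0 12 + 72 / 17 * x * psi 0 13) := by
    rw [ht, advect_7, advect_7, q3, q4, q5, q7, q14, hm.1, hm.2]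
    ring
  have c1 : ∀ k : Fin 17, 4 ≤ (k : ℕ) → k ≠ 12 → k ≠ 13 → ∀ s, sig k = s →
      psi 1 k = moments g w1 k + s * theta 0 k := by
    intro k hk h12 h13 s hs
    have : psi 1 k = equilibrium Q (psi 1) k + sig k * theta 0 k := h.relax 0 k hk
    rw [this, hs, hw1, ← hC.equilibrium_eq _ k hk, equilibrium, equilibrium, hQ k hk h12 h13]
  have u4 := c1 4 (by decide) (by decide) (by decide) S h4
  have u5 := c1 5 (by decide) (by decide) (by decide) S h5
  have u6 := c1 6 (by decide) (by decide) (by decide) T h6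
  have u7 := c1 7 (by decide) (by decide) (by decide) T h7
  have u0 : psi 1 0 = moments g w1 0 := (hC.moments_macroOf (psi 1) 0).symm
  have u1 : psi 1 1 = moments g w1 1 := (hC.moments_macroOf (psi 1) 1).symm
  have u2 : psi 1 2 = moments g w1 2 := (hC.moments_macroOf (psi 1) 2).symm
  have u3 : psi 1 3 = moments g w1 3 := (hC.moments_macroOf (psi 1) 3).symm
  have k0 := h.conserved 1 0
  have k1 := h.conserved 1 1
  have k2 := h.conserved 1 2
  have k3 := h.conserved 1 3
  change theta 1 0 = 0 at k0
  change theta 1 1 = 0 at k1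
  change theta 1 2 = 0 at k2
  change theta 1 3 = 0 at k3
  rw [h.theta1] at k0 k1 k2 k3
  simp only [Pi.add_apply, Pi.smul_apply, smul_eq_mul, advect_0, advect_1, advect_2, advect_3,
    u0, u1, u2, u3, u4, u5, u6, u7, d4, d5, d6, d7, q1, q2, q3, p0 0 (by decide) (by decide)]
    at k0 k1 k2 k3
  simp only [moments_0, moments_1, moments_2, moments_3, moments_4, moments_5, moments_6,
    moments_7, theta0_4, theta0_5, theta0_6, theta0_7] at k0 k1 k2 k3
  have s0 := r0.mass
  refine ⟨?_, ?_, ?_, ?_⟩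
  · linear_combination k0
  · simp only [hw0']
    linear_combination k1 + 1 / 2 * S * g * x * s0
  · simp only [hw0']
    linear_combination k2 - 1 / 2 * S * g * y * s0
  · simp only [hw0']
    linear_combination 1 / 34 * k3 + 30 / 17 * k0 + 1 / 6 * T * he

/-- An acoustic mode from isotropy, for any equilibria of `XX_e, XY_e`. -/
lemma exists_acoustic_mode {lam c0 : ℝ} (hlam : 0 < lam) (hc0 : 0 < c0) {R : Rates}
    (hR : R.Admissible) {Eq : Matrix (Fin 17) (Fin 4) ℝ} (hC : IsClosure g Q0 C)
    (hQ : ∀ k : Fin 17, 4 ≤ (k : ℕ) → k ≠ 12 → k ≠ 13 → scaledEquilibrium lam Eq k = Q0 k)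
    (hiso : FourthOrderIsotropic lam c0 R Eq) {kappa : ℝ} (hk0 : kappa ≠ 0) :
    ∃ ma : Fin 4 → ℂ, ma 0 = c0 * (Complex.I * kappa) ∧
      ∀ k : EuclideanSpace ℝ (Fin 2), ‖k‖ = kappa →
        ∃ psi theta, IsExpansion (-(Complex.I * lam * k 0)) (-(Complex.I * lam * k 1))
          (sigmaC R) (scaledEquilibrium lam Eq) ma psi theta ∧
          IsAcousticMode (fun n => macroOf C (psi n)) := by
  obtain ⟨p, pt, pb, h⟩ := (fourthOrderIsotropic_iff hlam hR Eq c0).1 hiso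
  refine ⟨modeCoeff c0 kappa (p kappa) (pt kappa) (pb kappa) 2, rfl, fun k hk => ?_⟩
  obtain ⟨psi, theta, hli, hexp⟩ := h k
  rw [hk] at hexp
  have hma : (c0 * (Complex.I * kappa) : ℂ) ≠ 0 := by
    refine mul_ne_zero ?_ (mul_ne_zero Complex.I_ne_zero ?_)
    · exact_mod_cast hc0.ne'
    · exact_mod_cast hk0
  have hq := waveVector_sq lam k
  have hq0 : (-((lam ^ 2 * ‖k‖ ^ 2 : ℝ) : ℂ)) ≠ 0 := by
    rw [neg_ne_zero, Complex.ofReal_ne_zero, hk]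
    positivity
  have hr := (hexp 2).row0_of_ne hC hQ
  have hm0 : modeCoeff c0 kappa (p kappa) (pt kappa) (pb kappa) 2 0
      = c0 * (Complex.I * kappa) := rfl
  rw [hm0] at hr
  have hp : pressureLin (psi 2 0) ≠ 0 := by
    intro hp
    have e1 := hr.div_law hq
    have e2 := hr.curl_law
    have e3 := hr.mass_law
    rw [hC.macroOf_p, hC.macroOf_div, hp] at e1
    rw [hC.macroOf_curl] at e2
    rw [hC.macroOf_r, hC.macroOf_div] at e3
    rw [mul_zero, add_zero] at e1
    have hd := (mul_eq_zero.1 e1).resolve_left hma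
    have hc := (mul_eq_zero.1 e2).resolve_left hma
    rw [hd, add_zero] at e3
    have hr := (mul_eq_zero.1 e3).resolve_left hma
    exact hli.ne_zero 2 (consLin_eq_zero hq hq0 hr hp hd hc)
  obtain ⟨psi', theta', h', e0, l0, l1, l2, l3⟩ := (hexp 2).normalize pressureLin hp 1
  refine ⟨psi', theta', h', ⟨?_, ?_, ?_, ?_⟩⟩
  all_goals rw [hC.macroOf_p]; assumption

/-- Momentum laws make the divergence of order one independent of direction; the energy law then
forces the remaining term, the shift of `l`, to be so as well. -/
lemma IsAcousticMode.flux_eq {e' x' y' : ℂ} {w w' : Fin 4 → Macro} (hq : x ^ 2 + y ^ 2 = q)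
    (hq' : x' ^ 2 + y' ^ 2 = q) (hq0 : q ≠ 0) (hT : T ≠ 0) (hm : m 0 ≠ 0)
    (h : Row0 g x y (m 0) (w 0)) (h' : Row0 g x' y' (m 0) (w' 0))
    (h1 : Row1 g S T x y (m 0) (m 1) { w 0 with l := (w 0).l + e } (w 1))
    (h1' : Row1 g S T x' y' (m 0) (m 1) { w' 0 with l := (w' 0).l + e' } (w' 1))
    (hl : (w 0).l = A * (w 0).r + B * (w 0).p) (hl' : (w' 0).l = A * (w' 0).r + B * (w' 0).p)
    (ha : IsAcousticMode w) (ha' : IsAcousticMode w') : e = e' := by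
  have a1 := h.div_law hq
  have a1' := h'.div_law hq'
  rw [ha.p] at a1
  rw [ha'.p] at a1'
  have d0 : (w' 0).div x' y' = (w 0).div x y :=
    mul_left_cancel₀ hm (by linear_combination a1' - a1)
  have r0 : (w' 0).r = (w 0).r :=
    mul_left_cancel₀ hm (by linear_combination h'.mass_law - h.mass_law - d0)
  have b1 := h1.div_law hq
  have b1' := h1'.div_law hq'
  change m 0 * (w 1).div x y + m 1 * (w 0).div x y + 1 / 2 * S * g * q * (w 0).div x y
    + q * (w 1).p = 0 at b1
  change m 0 * (w' 1).div x' y' + m 1 * (w' 0).div x' y' + 1 / 2 * S * g * q * (w' 0).div x' y'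
    + q * (w' 1).p = 0 at b1'
  rw [ha.p1] at b1
  rw [ha'.p1, d0] at b1'
  have d1 : (w' 1).div x' y' = (w 1).div x y :=
    mul_left_cancel₀ hm (by linear_combination b1' - b1)
  have c1 := h1.energy_law hq
  have c1' := h1'.energy_law hq'
  simp only [ha.p, ha.p1, hl] at c1
  simp only [ha'.p, ha'.p1, hl', d1, r0] at c1'
  exact mul_left_cancel₀ (mul_ne_zero hT hq0) (by linear_combination c1 - c1')

end

lemma norm_zero_five : ‖(!₂[0, 5] : EuclideanSpace ℝ (Fin 2))‖ = 5 := by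
  simp [EuclideanSpace.norm_eq]

/-- The coefficients with `XX_e = XY_e = 0` at equilibrium. -/
def TensorCoeffs.withoutTensor (v : TensorCoeffs) : TensorCoeffs := { v with xix := 0, xiy := 0 }

lemma generalEquilibrium_withoutTensor (lam c0 : ℝ) (a : ScalarCoeffs) (v : TensorCoeffs)
    (k : Fin 17) (h12 : k ≠ 12) (h13 : k ≠ 13) :
    generalEquilibrium lam c0 a v k = generalEquilibrium lam c0 a v.withoutTensor k := by
  revert h12 h13
  revert k
  apply forall_fin17 <;> intro h12 h13 <;> first
    | exact absurd rfl h12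
    | exact absurd rfl h13
    | (funext b; simp [generalEquilibrium, TensorCoeffs.withoutTensor])

/-- The shift is a combination of the harmonic forms `k₀² - k₁²` and `k₀ k₁`. Such a combination is
constant on a circle only if it is zero. -/
lemma tensor_equilibrium_of_isotropic {lam c0 : ℝ} (hlam : 0 < lam) (hc0 : 0 < c0) {R : Rates}
    (hR : R.Admissible) {a : ScalarCoeffs} {v : TensorCoeffs}
    (hiso : FourthOrderIsotropic lam c0 R (generalEquilibrium lam c0 a v)) :
    v.xix = 0 ∧ v.xiy = 0 := by
  obtain ⟨h1, h2, h3, h4, h5, h6, h7⟩ := vector_equilibrium_of_isotropic hlam hR hiso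
  have hlam' : (lam : ℂ) ≠ 0 := by exact_mod_cast hlam.ne'
  set v0 := v.withoutTensor
  have hC : IsClosure ((c0 ^ 2 / lam ^ 2 : ℝ) : ℂ)
      (scaledEquilibrium lam (generalEquilibrium lam c0 a v0)) (closure (c0 ^ 2 / lam ^ 2) a v0) :=
    isClosure_closure hlam c0 a v0 h1 h2 h3 h4 h5 h6 h7 rfl rfl
  have hQ : ∀ k : Fin 17, 4 ≤ (k : ℕ) → k ≠ 12 → k ≠ 13 →
      scaledEquilibrium lam (generalEquilibrium lam c0 a v) k
        = scaledEquilibrium lam (generalEquilibrium lam c0 a v0) k := by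
    intro k _ h12 h13
    funext b
    simp only [scaledEquilibrium, Matrix.of_apply,
      generalEquilibrium_withoutTensor lam c0 a v k h12 h13, v0]
  obtain ⟨ma, m0, h⟩ := exists_acoustic_mode hlam hc0 hR hC hQ hiso (by norm_num : (5 : ℝ) ≠ 0)
  have hm : ma 0 ≠ 0 := by
    rw [m0]
    refine mul_ne_zero ?_ (mul_ne_zero Complex.I_ne_zero (by norm_num))
    exact_mod_cast hc0.ne'
  have hT : ((sigma R.s7 : ℝ) : ℂ) ≠ 0 := by exact_mod_cast (sigma_pos hR.2.1).ne'
  have hq0 : (-((lam ^ 2 * 5 ^ 2 : ℝ) : ℂ)) ≠ 0 := by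
    rw [neg_ne_zero, Complex.ofReal_ne_zero]
    positivity
  have key : ∀ k k' : EuclideanSpace ℝ (Fin 2), ‖k‖ = 5 → ‖k'‖ = 5 →
      3 / 5 * (k 0 ^ 2 - k 1 ^ 2 : ℂ) * v.xix + 24 / 5 * (k 0 * k 1 : ℂ) * v.xiy
        = 3 / 5 * (k' 0 ^ 2 - k' 1 ^ 2 : ℂ) * v.xix + 24 / 5 * (k' 0 * k' 1 : ℂ) * v.xiy := by
    intro k k' hk hk'
    obtain ⟨psi, theta, he, ha⟩ := h k hk
    obtain ⟨psi', theta', he', ha'⟩ := h k' hk'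
    have hq := waveVector_sq lam k
    have hq' := waveVector_sq lam k'
    rw [hk] at hq
    rw [hk'] at hq'
    -- In units `λ = 1`, `ρ + E/60 = (34/60) p`, which is `17/30` on a mode of unit pressure.
    have e12 : ∀ u : Fin 17 → ℂ, (macroOf (closure (c0 ^ 2 / lam ^ 2) a v0) u).p = 1 →
        equilibrium (scaledEquilibrium lam (generalEquilibrium lam c0 a v)) u 12
          = 17 / 30 * v.xix ∧
        equilibrium (scaledEquilibrium lam (generalEquilibrium lam c0 a v)) u 13
          = 17 / 30 * v.xiy := by
      intro u hu
      have hu' : (u 3 + 60 * u 0) / 34 = 1 := hu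
      constructor
      · simp [equilibrium, scaledEquilibrium, generalEquilibrium, momentDegree, consIdx]
        field_simp
        linear_combination 1020 * (v.xix : ℂ) * hu'
      · simp [equilibrium, scaledEquilibrium, generalEquilibrium, momentDegree, consIdx]
        field_simp
        linear_combination 1020 * (v.xiy : ℂ) * hu'
    have f := e12 _ ha.p
    have f' := e12 _ ha'.p
    rw [← he.relax0 12 (by decide), ← he.relax0 13 (by decide)] at f
    rw [← he'.relax0 12 (by decide), ← he'.relax0 13 (by decide)] at f'
    set q : ℂ := -((lam ^ 2 * 5 ^ 2 : ℝ) : ℂ)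
    have hZ : ∀ x y z : ℂ, x ^ 2 + y ^ 2 = q → 6 * (x ^ 2 + y ^ 2) * (z / (6 * q)) = z := by
      intro x y z hxy
      rw [hxy]
      field_simp
    have e := ha.flux_eq hq hq' hq0 hT hm (he.row0_of_ne hC hQ) (he'.row0_of_ne hC hQ)
      (he.row1_of_ne hC hQ rfl rfl rfl rfl (hZ _ _ _ hq))
      (he'.row1_of_ne hC hQ rfl rfl rfl rfl (hZ _ _ _ hq')) (A := a.lr) (B := a.lp) rfl rfl ha'
    have e' := (div_left_inj' (mul_ne_zero (by norm_num) hq0)).1 e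
    rw [f.1, f.2, f'.1, f'.2] at e'
    refine mul_left_cancel₀ (pow_ne_zero 2 hlam') ?_
    have hI := Complex.I_sq
    linear_combination -e' + lam ^ 2 * ((3 / 5 * (k 0 ^ 2 - k 1 ^ 2 : ℂ) * v.xix
      + 24 / 5 * (k 0 * k 1 : ℂ) * v.xiy) - (3 / 5 * (k' 0 ^ 2 - k' 1 ^ 2 : ℂ) * v.xix
      + 24 / 5 * (k' 0 * k' 1 : ℂ) * v.xiy)) * hI
  -- Exchanging the axes changes the sign of `k₀² - k₁²`; the vector `(3, 4)` then detects `k₀ k₁`.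
  have k1 := key !₂[5, 0] !₂[0, 5] norm_five_zero norm_zero_five
  have k2 := key !₂[5, 0] !₂[3, 4] norm_five_zero norm_three_four
  simp at k1 k2
  have z1 : (v.xix : ℂ) = 0 := by linear_combination 1 / 30 * k1
  have z2 : (v.xiy : ℂ) = 0 := by linear_combination -5 / 288 * k2 + 1 / 3 * z1
  exact ⟨by exact_mod_cast z1, by exact_mod_cast z2⟩

/-! ### Second part, orders two and three: the equilibria of `r` and `τ`. -/

lemma norm_neg_five_zero : ‖(!₂[-5, 0] : EuclideanSpace ℝ (Fin 2))‖ = 5 := by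
  simp [EuclideanSpace.norm_eq]

lemma norm_zero_neg_five : ‖(!₂[0, -5] : EuclideanSpace ℝ (Fin 2))‖ = 5 := by
  simp [EuclideanSpace.norm_eq]

lemma norm_three_neg_four : ‖(!₂[3, -4] : EuclideanSpace ℝ (Fin 2))‖ = 5 := by
  rw [EuclideanSpace.norm_eq, Real.sqrt_eq_iff_mul_self_eq_of_pos (by norm_num)]
  simp
  norm_num

lemma sq_add_sq_of_norm {h q : ℂ} (hq : q = 25 * h ^ 2) {k : EuclideanSpace ℝ (Fin 2)}
    (hk : ‖k‖ = 5) : (h * k 0) ^ 2 + (h * k 1) ^ 2 = q := by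
  have e := EuclideanSpace.norm_sq_eq k
  rw [hk, Fin.sum_univ_two, Real.norm_eq_abs, Real.norm_eq_abs, sq_abs, sq_abs] at e
  have e' : (5 : ℂ) ^ 2 = (k 0 : ℂ) ^ 2 + (k 1 : ℂ) ^ 2 := by exact_mod_cast e
  rw [hq]
  linear_combination -h ^ 2 * e'

/-- The modes of an isotropic scheme with `q = c₁ j` and `XX_e = XY_e = 0` at equilibrium. -/
structure IsotropicModes (g S T s2 q : ℂ) (C : ℂ → ℂ → ℂ → ℂ → Macro)
    (x y : EuclideanSpace ℝ (Fin 2) → ℂ) (ms mt ma : Fin 4 → ℂ) : Prop where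
  shear : ∀ k : EuclideanSpace ℝ (Fin 2), ‖k‖ = 5 → ∃ w : Fin 4 → Macro,
    (∀ n, w n = C (w n).r (w n).jx (w n).jy (w n).p) ∧
    Rows g S T s2 q (x k) (y k) ms w ∧ IsShearMode (x k) (y k) w
  thermal : ∀ k : EuclideanSpace ℝ (Fin 2), ‖k‖ = 5 → ∃ w : Fin 4 → Macro,
    (∀ n, w n = C (w n).r (w n).jx (w n).jy (w n).p) ∧
    Rows g S T s2 q (x k) (y k) mt w ∧ IsThermalMode (x k) (y k) w
  acoustic : ∀ k : EuclideanSpace ℝ (Fin 2), ‖k‖ = 5 → ∃ w : Fin 4 → Macro,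
    (∀ n, w n = C (w n).r (w n).jx (w n).jy (w n).p) ∧
    Rows g S T s2 q (x k) (y k) ma w ∧ IsAcousticMode w
  ms0 : ms 0 = 0
  mt0 : mt 0 = 0
  ma0 : ma 0 ^ 2 = g * q

section

variable {g : ℝ} {S T s2 q h : ℂ} {a : ScalarCoeffs} {v : TensorCoeffs} {ms mt ma : Fin 4 → ℂ}
  {x y : ℂ} {w : Fin 4 → Macro}

lemma acoustic_field (hm : ma 0 ≠ 0) (h0 : Row0 g x y (ma 0) (w 0)) (ha : IsAcousticMode w) :
    (w 0).jx = -x / ma 0 ∧ (w 0).jy = -y / ma 0 ∧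
      (w 0).r = (x ^ 2 + y ^ 2) / ma 0 ^ 2 := by
  have e1 := h0.momX
  have e2 := h0.momY
  have e3 := h0.mass
  rw [ha.p] at e1 e2
  have f1 : (w 0).jx = -x / ma 0 := by
    rw [eq_div_iff hm]
    linear_combination e1
  have f2 : (w 0).jy = -y / ma 0 := by
    rw [eq_div_iff hm]
    linear_combination e2
  refine ⟨f1, f2, ?_⟩
  rw [eq_div_iff (pow_ne_zero 2 hm)]
  linear_combination ma 0 * e3 - x * e1 - y * e2

lemma IsotropicModes.ma0_ne_zero {C : ℂ → ℂ → ℂ → ℂ → Macro} {x y : EuclideanSpace ℝ (Fin 2) → ℂ}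
    (H : IsotropicModes g S T s2 q C x y ms mt ma) (hg : g ≠ 0) (hq0 : q ≠ 0) : ma 0 ≠ 0 := by
  intro e
  have := H.ma0
  rw [e] at this
  exact mul_ne_zero (Complex.ofReal_ne_zero.2 hg) hq0 (by rw [← this]; ring)

/-- For the thermal mode `x X + y Y` is a linear form in `k`; for the acoustic mode, whose momentum
is parallel to `k`, it is a linear plus a quadratic form. Constancy on a circle kills the linear
forms and makes the quadratic one a multiple of `|k|²`, so the matrix from `j` to `(X, Y)` is a
multiple of the identity plus a rotation by a right angle. -/
lemma IsotropicModes.order_two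
    (H : IsotropicModes g S T s2 q (closure g a v) (fun k => h * k 0) (fun k => h * k 1) ms mt ma)
    (hq : q = 25 * h ^ 2) (hh : h ≠ 0) (hg : g ≠ 0) (hs2 : 3 / 5 * T * s2 - 1 / 20 ≠ 0) :
    v.cx0 = 0 ∧ v.cxE = 0 ∧ v.cy0 = 0 ∧ v.cyE = 0 ∧ v.cxx = v.cyy ∧ v.cyx = -v.cxy := by
  have hq0 : q ≠ 0 := by
    rw [hq]
    exact mul_ne_zero (by norm_num) (pow_ne_zero 2 hh)
  have hm := H.ma0_ne_zero hg hq0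
  have hqk : ∀ k : EuclideanSpace ℝ (Fin 2), ‖k‖ = 5 → (h * k 0) ^ 2 + (h * k 1) ^ 2 = q :=
    fun k hk => sq_add_sq_of_norm hq hk
  have thermal : ∀ k k' : EuclideanSpace ℝ (Fin 2), ‖k‖ = 5 → ‖k'‖ = 5 →
      (v.cx0 - 60 * v.cxE) * (k 0 : ℂ) + (v.cy0 - 60 * v.cyE) * k 1
        = (v.cx0 - 60 * v.cxE) * (k' 0 : ℂ) + (v.cy0 - 60 * v.cyE) * k' 1 := by
    have aux : ∀ k : EuclideanSpace ℝ (Fin 2), ‖k‖ = 5 → (3 / 5 * T * s2 - 1 / 20) * q * h *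
        ((v.cx0 - 60 * v.cxE) * (k 0 : ℂ) + (v.cy0 - 60 * v.cyE) * k 1) = g * mt 2 := by
      intro k hk
      obtain ⟨w, hw, hr, ht⟩ := H.thermal k hk
      have e := ht.order_two (hqk k hk) hq0 hr H.mt0 (A := a.lr) (B := a.lp)
        (fun n => congrArg Macro.l (hw n))
      obtain ⟨j1, j2⟩ := eq_zero_of_div_curl (hqk k hk) hq0 ht.div ht.curl
      have eX : (w 0).X = v.cx0 - 60 * v.cxE := by
        refine (congrArg Macro.X (hw 0)).trans ?_
        simp only [closure, ht.r, ht.p, j1, j2]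
        ring
      have eY : (w 0).Y = v.cy0 - 60 * v.cyE := by
        refine (congrArg Macro.Y (hw 0)).trans ?_
        simp only [closure, ht.r, ht.p, j1, j2]
        ring
      rw [eX, eY] at e
      linear_combination e
    intro k k' hk hk'
    exact mul_left_cancel₀ (mul_ne_zero (mul_ne_zero hs2 hq0) hh)
      ((aux k hk).trans (aux k' hk').symm)
  have acoustic : ∀ k k' : EuclideanSpace ℝ (Fin 2), ‖k‖ = 5 → ‖k'‖ = 5 →
      ∀ u z : EuclideanSpace ℝ (Fin 2) → ℂ, (∀ k, u k = ma 0
        * ((v.cx0 * (q / ma 0 ^ 2) + v.cxE * (34 - 60 * (q / ma 0 ^ 2))) * (k 0 : ℂ)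
          + (v.cy0 * (q / ma 0 ^ 2) + v.cyE * (34 - 60 * (q / ma 0 ^ 2))) * k 1)) →
        (∀ k, z k = h * ((v.cxx - (31 - 21 * g) / 6) * (k 0 : ℂ) ^ 2
          + (v.cxy + v.cyx) * (k 0 * k 1) + (v.cyy - (31 - 21 * g) / 6) * (k 1 : ℂ) ^ 2)) →
        u k - z k = u k' - z k' := by
    intro k k' hk hk' u z hu hz
    obtain ⟨w, hw, hr, ha⟩ := H.acoustic k hk
    obtain ⟨w', hw', hr', ha'⟩ := H.acoustic k' hk'
    have e := ha.order_two (hqk k hk) (hqk k' hk') hq0 hm hr hr' ha' (A := a.lr) (B := a.lp)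
      (fun n => congrArg Macro.l (hw n)) (fun n => congrArg Macro.l (hw' n)) hs2
    obtain ⟨f1, f2, f3⟩ := acoustic_field hm hr.row0 ha
    obtain ⟨f1', f2', f3'⟩ := acoustic_field hm hr'.row0 ha'
    rw [hqk k hk] at f3
    rw [hqk k' hk'] at f3'
    rw [hw 0, hw' 0] at e
    simp only [closure, f1, f2, f3, f1', f2', f3', ha.p, ha'.p] at e
    refine mul_left_cancel₀ hh ?_
    rw [hu, hu, hz, hz]
    field_simp at e ⊢
    linear_combination -e
  -- Opposite wave vectors isolate the linear forms; afterwards `(5, 0)`, `(0, 5)` and `(3, 4)`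
  -- treat the quadratic form.
  have t1 := thermal !₂[5, 0] !₂[-5, 0] norm_five_zero norm_neg_five_zero
  have t2 := thermal !₂[0, 5] !₂[0, -5] norm_zero_five norm_zero_neg_five
  have a1 := acoustic !₂[5, 0] !₂[-5, 0] norm_five_zero norm_neg_five_zero _ _ (fun _ => rfl)
    (fun _ => rfl)
  have a2 := acoustic !₂[0, 5] !₂[0, -5] norm_zero_five norm_zero_neg_five _ _ (fun _ => rfl)
    (fun _ => rfl)
  have a3 := acoustic !₂[5, 0] !₂[0, 5] norm_five_zero norm_zero_five _ _ (fun _ => rfl)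
    (fun _ => rfl)
  have a4 := acoustic !₂[5, 0] !₂[3, 4] norm_five_zero norm_three_four _ _ (fun _ => rfl)
    (fun _ => rfl)
  simp at t1 t2 a1 a2 a3 a4
  have c1 : (v.cx0 : ℂ) = 60 * v.cxE := by linear_combination 1 / 10 * t1
  have c2 : (v.cy0 : ℂ) = 60 * v.cyE := by linear_combination 1 / 10 * t2
  rw [c1] at a1
  rw [c2] at a2
  have c3 : (v.cxE : ℂ) = 0 := mul_left_cancel₀ hm (by linear_combination 1 / 340 * a1)
  have c4 : (v.cyE : ℂ) = 0 := mul_left_cancel₀ hm (by linear_combination 1 / 340 * a2)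
  rw [c1, c2, c3, c4] at a3 a4
  have c5 : (v.cxx : ℂ) = v.cyy := mul_left_cancel₀ hh (by linear_combination -1 / 25 * a3)
  have c6 : (v.cyx : ℂ) = -v.cxy :=
    mul_left_cancel₀ hh (by linear_combination 1 / 12 * a4 + 16 / 12 * h * c5)
  rw [c3, mul_zero] at c1
  rw [c4, mul_zero] at c2
  exact ⟨by exact_mod_cast c1, by exact_mod_cast c3, by exact_mod_cast c2, by exact_mod_cast c4,
    by exact_mod_cast c5, by exact_mod_cast c6⟩

end

section

variable {g : ℝ} {S T s2 q h : ℂ} {a : ScalarCoeffs} {v : TensorCoeffs} {ms mt ma : Fin 4 → ℂ}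
  {x y : ℂ} {w : Fin 4 → Macro}

lemma closure_scalar (hA : AlphaRelations a) (r jx jy p : ℂ) :
    (closure g a v r jx jy p).D = 0 ∧ (closure g a v r jx jy p).F = 0 := by
  obtain ⟨h1, h2, h3, h4⟩ := (alphaRelations_iff a).1 hA
  simp [closure, h1, h2, h3, h4]

/-- Separates the defect into a part in `e`, even under `y ↦ -y`, and a part in `d`, odd under it.
-/
lemma acousticDefect_rotated {g S T q x y m0 X Y e d : ℂ} (hm : m0 ^ 2 = g * q)
    (hX : m0 * X = -(e * x + d * y)) (hY : m0 * Y = -(e * y - d * x)) :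
    m0 * acousticDefect g S T q x y m0 0 0 X Y
      = g * q * T * d * (x * y) * (q - 2 * x ^ 2) / 3
        - g * e * (q * (1 / 3 * (S + T) * (x ^ 4 - x ^ 2 * y ^ 2)
            + q * (-(3 / 10) * S * x ^ 2 + 1 / 30 * S * y ^ 2 - 1 / 2 * T * x ^ 2
              - 1 / 6 * T * y ^ 2))
          - S * (1 / 3 * (x ^ 6 + x ^ 4 * y ^ 2) - 2 / 3 * q * x ^ 2 * y ^ 2
            - 17 / 60 * q ^ 2 * x ^ 2 + 1 / 20 * q ^ 2 * y ^ 2)) := by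
  simp only [acousticDefect]
  linear_combination
    (m0 ^ 2 * (1 / 3 * (S + T) * x ^ 3 - 3 / 10 * q * S * x - 1 / 2 * q * T * x)
      - g * S * (1 / 3 * x ^ 5 - 17 / 60 * q ^ 2 * x)) * hX
    + (m0 ^ 2 * (-(1 / 3) * (S + T) * x ^ 2 * y + 1 / 30 * q * S * y - 1 / 6 * q * T * y)
      - g * S * (1 / 3 * x ^ 4 * y - 2 / 3 * q * x ^ 2 * y + 1 / 20 * q ^ 2 * y)) * hY
    + (d * (x * y) * (-(2 / 3) * (S + T) * x ^ 2 + 1 / 3 * q * (S + T))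
      - e * (1 / 3 * (S + T) * (x ^ 4 - x ^ 2 * y ^ 2)
        + q * (-(3 / 10) * S * x ^ 2 + 1 / 30 * S * y ^ 2 - 1 / 2 * T * x ^ 2
          - 1 / 6 * T * y ^ 2))) * hm

/-- The acoustic mode at `(3, 4)` and `(3, -4)` isolates the odd part of the defect and gives `d =
0`. The shear mode at `(5, 0)` and `(3, 4)` then gives `e = 0`, since its defect is `-S e (x⁴ - q
x²) / 3` up to a function of `q`. -/
lemma IsotropicModes.order_three
    (H : IsotropicModes g S T s2 q (closure g a v) (fun k => h * k 0) (fun k => h * k 1) ms mt ma)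
    (hA : AlphaRelations a) (hq : q = 25 * h ^ 2) (hh : h ≠ 0) (hg : g ≠ 0) (hS : S ≠ 0)
    (hT : T ≠ 0) {e d : ℂ}
    (hX : ∀ r jx jy p, (closure g a v r jx jy p).X = e * jx + d * jy)
    (hY : ∀ r jx jy p, (closure g a v r jx jy p).Y = e * jy - d * jx) :
    e = 0 ∧ d = 0 := by
  have hq0 : q ≠ 0 := by
    rw [hq]
    exact mul_ne_zero (by norm_num) (pow_ne_zero 2 hh)
  have hm := H.ma0_ne_zero hg hq0
  have hg' : (g : ℂ) ≠ 0 := Complex.ofReal_ne_zero.2 hg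
  suffices hd : d = 0 by
    refine ⟨?_, hd⟩
    subst hd
    simp only [zero_mul, add_zero, sub_zero] at hX hY
    have shear : ∀ k : EuclideanSpace ℝ (Fin 2), ‖k‖ = 5 → ∃ w : Fin 4 → Macro,
        Rows g S T s2 q (h * k 0) (h * k 1) ms w ∧ IsShearMode (h * k 0) (h * k 1) w ∧
        (w 0).D = 0 ∧ (w 0).F = 0 ∧
        shearDefect S q (h * k 0) (h * k 1) (w 0).X (w 0).Y
          = S * e * (-(1 / 3) * ((h * k 0) ^ 4 - q * (h * k 0) ^ 2) - q ^ 2 / 15) := by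
      intro k hk
      obtain ⟨w, hw, hr, hs⟩ := H.shear k hk
      have hqk := sq_add_sq_of_norm hq hk
      have hX0 := (congrArg Macro.X (hw 0)).trans (hX ..)
      have hY0 := (congrArg Macro.Y (hw 0)).trans (hY ..)
      have hD := (congrArg Macro.D (hw 0)).trans (closure_scalar hA ..).1
      have hF := (congrArg Macro.F (hw 0)).trans (closure_scalar hA ..).2
      refine ⟨w, hr, hs, hD, hF, ?_⟩
      have c1 := hs.curl
      have c2 := hs.div
      simp only [Macro.curl, Macro.div] at c1 c2
      generalize h * (k 0 : ℂ) = x at *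
      generalize h * (k 1 : ℂ) = y at *
      have jx : q * (w 0).jx = -y := by
        linear_combination x * c2 - y * c1 - (w 0).jx * hqk
      have jy : q * (w 0).jy = x := by
        linear_combination y * c2 + x * c1 - (w 0).jy * hqk
      refine mul_left_cancel₀ hq0 ?_
      rw [hX0, hY0, shearDefect]
      linear_combination e * S * (-(1 / 3) * x ^ 4 * y + 1 / 15 * q ^ 2 * y) * jx
        + e * S * (1 / 3 * x ^ 5 - 2 / 3 * q * x ^ 3 + 4 / 15 * q ^ 2 * x) * jy
        + S * e * (1 / 3 * x ^ 4 - 1 / 15 * q ^ 2) * hqk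
    obtain ⟨w, hr, hs, hD, hF, hE⟩ := shear !₂[5, 0] norm_five_zero
    obtain ⟨w', hr', hs', hD', hF', hE'⟩ := shear !₂[3, 4] norm_three_four
    have key := hs.defect_eq hr hr' H.ms0 hs' ⟨hD, hF⟩ ⟨hD', hF'⟩
    rw [hE, hE', hq] at key
    -- The quartic is `0` at `(5, 0)` and `-144 h⁴` at `(3, 4)`, and `144 / 3 = 48`.
    have e0 : 48 * h ^ 4 * S * e = 0 := by
      simp only [Matrix.cons_val_zero] at key
      push_cast at key
      linear_combination -key
    exact (mul_eq_zero.1 e0).resolve_left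
      (mul_ne_zero (mul_ne_zero (by norm_num) (pow_ne_zero 4 hh)) hS)
  have acoustic : ∀ k : EuclideanSpace ℝ (Fin 2), ‖k‖ = 5 → ∃ w : Fin 4 → Macro,
      Rows g S T s2 q (h * k 0) (h * k 1) ma w ∧ IsAcousticMode w ∧
      (∀ n, (w n).l = a.lr * (w n).r + a.lp * (w n).p) ∧
      (∀ n, (w n).D = 0 ∧ (w n).F = 0) ∧
      h * k 0 * (w 0).X + h * k 1 * (w 0).Y = e * (w 0).div (h * k 0) (h * k 1) ∧
      h * k 0 * (w 1).X + h * k 1 * (w 1).Y = e * (w 1).div (h * k 0) (h * k 1) ∧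
      ma 0 * (w 0).X = -(e * (h * k 0) + d * (h * k 1)) ∧
      ma 0 * (w 0).Y = -(e * (h * k 1) - d * (h * k 0)) := by
    intro k hk
    obtain ⟨w, hw, hr, ha⟩ := H.acoustic k hk
    have hqk := sq_add_sq_of_norm hq hk
    have hX0 := fun n => (congrArg Macro.X (hw n)).trans (hX ..)
    have hY0 := fun n => (congrArg Macro.Y (hw n)).trans (hY ..)
    -- The acoustic momentum is curl-free at orders zero and one, so the rotation `d` does not
    -- contribute to `x X + y Y`, which is `e` times the divergence and hence direction-independent.
    have c0 := (mul_eq_zero.1 hr.row0.curl_law).resolve_left hm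
    have c1 := hr.row1.curl_law hqk
    rw [c0, mul_zero, mul_zero, add_zero, add_zero] at c1
    have c1' := (mul_eq_zero.1 c1).resolve_left hm
    simp only [Macro.curl] at c0 c1'
    have m1 := hr.row0.momX
    have m2 := hr.row0.momY
    rw [ha.p] at m1 m2
    refine ⟨w, hr, ha, fun n => congrArg Macro.l (hw n), fun n =>
      ⟨(congrArg Macro.D (hw n)).trans (closure_scalar hA ..).1,
        (congrArg Macro.F (hw n)).trans (closure_scalar hA ..).2⟩, ?_, ?_, ?_, ?_⟩
    · rw [hX0, hY0, Macro.div]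
      linear_combination d * c0
    · rw [hX0, hY0, Macro.div]
      linear_combination d * c1'
    · rw [hX0]
      linear_combination e * m1 + d * m2
    · rw [hY0]
      linear_combination e * m2 - d * m1
  obtain ⟨w, hr, ha, hl, hD, hX0, hX1, f1, f2⟩ := acoustic !₂[3, 4] norm_three_four
  obtain ⟨w', hr', ha', hl', hD', hX0', hX1', f1', f2'⟩ :=
    acoustic !₂[3, -4] norm_three_neg_four
  have hqk := sq_add_sq_of_norm hq norm_three_four
  have hqk' := sq_add_sq_of_norm hq norm_three_neg_four
  obtain ⟨d0, r0, d1, r1⟩ := ha.fields hqk hqk' hm hr.row0 hr'.row0 hr.row1 hr'.row1 ha'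
  have key := ha.defect_eq hqk hqk' hm hr hr' ha' hl hl' ((hD' 0).1.trans (hD 0).1.symm)
    ((hD' 0).2.trans (hD 0).2.symm) (by rw [hX0, hX0', d0]) (by rw [hX1, hX1', d1])
  rw [(hD 0).1, (hD 0).2] at key
  have e1 := acousticDefect_rotated (S := S) (T := T) H.ma0 f1 f2
  have e2 := acousticDefect_rotated (S := S) (T := T) H.ma0 f1' f2'
  rw [key, e1] at e2
  simp only [Matrix.cons_val_zero, Matrix.cons_val_one, hq] at e2
  push_cast at e2
  -- At `(3, ±4)`, `q = 25 h²`, `x y = ±12 h²` and `q - 2 x² = 7 h²`; twice `25 · 12 · 7 / 3` is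
  -- `1400`.
  have e0 : 1400 * g * T * h ^ 6 * d = 0 := by linear_combination e2
  exact (mul_eq_zero.1 e0).resolve_left (mul_ne_zero (mul_ne_zero (mul_ne_zero (by norm_num) hg') hT)
    (pow_ne_zero 6 hh))

end

/-! ### Conclusion of the second part. -/

/-- Orders zero and one have fixed the equilibria of `q`, `XX_e` and `XY_e`, so the closure by
macroscopic fields applies with only `X` and `Y` unknown. -/
lemma isotropicModes_of_isotropic {lam c0 : ℝ} (hlam : 0 < lam) (hc0 : 0 < c0) {R : Rates}
    (hR : R.Admissible) {a : ScalarCoeffs} {v : TensorCoeffs}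
    (h57 : sigma R.s5 * sigma R.s7 = 1 / 12) (hS : SigmaRelations R) (hsp : Splits lam c0 R a)
    (hiso : FourthOrderIsotropic lam c0 R (generalEquilibrium lam c0 a v)) :
    ∃ ms mt ma : Fin 4 → ℂ,
      IsotropicModes ((c0 ^ 2 / lam ^ 2 : ℝ) : ℂ) (sigma R.s5 : ℝ) (sigma R.s7 : ℝ)
        (sigma R.sE2 : ℝ) (-((lam ^ 2 * 5 ^ 2 : ℝ) : ℂ)) (closure (c0 ^ 2 / lam ^ 2) a v)
        (fun k => -(Complex.I * lam) * k 0) (fun k => -(Complex.I * lam) * k 1) ms mt ma := by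
  obtain ⟨h1, h2, h3, h4, h5, h6, h7⟩ := vector_equilibrium_of_isotropic hlam hR hiso
  obtain ⟨h8, h9⟩ := tensor_equilibrium_of_isotropic hlam hc0 hR hiso
  have hC := isClosure_closure hlam c0 a v h1 h2 h3 h4 h5 h6 h7 h8 h9
  have hST : ((sigma R.s5 : ℝ) : ℂ) * ((sigma R.s7 : ℝ) : ℂ) = 1 / 12 :=
    (Complex.ofReal_mul _ _).symm.trans ((congrArg Complex.ofReal h57).trans (by push_cast; rfl))
  obtain ⟨ms, mt, ma, s0, t0, m0, h⟩ := exists_modes hlam hc0 hR rfl hC (A := a.lr) (B := a.lp)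
    (fun _ _ _ _ => rfl) (hsp.complex hlam hc0) hiso (by norm_num : (5 : ℝ) ≠ 0)
  have hq : ∀ k : EuclideanSpace ℝ (Fin 2), ‖k‖ = 5 →
      (-(Complex.I * lam * k 0)) ^ 2 + (-(Complex.I * lam * k 1)) ^ 2
        = -((lam ^ 2 * 5 ^ 2 : ℝ) : ℂ) := by
    intro k hk
    rw [← hk]
    exact waveVector_sq lam k
  have hx : ∀ z : ℂ, -(Complex.I * lam * z) = -(Complex.I * lam) * z :=
    fun _ => (neg_mul _ _).symm
  have rows := fun k hk m psi theta => IsExpansion.rows (m := m) (psi := psi) (theta := theta) hC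
    hST (sigmaC_eq_relaxSigma hS) (hq k hk)
  simp only [hx] at h rows
  refine ⟨ms, mt, ma, ⟨fun k hk => ?_, fun k hk => ?_, fun k hk => ?_, s0, t0, ?_⟩⟩
  · obtain ⟨⟨psi, theta, he, hm⟩, -, -⟩ := h k hk
    exact ⟨_, fun _ => rfl, rows k hk _ _ _ he, hm⟩
  · obtain ⟨-, ⟨psi, theta, he, hm⟩, -⟩ := h k hk
    exact ⟨_, fun _ => rfl, rows k hk _ _ _ he, hm⟩
  · obtain ⟨-, -, psi, theta, he, hm⟩ := h k hk
    exact ⟨_, fun _ => rfl, rows k hk _ _ _ he, hm⟩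
  · rw [m0]
    exact soundSpeed_sq hlam c0 5

/-- Isotropy for a given sound velocity, with the rates of the scalar moments left free. -/
theorem generalEquilibrium_isotropic_iff {lam c0 : ℝ} (hlam : 0 < lam) (hc0 : 0 < c0) {R : Rates}
    (hR : R.Admissible) {a : ScalarCoeffs} (h57 : sigma R.s5 * sigma R.s7 = 1 / 12)
    (hS : SigmaRelations R) (hA : AlphaRelations a) (hsp : Splits lam c0 R a) (v : TensorCoeffs) :
    (∀ sE2 ∈ Set.Ioo (0 : ℝ) 2, ∀ sE3 ∈ Set.Ioo (0 : ℝ) 2, ∀ sE4 ∈ Set.Ioo (0 : ℝ) 2,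
      FourthOrderIsotropic lam c0 { R with sE2 := sE2, sE3 := sE3, sE4 := sE4 }
        (generalEquilibrium lam c0 a v)) ↔
      generalEquilibrium lam c0 a v = isotropicEquilibrium lam c0 a := by
  have adm : ∀ sE2 ∈ Set.Ioo (0 : ℝ) 2, ∀ sE3 ∈ Set.Ioo (0 : ℝ) 2, ∀ sE4 ∈ Set.Ioo (0 : ℝ) 2,
      ({ R with sE2 := sE2, sE3 := sE3, sE4 := sE4 } : Rates).Admissible :=
    fun _ h2 _ h3 _ h4 =>
      ⟨hR.1, hR.2.1, hR.2.2.1, hR.2.2.2.1, hR.2.2.2.2.1, h2, h3, h4⟩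
  constructor
  · intro hiso
    -- The factor vanishes for at most one rate of `E₂`. The rates `1` and `1/2` have `σ = 1/2` and
    -- `3/2`, so at least one of them is suitable.
    obtain ⟨s, hs, hs2⟩ : ∃ s ∈ Set.Ioo (0 : ℝ) 2, 3 / 5 * sigma R.s7 * sigma s - 1 / 20 ≠ 0 := by
      by_cases h : 3 / 5 * sigma R.s7 * sigma 1 - 1 / 20 = 0
      · refine ⟨1 / 2, by norm_num, fun h' => ?_⟩
        norm_num [sigma] at h h'
        linarith
      · exact ⟨1, by norm_num, h⟩
    have h1 : (1 : ℝ) ∈ Set.Ioo (0 : ℝ) 2 := by norm_num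
    have hR' := adm s hs 1 h1 1 h1
    have hi := hiso s hs 1 h1 1 h1
    obtain ⟨ms, mt, ma, H⟩ := isotropicModes_of_isotropic hlam hc0 hR' h57 hS hsp hi
    obtain ⟨e1, e2, e3, e4, e5, e6, e7⟩ := vector_equilibrium_of_isotropic hlam hR' hi
    obtain ⟨e8, e9⟩ := tensor_equilibrium_of_isotropic hlam hc0 hR' hi
    have hq : -((lam ^ 2 * 5 ^ 2 : ℝ) : ℂ) = 25 * (-(Complex.I * lam)) ^ 2 := by
      push_cast
      linear_combination -25 * (lam : ℂ) ^ 2 * Complex.I_sq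
    have hh : -(Complex.I * (lam : ℂ)) ≠ 0 :=
      neg_ne_zero.2 (mul_ne_zero Complex.I_ne_zero (Complex.ofReal_ne_zero.2 hlam.ne'))
    have hg : c0 ^ 2 / lam ^ 2 ≠ 0 := by positivity
    obtain ⟨f1, f2, f3, f4, f5, f6⟩ := H.order_two hq hh hg fun h => hs2 <|
      Complex.ofReal_injective (by push_cast; exact h)
    obtain ⟨z1, z2⟩ := H.order_three (e := v.cxx - (31 - 21 * (c0 ^ 2 / lam ^ 2 : ℝ)) / 6)
      (d := v.cxy) hA hq hh hg (Complex.ofReal_ne_zero.2 (sigma_pos hR.1).ne')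
      (Complex.ofReal_ne_zero.2 (sigma_pos hR.2.1).ne')
      (fun r jx jy p => by simp [closure, f1, f2])
      (fun r jx jy p => by simp [closure, f3, f4, f5, f6]; ring)
    have z1' : v.cxx - (31 - 21 * (c0 ^ 2 / lam ^ 2)) / 6 = 0 :=
      Complex.ofReal_injective (by push_cast at z1 ⊢; exact z1)
    have z2' : v.cxy = 0 := Complex.ofReal_injective z2
    have z3 : v.cxx = (31 - 21 * (c0 ^ 2 / lam ^ 2)) / 6 := sub_eq_zero.1 z1'
    rw [z2', neg_zero] at f6
    rw [isotropicEquilibrium_eq hlam c0 a]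
    congr 1
    cases v
    simp only at *
    subst e1 e2 e3 e4 e5 e6 e7 e8 e9 f1 f2 f3 f4 f6 z2'
    rw [TensorCoeffs.isotropic, ← f5, ← z3]
  · intro h s2 h2 s3 h3 s4 h4
    rw [h]
    exact fourthOrderIsotropic_isotropicEquilibrium hlam hc0 (adm s2 h2 s3 h3 s4 h4) h57 hS hA

end D2Q17

end

/-- Fourth order isotropy of the D2Q17 scheme, when `σ₅ σ₇ = 1/12`. First part: with the vector and
tensor equilibria `q = c₁ j, r = c₂ j, τ = c₃ j, XX_e = XY_e = 0`, isotropy holds with the sound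
velocity `c₀` left free if and only if the relations for the `σ`'s, `α`'s and `β`'s hold.
Second part: under these relations and for any given `c₀`, isotropy, with the rates of
`E₂, E₃, E₄` left free, forces these equilibria, and conversely. -/
theorem mainTheorem6 (lam : ℝ) (hlam : 0 < lam) (R : D2Q17.Rates) (hR : R.Admissible)
    (a : D2Q17.ScalarCoeffs) (h57 : D2Q17.sigma R.s5 * D2Q17.sigma R.s7 = 1 / 12) :
    ((∀ c0 : ℝ, 0 < c0 → D2Q17.Splits lam c0 R a →
        D2Q17.FourthOrderIsotropic lam c0 R (D2Q17.isotropicEquilibrium lam c0 a)) ↔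
      D2Q17.SigmaRelations R ∧ D2Q17.AlphaRelations a) ∧
    (D2Q17.SigmaRelations R → D2Q17.AlphaRelations a →
      ∀ c0 : ℝ, 0 < c0 → D2Q17.Splits lam c0 R a → ∀ v : D2Q17.TensorCoeffs,
        (∀ sE2 ∈ Set.Ioo (0 : ℝ) 2, ∀ sE3 ∈ Set.Ioo (0 : ℝ) 2, ∀ sE4 ∈ Set.Ioo (0 : ℝ) 2,
          D2Q17.FourthOrderIsotropic lam c0 { R with sE2 := sE2, sE3 := sE3, sE4 := sE4 }
            (D2Q17.generalEquilibrium lam c0 a v)) ↔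
        D2Q17.generalEquilibrium lam c0 a v = D2Q17.isotropicEquilibrium lam c0 a) := by
  exact ⟨D2Q17.isotropic_iff_relations hlam hR a h57, fun hS hA _ hc0 hsp =>
    D2Q17.generalEquilibrium_isotropic_iff hlam hc0 hR h57 hS hA hsp⟩
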